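/- **Setting.** Let $\tau,\eta\in\mathbb C$ with $\operatorname{Im}\tau>0$ and $\eta\notin\mathbb Q+\mathbb Q\tau$. Let $\theta_\alpha(t)=\theta_\alpha(t|\tau)$ ($\theta_4=\theta_0$) be the Jacobi theta functions of the lattice $\mathbb Z+\mathbb Z\tau$, with $\theta_1(t)=2\sum_{m\ge0}(-1)^me^{\pi i\tau(m+1/2)^2}\sin((2m+1)\pi t)$; put $[t]=\theta_1(2t)/\theta_1(2\eta)$, $\varepsilon_2=-1$ and $\varepsilon_\alpha=1$ for $\alpha\ne2$, $\sqrt{\varepsilon_2}=i$ and $\sqrt{\varepsilon_\alpha}=1$ for $\alpha\neq 2$, and let $\sigma^0=1,\sigma^1,\sigma^2,\sigma^3$ be the Pauli matrices on $V=\mathbb C^2$. *Sklyanin algebra and trace.* $\mathcal A$ is the unital $\mathbb C$-algebra with generators $S_0,\dots,S_3$ and relations $[S_0,S_a]=iJ_{bc}(S_bS_c+S_cS_b)$, $[S_b,S_c]=i(S_0S_a+S_aS_0)$ for $(a,b,c)$ a cyclic permutation of $(1,2,3)$, where $J_{bc}=\varepsilon_a\theta_1(\eta)^2\theta_{a+1}(\eta)^2/(\theta_{b+1}(\eta)^2\theta_{c+1}(\eta)^2)$;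 $\mathcal A_m$ is the span of the products of $m$ generators. For $k\ge0$ let $\mathcal V^{(k)}$ be the space of entire $f$ with $f(u+1)=f(u)=f(-u)$, $f(u+\tau)=e^{-2\pi ik(2u+\tau)}f(u)$, and let $\pi^{(k)}:\mathcal A\to\operatorname{End}\mathcal V^{(k)}$ be the representation $$(\pi^{(k)}(S_\alpha)f)(u)=\frac{\sqrt{\varepsilon_\alpha}\,\theta_{\alpha+1}(\eta)}{\theta_1(2\eta)\theta_1(2u)}\bigl(\theta_{\alpha+1}(2u-k\eta)f(u+\eta)-\theta_{\alpha+1}(-2u-k\eta)f(u-\eta)\bigr).$$ $\mathrm{Tr}_\lambda$ is the linear functional on $\mathcal A$ with values in entire functions of $\lambda$ such that $\mathrm{Tr}_{k+1}A=\mathrm{tr}_{\mathcal V^{(k)}}\pi^{(k)}(A)$ for all $k\ge0$ and, for $A\in\mathcal A_m$, $\mathrm{Tr}_{t/\eta}A=\theta_1(t)^mg_0(t)$ if $m$ is odd and $\theta_1(t)^m(g_1(t)-\frac t\eta g_2(t))$ if $m$ is even, where $g_0$, $g_2$ and $g_1(t+\tau)-g_1(t)$ are elliptic with periods $1,\tau$,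 and $g_1$ is meromorphic with period $1$. *Operators.* Let $n\ge2$ and label the tensor components of $V^{\otimes 2n}$ by $1,\dots,n,\bar n,\dots,\bar1$; a suffix indicates the components on which an operator acts. $P_{xy}$ is the transposition, $\mathcal P^-_{xy}=(1-P_{xy})/2$, $t_{pq}=t_p-t_q$, $$L_x(t)=\tfrac12\sum_{\alpha=0}^3\frac{\theta_{\alpha+1}(2t+\eta)}{\theta_{\alpha+1}(\eta)}S_\alpha\otimes\sigma^\alpha_x,\qquad \check R_{xy}(t)=P_{xy}\,\frac{\rho(t)}{[t+\eta]}\cdot\tfrac12\sum_{\alpha=0}^3\frac{\theta_{\alpha+1}(2t+\eta)}{\theta_{\alpha+1}(\eta)}\sigma^\alpha_x\sigma^\alpha_y,$$ with an arbitrary meromorphic normalising factor $\rho$, not identically zero. Put $$\widehat X_n(t_1,\dots,t_n)=\frac{1}{[t_{12}]\prod_{p=3}^n[t_{1p}][t_{2p}]}\mathrm{Tr}_{t_{12}/\eta}\Bigl(T\bigl(\tfrac{t_1+t_2}2\bigr)\Bigr)P_{12}\mathcal P^-_{1\bar1}\mathcal P^-_{2\bar2},$$ $T(z)=L_{\bar2}(z-t_2-\eta)\cdots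 L_{\bar n}(z-t_n-\eta)L_n(z-t_n)\cdots L_2(z-t_2)$. For $i<j$ put $$\widehat X^{(i,j)}_n=\widehat X^{(j,i)}_n=\mathbb R\,\widehat X_n(t_i,t_j,t_1,\dots,\widehat{t_i},\dots,\widehat{t_j},\dots,t_n)\,\mathbb R^{-1},$$ where $$\mathbb R=\prod_{m<i}\check R_{m+1,m}(t_{im})\prod_{i<m<j}\check R_{m+1,m}(t_{jm})\prod_{m<i}\check R_{m+2,m+1}(t_{jm})\prod_{m<i}\check R_{\overline m,\overline{m+1}}(t_{mi})\prod_{i<m<j}\check R_{\overline m,\overline{m+1}}(t_{mj})\prod_{m<i}\check R_{\overline{m+1},\overline{m+2}}(t_{mj}),$$ each product being taken with $m$ decreasing from left to right. With $\Delta^{(i)}_af=f(\dots,t_i+a,\dots)-f$ and $c=-2\theta_1'(0)/\theta_1(2\eta)$, define for all $i\ne j$ $$c\widehat X^{(i,j)}_{1,n}=\widehat X^{(i,j)}_n-t_{ij}\Delta_1^{(i)}\widehat X_n^{(i,j)},\quad c\widehat X^{(i,j)}_{2,n}=-\eta\Delta_1^{(i)}\widehat X_n^{(i,j)},\quad c\widehat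 X^{(i,j)}_{3,n}=\Delta_\tau^{(i)}\widehat X_n^{(i,j)}-\tau\Delta_1^{(i)}\widehat X_n^{(i,j)}.$$ **Proposition.** Let $1\le i\ne j\le n$, $1\le k\le n$, $a\in\{1,2,3\}$. The following identities hold between meromorphic functions of $t_1,\dots,t_n$; precisely, at every point where, for all $p\ne q$, $\theta_1(2t_{pq})\ne0$, $\theta_1(2(t_{pq}+\eta))\neq0$ and $\rho$ does not vanish on $t_{pq}+\frac12(\mathbb Z+\mathbb Z\tau)$. (Only the shifted variable is displayed.) (i) If $k\ne i,j$, then $$\sigma^1_{\bar k}\sigma^1_k\widehat X^{(i,j)}_{a,n}(t_k+\tfrac12)=\widehat X^{(i,j)}_{a,n}(t_k)\,\sigma^1_k\sigma^1_{\bar k},\qquad \sigma^3_{\bar k}\sigma^3_k\widehat X^{(i,j)}_{a,n}(t_k+\tfrac\tau2)=\widehat X^{(i,j)}_{a,n}(t_k)\,\sigma^3_k\sigma^3_{\bar k}.$$ (ii) If $k=i$ or $k=j$, then $$\sigma^1_{\bar k}\sigma^1_k\widehat X^{(i,j)}_{a,n}(t_k+\tfrac12)=\widehat X^{(i,j)}_{a,n}(t_k)\times(-1)^n\prod_{p\ne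 k}\sigma^1_p\sigma^1_{\bar p},$$ $$\sigma^3_{\bar k}\sigma^3_k\widehat X^{(i,j)}_{a,n}(t_k+\tfrac\tau2)=\Bigl(\widehat X^{(i,j)}_{a,n}(t_k)\pm\tfrac12\delta_{a1}\widehat X^{(i,j)}_{3,n}(t_k)\Bigr)\times(-1)^n\prod_{p\ne k}\sigma^3_p\sigma^3_{\bar p},$$ with the upper sign for $k=i$ and the lower sign for $k=j$. If $\{i,j\}=\{1,2\}$, both formulas also hold with $(-1)^n\prod_{p\ne k}$ replaced by $(-1)^{n-1}\prod_{p\ne i,j}$. (iii) In particular $\widehat X^{(i,j)}_{2,n}$ and $\widehat X^{(i,j)}_{3,n}$ are elliptic functions of each of $t_1,\dots,t_n$: they are meromorphic in each $t_k$, with periods $1$ and $\tau$. -/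

import Mathlib

open Complex

noncomputable section

namespace EightVertex

/-! ### Theta functions and the Sklyanin algebra -/

/-- The Jacobi theta functions for the lattice `ℤ + ℤτ`: `theta τ α t = θ_{α+1}(t|τ)` for
`α = 0, 1, 2, 3`, where `θ₄ = θ₀`. In particular
`theta τ 0 t = θ₁(t|τ) = 2 ∑_{m ≥ 0} (-1)^m e^{πiτ(m+1/2)²} sin((2m+1)πt)`. -/
def theta (τ : ℂ) (α : Fin 4) (t : ℂ) : ℂ :=
  match α with
  | 0 => -I * exp (Real.pi * I * (τ / 4 + t)) * jacobiTheta₂ (t + 1 / 2 + τ / 2) τ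
  | 1 => exp (Real.pi * I * (τ / 4 + t)) * jacobiTheta₂ (t + τ / 2) τ
  | 2 => jacobiTheta₂ t τ
  | 3 => jacobiTheta₂ (t + 1 / 2) τ

/-- `[t] = θ₁(2t) / θ₁(2η)`. -/
def bracket (τ η t : ℂ) : ℂ := theta τ 0 (2 * t) / theta τ 0 (2 * η)

/-- The signs `ε_α`: `ε₂ = -1` and `ε_α = 1` otherwise. -/
def eps (α : Fin 4) : ℂ := if α = 2 then -1 else 1

/-- The square roots `√ε_α`: `√ε₂ = i` and `√ε_α = 1` otherwise. -/
def sqrtEps (α : Fin 4) : ℂ := if α = 2 then I else 1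

/-- The structure constant `J_{bc}`, where `(a, b, c)` is a cyclic permutation of `(1, 2, 3)`. -/
def structureConst (τ η : ℂ) (a b c : Fin 4) : ℂ :=
  eps a * (theta τ 0 η ^ 2 * theta τ a η ^ 2) / (theta τ b η ^ 2 * theta τ c η ^ 2)

/-- `(a, b, c)` is a cyclic permutation of `(1, 2, 3)`. -/
def IsCyclicTriple (a b c : Fin 4) : Prop :=
  (a, b, c) = (1, 2, 3) ∨ (a, b, c) = (2, 3, 1) ∨ (a, b, c) = (3, 1, 2)

/-- The defining quadratic relations of the Sklyanin algebra:
`[S₀, S_a] = i J_{bc} (S_b S_c + S_c S_b)` and `[S_b, S_c] = i (S₀ S_a + S_a S₀)`. -/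
inductive SklyaninRel (τ η : ℂ) : FreeAlgebra ℂ (Fin 4) → FreeAlgebra ℂ (Fin 4) → Prop
  | quad1 (a b c : Fin 4) (h : IsCyclicTriple a b c) :
      SklyaninRel τ η
        (FreeAlgebra.ι ℂ 0 * FreeAlgebra.ι ℂ a - FreeAlgebra.ι ℂ a * FreeAlgebra.ι ℂ 0)
        ((I * structureConst τ η a b c) •
          (FreeAlgebra.ι ℂ b * FreeAlgebra.ι ℂ c + FreeAlgebra.ι ℂ c * FreeAlgebra.ι ℂ b))
  | quad2 (a b c : Fin 4) (h : IsCyclicTriple a b c) :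
      SklyaninRel τ η
        (FreeAlgebra.ι ℂ b * FreeAlgebra.ι ℂ c - FreeAlgebra.ι ℂ c * FreeAlgebra.ι ℂ b)
        (I • (FreeAlgebra.ι ℂ 0 * FreeAlgebra.ι ℂ a + FreeAlgebra.ι ℂ a * FreeAlgebra.ι ℂ 0))

/-- The Sklyanin algebra `𝒜`. -/
abbrev Sklyanin (τ η : ℂ) : Type := RingQuot (SklyaninRel τ η)

/-- The generators `S_α`. -/
def gen (τ η : ℂ) (α : Fin 4) : Sklyanin τ η :=
  RingQuot.mkAlgHom ℂ (SklyaninRel τ η) (FreeAlgebra.ι ℂ α)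

/-- The homogeneous component `𝒜_n`, spanned by the products of `n` generators. -/
def homogeneous (τ η : ℂ) (n : ℕ) : Submodule ℂ (Sklyanin τ η) :=
  Submodule.span ℂ (Set.range (gen τ η)) ^ n

/-! ### The representations of series (a) and the functional `Tr_λ` -/

/-- The space `𝒱^{(k)}` of entire functions `f` with `f(u+1) = f(u) = f(-u)` and
`f(u+τ) = e^{-2πik(2u+τ)} f(u)`. -/
def repSpace (τ : ℂ) (k : ℕ) : Submodule ℂ (ℂ → ℂ) where
  carrier := {f | Differentiable ℂ f ∧ (∀ u, f (u + 1) = f u) ∧ (∀ u, f (-u) = f u) ∧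
    ∀ u, f (u + τ) = exp (-2 * Real.pi * I * k * (2 * u + τ)) * f u}
  add_mem' := by
    rintro f g ⟨h1, h2, h3, h4⟩ ⟨k1, k2, k3, k4⟩
    refine ⟨h1.add k1, fun u => ?_, fun u => ?_, fun u => ?_⟩
    · simp [h2, k2]
    · simp [h3, k3]
    · simp only [Pi.add_apply, h4, k4]; ring
  zero_mem' := ⟨differentiable_const 0, by simp, by simp, by simp⟩
  smul_mem' := by
    rintro c f ⟨h1, h2, h3, h4⟩
    refine ⟨h1.const_smul c, fun u => ?_, fun u => ?_, fun u => ?_⟩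
    · simp [h2]
    · simp [h3]
    · simp only [Pi.smul_apply, smul_eq_mul, h4]; ring

/-- `φ` is the representation `π^{(k)} : 𝒜 → End 𝒱^{(k)}`, i.e.
`(π(S_α) f)(u) = √ε_α θ_{α+1}(η) / (θ₁(2η) θ₁(2u)) *
  (θ_{α+1}(2u-kη) f(u+η) - θ_{α+1}(-2u-kη) f(u-η))`.
The denominator `θ₁(2η) θ₁(2u)` is cleared, so that the formula makes sense at the zeros of
`θ₁(2u)`; by continuity it determines `φ`. -/
def IsSeriesA (τ η : ℂ) (k : ℕ)
    (φ : Sklyanin τ η →ₐ[ℂ] Module.End ℂ (repSpace τ k)) : Prop :=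
  ∀ (α : Fin 4) (f : repSpace τ k) (u : ℂ),
    theta τ 0 (2 * η) * theta τ 0 (2 * u) * (φ (gen τ η α) f : ℂ → ℂ) u =
      sqrtEps α * theta τ α η *
        (theta τ α (2 * u - k * η) * (f : ℂ → ℂ) (u + η) -
          theta τ α (-2 * u - k * η) * (f : ℂ → ℂ) (u - η))

open Classical in
/-- `tr_{𝒱^{(k)}} π^{(k)}(A)`. (The representation `π^{(k)}` exists and is unique.) -/
def repTrace (τ η : ℂ) (k : ℕ) (A : Sklyanin τ η) : ℂ :=
  if h : ∃ φ, IsSeriesA τ η k φ then LinearMap.trace ℂ (repSpace τ k) (h.choose A) else 0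

/-- Elliptic functions with periods `1` and `τ`. -/
def IsElliptic (τ : ℂ) (g : ℂ → ℂ) : Prop :=
  MeromorphicOn g Set.univ ∧ (∀ t, g (t + 1) = g t) ∧ ∀ t, g (t + τ) = g t

/-- The functional form of `F = Tr_λ A`, as a function of `λ`, for `A` homogeneous of degree `n`:
`F(t/η) = θ₁(t)^n g₀(t)` for odd `n` and `F(t/η) = θ₁(t)^n (g₁(t) - (t/η) g₂(t))` for even `n`,
where `g₀`, `g₂` and `g₃(t) = g₁(t+τ) - g₁(t)` are elliptic and `g₁` is meromorphic with
period `1`. (Off the zeros of `θ₁` the functions `g` are regular.) -/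
def HasTraceForm (τ η : ℂ) (n : ℕ) (F : ℂ → ℂ) : Prop :=
  (Odd n → ∃ g₀ : ℂ → ℂ, IsElliptic τ g₀ ∧
    ∀ t, theta τ 0 t ≠ 0 → F (t / η) = theta τ 0 t ^ n * g₀ t) ∧
  (Even n → ∃ g₁ g₂ : ℂ → ℂ, MeromorphicOn g₁ Set.univ ∧ (∀ t, g₁ (t + 1) = g₁ t) ∧
    IsElliptic τ g₂ ∧ IsElliptic τ (fun t => g₁ (t + τ) - g₁ t) ∧
    ∀ t, theta τ 0 t ≠ 0 → F (t / η) = theta τ 0 t ^ n * (g₁ t - t / η * g₂ t))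

/-- The characterization of the functional `A ↦ Tr_λ A`, with values in entire functions of `λ`:
it interpolates the traces on `𝒱^{(k)}` at `λ = k + 1`, and it has the functional form above on
each homogeneous component. -/
def IsTraceFunctional (τ η : ℂ) (T : Sklyanin τ η →ₗ[ℂ] (ℂ → ℂ)) : Prop :=
  (∀ A, Differentiable ℂ (T A)) ∧
  (∀ (A : Sklyanin τ η) (k : ℕ), T A (k + 1) = repTrace τ η k A) ∧
  ∀ (n : ℕ), ∀ A ∈ homogeneous τ η n, HasTraceForm τ η n (T A)

open Classical in
/-- The functional `Tr_λ`: `Tr τ η A lam = Tr_lam A`. (It exists and is unique for `Im τ > 0` and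
`η ∉ ℚ + ℚτ`.) -/
def Tr (τ η : ℂ) : Sklyanin τ η →ₗ[ℂ] (ℂ → ℂ) :=
  if h : ∃ T, IsTraceFunctional τ η T then h.choose else 0

/-! ### Operators on `V^{⊗ι}`

The sites of the tensor product are labelled by a finite type `ι`, and an operator on `V^{⊗ι}`,
`V = ℂ²`, is a matrix indexed by the configurations `ι → Fin 2` (`0` for `v₊`, `1` for `v₋`). -/

section Local

variable {ι : Type} [Fintype ι] [DecidableEq ι]

/-- The Pauli matrices `σ^α`, `σ⁰ = 1`. -/
def pauli (α : Fin 4) : Matrix (Fin 2) (Fin 2) ℂ :=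
  match α with
  | 0 => 1
  | 1 => !![0, 1; 1, 0]
  | 2 => !![0, -I; I, 0]
  | 3 => !![1, 0; 0, -1]

/-- `σ^α_x`: the Pauli matrix `σ^α` acting on the tensor component `x`. -/
def sigma (α : Fin 4) (x : ι) : Matrix (ι → Fin 2) (ι → Fin 2) ℂ :=
  fun a b => if ∀ y, y ≠ x → a y = b y then pauli α (a x) (b x) else 0

/-- `P_{xy}`: the transposition of the tensor components `x` and `y`. -/
def perm (x y : ι) : Matrix (ι → Fin 2) (ι → Fin 2) ℂ :=
  fun a b => if a = b ∘ Equiv.swap x y then 1 else 0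

/-- `𝒫⁻_{xy} = (1 - P_{xy}) / 2`. -/
def projMinus (x y : ι) : Matrix (ι → Fin 2) (ι → Fin 2) ℂ :=
  (1 / 2 : ℂ) • (1 - perm x y)

/-- `R_{xy}(t) = ρ(t) r_{xy}(t) / [t+η]` with
`r_{xy}(t) = 1/2 ∑_α θ_{α+1}(2t+η) / θ_{α+1}(η) σ^α_x σ^α_y`. -/
def Rmat (τ η : ℂ) (ρ : ℂ → ℂ) (x y : ι) (t : ℂ) : Matrix (ι → Fin 2) (ι → Fin 2) ℂ :=
  (ρ t / bracket τ η (t + η)) •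
    ((1 / 2 : ℂ) • ∑ α : Fin 4,
      (theta τ α (2 * t + η) / theta τ α η) • (sigma α x * sigma α y))

/-- `Ř_{xy}(t) = P_{xy} R_{xy}(t)`. -/
def Rcheck (τ η : ℂ) (ρ : ℂ → ℂ) (x y : ι) (t : ℂ) : Matrix (ι → Fin 2) (ι → Fin 2) ℂ :=
  perm x y * Rmat τ η ρ x y t

/-- The `L` operator `L_x(t) = 1/2 ∑_α θ_{α+1}(2t+η) / θ_{α+1}(η) S_α ⊗ σ^α_x`, a matrix with
entries in the Sklyanin algebra. -/
def Lop (τ η : ℂ) (x : ι) (t : ℂ) : Matrix (ι → Fin 2) (ι → Fin 2) (Sklyanin τ η) :=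
  fun a b => (1 / 2 : ℂ) • ∑ α : Fin 4,
    (theta τ α (2 * t + η) / theta τ α η * sigma α x a b) • gen τ η α

end Local

/-! ### The matrices `X̂`

From here on `n = N + 2 ≥ 2`. The tensor components `1, …, n, n̄, …, 1̄` of `V^{⊗2n}` are labelled
by `Fin n ⊕ Fin n`, where `inl` stands for the unbarred and `inr` for the barred sites. Indices
start with `0`, so that `0`, `1` in `Fin n` are the sites `1`, `2`. -/

/-- The labels of the `2n` tensor components, `n = N + 2`. -/
abbrev Site (N : ℕ) : Type := Fin (N + 2) ⊕ Fin (N + 2)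

/-- `End(V^{⊗2n})`, `n = N + 2`. -/
abbrev Op (N : ℕ) : Type := Matrix (Site N → Fin 2) (Site N → Fin 2) ℂ

/-- The unbarred site `p`. -/
abbrev site {N : ℕ} (p : Fin (N + 2)) : Site N := Sum.inl p

/-- The barred site `p̄`. -/
abbrev bar {N : ℕ} (p : Fin (N + 2)) : Site N := Sum.inr p

/-- `σ^α_p σ^α_{p̄}`. -/
def sigmaPair {N : ℕ} (α : Fin 4) (p : Fin (N + 2)) : Op N :=
  sigma α (site p) * sigma α (bar p)

/-- The product of the (commuting) operators `σ^α_p σ^α_{p̄}` over all `p` in `s`. -/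
def sigmaProd {N : ℕ} (α : Fin 4) (s : Finset (Fin (N + 2))) : Op N :=
  (((List.finRange (N + 2)).filter (· ∈ s)).map (sigmaPair α)).prod

/-- `T^{[1]}_n(z; t₁, …, t_n) =
L_{2̄}(z-t₂-η) ⋯ L_{n̄}(z-t_n-η) L_n(z-t_n) ⋯ L_2(z-t₂)`. -/
def monodromy (τ η : ℂ) {N : ℕ} (z : ℂ) (t : Fin (N + 2) → ℂ) :
    Matrix (Site N → Fin 2) (Site N → Fin 2) (Sklyanin τ η) :=
  ((List.finRange (N + 2)).tail.map fun p => Lop τ η (bar p) (z - t p - η)).prod *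
    ((List.finRange (N + 2)).tail.reverse.map fun p => Lop τ η (site p) (z - t p)).prod

/-- The transfer matrix
`X̂_n(t₁, …, t_n) = ([t₁₂] ∏_{p ≥ 3} [t_{1p}] [t_{2p}])⁻¹
  Tr_{t₁₂/η}(T^{[1]}_n((t₁+t₂)/2; t₁, …, t_n)) P₁₂ 𝒫⁻_{11̄} 𝒫⁻_{22̄}`. -/
def Xbase (τ η : ℂ) {N : ℕ} (t : Fin (N + 2) → ℂ) : Op N :=
  (1 / (bracket τ η (t 0 - t 1) *
      ∏ p ∈ Finset.univ.filter (fun p : Fin (N + 2) => p ≠ 0 ∧ p ≠ 1),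
        (bracket τ η (t 0 - t p) * bracket τ η (t 1 - t p)))) •
    ((monodromy τ η ((t 0 + t 1) / 2) t).map (fun A => Tr τ η A ((t 0 - t 1) / η)) *
      perm (site 0) (site 1) * projMinus (site 0) (bar 0) * projMinus (site 1) (bar 1))

/-- The tuple `(t_i, t_j, t₁, …, t̂_i, …, t̂_j, …, t_n)`. -/
def reorder {N : ℕ} (i j : Fin (N + 2)) (t : Fin (N + 2) → ℂ) : Fin (N + 2) → ℂ :=
  fun p => ((i :: j :: (List.finRange (N + 2)).filter (fun q => q ≠ i ∧ q ≠ j)).map t).getD p 0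

/-- The product of `R` matrices `ℝ_n^{(i,j)}(t₁, …, t_n)`, `i < j`. In each of the six chains
the lower index `m` decreases from left to right. -/
def Rprod (τ η : ℂ) (ρ : ℂ → ℂ) {N : ℕ} (i j : Fin (N + 2)) (t : Fin (N + 2) → ℂ) : Op N :=
  let idx : ℕ → Fin (N + 2) := fun m => Fin.ofNat (N + 2) m
  let below : List ℕ := (List.range i.val).reverse
  let between : List ℕ := (List.range' (i.val + 1) (j.val - (i.val + 1))).reverse
  (below.map fun m => Rcheck τ η ρ (site (idx (m + 1))) (site (idx m)) (t i - t (idx m))).prod *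
  (between.map fun m => Rcheck τ η ρ (site (idx (m + 1))) (site (idx m)) (t j - t (idx m))).prod *
  (below.map fun m =>
    Rcheck τ η ρ (site (idx (m + 2))) (site (idx (m + 1))) (t j - t (idx m))).prod *
  (below.map fun m => Rcheck τ η ρ (bar (idx m)) (bar (idx (m + 1))) (t (idx m) - t i)).prod *
  (between.map fun m => Rcheck τ η ρ (bar (idx m)) (bar (idx (m + 1))) (t (idx m) - t j)).prod *
  (below.map fun m =>
    Rcheck τ η ρ (bar (idx (m + 1))) (bar (idx (m + 2))) (t (idx m) - t j)).prod

/-- `X̂_n^{(i,j)} = X̂_n^{(j,i)} = ℝ_n^{(i,j)} X̂_n(t_i, t_j, …) (ℝ_n^{(i,j)})⁻¹` for `i < j`. -/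
def Xij (τ η : ℂ) (ρ : ℂ → ℂ) {N : ℕ} (i j : Fin (N + 2)) (t : Fin (N + 2) → ℂ) : Op N :=
  let i' := min i j
  let j' := max i j
  Rprod τ η ρ i' j' t * Xbase τ η (reorder i' j' t) * (Rprod τ η ρ i' j' t)⁻¹

/-- `(…, t_k + a, …)`. -/
def shift {N : ℕ} (k : Fin (N + 2)) (a : ℂ) (t : Fin (N + 2) → ℂ) : Fin (N + 2) → ℂ :=
  Function.update t k (t k + a)

/-- `Δ_a^{(k)} f = f(…, t_k + a, …) - f(…, t_k, …)`. -/
def diff {N : ℕ} (k : Fin (N + 2)) (a : ℂ) (f : (Fin (N + 2) → ℂ) → Op N)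
    (t : Fin (N + 2) → ℂ) : Op N :=
  f (shift k a t) - f t

/-- `c = -2 θ₁'(0) / θ₁(2η)`. -/
def cConst (τ η : ℂ) : ℂ := -2 * deriv (theta τ 0) 0 / theta τ 0 (2 * η)

/-- `X̂_{a,n}^{(i,j)}`, where `a = 0, 1, 2` in `Fin 3` stands for `a = 1, 2, 3`:
`c X̂₁ = X̂ - t_{ij} Δ_1^{(i)} X̂`, `c X̂₂ = -η Δ_1^{(i)} X̂`,
`c X̂₃ = Δ_τ^{(i)} X̂ - τ Δ_1^{(i)} X̂`. -/
def Xhat (τ η : ℂ) (ρ : ℂ → ℂ) {N : ℕ} (a : Fin 3) (i j : Fin (N + 2))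
    (t : Fin (N + 2) → ℂ) : Op N :=
  (cConst τ η)⁻¹ •
    match a with
    | 0 => Xij τ η ρ i j t - (t i - t j) • diff i 1 (Xij τ η ρ i j) t
    | 1 => (-η) • diff i 1 (Xij τ η ρ i j) t
    | 2 => diff i τ (Xij τ η ρ i j) t - τ • diff i 1 (Xij τ η ρ i j) t

/-- The points `t` at which (together with all their translates by half periods) the formulas
for `X̂` involve no division by zero and only invertible `R` matrices: for `p ≠ q`,
`[t_{pq}] ≠ 0`, `[t_{pq} + η] ≠ 0`, and `ρ` has no zero at `t_{pq}` modulo half periods. -/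
def Regular (τ η : ℂ) (ρ : ℂ → ℂ) {N : ℕ} (t : Fin (N + 2) → ℂ) : Prop :=
  ∀ p q, p ≠ q →
    theta τ 0 (2 * (t p - t q)) ≠ 0 ∧ theta τ 0 (2 * (t p - t q + η)) ≠ 0 ∧
      ∀ a b : ℤ, ρ (t p - t q + (a + b * τ) / 2) ≠ 0

end EightVertex

end

/-! On a word w of even length m = 2(n-1) in the generators, Tr_{t/η} w equals a constant times
B_w(t) + t C_w(t) with entire B_w and C_w. Everything rests on their behaviour under the half
periods of t. The translations by 1/2 and τ/2, combined with the permutations `permA` and `permB` of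
the letters, multiply these functions by explicit factors, except that for τ/2 the function B_w is
first replaced by B_w + D_w/2, where D_w itself transforms by the factor alone. Up to constants,
X̂₁, X̂₂, X̂₃ are the parts of X̂ built from B, C and D. This is why only X̂₁ jumps, and why it
jumps by half of X̂₃.

A function of trace form is determined by its values at large integers λ = K (`HasTraceForm.eqM`).
Since η is not a torsion point modulo ℤ + ℤτ, an elliptic function with zeros at the points t = Kη
vanishes, and the quasi-periodic case is reduced to the elliptic one by difference Wronskians
(`eqM_zero_of_traceForm`). So it suffices to compute the traces on 𝒱^{(K-1)}. This is done by
Lagrange interpolation at K nodes with step 2η. A word acts as a difference operator, and the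
displacements that occur for even length carry nodes to nodes, where the interpolation functions
vanish unless the displacement is zero or leaves the row. What remains (`traceSum_eq`) is the sum of
the diagonal coefficient over the nodes and a number of boundary terms independent of K, which are
functions of Kη by telescoping of theta products. For neutral words the diagonal coefficient is even
and elliptic in u with at most simple poles at multiples of η, so it is a constant plus a
combination of differences of θ₁'/θ₁ (`exists_wordCoeff_expansion`). Summed over the nodes, the
constant is multiplied by K = t/η and gives C, while the other terms telescope and contribute to B.
The quasi-period -2πi of θ₁'/θ₁ produces D. Words that are not neutral have trace zero, because a
half-period translation of the nodes multiplies by a sign a quantity that does not depend on the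
nodes.

On the side of matrices, a half period permutes the theta functions in the same way as left
multiplication by σ¹ or σ³ permutes the matrices √ε_α σ^α (`IsHalfPeriod`). Translating t₁ by a half
period therefore multiplies the product of L operators by σ^β at all its sites and permutes the
words, which the law of the trace compensates. A translation of t_k with k ≥ 3 changes the arguments
at k and k̄ by a full period, which amounts to a conjugation by σ^β_k σ^β_k̄. The singlet projectors
absorb pairs σ^β_p σ^β_p̄ with the sign -1. Finally, in ℝ a matrix σ^β travels along the line k
through every crossing (`IsHalfPeriod.Rprod_shift`), and this carries the laws from the positions 1,
2 to i, j; scalar factors cancel in ℝ Y ℝ⁻¹.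

The argument does not depend on the existence of the representations or of the functional: the
default values are zero, and `seriesA_dichotomy` shows that either all representations are available
or all traces are zero. -/

noncomputable section
namespace EightVertex

/-! ### Theta functions under half periods -/

/-- The action of the translation by `1/2` on the labels of the theta functions. -/
def permA : Fin 4 → Fin 4 := ![1, 0, 3, 2]

/-- The action of the translation by `τ/2` on the labels of the theta functions. -/
def permB : Fin 4 → Fin 4 := ![3, 2, 1, 0]

/-- The sign in the translation by `1/2`. -/
def sgnA : Fin 4 → ℂ := ![1, -1, 1, 1]

/-- The constant in the translation by `τ/2`. -/
def sgnB : Fin 4 → ℂ := ![I, 1, 1, I]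

/-- The character of the translation by `1` relative to `θ₁`. -/
def charA : Fin 4 → ℂ := ![1, 1, -1, -1]

/-- The character of the translation by `τ` relative to `θ₁`. -/
def charB : Fin 4 → ℂ := ![1, -1, -1, 1]

lemma exp_half_pi_I : exp (Real.pi * I * (1 / 2)) = I := by
  rw [show (Real.pi * I * (1 / 2) : ℂ) = Real.pi / 2 * I by ring, exp_pi_div_two_mul_I]

lemma theta_add_half (τ : ℂ) (α : Fin 4) (z : ℂ) :
    theta τ α (z + 1 / 2) = sgnA α * theta τ (permA α) z := by
  have e1 : exp (Real.pi * I * (τ / 4 + (z + 1 / 2))) = I * exp (Real.pi * I * (τ / 4 + z)) := by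
    rw [show Real.pi * I * (τ / 4 + (z + 1 / 2)) =
      Real.pi * I * (1 / 2) + Real.pi * I * (τ / 4 + z) by ring, exp_add, exp_half_pi_I]
  have h1 := jacobiTheta₂_add_left (z + τ / 2) τ
  have h2 := jacobiTheta₂_add_left z τ
  fin_cases α
  · simp only [theta, sgnA, permA, Fin.zero_eta, Matrix.cons_val_zero, e1]
    rw [show z + 1 / 2 + 1 / 2 + τ / 2 = z + τ / 2 + 1 by ring, h1]
    linear_combination -exp (Real.pi * I * (τ / 4 + z)) * jacobiTheta₂ (z + τ / 2) τ * I_sq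
  · simp only [theta, sgnA, permA, Fin.mk_one, Matrix.cons_val_one, Matrix.cons_val_zero, e1]
    ring
  · simp [theta, sgnA, permA]
  · simp only [theta, sgnA, permA]
    rw [show z + 1 / 2 + 1 / 2 = z + 1 by ring, h2]
    simp

lemma theta_add_half_tau (τ : ℂ) (α : Fin 4) (z : ℂ) :
    theta τ α (z + τ / 2) =
      sgnB α * exp (-Real.pi * I * (τ / 4 + z)) * theta τ (permB α) z := by
  have hm : exp (-Real.pi * I * (τ / 4 + z)) * exp (Real.pi * I * (τ / 4 + z)) = 1 := by
    rw [← exp_add, show -Real.pi * I * (τ / 4 + z) + Real.pi * I * (τ / 4 + z) = 0 by ring,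
      exp_zero]
  have e1 : exp (Real.pi * I * (τ / 4 + (z + τ / 2))) * exp (-Real.pi * I * (τ + 2 * z)) =
      exp (-Real.pi * I * (τ / 4 + z)) := by
    rw [← exp_add]; congr 1; ring
  have e2 : exp (Real.pi * I * (τ / 4 + (z + τ / 2))) *
      exp (-Real.pi * I * (τ + 2 * (z + 1 / 2))) = -exp (-Real.pi * I * (τ / 4 + z)) := by
    rw [← exp_add, show Real.pi * I * (τ / 4 + (z + τ / 2)) +
      -Real.pi * I * (τ + 2 * (z + 1 / 2)) =
      -Real.pi * I * (τ / 4 + z) - Real.pi * I by ring, exp_sub, exp_pi_mul_I]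
    ring
  have h1 := jacobiTheta₂_add_left' z τ
  have h2 := jacobiTheta₂_add_left' (z + 1 / 2) τ
  fin_cases α
  · simp only [theta, sgnB, permB, Fin.zero_eta, Matrix.cons_val_zero]
    rw [show z + τ / 2 + 1 / 2 + τ / 2 = z + 1 / 2 + τ by ring, h2]
    linear_combination -I * jacobiTheta₂ (z + 1 / 2) τ * e2
  · simp only [theta, sgnB, permB, Fin.mk_one, Matrix.cons_val_one, Matrix.cons_val_zero]
    rw [show z + τ / 2 + τ / 2 = z + τ by ring, h1]
    linear_combination jacobiTheta₂ z τ * e1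
  · simp only [theta, sgnB, permB, Fin.reduceFinMk, Matrix.cons_val]
    linear_combination -jacobiTheta₂ (z + τ / 2) τ * hm
  · simp only [theta, sgnB, permB, Fin.reduceFinMk, Matrix.cons_val]
    rw [show z + τ / 2 + 1 / 2 = z + 1 / 2 + τ / 2 by ring]
    linear_combination (-jacobiTheta₂ (z + 1 / 2 + τ / 2) τ) * hm +
      (exp (-Real.pi * I * (τ / 4 + z)) * exp (Real.pi * I * (τ / 4 + z))) *
        jacobiTheta₂ (z + 1 / 2 + τ / 2) τ * I_sq

lemma theta_add_one (τ : ℂ) (α : Fin 4) (z : ℂ) :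
    theta τ α (z + 1) = -charA α * theta τ α z := by
  rw [show z + 1 = z + 1 / 2 + 1 / 2 by ring, theta_add_half, theta_add_half]
  fin_cases α <;> simp [sgnA, permA, charA]

lemma theta_add_tau (τ : ℂ) (α : Fin 4) (z : ℂ) :
    theta τ α (z + τ) = -charB α * exp (-Real.pi * I * (τ + 2 * z)) * theta τ α z := by
  have e : exp (-Real.pi * I * (τ / 4 + (z + τ / 2))) * exp (-Real.pi * I * (τ / 4 + z)) =
      exp (-Real.pi * I * (τ + 2 * z)) := by
    rw [← exp_add]; congr 1; ring
  rw [show z + τ = z + τ / 2 + τ / 2 by ring, theta_add_half_tau, theta_add_half_tau, ← e]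
  fin_cases α <;> simp [sgnB, permB, charB] <;> ring_nf <;> simp

lemma theta_neg (τ : ℂ) (α : Fin 4) (z : ℂ) :
    theta τ α (-z) = (if α = 0 then -1 else 1) * theta τ α z := by
  have hA : ∀ w, jacobiTheta₂ (-w + τ / 2) τ =
      exp (2 * Real.pi * I * w) * jacobiTheta₂ (w + τ / 2) τ := by
    intro w
    have h := jacobiTheta₂_add_left' (-w - τ / 2) τ
    rw [show -w - τ / 2 + τ = -w + τ / 2 by ring, show -w - τ / 2 = -(w + τ / 2) by ring,
      jacobiTheta₂_neg_left] at h
    rw [h]; congr 2; ring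
  have e : exp (Real.pi * I * (τ / 4 + -z)) * exp (2 * Real.pi * I * z) =
      exp (Real.pi * I * (τ / 4 + z)) := by
    rw [← exp_add]; congr 1; ring
  have e2 : exp (Real.pi * I * (τ / 4 + -z)) * exp (2 * Real.pi * I * (z + 1 / 2)) =
      -exp (Real.pi * I * (τ / 4 + z)) := by
    rw [← exp_add, show Real.pi * I * (τ / 4 + -z) + 2 * Real.pi * I * (z + 1 / 2) =
      Real.pi * I * (τ / 4 + z) + Real.pi * I by ring, exp_add, exp_pi_mul_I]
    ring
  have h1 := hA (z + 1 / 2)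
  rw [← jacobiTheta₂_add_left, show -(z + 1 / 2) + τ / 2 + 1 = -z + 1 / 2 + τ / 2 by ring] at h1
  have h3 : jacobiTheta₂ (-z + 1 / 2) τ = jacobiTheta₂ (z + 1 / 2) τ := by
    rw [← jacobiTheta₂_neg_left, ← jacobiTheta₂_add_left]; congr 1; ring
  fin_cases α
  · simp only [theta, Fin.zero_eta, if_true, h1]
    linear_combination -I * jacobiTheta₂ (z + 1 / 2 + τ / 2) τ * e2
  · simp only [theta, hA]
    simp
    linear_combination jacobiTheta₂ (z + τ / 2) τ * e
  · simp [theta]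
  · simp [theta]; simpa using h3

variable {τ : ℂ}

@[fun_prop]
lemma differentiable_theta (hτ : 0 < τ.im) (α : Fin 4) : Differentiable ℂ (theta τ α) := by
  have hJ : Differentiable ℂ (fun z => jacobiTheta₂ z τ) := fun z =>
    differentiableAt_jacobiTheta₂_fst z hτ
  have hJ' : ∀ c : ℂ, Differentiable ℂ (fun z => jacobiTheta₂ (z + c) τ) := fun c =>
    hJ.comp (differentiable_id.add_const c)
  have h0 : Differentiable ℂ (fun z => jacobiTheta₂ (z + 1 / 2 + τ / 2) τ) := by
    simpa [add_assoc] using hJ' (1 / 2 + τ / 2)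
  have h1 := hJ' (τ / 2)
  have h3 := hJ' (1 / 2)
  fin_cases α
  · exact ((by fun_prop : Differentiable ℂ
      (fun t => -I * exp (Real.pi * I * (τ / 4 + t)))).mul h0)
  · exact ((by fun_prop : Differentiable ℂ
      (fun t => exp (Real.pi * I * (τ / 4 + t)))).mul h1)
  · exact hJ
  · exact h3

/-- A theta function does not vanish identically. -/
lemma exists_jacobiTheta₂_ne_zero (hτ : 0 < τ.im) : ∃ z, jacobiTheta₂ z τ ≠ 0 := by
  by_contra! hz
  -- Integration over a real period isolates the constant Fourier coefficient, which is 1; for a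
  -- function that vanishes identically it would be 0.
  have hint : ∀ n : ℤ, n ≠ 0 →
      ∫ x in (0 : ℝ)..1, jacobiTheta₂_term n x τ = 0 := by
    intro n hn
    have hc : (2 * Real.pi * I * n : ℂ) ≠ 0 := by
      simp [hn, Real.pi_ne_zero]
    have hr : (fun x : ℝ => jacobiTheta₂_term n x τ) =
        fun x : ℝ => exp (Real.pi * I * n ^ 2 * τ) * exp ((2 * Real.pi * I * n) * x) := by
      funext x
      rw [jacobiTheta₂_term, add_comm, exp_add]
    rw [hr, intervalIntegral.integral_const_mul, integral_exp_mul_complex hc]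
    have : exp (2 * Real.pi * I * n * (1 : ℝ)) = 1 := by
      rw [exp_eq_one_iff]; exact ⟨n, by push_cast; ring⟩
    rw [this]; simp
  have hsum : HasSum (fun n : ℤ => ∫ x in (0 : ℝ)..1, jacobiTheta₂_term n x τ)
      (∫ x in (0 : ℝ)..1, ∑' n : ℤ, jacobiTheta₂_term n x τ) := by
    refine intervalIntegral.hasSum_intervalIntegral_of_summable_norm
      (f := fun n : ℤ => ⟨fun x : ℝ => jacobiTheta₂_term n x τ, by
        unfold jacobiTheta₂_term; fun_prop⟩) ?_
    refine Summable.of_nonneg_of_le (fun _ => norm_nonneg _) (fun n => ?_)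
      (summable_pow_mul_jacobiTheta₂_term_bound 0 hτ 0)
    rw [ContinuousMap.norm_le _ (by positivity)]
    intro x
    simpa using norm_jacobiTheta₂_term_le hτ (z := (x : ℝ)) (S := 0) (by simp) le_rfl n
  have h0 : ∀ x : ℝ, ∑' n : ℤ, jacobiTheta₂_term n x τ = 0 := fun x => hz x
  simp only [h0, intervalIntegral.integral_zero] at hsum
  have h1 := hsum.unique (hasSum_single 0 fun n hn => hint n hn)
  simp [jacobiTheta₂_term] at h1

end EightVertex

end

noncomputable section
namespace EightVertex
open Filter Topology Function

/-! ### Meromorphic functions up to equality off a discrete set -/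

/-- Equality of functions off a closed discrete set. -/
def EqM (f g : ℂ → ℂ) : Prop := ∀ z, f =ᶠ[𝓝[≠] z] g

namespace EqM

variable {f g h f' g' : ℂ → ℂ}

lemma of_eq (h : ∀ z, f z = g z) : EqM f g := fun _ => Eventually.of_forall h

lemma refl (f : ℂ → ℂ) : EqM f f := fun _ => EventuallyEq.rfl

lemma symm (h : EqM f g) : EqM g f := fun z => (h z).symm

lemma trans (h₁ : EqM f g) (h₂ : EqM g h) : EqM f h := fun z => (h₁ z).trans (h₂ z)

lemma comp_add (h : EqM f g) (c : ℂ) : EqM (fun z => f (z + c)) fun z => g (z + c) := by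
  intro z
  have : Tendsto (fun w => w + c) (𝓝[≠] z) (𝓝[≠] (z + c)) := by
    refine tendsto_nhdsWithin_of_tendsto_nhds_of_eventually_within _ ?_ ?_
    · exact ((continuous_id.add continuous_const).tendsto z).mono_left nhdsWithin_le_nhds
    · filter_upwards [self_mem_nhdsWithin] with w hw
      simpa using hw
  exact this.eventually (h (z + c))

lemma eq_of_continuous (h : EqM f g) (hf : Continuous f) (hg : Continuous g) : f = g := by
  funext z
  exact tendsto_nhds_unique_of_eventuallyEq
    (hf.continuousAt.tendsto.mono_left nhdsWithin_le_nhds)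
    (hg.continuousAt.tendsto.mono_left nhdsWithin_le_nhds) (h z)

lemma meromorphicOrderAt_eq (h : EqM f g) (z : ℂ) :
    meromorphicOrderAt f z = meromorphicOrderAt g z :=
  meromorphicOrderAt_congr (h z)

lemma meromorphic (h : EqM f g) (hf : Meromorphic f) : Meromorphic g :=
  fun z => (hf z).congr (h z)

end EqM

lemma Meromorphic.comp_add_const {f : ℂ → ℂ} (hf : Meromorphic f) (c : ℂ) :
    Meromorphic fun z => f (z + c) :=
  fun z => meromorphicAt_comp_add_const_iff_meromorphicAt.2 (hf (z + c))

lemma meromorphic_of_differentiable {f : ℂ → ℂ} (hf : Differentiable ℂ f) : Meromorphic f :=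
  fun z => (hf.analyticAt z).meromorphicAt

/-- A meromorphic function vanishes identically or has isolated zeros. -/
lemma eqM_zero_or_eventually_ne_zero {f : ℂ → ℂ} (hf : Meromorphic f) :
    EqM f 0 ∨ ∀ z, ∀ᶠ w in 𝓝[≠] z, f w ≠ 0 := by
  have h := MeromorphicOn.exists_meromorphicOrderAt_ne_top_iff_forall (f := f)
    (U := Set.univ) (hf.meromorphicOn) isConnected_univ
  by_cases hne : ∃ u : (Set.univ : Set ℂ), meromorphicOrderAt f u ≠ ⊤
  · right
    intro z
    exact (meromorphicOrderAt_ne_top_iff_eventually_ne_zero (hf z)).1 (h.1 hne ⟨z, trivial⟩)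
  · left
    push Not at hne
    intro z
    exact meromorphicOrderAt_eq_top_iff.1 (hne ⟨z, trivial⟩)

lemma eqM_zero_of_frequently {f : ℂ → ℂ} (hf : Meromorphic f) {z : ℂ}
    (h : ∃ᶠ w in 𝓝[≠] z, f w = 0) : EqM f 0 :=
  (eqM_zero_or_eventually_ne_zero hf).resolve_right fun h' => h (h' z)

/-! ### The normal form of a meromorphic function -/

/-- The normal form of a meromorphic function: the value is the limit, and `0` at the poles. -/
def nf (f : ℂ → ℂ) : ℂ → ℂ := toMeromorphicNFOn f Set.univ

lemma nf_eqM {f : ℂ → ℂ} (hf : Meromorphic f) : EqM (nf f) f := fun z =>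
  hf.meromorphicOn.toMeromorphicNFOn_eq_self_on_nhdsNE (Set.mem_univ z)

lemma meromorphicNFAt_nf (f : ℂ → ℂ) (z : ℂ) : MeromorphicNFAt (nf f) z :=
  meromorphicNFOn_toMeromorphicNFOn f Set.univ trivial

lemma eq_of_eqM_of_meromorphicNFAt {f g : ℂ → ℂ} (h : EqM f g) (hf : ∀ z, MeromorphicNFAt f z)
    (hg : ∀ z, MeromorphicNFAt g z) : f = g := by
  funext z
  exact (((hf z).eventuallyEq_nhdsNE_iff_eventuallyEq_nhds (hg z)).1 (h z)).eq_of_nhds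

lemma analyticAt_nf {f : ℂ → ℂ} (hf : Meromorphic f) {z : ℂ} (h : 0 ≤ meromorphicOrderAt f z) :
    AnalyticAt ℂ (nf f) z := by
  rw [← (meromorphicNFAt_nf f z).meromorphicOrderAt_nonneg_iff_analyticAt,
    (nf_eqM hf).meromorphicOrderAt_eq]
  exact h

lemma nf_apply_of_analyticAt {f : ℂ → ℂ} (hf : Meromorphic f) {z : ℂ} (h : AnalyticAt ℂ f z) :
    nf f z = f z :=
  tendsto_nhds_unique_of_eventuallyEq
    ((analyticAt_nf hf h.meromorphicOrderAt_nonneg).continuousAt.tendsto.mono_left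
      nhdsWithin_le_nhds)
    (h.continuousAt.tendsto.mono_left nhdsWithin_le_nhds) (nf_eqM hf z)

/-- Two functions in normal form that agree off a discrete set agree everywhere. Passing to normal
forms thus turns periods up to discrete sets into genuine periods, so that zero sets become
invariant under the lattice. -/
lemma nf_add_of_eqM {f : ℂ → ℂ} (hf : Meromorphic f) {c : ℂ}
    (h : EqM (fun z => f (z + c)) f) (z : ℂ) : nf f (z + c) = nf f z := by
  have h1 : EqM (fun z => nf f (z + c)) (nf f) :=
    (((nf_eqM hf).comp_add c).trans h).trans (nf_eqM hf).symm
  exact congrFun (eq_of_eqM_of_meromorphicNFAt h1 (fun w =>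
    meromorphicNFAt_comp_add_const_iff_meromorphicNFAt.2 (meromorphicNFAt_nf f (w + c)))
    (meromorphicNFAt_nf f)) z

/-! ### The lattice `ℤ + ℤτ` -/

section Lattice

variable {τ η : ℂ}

/-- A compact set that meets every class modulo `ℤ + ℤτ`. -/
def cell (τ : ℂ) : Set ℂ :=
  (fun p : ℝ × ℝ => (p.1 + p.2 * τ : ℂ)) '' (Set.Icc 0 1 ×ˢ Set.Icc 0 1)

lemma isCompact_cell (τ : ℂ) : IsCompact (cell τ) :=
  (isCompact_Icc.prod isCompact_Icc).image (by fun_prop)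

lemma exists_sub_mem_cell (hτ : 0 < τ.im) (z : ℂ) : ∃ a b : ℤ, z - (a + b * τ) ∈ cell τ := by
  set y : ℝ := z.im / τ.im
  set x : ℝ := z.re - y * τ.re
  have hz : z = x + y * τ := by
    apply Complex.ext
    · simp [x]
    · simp [y, hτ.ne']
  refine ⟨⌊x⌋, ⌊y⌋, (Int.fract x, Int.fract y), ⟨?_, ?_⟩, ?_⟩
  · exact ⟨Int.fract_nonneg _, (Int.fract_lt_one _).le⟩
  · exact ⟨Int.fract_nonneg _, (Int.fract_lt_one _).le⟩
  · simp only [Int.fract]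
    push_cast
    linear_combination -hz

lemma apply_add_lattice {X : Type*} {f : ℂ → X} (h1 : ∀ z, f (z + 1) = f z)
    (h2 : ∀ z, f (z + τ) = f z) (z : ℂ) (a b : ℤ) : f (z + (a + b * τ)) = f z := by
  have p1 : Function.Periodic f 1 := h1
  have p2 : Function.Periodic f τ := h2
  have e1 := p1.int_mul a (z + b * τ)
  have e2 := p2.int_mul b z
  rw [mul_one] at e1
  rw [show z + (a + b * τ) = z + b * τ + a by ring]
  exact e1.trans e2

/-- A set that is invariant under `ℤ + ℤτ` and contains infinitely many points `z₀ + Kη`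
accumulates. -/
lemma exists_frequently_mem_of_periodic (hτ : 0 < τ.im) (hη : ∀ a b : ℚ, η ≠ a + b * τ)
    {S : Set ℂ} (h1 : ∀ z, (z + 1 ∈ S) = (z ∈ S)) (h2 : ∀ z, (z + τ ∈ S) = (z ∈ S)) (z₀ : ℂ)
    (h : ∃ᶠ K : ℕ in atTop, z₀ + K * η ∈ S) : ∃ p, ∃ᶠ z in 𝓝[≠] p, z ∈ S := by
  choose a b hab using fun z => exists_sub_mem_cell hτ z
  set p : ℕ → ℂ := fun K => z₀ + K * η - (a (z₀ + K * η) + b (z₀ + K * η) * τ) with hp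
  -- Two equal representatives would make (K - L)η a lattice point and place η in ℚ + ℚτ.
  have hinj : Function.Injective p := by
    intro K L hKL
    by_contra hne
    have hne' : ((K : ℚ) - L) ≠ 0 := by
      rw [sub_ne_zero]; exact_mod_cast hne
    have hne'' : ((K : ℂ) - L) ≠ 0 := by exact_mod_cast hne'
    simp only [hp] at hKL
    generalize a (z₀ + K * η) = a₁, a (z₀ + L * η) = a₂, b (z₀ + K * η) = b₁,
      b (z₀ + L * η) = b₂ at hKL
    refine hη ((a₁ - a₂) / (K - L)) ((b₁ - b₂) / (K - L)) ?_
    push_cast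
    field_simp
    linear_combination hKL
  have hpS : ∀ K : ℕ, z₀ + K * η ∈ S → p K ∈ S := by
    intro K hK
    have := apply_add_lattice (f := fun z => z ∈ S) (τ := τ) h1 h2 (p K) (a (z₀ + K * η))
      (b (z₀ + K * η))
    rw [← this]
    simpa [hp] using hK
  -- Infinitely many distinct representatives lie in a compact cell, hence accumulate there.
  have hinf : (p '' {K : ℕ | z₀ + K * η ∈ S}).Infinite :=
    (Nat.frequently_atTop_iff_infinite.1 h).image hinj.injOn
  obtain ⟨q, -, hq⟩ := hinf.exists_accPt_of_subset_isCompact (isCompact_cell τ) (by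
    rintro _ ⟨K, -, rfl⟩; exact hab _)
  refine ⟨q, (accPt_iff_frequently_nhdsNE.1 hq).mono ?_⟩
  rintro _ ⟨K, hK, rfl⟩
  exact hpS K hK

/-- Contrapositive of the accumulation principle. It is applied to the set of singularities of
periodic functions, which is discrete, to make them regular at almost all points z₀ + Kη. -/
lemma eventually_analyticAt_of_periodic (hτ : 0 < τ.im) (hη : ∀ a b : ℚ, η ≠ a + b * τ)
    {S : Set ℂ} (h1 : ∀ z, (z + 1 ∈ S) = (z ∈ S)) (h2 : ∀ z, (z + τ ∈ S) = (z ∈ S))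
    (hS : ∀ p, ∀ᶠ z in 𝓝[≠] p, z ∉ S) (z₀ : ℂ) : ∀ᶠ K : ℕ in atTop, z₀ + K * η ∉ S := by
  by_contra h
  obtain ⟨p, hp⟩ := exists_frequently_mem_of_periodic hτ hη h1 h2 z₀
    (by simpa [Filter.Frequently] using h)
  exact hp (hS p)

/-- An entire function whose derivative is elliptic is affine. -/
lemma exists_affine_of_add_const (hτ : 0 < τ.im) {f : ℂ → ℂ} (hf : Differentiable ℂ f) {c₁ c₂ : ℂ}
    (h1 : ∀ z, f (z + 1) = f z + c₁) (h2 : ∀ z, f (z + τ) = f z + c₂) :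
    ∃ β, (∀ z, f z = c₁ * z + β) ∧ c₂ = c₁ * τ := by
  have hd : Differentiable ℂ (deriv f) := fun z =>
    (hf.analyticAt z).deriv.differentiableAt
  have p1 : ∀ z, deriv f (z + 1) = deriv f z := fun z => by
    rw [← deriv_comp_add_const, funext h1, deriv_add_const]
  have p2 : ∀ z, deriv f (z + τ) = deriv f z := fun z => by
    rw [← deriv_comp_add_const, funext h2, deriv_add_const]
  -- The derivative is elliptic, hence takes all its values on the compact cell, and Liouville's
  -- theorem applies.
  have hb : Bornology.IsBounded (Set.range (deriv f)) := by
    refine ((isCompact_cell τ).image hd.continuous).isBounded.subset ?_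
    rintro _ ⟨z, rfl⟩
    obtain ⟨a, b, hab⟩ := exists_sub_mem_cell hτ z
    refine ⟨_, hab, ?_⟩
    rw [← apply_add_lattice p1 p2 (z - (a + b * τ)) a b, sub_add_cancel]
  obtain ⟨α, hα⟩ := hd.exists_const_forall_eq_of_bounded hb
  have hc : ∀ z, f z - α * z = f 0 - α * 0 := by
    intro z
    refine is_const_of_deriv_eq_zero (f := fun z => f z - α * z) (by fun_prop) (fun w => ?_) z 0
    rw [deriv_fun_sub (hf w) (by fun_prop), hα w]
    simp
  have hα1 : α = c₁ := by
    have e0 := hc 1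
    have e1 := h1 0
    rw [zero_add] at e1
    linear_combination e1 - e0
  refine ⟨f 0, fun z => ?_, ?_⟩
  · rw [← hα1]; linear_combination hc z
  · have e0 := hc τ
    have e1 := h2 0
    rw [zero_add] at e1
    rw [← hα1]
    linear_combination e0 - e1

/-- A meromorphic function without poles whose translates by the periods differ from it by
constants is affine. -/
lemma exists_eqM_affine (hτ : 0 < τ.im) {f : ℂ → ℂ} (hf : Meromorphic f)
    (h0 : ∀ z, 0 ≤ meromorphicOrderAt f z) {c₁ c₂ : ℂ}
    (h1 : EqM (fun z => f (z + 1)) fun z => f z + c₁)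
    (h2 : EqM (fun z => f (z + τ)) fun z => f z + c₂) :
    ∃ β, EqM f (fun z => c₁ * z + β) ∧ c₂ = c₁ * τ := by
  have hd : Differentiable ℂ (nf f) := fun z => (analyticAt_nf hf (h0 z)).differentiableAt
  have key : ∀ (c d : ℂ), EqM (fun z => f (z + c)) (fun z => f z + d) →
      ∀ z, nf f (z + c) = nf f z + d := by
    intro c d h z
    refine congrFun (EqM.eq_of_continuous (f := fun z => nf f (z + c))
      (g := fun z => nf f z + d) ?_ ?_ ?_) z
    · refine (((nf_eqM hf).comp_add c).trans h).trans fun w => ?_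
      filter_upwards [nf_eqM hf w] with v hv
      rw [hv]
    · exact hd.continuous.comp (by fun_prop)
    · exact hd.continuous.add continuous_const
  obtain ⟨β, h3, h4⟩ := exists_affine_of_add_const hτ hd (key 1 c₁ h1) (key τ c₂ h2)
  exact ⟨β, (nf_eqM hf).symm.trans (EqM.of_eq h3), h4⟩

lemma exists_eqM_const (hτ : 0 < τ.im) {f : ℂ → ℂ} (hf : Meromorphic f)
    (h0 : ∀ z, 0 ≤ meromorphicOrderAt f z)
    (h1 : EqM (fun z => f (z + 1)) f) (h2 : EqM (fun z => f (z + τ)) f) :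
    ∃ β, EqM f fun _ => β := by
  obtain ⟨β, h, -⟩ := exists_eqM_affine hτ hf h0 (c₁ := 0) (c₂ := 0) (by simpa using h1)
    (by simpa using h2)
  exact ⟨β, by simpa using h⟩

/-- If the translates of a meromorphic function by `1`, `τ` and a non-torsion `η` differ from it
by constants, then it is affine. -/
lemma exists_eqM_affine_of_nontorsion (hτ : 0 < τ.im) (hη : ∀ a b : ℚ, η ≠ a + b * τ) {f : ℂ → ℂ}
    (hf : Meromorphic f) {c₁ c₂ c₃ : ℂ}
    (h1 : EqM (fun z => f (z + 1)) fun z => f z + c₁)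
    (h2 : EqM (fun z => f (z + τ)) fun z => f z + c₂)
    (h3 : EqM (fun z => f (z + η)) fun z => f z + c₃) :
    ∃ β, EqM f (fun z => c₁ * z + β) ∧ c₂ = c₁ * τ ∧ c₃ = c₁ * η := by
  have key : ∀ c d : ℂ, EqM (fun z => f (z + c)) (fun z => f z + d) →
      ∀ z, (meromorphicOrderAt f (z + c) < 0 ↔ meromorphicOrderAt f z < 0) := by
    intro c d h z
    rw [← meromorphicOrderAt_comp_add_const_eq_meromorphicOrderAt]
    have e : meromorphicOrderAt (fun z => f (z + c)) z = meromorphicOrderAt (f + fun _ => d) z :=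
      h.meromorphicOrderAt_eq z
    change meromorphicOrderAt (fun z => f (z + c)) z < 0 ↔ _
    rw [e]
    have hd : 0 ≤ meromorphicOrderAt (fun _ : ℂ => d) z :=
      (analyticAt_const).meromorphicOrderAt_nonneg
    constructor
    · intro hlt
      by_contra hge
      push Not at hge
      exact absurd (le_trans (le_min hge hd) (meromorphicOrderAt_add (hf z) (.const d z)))
        (not_le.2 hlt)
    · intro hlt
      rwa [meromorphicOrderAt_add_eq_left_of_lt (.const d z) (hlt.trans_le hd)]
  -- The set of poles is invariant under 1, τ and η, since adding a constant does not affect a pole.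
  -- A pole at z₀ would thus recur at all z₀ + Kη, and the poles would accumulate modulo the
  -- lattice.
  have h0 : ∀ z, 0 ≤ meromorphicOrderAt f z := by
    by_contra! hz
    obtain ⟨z₀, hz₀⟩ := hz
    have hK : ∀ K : ℕ, meromorphicOrderAt f (z₀ + K * η) < 0 := by
      intro K
      induction K with
      | zero => simpa using hz₀
      | succ K ih =>
        have := (key η c₃ h3 (z₀ + K * η)).2 ih
        rw [add_assoc, ← add_one_mul] at this
        exact_mod_cast this
    obtain ⟨p, hp⟩ := exists_frequently_mem_of_periodic hτ hη
      (S := {z | meromorphicOrderAt f z < 0}) (fun z => propext (key 1 c₁ h1 z))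
      (fun z => propext (key τ c₂ h2 z)) z₀ (Eventually.of_forall hK).frequently
    refine hp ?_
    filter_upwards [(hf p).eventually_analyticAt] with w hw
    simpa using hw.meromorphicOrderAt_nonneg
  obtain ⟨β, h4, h5⟩ := exists_eqM_affine hτ hf h0 h1 h2
  refine ⟨β, h4, h5, ?_⟩
  have h6 : EqM (fun z => c₁ * (z + η) + β) fun z => c₁ * z + β + c₃ := by
    refine ((h4.comp_add η).symm.trans h3).trans fun w => ?_
    filter_upwards [h4 w] with v hv
    rw [hv]
  have h7 := congrFun (h6.eq_of_continuous (by fun_prop) (by fun_prop)) 0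
  simp only [zero_add, mul_zero] at h7
  linear_combination -h7

end Lattice

end EightVertex

end

noncomputable section
namespace EightVertex
open Filter Topology Function

/-! ### Functions determined by their values at the multiples of `η` -/

section Uniqueness

variable {τ η : ℂ}

/-- `f` is regular and zero at almost all positive multiples of `η`. -/
def VanishesAlong (η : ℂ) (f : ℂ → ℂ) : Prop :=
  ∀ᶠ K : ℕ in atTop, AnalyticAt ℂ f (K * η) ∧ f (K * η) = 0

/-- The points Kη are pairwise inequivalent modulo the lattice, so infinitely many zeros among them
accumulate modulo periods. The zero set used is that of the normal form, which is genuinely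
periodic. -/
lemma eqM_zero_of_elliptic (hτ : 0 < τ.im) (hη : ∀ a b : ℚ, η ≠ a + b * τ) {f : ℂ → ℂ}
    (hf : Meromorphic f) (h1 : EqM (fun z => f (z + 1)) f) (h2 : EqM (fun z => f (z + τ)) f)
    (h : ∃ᶠ K : ℕ in atTop, AnalyticAt ℂ f (K * η) ∧ f (K * η) = 0) : EqM f 0 := by
  obtain ⟨p, hp⟩ := exists_frequently_mem_of_periodic hτ hη (S := {z | nf f z = 0})
    (fun z => by simp [nf_add_of_eqM hf h1]) (fun z => by simp [nf_add_of_eqM hf h2]) 0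
    (h.mono fun K hK => by
      simp only [zero_add, Set.mem_ofPred_eq]
      rw [nf_apply_of_analyticAt hf hK.1, hK.2])
  have hm : Meromorphic (nf f) := (nf_eqM hf).symm.meromorphic hf
  exact (nf_eqM hf).symm.trans (eqM_zero_of_frequently hm hp)

lemma eq_zero_of_eqM_zero {f : ℂ → ℂ} (h : EqM f 0) {z : ℂ} (hf : ContinuousAt f z) : f z = 0 :=
  tendsto_nhds_unique_of_eventuallyEq (hf.tendsto.mono_left nhdsWithin_le_nhds)
    (tendsto_const_nhds (x := (0 : ℂ))) (h z)

lemma VanishesAlong.comp_add {f : ℂ → ℂ} (h : VanishesAlong η f) :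
    VanishesAlong η (fun z => f (z + η)) := by
  have h' := (tendsto_add_atTop_nat 1).eventually h
  filter_upwards [h'] with K hK
  have e : (K : ℂ) * η + η = ((K + 1 : ℕ) : ℂ) * η := by push_cast; ring
  rw [e]
  refine ⟨?_, hK.2⟩
  have h1 := hK.1
  rw [← e] at h1
  exact h1.comp (f := fun z => z + η) (by fun_prop)

/-- A meromorphic function with period `1`, whose translate by `τ` differs from it by an elliptic
function, vanishes if it vanishes at the multiples of `η`. -/
lemma eqM_zero_of_quasi (hτ : 0 < τ.im) (hη : ∀ a b : ℚ, η ≠ a + b * τ) {f e : ℂ → ℂ}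
    (hf : Meromorphic f) (he : Meromorphic e)
    (h1 : EqM (fun z => f (z + 1)) f) (h2 : EqM (fun z => f (z + τ)) fun z => f z + e z)
    (he1 : EqM (fun z => e (z + 1)) e) (he2 : EqM (fun z => e (z + τ)) e)
    (hea : ∀ᶠ K : ℕ in atTop, AnalyticAt ℂ e (K * η) ∧ AnalyticAt ℂ (fun z => e (z + η)) (K * η))
    (h : VanishesAlong η f) : EqM f 0 := by
  have hfη : Meromorphic fun z => f (z + η) := Meromorphic.comp_add_const hf η
  have heη : Meromorphic fun z => e (z + η) := Meromorphic.comp_add_const he η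
  rcases eqM_zero_or_eventually_ne_zero he with h0 | hne
  · refine eqM_zero_of_elliptic hτ hη hf h1 (fun z => ?_) h.frequently
    filter_upwards [h2 z, h0 z] with w a b
    rw [a, b]; simp
  · exfalso
    -- The difference Wronskian of f and e. Under z ↦ z + τ the two contributions of e cancel, so it
    -- is elliptic, and it vanishes at Kη because f does at Kη and at (K+1)η.
    have hW : EqM (fun z => f z * e (z + η) - f (z + η) * e z) 0 := by
      refine eqM_zero_of_elliptic hτ hη ((hf.mul heη).sub (hfη.mul he)) (fun z => ?_)
        (fun z => ?_) (Eventually.frequently ?_)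
      · filter_upwards [h1 z, h1.comp_add η z, he1 z, he1.comp_add η z] with w a b c d
        rw [add_right_comm w 1 η, a, b, c, d]
      · filter_upwards [h2 z, h2.comp_add η z, he2 z, he2.comp_add η z] with w a b c d
        rw [add_right_comm w τ η, a, b, c, d]; ring
      · filter_upwards [h, h.comp_add, hea] with K a b c
        exact ⟨(a.1.mul c.2).sub (b.1.mul c.1), by rw [a.2, b.2]; ring⟩
    have hneη : ∀ z, ∀ᶠ w in 𝓝[≠] z, e (w + η) ≠ 0 :=
      ((eqM_zero_or_eventually_ne_zero heη).resolve_left fun h0 => by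
        have h0' := h0.comp_add (-η)
        obtain ⟨w, hw1, hw2⟩ := ((h0' 0).and (hne 0)).exists
        exact hw2 (by simpa using hw1))
    -- The quotient f/e is invariant under 1 and η but increases by 1 under τ. An affine function of
    -- slope 0 cannot do this.
    obtain ⟨β, -, h5, -⟩ := exists_eqM_affine_of_nontorsion hτ hη (f := fun z => f z / e z)
      (hf.div he) (c₁ := 0) (c₂ := 1) (c₃ := 0)
      (fun z => by
        filter_upwards [h1 z, he1 z] with w a b
        rw [a, b, add_zero])
      (fun z => by
        filter_upwards [h2 z, he2 z, hne z] with w a b c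
        rw [a, b]; field_simp)
      (fun z => by
        filter_upwards [hW z, hne z, hneη z] with w a b c
        simp only [Pi.zero_apply] at a
        rw [add_zero, div_eq_div_iff c b]; linear_combination -a)
    simp at h5

/-- A function `g₁(t) - (t/η) g₂(t)` of the trace form that vanishes at the multiples of `η` is
zero. -/
lemma eqM_zero_of_traceForm (hτ : 0 < τ.im) (hη : ∀ a b : ℚ, η ≠ a + b * τ) {g₁ g₂ g₃ : ℂ → ℂ}
    (m1 : Meromorphic g₁) (m2 : Meromorphic g₂) (m3 : Meromorphic g₃)
    (h11 : EqM (fun z => g₁ (z + 1)) g₁) (h1τ : EqM (fun z => g₁ (z + τ)) fun z => g₁ z + g₃ z)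
    (h21 : EqM (fun z => g₂ (z + 1)) g₂) (h2τ : EqM (fun z => g₂ (z + τ)) g₂)
    (h31 : EqM (fun z => g₃ (z + 1)) g₃) (h3τ : EqM (fun z => g₃ (z + τ)) g₃)
    (ha : ∀ᶠ K : ℕ in atTop,
      AnalyticAt ℂ g₁ (K * η) ∧ AnalyticAt ℂ g₂ (K * η) ∧ AnalyticAt ℂ g₃ (K * η))
    (h : ∀ᶠ K : ℕ in atTop, g₁ (K * η) - K * g₂ (K * η) = 0) : EqM g₁ 0 ∧ EqM g₂ 0 := by
  have hη0 : η ≠ 0 := by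
    have := hη 0 0; simpa using this
  have m1η : Meromorphic fun z => g₁ (z + η) := Meromorphic.comp_add_const m1 η
  have m2η : Meromorphic fun z => g₂ (z + η) := Meromorphic.comp_add_const m2 η
  have m3η : Meromorphic fun z => g₃ (z + η) := Meromorphic.comp_add_const m3 η
  have sh : ∀ g : ℂ → ℂ, ∀ K : ℕ, AnalyticAt ℂ g ((K + 1 : ℕ) * η) →
      AnalyticAt ℂ (fun z => g (z + η)) (K * η) := by
    intro g K hK
    have e : (K : ℂ) * η + η = ((K + 1 : ℕ) : ℂ) * η := by push_cast; ring
    rw [← e] at hK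
    exact hK.comp (f := fun z => z + η) (by fun_prop)
  have ha' := (tendsto_add_atTop_nat 1).eventually ha
  have ha'' := (tendsto_add_atTop_nat 1).eventually ha'
  have h' := (tendsto_add_atTop_nat 1).eventually h
  have hg2 : EqM g₂ 0 := by
    refine (eqM_zero_or_eventually_ne_zero m2).resolve_right fun hne => ?_
    have hneη : ∀ z, ∀ᶠ w in 𝓝[≠] z, g₂ (w + η) ≠ 0 :=
      ((eqM_zero_or_eventually_ne_zero m2η).resolve_left fun h0 => by
        have h0' := h0.comp_add (-η)
        obtain ⟨w, hw1, hw2⟩ := ((h0' 0).and (hne 0)).exists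
        exact hw2 (by simpa using hw1))
    -- This expresses that g₁/g₂ increases by 1 under η. At z = Kη it holds since g₁/g₂ takes the
    -- values K and K + 1 at Kη and (K+1)η wherever g₂ is nonzero; the function is quasi-periodic
    -- with an elliptic increment, so `eqM_zero_of_quasi` applies.
    have hW : EqM (fun z => g₁ (z + η) * g₂ z - g₁ z * g₂ (z + η) - g₂ z * g₂ (z + η)) 0 := by
      refine eqM_zero_of_quasi hτ hη (e := fun z => g₃ (z + η) * g₂ z - g₃ z * g₂ (z + η))
        (((m1η.mul m2).sub (m1.mul m2η)).sub (m2.mul m2η)) ((m3η.mul m2).sub (m3.mul m2η))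
        (fun z => ?_) (fun z => ?_) (fun z => ?_) (fun z => ?_) ?_ ?_
      · filter_upwards [h11 z, h11.comp_add η z, h21 z, h21.comp_add η z] with w a b c d
        rw [add_right_comm w 1 η, a, b, c, d]
      · filter_upwards [h1τ z, h1τ.comp_add η z, h2τ z, h2τ.comp_add η z] with w a b c d
        rw [add_right_comm w τ η, a, b, c, d]; ring
      · filter_upwards [h31 z, h31.comp_add η z, h21 z, h21.comp_add η z] with w a b c d
        rw [add_right_comm w 1 η, a, b, c, d]
      · filter_upwards [h3τ z, h3τ.comp_add η z, h2τ z, h2τ.comp_add η z] with w a b c d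
        rw [add_right_comm w τ η, a, b, c, d]
      · have key : ∀ᶠ K : ℕ in atTop,
            AnalyticAt ℂ (fun z => g₃ (z + η) * g₂ z - g₃ z * g₂ (z + η)) (K * η) := by
          filter_upwards [ha, ha'] with K a b
          exact ((sh _ _ b.2.2).mul a.2.1).sub (a.2.2.mul (sh _ _ b.2.1))
        filter_upwards [key, (tendsto_add_atTop_nat 1).eventually key] with K a b
        exact ⟨a, sh _ _ b⟩
      · filter_upwards [ha, ha', h, h'] with K a b c d
        refine ⟨(((sh _ _ b.1).mul a.2.1).sub (a.1.mul (sh _ _ b.2.1))).sub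
          (a.2.1.mul (sh _ _ b.2.1)), ?_⟩
        have e : (K : ℂ) * η + η = ((K + 1 : ℕ) : ℂ) * η := by push_cast; ring
        rw [e]
        push_cast at d ⊢
        linear_combination g₂ (K * η) * d - g₂ ((K + 1) * η) * c
    have hy1 : EqM (fun z => g₁ (z + 1) / g₂ (z + 1)) fun z => g₁ z / g₂ z + 0 := fun z => by
      filter_upwards [h11 z, h21 z] with w a b
      rw [a, b, add_zero]
    have hyη : EqM (fun z => g₁ (z + η) / g₂ (z + η)) fun z => g₁ z / g₂ z + 1 := fun z => by
      filter_upwards [hW z, hne z, hneη z] with w a b c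
      simp only [Pi.zero_apply] at a
      field_simp
      linear_combination a
    have hyτ : EqM (fun z => g₁ (z + τ) / g₂ (z + τ)) fun z => g₁ z / g₂ z + g₃ z / g₂ z :=
      fun z => by
        filter_upwards [h1τ z, h2τ z] with w a b
        rw [a, b, add_div]
    -- The increment g₃/g₂ of g₁/g₂ under τ is elliptic. Translating g₁/g₂ by τ and η in either
    -- order shows that it is also invariant under η, hence constant.
    obtain ⟨β, hβ, -⟩ := exists_eqM_affine_of_nontorsion hτ hη (f := fun z => g₃ z / g₂ z)
      (m3.div m2) (c₁ := 0) (c₂ := 0) (c₃ := 0)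
      (fun z => by
        filter_upwards [h31 z, h21 z] with w a b
        rw [a, b, add_zero])
      (fun z => by
        filter_upwards [h3τ z, h2τ z] with w a b
        rw [a, b, add_zero])
      (fun z => by
        filter_upwards [hyτ z, hyτ.comp_add η z, hyη z, hyη.comp_add τ z] with w a b c d
        rw [add_right_comm w η τ, d] at b
        rw [a, c] at b
        linear_combination -b)
    -- The increments of g₁/g₂ under 1, τ, η are 0, β, 1. Slope 0 contradicts the increment 1.
    obtain ⟨-, -, -, h5⟩ := exists_eqM_affine_of_nontorsion hτ hη (f := fun z => g₁ z / g₂ z)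
      (m1.div m2) (c₁ := 0) (c₂ := β) (c₃ := 1) hy1
      (fun z => by
        filter_upwards [hyτ z, hβ z] with w a b
        rw [a, b]; simp) hyη
    simp at h5
  refine ⟨?_, hg2⟩
  refine eqM_zero_of_quasi hτ hη m1 m3 h11 h1τ h31 h3τ ?_ ?_
  · filter_upwards [ha, ha'] with K a b
    exact ⟨a.2.2, sh _ _ b.2.2⟩
  · filter_upwards [ha, h] with K a c
    refine ⟨a.1, ?_⟩
    have : g₂ (K * η) = 0 := eq_zero_of_eqM_zero hg2 a.2.1.continuousAt
    rw [this] at c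
    simpa using c

end Uniqueness

end EightVertex

end

noncomputable section
namespace EightVertex
open Filter Topology Function

/-! ### The zeros of `θ₁` -/

section Zeros

variable {τ : ℂ}

/-- Half of the product formula for `θ₁`. -/
def halfProd (τ z : ℂ) : ℂ :=
  ∏' n : ℕ, (1 + -(exp (2 * Real.pi * I * τ) ^ n * exp (2 * Real.pi * I * z)))

lemma norm_exp_tau_lt_one (hτ : 0 < τ.im) : ‖exp (2 * Real.pi * I * τ)‖ < 1 := by
  rw [norm_exp, Real.exp_lt_one_iff]
  have : (2 * Real.pi * I * τ).re = -(2 * Real.pi * τ.im) := by simp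
  rw [this]
  have := Real.pi_pos
  have : 0 < 2 * Real.pi * τ.im := by positivity
  linarith

lemma summable_halfProd (hτ : 0 < τ.im) (z : ℂ) :
    Summable fun n : ℕ => ‖-(exp (2 * Real.pi * I * τ) ^ n * exp (2 * Real.pi * I * z))‖ := by
  simp only [norm_neg, norm_mul, norm_pow]
  exact (summable_geometric_of_lt_one (norm_nonneg _) (norm_exp_tau_lt_one hτ)).mul_right _

lemma differentiable_halfProd (hτ : 0 < τ.im) : Differentiable ℂ (halfProd τ) := by
  have h : HasProdLocallyUniformlyOn
      (fun (n : ℕ) z => (1 + -(exp (2 * Real.pi * I * τ) ^ n * exp (2 * Real.pi * I * z))))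
      (halfProd τ) Set.univ := by
    refine hasProdLocallyUniformlyOn_of_forall_compact isOpen_univ fun K _ hK => ?_
    obtain ⟨M, hM⟩ := hK.exists_bound_of_continuousOn
      (f := fun z : ℂ => exp (2 * Real.pi * I * z)) (by fun_prop)
    refine Summable.hasProdUniformlyOn_nat_one_add
      (u := fun n => ‖exp (2 * Real.pi * I * τ)‖ ^ n * M) hK ?_ ?_ ?_
    · exact (summable_geometric_of_lt_one (norm_nonneg _) (norm_exp_tau_lt_one hτ)).mul_right _
    · refine .of_forall fun n z hz => ?_
      simp only [norm_neg, norm_mul, norm_pow]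
      exact mul_le_mul_of_nonneg_left (hM z hz) (by positivity)
    · exact fun n => by fun_prop
  rw [← differentiableOn_univ]
  exact h.differentiableOn (.of_forall fun _ => by
    simpa [Finset.prod_fn] using DifferentiableOn.finsetProd (fun _ _ => by fun_prop)) isOpen_univ

/-- The factor with n = 0 is split off; in the remaining factors the index shift is absorbed in z ↦
z + τ. -/
lemma halfProd_eq_mul (hτ : 0 < τ.im) (z : ℂ) :
    halfProd τ z = (1 - exp (2 * Real.pi * I * z)) * halfProd τ (z + τ) := by
  set f : ℕ → ℂ := fun n =>
    1 + -(exp (2 * Real.pi * I * τ) ^ n * exp (2 * Real.pi * I * z)) with hf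
  have hm' : Multipliable fun n : ℕ => f (n + 1) :=
    multipliable_one_add_of_summable (((summable_nat_add_iff 1).2 (summable_halfProd hτ z)))
  have h1 : ∏' n, f n = f 0 * ∏' n, f (n + 1) := tprod_eq_zero_mul' hm'
  have h2 : ∀ n, f (n + 1) = 1 + -(exp (2 * Real.pi * I * τ) ^ n *
      exp (2 * Real.pi * I * (z + τ))) := by
    intro n
    rw [mul_add, exp_add]
    simp only [hf]
    ring
  have h0 : f 0 = 1 - exp (2 * Real.pi * I * z) := by
    simp only [hf]
    ring
  rw [tprod_congr h2, h0] at h1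
  exact h1

lemma halfProd_ne_zero (hτ : 0 < τ.im) {z : ℂ} (h : ∀ a b : ℤ, z ≠ a + b * τ) :
    halfProd τ z ≠ 0 := by
  refine tprod_one_add_ne_zero_of_summable (fun n h0 => ?_) (summable_halfProd hτ z)
  rw [← exp_nat_mul, ← exp_add, ← sub_eq_add_neg, sub_eq_zero, eq_comm, exp_eq_one_iff] at h0
  obtain ⟨k, hk⟩ := h0
  refine h k (-n) ?_
  have h2 : (2 * Real.pi * I : ℂ) ≠ 0 := two_pi_I_ne_zero
  push_cast
  apply mul_left_cancel₀ h2
  linear_combination hk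

/-- As τ is a lattice point, `halfProd_ne_zero` does not apply; here the factors are 1 - q^{n+1}
with |q| < 1. -/
lemma halfProd_tau_ne_zero (hτ : 0 < τ.im) : halfProd τ τ ≠ 0 := by
  refine tprod_one_add_ne_zero_of_summable (fun n h0 => ?_) (summable_halfProd hτ τ)
  rw [← sub_eq_add_neg, sub_eq_zero, eq_comm, ← pow_succ] at h0
  have := congrArg norm h0
  rw [norm_pow, norm_one] at this
  exact absurd this (pow_lt_one₀ (norm_nonneg _) (norm_exp_tau_lt_one hτ) (by simp)).ne

/-- The product formula for `θ₁`, up to a constant factor. -/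
def thetaProd (τ z : ℂ) : ℂ :=
  exp (-Real.pi * I * z) * (halfProd τ z * halfProd τ (τ - z))

lemma differentiable_thetaProd (hτ : 0 < τ.im) : Differentiable ℂ (thetaProd τ) := by
  have h := differentiable_halfProd hτ
  unfold thetaProd
  fun_prop

lemma thetaProd_add_one (z : ℂ) : thetaProd τ (z + 1) = -thetaProd τ z := by
  have h : ∀ w (n : ℤ), halfProd τ (w + n) = halfProd τ w := by
    intro w n
    unfold halfProd
    rw [show 2 * Real.pi * I * (w + n) = 2 * Real.pi * I * w + n * (2 * Real.pi * I) by ring,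
      exp_periodic.int_mul n]
  have h1 := h z 1
  have h2 := h (τ - z) (-1)
  push_cast at h1 h2
  unfold thetaProd
  rw [h1, show τ - (z + 1) = τ - z + -1 by ring, h2,
    show -Real.pi * I * (z + 1) = -Real.pi * I * z - Real.pi * I by ring, exp_sub, exp_pi_mul_I]
  ring

lemma thetaProd_add_tau (hτ : 0 < τ.im) (z : ℂ) :
    thetaProd τ (z + τ) = -exp (-Real.pi * I * (τ + 2 * z)) * thetaProd τ z := by
  have h1 := halfProd_eq_mul hτ z
  have h2 := halfProd_eq_mul hτ (-z)
  have e : exp (2 * Real.pi * I * -z) * exp (2 * Real.pi * I * z) = 1 := by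
    rw [← exp_add, show 2 * Real.pi * I * -z + 2 * Real.pi * I * z = 0 by ring, exp_zero]
  have e2 : exp (-Real.pi * I * (z + τ)) * exp (2 * Real.pi * I * -z) =
      exp (-Real.pi * I * (τ + 2 * z)) * exp (-Real.pi * I * z) := by
    rw [← exp_add, ← exp_add]; congr 1; ring
  unfold thetaProd
  rw [show τ - (z + τ) = -z by ring, h2, h1, show -z + τ = τ - z by ring]
  linear_combination (-exp (-Real.pi * I * (z + τ)) * halfProd τ (z + τ) * halfProd τ (τ - z)) * e
    - (1 - exp (2 * Real.pi * I * z)) * halfProd τ (z + τ) * halfProd τ (τ - z) * e2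

lemma thetaProd_ne_zero (hτ : 0 < τ.im) {z : ℂ} (h : ∀ a b : ℤ, z ≠ a + b * τ) :
    thetaProd τ z ≠ 0 := by
  refine mul_ne_zero (exp_ne_zero _) (mul_ne_zero (halfProd_ne_zero hτ h)
    (halfProd_ne_zero hτ fun a b hab => h (-a) (1 - b) ?_))
  push_cast
  linear_combination -hab

/-- The first factor 1 - e^{2πiz} carries the zero, with derivative -2πi, and its cofactor at 0 is
the square of `halfProd τ τ`. -/
lemma hasDerivAt_thetaProd_zero (hτ : 0 < τ.im) :
    thetaProd τ 0 = 0 ∧ deriv (thetaProd τ) 0 ≠ 0 := by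
  have hd := differentiable_halfProd hτ
  have he : thetaProd τ = fun z => (1 - exp (2 * Real.pi * I * z)) *
      (exp (-Real.pi * I * z) * halfProd τ (z + τ) * halfProd τ (τ - z)) := by
    funext z
    rw [thetaProd, halfProd_eq_mul hτ z]; ring
  refine ⟨by simp [he], ?_⟩
  have h1 : HasDerivAt (fun z : ℂ => 1 - exp (2 * Real.pi * I * z)) (-(2 * Real.pi * I)) 0 := by
    have := ((hasDerivAt_id (0 : ℂ)).const_mul (2 * Real.pi * I)).cexp.const_sub 1
    simpa using this
  have h2 : DifferentiableAt ℂ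
      (fun z => exp (-Real.pi * I * z) * halfProd τ (z + τ) * halfProd τ (τ - z)) 0 := by
    have : Differentiable ℂ
      (fun z => exp (-Real.pi * I * z) * halfProd τ (z + τ) * halfProd τ (τ - z)) := by fun_prop
    exact this 0
  rw [he, (h1.fun_mul h2.hasDerivAt).deriv]
  simp [halfProd_tau_ne_zero hτ, Real.pi_ne_zero]

lemma theta_zero_lattice (a b : ℤ) : theta τ 0 (a + b * τ) = 0 := by
  have h0 : theta τ 0 0 = 0 := by
    have := theta_neg τ 0 0
    simp only [neg_zero, if_true] at this
    linear_combination this / 2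
  have := apply_add_lattice (f := fun z => theta τ 0 z = 0) (τ := τ)
    (fun z => by simp [theta_add_one, charA]) (fun z => by simp [theta_add_tau, charB]) 0 a b
  rw [zero_add] at this
  rw [this]
  exact h0

lemma meromorphicOrderAt_eq_one {f : ℂ → ℂ} {z : ℂ} (hf : AnalyticAt ℂ f z) (h0 : f z = 0)
    (h1 : deriv f z ≠ 0) : meromorphicOrderAt f z = 1 := by
  have := hf.analyticOrderAt_sub_eq_one_of_deriv_ne_zero h1
  simp only [h0, sub_zero] at this
  rw [hf.meromorphicOrderAt_eq, this]
  rfl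

/-- `θ₁` is a multiple of the product. -/
lemma exists_theta_eq_thetaProd (hτ : 0 < τ.im) :
    ∃ c : ℂ, c ≠ 0 ∧ ∀ z, theta τ 0 z = c * thetaProd τ z := by
  have hd := differentiable_theta hτ 0
  have hp := differentiable_thetaProd hτ
  have p1 : ∀ z, theta τ 0 (z + 1) / thetaProd τ (z + 1) = theta τ 0 z / thetaProd τ z := by
    intro z
    rw [theta_add_one, thetaProd_add_one]; simp [charA]
  have p2 : ∀ z, theta τ 0 (z + τ) / thetaProd τ (z + τ) = theta τ 0 z / thetaProd τ z := by
    intro z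
    rw [theta_add_tau, thetaProd_add_tau hτ]
    rw [show -charB 0 = -1 by simp [charB], neg_one_mul]
    exact mul_div_mul_left _ _ (neg_ne_zero.2 (exp_ne_zero _))
  have hm : Meromorphic fun z => theta τ 0 z / thetaProd τ z :=
    (meromorphic_of_differentiable hd).div (meromorphic_of_differentiable hp)
  -- The quotient is elliptic, since θ₁ and the product have the same multipliers. Its only possible
  -- poles are at lattice points, where the simple zero of the product is compensated by the zero of
  -- θ₁. Hence it is constant.
  have key : ∀ z, 0 ≤ meromorphicOrderAt (fun z => theta τ 0 z / thetaProd τ z) z := by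
    have hz0 : 0 ≤ meromorphicOrderAt (fun z => theta τ 0 z / thetaProd τ z) 0 := by
      obtain ⟨h0, h1⟩ := hasDerivAt_thetaProd_zero hτ
      have e := meromorphicOrderAt_div (hd.analyticAt 0).meromorphicAt
        (hp.analyticAt 0).meromorphicAt
      rw [meromorphicOrderAt_eq_one (hp.analyticAt 0) h0 h1] at e
      change 0 ≤ meromorphicOrderAt (theta τ 0 / thetaProd τ) 0
      rw [e]
      have h2 : 0 < meromorphicOrderAt (theta τ 0) 0 := by
        rw [← tendsto_zero_iff_meromorphicOrderAt_pos (hd.analyticAt 0).meromorphicAt]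
        have : theta τ 0 0 = 0 := by simpa using theta_zero_lattice (τ := τ) 0 0
        have h3 := (hd.continuous.tendsto 0).mono_left (nhdsWithin_le_nhds (s := {0}ᶜ))
        rwa [this] at h3
      induction h : meromorphicOrderAt (theta τ 0) 0 with
      | top => simp
      | coe n =>
        rw [h] at h2
        have hn : (0 : ℤ) < n := by exact_mod_cast h2
        have : (0 : ℤ) ≤ n - 1 := by omega
        exact_mod_cast this
    intro z
    by_cases hz : ∃ a b : ℤ, z = a + b * τ
    · obtain ⟨a, b, rfl⟩ := hz
      have := apply_add_lattice (τ := τ)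
        (f := fun w => meromorphicOrderAt (fun z => theta τ 0 z / thetaProd τ z) w)
        (fun w => by
          rw [← meromorphicOrderAt_comp_add_const_eq_meromorphicOrderAt]
          exact congrFun (congrArg _ (funext p1)) w)
        (fun w => by
          rw [← meromorphicOrderAt_comp_add_const_eq_meromorphicOrderAt]
          exact congrFun (congrArg _ (funext p2)) w) 0 a b
      rw [zero_add] at this
      rw [this]; exact hz0
    · push Not at hz
      exact ((hd.analyticAt z).div (hp.analyticAt z)
        (thetaProd_ne_zero hτ hz)).meromorphicOrderAt_nonneg
  obtain ⟨c, hc⟩ := exists_eqM_const hτ hm key (EqM.of_eq p1) (EqM.of_eq p2)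
  have hne : ∀ z, ∀ᶠ w in 𝓝[≠] z, thetaProd τ w ≠ 0 := by
    refine (eqM_zero_or_eventually_ne_zero (meromorphic_of_differentiable hp)).resolve_left
      fun h0 => (hasDerivAt_thetaProd_zero hτ).2 ?_
    have : thetaProd τ = 0 := h0.eq_of_continuous hp.continuous continuous_const
    rw [this]; simp
  have heq : theta τ 0 = fun z => c * thetaProd τ z := by
    refine EqM.eq_of_continuous (fun z => ?_) hd.continuous (continuous_const.mul hp.continuous)
    filter_upwards [hc z, hne z] with w h1 h2
    rw [← h1]; field_simp
  refine ⟨c, ?_, fun z => congrFun heq z⟩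
  rintro rfl
  obtain ⟨z, hz⟩ := exists_jacobiTheta₂_ne_zero hτ
  have := congrFun heq (z - (1 / 2 + τ / 2))
  simp only [theta, zero_mul] at this
  rw [show z - (1 / 2 + τ / 2) + 1 / 2 + τ / 2 = z by ring] at this
  simp [hz] at this

lemma theta_ne_zero (hτ : 0 < τ.im) {z : ℂ} (h : ∀ a b : ℤ, z ≠ a + b * τ) : theta τ 0 z ≠ 0 := by
  obtain ⟨c, hc, he⟩ := exists_theta_eq_thetaProd hτ
  rw [he]
  exact mul_ne_zero hc (thetaProd_ne_zero hτ h)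

lemma exists_lattice_of_theta_eq_zero (hτ : 0 < τ.im) {z : ℂ} (h : theta τ 0 z = 0) :
    ∃ a b : ℤ, z = a + b * τ := by
  by_contra! hz
  exact theta_ne_zero hτ hz h

lemma theta_zero_zero : theta τ 0 0 = 0 := by simpa using theta_zero_lattice (τ := τ) 0 0

lemma deriv_theta_ne_zero (hτ : 0 < τ.im) : deriv (theta τ 0) 0 ≠ 0 := by
  obtain ⟨c, hc, he⟩ := exists_theta_eq_thetaProd hτ
  rw [funext he, deriv_const_mul _ ((differentiable_thetaProd hτ) 0)]
  exact mul_ne_zero hc (hasDerivAt_thetaProd_zero hτ).2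

lemma meromorphicOrderAt_theta (hτ : 0 < τ.im) {z : ℂ} (h : theta τ 0 z = 0) :
    meromorphicOrderAt (theta τ 0) z = 1 := by
  have hd := differentiable_theta hτ 0
  have h0 : meromorphicOrderAt (theta τ 0) 0 = 1 :=
    meromorphicOrderAt_eq_one (hd.analyticAt 0) theta_zero_zero (deriv_theta_ne_zero hτ)
  obtain ⟨a, b, rfl⟩ := exists_lattice_of_theta_eq_zero hτ h
  have := apply_add_lattice (τ := τ) (f := fun w => meromorphicOrderAt (theta τ 0) w)
    (fun w => by
      rw [← meromorphicOrderAt_comp_add_const_eq_meromorphicOrderAt,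
        show (theta τ 0 ∘ fun x => x + 1) = (fun _ => (-1 : ℂ)) * theta τ 0 from
          funext fun z => by simp [theta_add_one, charA]]
      exact meromorphicOrderAt_mul_of_ne_zero analyticAt_const (by simp))
    (fun w => by
      rw [← meromorphicOrderAt_comp_add_const_eq_meromorphicOrderAt,
        show (theta τ 0 ∘ fun x => x + τ) =
          (fun z => -exp (-Real.pi * I * (τ + 2 * z))) * theta τ 0 from
          funext fun z => by simp [theta_add_tau, charB]]
      exact meromorphicOrderAt_mul_of_ne_zero (by fun_prop) (by simp)) 0 a b
  rw [zero_add] at this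
  rw [this, h0]

lemma eventually_theta_ne_zero (hτ : 0 < τ.im) (z : ℂ) : ∀ᶠ w in 𝓝[≠] z, theta τ 0 w ≠ 0 := by
  have hd := differentiable_theta hτ 0
  refine (eqM_zero_or_eventually_ne_zero (meromorphic_of_differentiable hd)).resolve_left
    (fun h0 => deriv_theta_ne_zero hτ ?_) z
  have : theta τ 0 = 0 := h0.eq_of_continuous hd.continuous continuous_const
  rw [this]; simp

end Zeros

end EightVertex

end

noncomputable section
namespace EightVertex
open Filter Topology Function

/-! ### Interpolation in the spaces `𝒱^{(k)}` -/

section Interpolation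

variable {τ : ℂ}

/-- At a simple zero of p the quotient has a removable singularity, and the normal form supplies the
missing value. -/
lemma exists_differentiable_div {f p : ℂ → ℂ} (hf : Differentiable ℂ f) (hp : Differentiable ℂ p)
    (hne : ∀ z, ∀ᶠ w in 𝓝[≠] z, p w ≠ 0)
    (h : ∀ z, p z = 0 → f z = 0 ∧ meromorphicOrderAt p z = 1) :
    ∃ g : ℂ → ℂ, Differentiable ℂ g ∧ ∀ z, f z = p z * g z := by
  have hm : Meromorphic (f / p) :=
    (meromorphic_of_differentiable hf).div (meromorphic_of_differentiable hp)
  have hg : Differentiable ℂ (nf (f / p)) := by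
    refine fun z => (analyticAt_nf hm ?_).differentiableAt
    by_cases hz : p z = 0
    · obtain ⟨h0, h1⟩ := h z hz
      rw [meromorphicOrderAt_div (hf.analyticAt z).meromorphicAt (hp.analyticAt z).meromorphicAt,
        h1]
      have h2 : 0 < meromorphicOrderAt f z := by
        rw [← tendsto_zero_iff_meromorphicOrderAt_pos (hf.analyticAt z).meromorphicAt]
        have h3 := (hf.continuous.tendsto z).mono_left (nhdsWithin_le_nhds (s := {z}ᶜ))
        rwa [h0] at h3
      induction h' : meromorphicOrderAt f z with
      | top => simp
      | coe n =>
        rw [h'] at h2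
        have hn : (0 : ℤ) < n := by exact_mod_cast h2
        have : (0 : ℤ) ≤ n - 1 := by omega
        exact_mod_cast this
    · exact ((hf.analyticAt z).div (hp.analyticAt z) hz).meromorphicOrderAt_nonneg
  refine ⟨_, hg, fun z => ?_⟩
  refine congrFun (EqM.eq_of_continuous (f := f) (g := fun z => p z * nf (f / p) z) (fun z => ?_)
    hf.continuous (hp.continuous.mul hg.continuous)) z
  filter_upwards [nf_eqM hm z, hne z] with w h1 h2
  rw [h1, Pi.div_apply]; field_simp

/-- The even theta function of order `2` with zeros `±a`. -/
def thetaPair (τ a u : ℂ) : ℂ := theta τ 0 (u - a) * theta τ 0 (u + a)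

lemma thetaPair_mem (hτ : 0 < τ.im) (a : ℂ) : thetaPair τ a ∈ repSpace τ 1 := by
  have hd := differentiable_theta hτ 0
  refine ⟨?_, fun u => ?_, fun u => ?_, fun u => ?_⟩
  · unfold thetaPair; fun_prop
  · simp only [thetaPair]
    rw [add_sub_right_comm, add_right_comm, theta_add_one, theta_add_one]
    simp [charA]
  · simp only [thetaPair]
    rw [show -u - a = -(u + a) by ring, show -u + a = -(u - a) by ring, theta_neg, theta_neg]
    simp; ring
  · simp only [thetaPair]
    rw [add_sub_right_comm, add_right_comm, theta_add_tau, theta_add_tau]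
    have e : exp (-2 * Real.pi * I * (1 : ℕ) * (2 * u + τ)) =
        exp (-Real.pi * I * (τ + 2 * (u - a))) * exp (-Real.pi * I * (τ + 2 * (u + a))) := by
      rw [← exp_add]; congr 1; push_cast; ring
    rw [e]
    simp [charB]; ring

lemma mul_mem_repSpace {j k : ℕ} {f g : ℂ → ℂ} (hf : f ∈ repSpace τ j) (hg : g ∈ repSpace τ k) :
    (fun u => f u * g u) ∈ repSpace τ (j + k) := by
  obtain ⟨f1, f2, f3, f4⟩ := hf
  obtain ⟨g1, g2, g3, g4⟩ := hg
  refine ⟨f1.mul g1, fun u => by simp only [f2, g2], fun u => by simp only [f3, g3], fun u => ?_⟩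
  simp only [f4, g4]
  rw [show -2 * Real.pi * I * ((j + k : ℕ) : ℂ) * (2 * u + τ) = -2 * Real.pi * I * j * (2 * u + τ) +
    -2 * Real.pi * I * k * (2 * u + τ) by push_cast; ring, exp_add]
  ring

lemma const_mem_repSpace (c : ℂ) : (fun _ => c) ∈ repSpace τ 0 :=
  ⟨differentiable_const c, fun _ => rfl, fun _ => rfl, fun _ => by simp⟩

lemma prod_thetaPair_mem (hτ : 0 < τ.im) {ι : Type*} (s : Finset ι) (a : ι → ℂ) :
    (fun u => ∏ i ∈ s, thetaPair τ (a i) u) ∈ repSpace τ s.card := by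
  classical
  induction s using Finset.induction_on with
  | empty => simpa using const_mem_repSpace (τ := τ) 1
  | insert i s hi ih =>
    rw [Finset.card_insert_of_notMem hi, add_comm]
    simpa only [Finset.prod_insert hi] using mul_mem_repSpace (thetaPair_mem hτ (a i)) ih

/-- The points `u 0, …, u (K-1)` are in general position: `±u q` are distinct modulo `ℤ + ℤτ`. -/
def GenericPoints (τ : ℂ) (K : ℕ) (u : ℕ → ℂ) : Prop :=
  ∀ q < K, theta τ 0 (2 * u q) ≠ 0 ∧ ∀ l < K, q ≠ l → thetaPair τ (u q) (u l) ≠ 0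

lemma eventually_thetaPair_ne_zero (hτ : 0 < τ.im) (a z : ℂ) :
    ∀ᶠ w in 𝓝[≠] z, thetaPair τ a w ≠ 0 := by
  have key : ∀ c, ∀ᶠ w in 𝓝[≠] z, theta τ 0 (w + c) ≠ 0 := by
    intro c
    have hd := differentiable_theta hτ 0
    refine (eqM_zero_or_eventually_ne_zero (f := fun w => theta τ 0 (w + c))
      (meromorphic_of_differentiable (by fun_prop))).resolve_left (fun h => ?_) z
    obtain ⟨w, h1, h2⟩ := (((h.comp_add (-c)) 0).and (eventually_theta_ne_zero hτ 0)).exists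
    simp at h1
    exact h2 h1
  filter_upwards [key a, key (-a)] with w h1 h2
  exact mul_ne_zero (by rwa [sub_eq_add_neg]) h1

/-- Induction on k. A function in 𝒱^{(k+1)} with a zero at a = u_{k+1} also vanishes at -a and at
all translates, hence is divisible by `thetaPair τ a`. The quotient lies in 𝒱^{(k)} and keeps the
remaining zeros. For k = 0 the space consists of the constants. -/
lemma eq_zero_of_repSpace (hτ : 0 < τ.im) {k : ℕ} {u : ℕ → ℂ} (hu : GenericPoints τ (k + 1) u)
    {f : ℂ → ℂ} (hf : f ∈ repSpace τ k) (h0 : ∀ q < k + 1, f (u q) = 0) : f = 0 := by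
  have hth := differentiable_theta hτ 0
  induction k generalizing f with
  | zero =>
    obtain ⟨f1, f2, f3, f4⟩ := hf
    obtain ⟨β, hβ, -⟩ := exists_affine_of_add_const hτ f1 (c₁ := 0) (c₂ := 0)
      (by simpa using f2) (by simpa using f4)
    have := h0 0 (by norm_num)
    funext z
    rw [hβ] at this
    rw [hβ z]
    simpa using this
  | succ k ih =>
    set a := u (k + 1)
    have ha2 : theta τ 0 (2 * a) ≠ 0 := (hu (k + 1) (by omega)).1
    have hfa : f a = 0 := h0 (k + 1) (by omega)
    have hpm := thetaPair_mem hτ a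
    have hp := hpm.1
    obtain ⟨f1, f2, f3, f4⟩ := hf
    have hper := apply_add_lattice (f := fun z => f z = 0) (τ := τ) (fun z => by simp [f2])
      (fun z => by simp [f4])
    have horder : ∀ z, thetaPair τ a z = 0 → f z = 0 ∧ meromorphicOrderAt (thetaPair τ a) z = 1 := by
      intro z hz
      have hc : ∀ c : ℂ, meromorphicOrderAt (fun w => theta τ 0 (w + c)) z =
          meromorphicOrderAt (theta τ 0) (z + c) := fun c =>
        meromorphicOrderAt_comp_add_const_eq_meromorphicOrderAt (f := theta τ 0) (c := c) (x := z)
      rcases mul_eq_zero.1 hz with h1 | h1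
      · obtain ⟨m, n, hmn⟩ := exists_lattice_of_theta_eq_zero hτ h1
        have hz' : z = a + (m + n * τ) := by linear_combination hmn
        refine ⟨by rw [hz', hper a m n]; exact hfa, ?_⟩
        -- If both factors vanished, 2a would be a lattice point. So the zeros of the pair are
        -- simple.
        have h2 : theta τ 0 (z + a) ≠ 0 := by
          intro h2
          obtain ⟨m', n', hmn'⟩ := exists_lattice_of_theta_eq_zero hτ h2
          apply ha2
          rw [show 2 * a = ((m' - m : ℤ) : ℂ) + ((n' - n : ℤ) : ℂ) * τ by
            push_cast; linear_combination hmn' - hmn]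
          exact theta_zero_lattice _ _
        have := meromorphicOrderAt_mul_of_ne_zero (f := fun w => theta τ 0 (w + -a))
          (g := fun w => theta τ 0 (w + a)) (x := z)
          (by have : Differentiable ℂ (fun w => theta τ 0 (w + a)) := by fun_prop
              exact this.analyticAt z) h2
        rw [hc] at this
        rw [← sub_eq_add_neg, meromorphicOrderAt_theta hτ h1] at this
        rw [← this]
        congr 1
        funext w
        simp only [thetaPair, Pi.mul_apply, sub_eq_add_neg, mul_comm]
      · obtain ⟨m, n, hmn⟩ := exists_lattice_of_theta_eq_zero hτ h1
        have hz' : z = -a + (m + n * τ) := by linear_combination hmn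
        refine ⟨by rw [hz', hper (-a) m n, f3]; exact hfa, ?_⟩
        have h2 : theta τ 0 (z + -a) ≠ 0 := by
          intro h2
          obtain ⟨m', n', hmn'⟩ := exists_lattice_of_theta_eq_zero hτ h2
          apply ha2
          rw [show 2 * a = ((m - m' : ℤ) : ℂ) + ((n - n' : ℤ) : ℂ) * τ by
            push_cast; linear_combination hmn - hmn']
          exact theta_zero_lattice _ _
        have := meromorphicOrderAt_mul_of_ne_zero (f := fun w => theta τ 0 (w + a))
          (g := fun w => theta τ 0 (w + -a)) (x := z)
          (by have : Differentiable ℂ (fun w => theta τ 0 (w + -a)) := by fun_prop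
              exact this.analyticAt z) h2
        rw [hc, meromorphicOrderAt_theta hτ h1] at this
        rw [← this]
        congr 1
    obtain ⟨g, hg, hfg⟩ := exists_differentiable_div f1 hp (eventually_thetaPair_ne_zero hτ a)
      horder
    have hne := eventually_thetaPair_ne_zero hτ a
    have cancel : ∀ (x y : ℂ → ℂ), Continuous x → Continuous y →
        (∀ z, thetaPair τ a z * x z = thetaPair τ a z * y z) → x = y := by
      intro x y hx hy h
      refine EqM.eq_of_continuous (fun z => ?_) hx hy
      filter_upwards [hne z] with w hw
      exact mul_left_cancel₀ hw (h w)
    have hgm : g ∈ repSpace τ k := by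
      have hgc := hg.continuous
      refine ⟨hg, congrFun (cancel _ _ (by fun_prop) hgc fun z => ?_),
        congrFun (cancel _ _ (by fun_prop) hgc fun z => ?_),
        congrFun (cancel _ _ (by fun_prop) (by fun_prop) fun z => ?_)⟩
      · have e := f2 z
        rw [hfg, hfg, hpm.2.1] at e; exact e
      · have e := f3 z
        rw [hfg, hfg, hpm.2.2.1] at e; exact e
      · have e := f4 z
        rw [hfg, hfg, hpm.2.2.2] at e
        refine mul_left_cancel₀ (exp_ne_zero (-2 * Real.pi * I * (1 : ℕ) * (2 * z + τ))) ?_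
        rw [← mul_assoc, e, show -2 * Real.pi * I * ((k + 1 : ℕ) : ℂ) * (2 * z + τ) =
          -2 * Real.pi * I * (1 : ℕ) * (2 * z + τ) + -2 * Real.pi * I * k * (2 * z + τ) by
            push_cast; ring, exp_add]
        ring
    have hg0 : g = 0 := by
      refine ih (fun q hq => ⟨(hu q (by omega)).1, fun l hl => (hu q (by omega)).2 l (by omega)⟩)
        hgm fun q hq => ?_
      have e := h0 q (by omega)
      rw [hfg] at e
      exact (mul_eq_zero.1 e).resolve_left ((hu (k + 1) (by omega)).2 q (by omega) (by omega))
    funext z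
    rw [hfg, hg0]; simp

/-- The Lagrange interpolation functions for the points `u 0, …, u (K-1)`. -/
def lagrange (τ : ℂ) (K : ℕ) (u : ℕ → ℂ) (l : ℕ) (v : ℂ) : ℂ :=
  ∏ q ∈ (Finset.range K).erase l, thetaPair τ (u q) v / thetaPair τ (u q) (u l)

lemma lagrange_mem (hτ : 0 < τ.im) {k : ℕ} (u : ℕ → ℂ) {l : ℕ} (hl : l < k + 1) :
    lagrange τ (k + 1) u l ∈ repSpace τ k := by
  have hc : ((Finset.range (k + 1)).erase l).card = k := by
    rw [Finset.card_erase_of_mem (Finset.mem_range.2 hl)]; simp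
  have h := prod_thetaPair_mem hτ ((Finset.range (k + 1)).erase l) u
  rw [hc] at h
  have h2 := (repSpace τ k).smul_mem
    (∏ q ∈ (Finset.range (k + 1)).erase l, thetaPair τ (u q) (u l))⁻¹ h
  convert h2 using 1
  funext v
  simp only [lagrange, Finset.prod_div_distrib, Pi.smul_apply, smul_eq_mul]
  rw [div_eq_inv_mul]

lemma lagrange_self {K : ℕ} {u : ℕ → ℂ} (hu : GenericPoints τ K u) {l : ℕ} (hl : l < K) :
    lagrange τ K u l (u l) = 1 := by
  refine Finset.prod_eq_one fun q hq => div_self ?_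
  rw [Finset.mem_erase, Finset.mem_range] at hq
  exact (hu q hq.2).2 l hl hq.1

lemma lagrange_eq_zero {K : ℕ} {u : ℕ → ℂ} {l q : ℕ} (hq : q < K) (h : q ≠ l) :
    lagrange τ K u l (u q) = 0 := by
  refine Finset.prod_eq_zero (i := q) (by simp [hq, h]) ?_
  simp [thetaPair, theta_zero_zero]

/-- The trace of an endomorphism of `𝒱^{(k)}` in terms of interpolation. -/
lemma trace_repSpace (hτ : 0 < τ.im) {k : ℕ} {u : ℕ → ℂ} (hu : GenericPoints τ (k + 1) u)
    (φ : Module.End ℂ (repSpace τ k)) :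
    LinearMap.trace ℂ (repSpace τ k) φ = ∑ l : Fin (k + 1),
      (φ ⟨lagrange τ (k + 1) u l, lagrange_mem hτ u l.2⟩ : ℂ → ℂ) (u l) := by
  -- Evaluation at the k + 1 points is an isomorphism onto ℂ^{k+1}. The interpolation functions form
  -- the basis dual to the evaluations, so the summands are the diagonal matrix entries.
  let ev : repSpace τ k →ₗ[ℂ] (Fin (k + 1) → ℂ) :=
    { toFun := fun f l => (f : ℂ → ℂ) (u l)
      map_add' := fun _ _ => rfl
      map_smul' := fun _ _ => rfl }
  have hval : ∀ l m : Fin (k + 1), lagrange τ (k + 1) u l (u m) = if m = l then 1 else 0 := by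
    intro l m
    split_ifs with h
    · rw [h]; exact lagrange_self hu l.2
    · exact lagrange_eq_zero m.2 fun h' => h (Fin.ext h')
  have hinj : Function.Injective ev := by
    rw [← LinearMap.ker_eq_bot, LinearMap.ker_eq_bot']
    intro f hf
    refine Subtype.ext (eq_zero_of_repSpace hτ hu f.2 fun q hq => congrFun hf ⟨q, hq⟩)
  have hsurj : Function.Surjective ev := by
    intro c
    refine ⟨∑ l, c l • ⟨lagrange τ (k + 1) u l, lagrange_mem hτ u l.2⟩, ?_⟩
    rw [map_sum]
    funext m
    simp only [map_smul, Finset.sum_apply, Pi.smul_apply, smul_eq_mul]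
    rw [Finset.sum_eq_single m]
    · change c m * lagrange τ (k + 1) u m (u m) = c m
      rw [hval]; simp
    · intro l _ hl
      change c l * lagrange τ (k + 1) u l (u m) = 0
      rw [hval, if_neg (Ne.symm hl), mul_zero]
    · simp
  let e := LinearEquiv.ofBijective ev ⟨hinj, hsurj⟩
  let b := Module.Basis.ofEquivFun e
  have hb : ∀ l, b l = ⟨lagrange τ (k + 1) u l, lagrange_mem hτ u l.2⟩ := by
    intro l
    rw [Module.Basis.coe_ofEquivFun, LinearEquiv.symm_apply_eq]
    funext m
    change _ = lagrange τ (k + 1) u l (u m)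
    rw [hval, Pi.single_apply]
  rw [LinearMap.trace_eq_matrix_trace ℂ b, Matrix.trace]
  refine Finset.sum_congr rfl fun l _ => ?_
  rw [Matrix.diag_apply, LinearMap.toMatrix_apply, hb]
  rfl

end Interpolation

end EightVertex

end

noncomputable section
namespace EightVertex
open Filter Topology Function

/-! ### The difference operators that represent words in the generators -/

section Words

variable {τ η : ℂ}

/-- The coefficient of the shift `u ↦ u + η` in the operator that represents `S_α`, up to a
constant; the coefficient of `u ↦ u - η` is its value at `-u`. Here `t = (k+1)η`. -/
def stepCoeff (τ η : ℂ) (α : Fin 4) (u t : ℂ) : ℂ :=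
  theta τ α (2 * u - t + η) / theta τ 0 (2 * u)

/-- The coefficient of the shift `u ↦ u + jη` in the operator that represents a word. -/
def wordCoeff (τ η : ℂ) : List (Fin 4) → ℤ → ℂ → ℂ → ℂ
  | [], j, _, _ => if j = 0 then 1 else 0
  | α :: w, j, u, t => stepCoeff τ η α u t * wordCoeff τ η w (j - 1) (u + η) t +
      stepCoeff τ η α (-u) t * wordCoeff τ η w (j + 1) (u - η) t

/-- The constant by which `S_α` is normalised. -/
def genNorm (τ η : ℂ) (α : Fin 4) : ℂ := sqrtEps α * theta τ α η / theta τ 0 (2 * η)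

/-- The product of the constants of a word. -/
def wordNorm (τ η : ℂ) (w : List (Fin 4)) : ℂ := (w.map (genNorm τ η)).prod

/-- The product of generators that belongs to a word. -/
def wordGen (τ η : ℂ) (w : List (Fin 4)) : Sklyanin τ η := (w.map (gen τ η)).prod

/-- The multiplicative extension of a function on letters to words. -/
def wordProd (c : Fin 4 → ℂ) (w : List (Fin 4)) : ℂ := (w.map c).prod

@[simp] lemma wordProd_nil (c : Fin 4 → ℂ) : wordProd c [] = 1 := rfl

@[simp] lemma wordProd_cons (c : Fin 4 → ℂ) (α : Fin 4) (w : List (Fin 4)) :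
    wordProd c (α :: w) = c α * wordProd c w := by simp [wordProd]

lemma wordCoeff_eq_zero (w : List (Fin 4)) (j : ℤ) (u t : ℂ) (h : (w.length : ℤ) < |j|) :
    wordCoeff τ η w j u t = 0 := by
  induction w generalizing j u with
  | nil =>
    simp only [wordCoeff]
    rw [if_neg]; rintro rfl; simp at h
  | cons α w ih =>
    simp only [List.length_cons, Nat.cast_add, Nat.cast_one] at h
    have h1 := lt_abs.1 h
    simp only [wordCoeff]
    rw [ih (j - 1) _ (lt_abs.2 (by omega)), ih (j + 1) _ (lt_abs.2 (by omega))]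
    ring

lemma wordCoeff_eq_zero_of_parity (w : List (Fin 4)) (j : ℤ) (u t : ℂ)
    (h : ¬ Even (j + w.length)) : wordCoeff τ η w j u t = 0 := by
  induction w generalizing j u with
  | nil =>
    simp only [wordCoeff]
    rw [if_neg]; rintro rfl; simp at h
  | cons α w ih =>
    simp only [List.length_cons, Nat.cast_add, Nat.cast_one] at h
    simp only [wordCoeff]
    rw [ih (j - 1) _ (fun h' => h (by rw [Int.even_iff] at *; omega)),
      ih (j + 1) _ (fun h' => h (by rw [Int.even_iff] at *; omega))]
    ring

/-- Each step operator commutes with the reflection u ↦ -u, which interchanges its two terms. -/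
lemma wordCoeff_neg (w : List (Fin 4)) (j : ℤ) (u t : ℂ) :
    wordCoeff τ η w (-j) (-u) t = wordCoeff τ η w j u t := by
  induction w generalizing j u with
  | nil => simp [wordCoeff]
  | cons α w ih =>
    simp only [wordCoeff]
    rw [show -j - 1 = -(j + 1) by ring, show -j + 1 = -(j - 1) by ring,
      show -u + η = -(u - η) by ring, show -u - η = -(u + η) by ring, ih, ih, neg_neg]
    ring

lemma charA_sq (α : Fin 4) : charA α * charA α = 1 := by fin_cases α <;> simp [charA]

lemma charB_sq (α : Fin 4) : charB α * charB α = 1 := by fin_cases α <;> simp [charB]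

lemma stepCoeff_add_half (α : Fin 4) (u t : ℂ) :
    stepCoeff τ η α (u + 1 / 2) t = charA α * stepCoeff τ η α u t := by
  unfold stepCoeff
  rw [show 2 * (u + 1 / 2) - t + η = 2 * u - t + η + 1 by ring,
    show 2 * (u + 1 / 2) = 2 * u + 1 by ring, theta_add_one, theta_add_one,
    show -charA 0 = -1 by simp [charA]]
  rw [neg_mul, neg_one_mul, neg_div_neg_eq, mul_div_assoc]

lemma stepCoeff_add_half_tau (α : Fin 4) (u t : ℂ) :
    stepCoeff τ η α (u + τ / 2) t =
      charB α * exp (2 * Real.pi * I * (t - η)) * stepCoeff τ η α u t := by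
  unfold stepCoeff
  rw [show 2 * (u + τ / 2) - t + η = 2 * u - t + η + τ by ring,
    show 2 * (u + τ / 2) = 2 * u + τ by ring, theta_add_tau, theta_add_tau,
    show -charB 0 = -1 by simp [charB],
    show exp (-Real.pi * I * (τ + 2 * (2 * u - t + η))) =
      exp (2 * Real.pi * I * (t - η)) * exp (-Real.pi * I * (τ + 2 * (2 * u))) by
        rw [← exp_add]; congr 1; ring]
  rw [div_eq_mul_inv, mul_inv, mul_inv]
  have := exp_ne_zero (-Real.pi * I * (τ + 2 * (2 * u)))
  field_simp

lemma wordCoeff_add_half (w : List (Fin 4)) (j : ℤ) (u t : ℂ) :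
    wordCoeff τ η w j (u + 1 / 2) t = wordProd charA w * wordCoeff τ η w j u t := by
  induction w generalizing j u with
  | nil => simp [wordCoeff]
  | cons α w ih =>
    have h2 : stepCoeff τ η α (-(u + 1 / 2)) t = charA α * stepCoeff τ η α (-u) t := by
      have := stepCoeff_add_half (τ := τ) (η := η) α (-(u + 1 / 2)) t
      rw [show -(u + 1 / 2) + 1 / 2 = -u by ring] at this
      rw [this, ← mul_assoc, charA_sq, one_mul]
    simp only [wordCoeff, wordProd_cons]
    rw [add_right_comm, add_sub_right_comm, ih, ih, stepCoeff_add_half, h2]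
    ring

/-- Every step to the right contributes e^{2πi(t-η)} and every step to the left its inverse, so the
exponential depends only on the total displacement j. -/
lemma wordCoeff_add_half_tau (w : List (Fin 4)) (j : ℤ) (u t : ℂ) :
    wordCoeff τ η w j (u + τ / 2) t =
      wordProd charB w * exp (2 * Real.pi * I * j * (t - η)) * wordCoeff τ η w j u t := by
  induction w generalizing j u with
  | nil =>
    simp only [wordCoeff, wordProd_nil]
    split_ifs with h
    · simp [h]
    · simp
  | cons α w ih =>
    have h2 : stepCoeff τ η α (-(u + τ / 2)) t =
        charB α * exp (-(2 * Real.pi * I * (t - η))) * stepCoeff τ η α (-u) t := by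
      have := stepCoeff_add_half_tau (τ := τ) (η := η) α (-(u + τ / 2)) t
      rw [show -(u + τ / 2) + τ / 2 = -u by ring] at this
      rw [this, exp_neg]
      have := exp_ne_zero (2 * Real.pi * I * (t - η))
      field_simp
      rw [pow_two, charB_sq, mul_one]
    simp only [wordCoeff, wordProd_cons]
    have e1 : exp (2 * Real.pi * I * j * (t - η)) = exp (2 * Real.pi * I * (t - η)) *
        exp (2 * Real.pi * I * ((j - 1 : ℤ) : ℂ) * (t - η)) := by
      rw [← exp_add]; congr 1; push_cast; ring
    have e2 : exp (2 * Real.pi * I * j * (t - η)) = exp (-(2 * Real.pi * I * (t - η))) *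
        exp (2 * Real.pi * I * ((j + 1 : ℤ) : ℂ) * (t - η)) := by
      rw [← exp_add]; congr 1; push_cast; ring
    rw [add_right_comm, add_sub_right_comm, ih, ih, stepCoeff_add_half_tau, h2, mul_add]
    nth_rewrite 1 [e1]
    rw [e2]
    ring

lemma permA_permA (α : Fin 4) : permA (permA α) = α := by fin_cases α <;> rfl

lemma permB_permB (α : Fin 4) : permB (permB α) = α := by fin_cases α <;> rfl

lemma sgnB_ne_zero (α : Fin 4) : sgnB α ≠ 0 := by fin_cases α <;> simp [sgnB]

/-- Only the numerator contains t, and with the sign -t; the sign passes to the other side since its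
square is 1. -/
lemma stepCoeff_permA (α : Fin 4) (u t : ℂ) :
    stepCoeff τ η (permA α) u (t + 1 / 2) = sgnA α * stepCoeff τ η α u t := by
  have h := theta_add_half τ α (2 * u - t + η - 1 / 2)
  rw [sub_add_cancel] at h
  have h2 : sgnA α * sgnA α = 1 := by fin_cases α <;> simp [sgnA]
  unfold stepCoeff
  rw [h, show 2 * u - (t + 1 / 2) + η = 2 * u - t + η - 1 / 2 by ring, ← mul_div_assoc, ← mul_assoc,
    h2, one_mul]

lemma stepCoeff_permB (α : Fin 4) (u t : ℂ) :
    stepCoeff τ η (permB α) u (t + τ / 2) =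
      (sgnB α)⁻¹ * exp (Real.pi * I * (2 * u - t + η - τ / 4)) * stepCoeff τ η α u t := by
  have h := theta_add_half_tau τ α (2 * u - t + η - τ / 2)
  rw [sub_add_cancel] at h
  have h2 := sgnB_ne_zero α
  have h3 : exp (Real.pi * I * (2 * u - t + η - τ / 4)) *
      exp (-Real.pi * I * (τ / 4 + (2 * u - t + η - τ / 2))) = 1 := by
    rw [← exp_add, ← exp_zero]; congr 1; ring
  unfold stepCoeff
  rw [h, show 2 * u - (t + τ / 2) + η = 2 * u - t + η - τ / 2 by ring, ← mul_div_assoc]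
  congr 1
  generalize theta τ (permB α) (2 * u - t + η - τ / 2) = x
  generalize exp (Real.pi * I * (2 * u - t + η - τ / 4)) = e1 at h3 ⊢
  generalize exp (-Real.pi * I * (τ / 4 + (2 * u - t + η - τ / 2))) = e2 at h3 ⊢
  linear_combination -x * h3 - x * e1 * e2 * inv_mul_cancel₀ h2

lemma wordCoeff_permA (w : List (Fin 4)) (j : ℤ) (u t : ℂ) :
    wordCoeff τ η (w.map permA) j u (t + 1 / 2) = wordProd sgnA w * wordCoeff τ η w j u t := by
  induction w generalizing j u with
  | nil => simp [wordCoeff]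
  | cons α w ih =>
    simp only [List.map_cons, wordCoeff, wordProd_cons]
    rw [ih, ih, stepCoeff_permA, stepCoeff_permA]
    ring

/-- A step from u contributes an exponential linear in u. Along a path of steps the exponents add up
to 2ju + ηj², which depends on the path only through its endpoint. This is why the factor can be
taken out of the sum over paths, and why it does not involve u when j = 0. -/
lemma wordCoeff_permB (w : List (Fin 4)) (j : ℤ) (u t : ℂ) :
    wordCoeff τ η (w.map permB) j u (t + τ / 2) = (wordProd sgnB w)⁻¹ *
      exp (Real.pi * I * (2 * j * u + η * j ^ 2 - w.length * (t + τ / 4))) *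
        wordCoeff τ η w j u t := by
  induction w generalizing j u with
  | nil =>
    simp only [List.map_nil, wordCoeff, wordProd_nil]
    split_ifs with h
    · simp [h]
    · simp
  | cons α w ih =>
    simp only [List.map_cons, wordCoeff, wordProd_cons, List.length_cons]
    rw [ih, ih, stepCoeff_permB, stepCoeff_permB]
    have e1 : exp (Real.pi * I * (2 * j * u + η * j ^ 2 - ((w.length + 1 : ℕ) : ℂ) * (t + τ / 4))) =
        exp (Real.pi * I * (2 * u - t + η - τ / 4)) *
        exp (Real.pi * I * (2 * ((j - 1 : ℤ) : ℂ) * (u + η) + η * ((j - 1 : ℤ) : ℂ) ^ 2 -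
          w.length * (t + τ / 4))) := by
      rw [← exp_add]; congr 1; push_cast; ring
    have e2 : exp (Real.pi * I * (2 * j * u + η * j ^ 2 - ((w.length + 1 : ℕ) : ℂ) * (t + τ / 4))) =
        exp (Real.pi * I * (2 * -u - t + η - τ / 4)) *
        exp (Real.pi * I * (2 * ((j + 1 : ℤ) : ℂ) * (u - η) + η * ((j + 1 : ℤ) : ℂ) ^ 2 -
          w.length * (t + τ / 4))) := by
      rw [← exp_add]; congr 1; push_cast; ring
    rw [mul_inv, mul_add _ (stepCoeff τ η α u t * _)]
    nth_rewrite 1 [e1]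
    rw [e2]
    ring

lemma differentiable_wordCoeff (hτ : 0 < τ.im) (w : List (Fin 4)) (j : ℤ) (u : ℂ) :
    Differentiable ℂ (wordCoeff τ η w j u) := by
  induction w generalizing j u with
  | nil => exact differentiable_const _
  | cons α w ih =>
    have hs : ∀ v, Differentiable ℂ (stepCoeff τ η α v) := by
      intro v
      have := differentiable_theta hτ α
      unfold stepCoeff
      fun_prop
    exact ((hs u).mul (ih _ _)).add ((hs (-u)).mul (ih _ _))

lemma analyticAt_wordCoeff (hτ : 0 < τ.im) (w : List (Fin 4)) (j : ℤ) {u t : ℂ → ℂ}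
    (hu : Differentiable ℂ u) (ht : Differentiable ℂ t) {z : ℂ}
    (h : ∀ n : ℤ, theta τ 0 (2 * (u z + n * η)) ≠ 0) :
    AnalyticAt ℂ (fun z => wordCoeff τ η w j (u z) (t z)) z := by
  induction w generalizing j u with
  | nil => exact analyticAt_const
  | cons α w ih =>
    have h0 := differentiable_theta hτ 0
    have hα := differentiable_theta hτ α
    have hn : theta τ 0 (2 * u z) ≠ 0 := by simpa using h 0
    have hn' : theta τ 0 (2 * -u z) ≠ 0 := by
      rw [mul_neg, theta_neg]; simpa using hn
    have hs : ∀ v : ℂ → ℂ, Differentiable ℂ v → theta τ 0 (2 * v z) ≠ 0 →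
        AnalyticAt ℂ (fun z => stepCoeff τ η α (v z) (t z)) z := by
      intro v hv hvz
      have d1 : Differentiable ℂ fun z => theta τ α (2 * v z - t z + η) := by fun_prop
      have d2 : Differentiable ℂ fun z => theta τ 0 (2 * v z) := by fun_prop
      exact (d1.analyticAt z).div (d2.analyticAt z) hvz
    have i1 := ih (u := fun z => u z + η) (j := j - 1) (by fun_prop) (fun n => by
      have := h (n + 1)
      push_cast at this
      rwa [show u z + η + n * η = u z + (n + 1) * η by ring])
    have i2 := ih (u := fun z => u z - η) (j := j + 1) (by fun_prop) (fun n => by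
      have := h (n - 1)
      push_cast at this
      rwa [show u z - η + n * η = u z + (n - 1) * η by ring])
    exact ((hs u hu hn).mul i1).add ((hs (fun z => -u z) hu.neg hn').mul i2)

lemma meromorphic_wordCoeff (hτ : 0 < τ.im) (w : List (Fin 4)) (j : ℤ) {u t : ℂ → ℂ}
    (hu : Differentiable ℂ u) (ht : Differentiable ℂ t) :
    Meromorphic (fun z => wordCoeff τ η w j (u z) (t z)) := by
  induction w generalizing j u with
  | nil => exact Meromorphic.const _
  | cons α w ih =>
    have h0 := differentiable_theta hτ 0
    have hα := differentiable_theta hτ α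
    have hs : ∀ v : ℂ → ℂ, Differentiable ℂ v →
        Meromorphic (fun z => stepCoeff τ η α (v z) (t z)) := by
      intro v hv
      have d1 : Differentiable ℂ fun z => theta τ α (2 * v z - t z + η) := by fun_prop
      have d2 : Differentiable ℂ fun z => theta τ 0 (2 * v z) := by fun_prop
      exact (meromorphic_of_differentiable d1).div (meromorphic_of_differentiable d2)
    exact ((hs u hu).mul (ih _ (by fun_prop))).add
      ((hs (fun z => -u z) hu.neg).mul (ih _ (by fun_prop)))

/-- The value at `u` of the difference operator that represents a word, on a function that takes
the value `g j` at `u + jη`. -/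
def wordOp (τ η : ℂ) (w : List (Fin 4)) (t u : ℂ) (g : ℤ → ℂ) : ℂ :=
  ∑ᶠ j : ℤ, wordCoeff τ η w j u t * g j

lemma support_wordCoeff_subset (w : List (Fin 4)) (u t : ℂ) (f : ℤ → ℂ) :
    (Function.support fun j : ℤ => wordCoeff τ η w j u t * f j) ⊆
      (Finset.Icc (-w.length : ℤ) w.length : Finset ℤ) := by
  intro j hj
  simp only [Function.mem_support] at hj
  rw [Finset.coe_Icc, Set.mem_Icc, ← abs_le]
  by_contra h
  push Not at h
  exact hj (by rw [wordCoeff_eq_zero w j u t h, zero_mul])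

lemma wordOp_eq_sum (w : List (Fin 4)) (t u : ℂ) (g : ℤ → ℂ) :
    wordOp τ η w t u g = ∑ j ∈ Finset.Icc (-w.length : ℤ) w.length,
      wordCoeff τ η w j u t * g j :=
  finsum_eq_sum_of_support_subset _ (support_wordCoeff_subset w u t g)

lemma wordOp_nil (t u : ℂ) (g : ℤ → ℂ) : wordOp τ η [] t u g = g 0 := by
  simp [wordOp_eq_sum, wordCoeff]

/-- The first letter acts last: it evaluates the operator of the remaining word at u ± η, and the
family g is re-indexed relative to the new base point. -/
lemma wordOp_cons (α : Fin 4) (w : List (Fin 4)) (t u : ℂ) (g : ℤ → ℂ) :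
    wordOp τ η (α :: w) t u g = stepCoeff τ η α u t * wordOp τ η w t (u + η) (fun j => g (j + 1)) +
      stepCoeff τ η α (-u) t * wordOp τ η w t (u - η) (fun j => g (j - 1)) := by
  have hfin : ∀ v : ℂ, ∀ g : ℤ → ℂ,
      (Function.support fun j : ℤ => wordCoeff τ η w j v t * g j).Finite := fun v g =>
    (Finset.finite_toSet _).subset (support_wordCoeff_subset w v t g)
  have e1 : wordOp τ η w t (u + η) (fun j => g (j + 1)) =
      ∑ᶠ j : ℤ, wordCoeff τ η w (j - 1) (u + η) t * g j := by
    rw [wordOp, ← finsum_comp_equiv (Equiv.subRight (1 : ℤ))]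
    refine finsum_congr fun j => ?_
    simp only [Equiv.subRight_apply, sub_add_cancel]
  have e2 : wordOp τ η w t (u - η) (fun j => g (j - 1)) =
      ∑ᶠ j : ℤ, wordCoeff τ η w (j + 1) (u - η) t * g j := by
    rw [wordOp, ← finsum_comp_equiv (Equiv.addRight (1 : ℤ))]
    refine finsum_congr fun j => ?_
    simp only [Equiv.coe_addRight, add_sub_cancel_right]
  have f1 : (Function.support fun j : ℤ =>
      wordCoeff τ η w (j - 1) (u + η) t * g j).Finite := by
    have := (hfin (u + η) fun j => g (j + 1)).preimage
      (Equiv.subRight (1 : ℤ)).injective.injOn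
    refine this.subset fun j hj => ?_
    simpa using hj
  have f2 : (Function.support fun j : ℤ =>
      wordCoeff τ η w (j + 1) (u - η) t * g j).Finite := by
    have := (hfin (u - η) fun j => g (j - 1)).preimage
      (Equiv.addRight (1 : ℤ)).injective.injOn
    refine this.subset fun j hj => ?_
    simpa using hj
  rw [e1, e2, ← smul_eq_mul, ← smul_eq_mul (a := stepCoeff τ η α (-u) t), smul_finsum, smul_finsum,
    wordOp, ← finsum_add_distrib]
  · refine finsum_congr fun j => ?_
    simp only [wordCoeff, smul_eq_mul]; ring
  · exact f1.subset fun j hj => by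
      simp only [Function.mem_support, smul_eq_mul] at hj ⊢
      exact right_ne_zero_of_mul hj
  · exact f2.subset fun j hj => by
      simp only [Function.mem_support, smul_eq_mul] at hj ⊢
      exact right_ne_zero_of_mul hj

/-- The action of a word in the representation `π^{(k)}`. -/
lemma seriesA_apply_word {k : ℕ} {φ : Sklyanin τ η →ₐ[ℂ] Module.End ℂ (repSpace τ k)}
    (hφ : IsSeriesA τ η k φ) (hη2 : theta τ 0 (2 * η) ≠ 0) (w : List (Fin 4)) (f : repSpace τ k)
    {u : ℂ} (hu : ∀ n : ℤ, theta τ 0 (2 * (u + n * η)) ≠ 0) :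
    (φ (wordGen τ η w) f : ℂ → ℂ) u =
      wordNorm τ η w * wordOp τ η w ((k + 1) * η) u (fun j => (f : ℂ → ℂ) (u + j * η)) := by
  induction w generalizing u with
  | nil => simp [wordGen, wordNorm, wordOp_nil]
  | cons α w ih =>
    have h0 : theta τ 0 (2 * u) ≠ 0 := by simpa using hu 0
    have hstep := hφ α (φ (wordGen τ η w) f) u
    have i1 := ih (u := u + η) (fun n => by
      have := hu (n + 1)
      push_cast at this
      rwa [show u + η + n * η = u + (n + 1) * η by ring])
    have i2 := ih (u := u - η) (fun n => by
      have := hu (n - 1)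
      push_cast at this
      rwa [show u - η + n * η = u + (n - 1) * η by ring])
    have e : φ (wordGen τ η (α :: w)) f = φ (gen τ η α) (φ (wordGen τ η w) f) := by
      simp [wordGen]
    rw [e, wordOp_cons]
    have hn : wordNorm τ η (α :: w) = genNorm τ η α * wordNorm τ η w := by simp [wordNorm]
    rw [i1, i2] at hstep
    rw [hn]
    have a1 : (fun j : ℤ => (f : ℂ → ℂ) (u + ((j + 1 : ℤ) : ℂ) * η)) =
        fun j : ℤ => (f : ℂ → ℂ) (u + η + j * η) := by
      funext j; push_cast; ring_nf
    have a2 : (fun j : ℤ => (f : ℂ → ℂ) (u + ((j - 1 : ℤ) : ℂ) * η)) =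
        fun j : ℤ => (f : ℂ → ℂ) (u - η + j * η) := by
      funext j; push_cast; ring_nf
    rw [a1, a2]
    have h0' : theta τ 0 (2 * -u) = -theta τ 0 (2 * u) := by
      rw [mul_neg, theta_neg]; simp
    simp only [genNorm, stepCoeff, h0']
    -- With t = (k+1)η the argument 2u - t + η of `stepCoeff` is the argument 2u - kη of the
    -- representation.
    rw [show 2 * u - (k + 1) * η + η = 2 * u - k * η by ring,
      show 2 * -u - (k + 1) * η + η = -2 * u - k * η by ring]
    generalize wordOp τ η w ((k + 1) * η) (u + η) _ = x at hstep ⊢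
    generalize wordOp τ η w ((k + 1) * η) (u - η) _ = y at hstep ⊢
    generalize theta τ α (2 * u - k * η) = p at hstep ⊢
    generalize theta τ α (-2 * u - k * η) = q at hstep ⊢
    generalize theta τ 0 (2 * u) = r at h0 hstep ⊢
    generalize theta τ 0 (2 * η) = s at hη2 hstep ⊢
    rw [← mul_right_inj' (mul_ne_zero hη2 h0), hstep]
    field_simp
    ring

end Words

end EightVertex

end

noncomputable section
namespace EightVertex
open Filter Topology Function

/-! ### The poles of the diagonal coefficient -/

/-- The function `f` has at most a removable singularity at `z`. -/
def RegularAt (f : ℂ → ℂ) (z : ℂ) : Prop := ∃ g, AnalyticAt ℂ g z ∧ f =ᶠ[𝓝[≠] z] g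

lemma tendsto_neg_punctured : Tendsto (fun x : ℂ => -x) (𝓝[≠] 0) (𝓝[≠] 0) := by
  refine tendsto_nhdsWithin_iff.2 ⟨?_, ?_⟩
  · have : ContinuousAt (fun x : ℂ => -x) 0 := by fun_prop
    have := this.tendsto.mono_left (nhdsWithin_le_nhds (s := {0}ᶜ))
    simpa using this
  · filter_upwards [self_mem_nhdsWithin] with x hx
    simpa using hx

namespace RegularAt

variable {f g : ℂ → ℂ} {z : ℂ}

lemma of_analyticAt (h : AnalyticAt ℂ f z) : RegularAt f z := ⟨f, h, EventuallyEq.rfl⟩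

lemma congr (h : RegularAt f z) (hfg : f =ᶠ[𝓝[≠] z] g) : RegularAt g z := by
  obtain ⟨k, hk, h⟩ := h
  exact ⟨k, hk, hfg.symm.trans h⟩

lemma const (c : ℂ) : RegularAt (fun _ => c) z := of_analyticAt analyticAt_const

lemma add (hf : RegularAt f z) (hg : RegularAt g z) : RegularAt (fun x => f x + g x) z := by
  obtain ⟨k, hk, h⟩ := hf
  obtain ⟨k', hk', h'⟩ := hg
  exact ⟨_, hk.add hk', h.add h'⟩

lemma mul (hf : RegularAt f z) (hg : RegularAt g z) : RegularAt (fun x => f x * g x) z := by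
  obtain ⟨k, hk, h⟩ := hf
  obtain ⟨k', hk', h'⟩ := hg
  exact ⟨_, hk.mul hk', h.mul h'⟩

lemma neg (hf : RegularAt f z) : RegularAt (fun x => -f x) z := by
  simpa using (const (-1)).mul hf

lemma sub (hf : RegularAt f z) (hg : RegularAt g z) : RegularAt (fun x => f x - g x) z := by
  simpa [sub_eq_add_neg] using hf.add hg.neg

lemma sum {ι : Type*} (s : Finset ι) {f : ι → ℂ → ℂ} (h : ∀ i ∈ s, RegularAt (f i) z) :
    RegularAt (fun x => ∑ i ∈ s, f i x) z := by
  classical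
  induction s using Finset.induction_on with
  | empty => simpa using const 0
  | insert i s hi ih =>
    simp only [Finset.sum_insert hi]
    exact (h i (by simp)).add (ih fun j hj => h j (by simp [hj]))

lemma order_nonneg (h : RegularAt f z) : 0 ≤ meromorphicOrderAt f z := by
  obtain ⟨k, hk, h⟩ := h
  rw [meromorphicOrderAt_congr h]
  exact hk.meromorphicOrderAt_nonneg

lemma comp_neg (hf : RegularAt f 0) : RegularAt (fun x => f (-x)) 0 := by
  obtain ⟨k, hk, h⟩ := hf
  refine ⟨fun x => k (-x), ?_, tendsto_neg_punctured.eventually h⟩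
  have hk' : AnalyticAt ℂ k (-0) := by simpa using hk
  exact hk'.comp_of_eq (f := fun x => -x) (by fun_prop) rfl

/-- A function that vanishes at `0` may be divided by a function with a simple zero. -/
lemma div_of_apply_eq_zero (hf : AnalyticAt ℂ f 0) (hf0 : f 0 = 0) (hg : AnalyticAt ℂ g 0)
    (h0 : g 0 = 0) (h1 : deriv g 0 ≠ 0) : RegularAt (fun x => f x / g x) 0 := by
  have hd : ∀ {k : ℂ → ℂ}, AnalyticAt ℂ k 0 → AnalyticAt ℂ (dslope k 0) 0 := by
    rintro k ⟨p, hp⟩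
    exact ⟨_, hp.has_fpower_series_dslope_fslope⟩
  refine ⟨fun x => dslope f 0 x / dslope g 0 x, (hd hf).div (hd hg) (by rwa [dslope_same]), ?_⟩
  filter_upwards [self_mem_nhdsWithin] with x hx0
  have e1 := sub_smul_dslope g 0 x
  have e2 := sub_smul_dslope f 0 x
  simp only [sub_zero, smul_eq_mul, h0, hf0] at e1 e2
  rw [← e1, ← e2, mul_div_mul_left _ _ hx0]

/-- A regular odd function remains regular if it is divided by a function with a simple zero. -/
lemma div_of_odd (hf : RegularAt f 0) (ho : ∀ x, f (-x) = -f x) (hg : AnalyticAt ℂ g 0)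
    (h0 : g 0 = 0) (h1 : deriv g 0 ≠ 0) : RegularAt (fun x => f x / g x) 0 := by
  obtain ⟨k, hk, h⟩ := hf
  have hk0 : k 0 = 0 := by
    have e1 : Tendsto k (𝓝[≠] 0) (𝓝 (k 0)) := hk.continuousAt.tendsto.mono_left nhdsWithin_le_nhds
    have e2 : Tendsto (fun x => -k (-x)) (𝓝[≠] 0) (𝓝 (-k 0)) := (e1.comp tendsto_neg_punctured).neg
    have e3 : (fun x => -k (-x)) =ᶠ[𝓝[≠] 0] k := by
      filter_upwards [h, tendsto_neg_punctured.eventually h] with x hx hx'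
      rw [← hx', ho, hx, neg_neg]
    have := tendsto_nhds_unique (e2.congr' e3) e1
    linear_combination (-1 / 2 : ℂ) * this
  refine (div_of_apply_eq_zero hk hk0 hg h0 h1).congr ?_
  filter_upwards [h] with x hx
  rw [hx]

end RegularAt

section Poles

variable {τ η : ℂ}

/-- Words preserve the regularity, at the integral multiples of `η`, of even families of germs. -/
lemma regularAt_wordOp (hτ : 0 < τ.im) (hη : ∀ n : ℤ, n ≠ 0 → theta τ 0 (2 * (n * η)) ≠ 0)
    (w : List (Fin 4)) (t : ℂ) {f : ℤ → ℂ → ℂ} (hf : ∀ n, RegularAt (f n) 0)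
    (hs : ∀ n x, f (-n) x = f n (-x)) :
    (∀ n : ℤ, RegularAt (fun x => wordOp τ η w t (n * η + x) fun j => f (n + j) x) 0) ∧
    ∀ (n : ℤ) x, wordOp τ η w t ((-n : ℤ) * η + x) (fun j => f (-n + j) x) =
      wordOp τ η w t (n * η + -x) fun j => f (n + j) (-x) := by
  induction w with
  | nil => simpa [wordOp_nil] using ⟨hf, hs⟩
  | cons α w ih =>
    obtain ⟨h1, h2⟩ := ih
    set G : ℤ → ℂ → ℂ := fun n x => wordOp τ η w t (n * η + x) fun j => f (n + j) x with hG
    have key : ∀ (n : ℤ) x, (wordOp τ η (α :: w) t (n * η + x) fun j => f (n + j) x) =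
        stepCoeff τ η α (n * η + x) t * G (n + 1) x +
          stepCoeff τ η α (-(n * η + x)) t * G (n - 1) x := by
      intro n x
      rw [wordOp_cons]
      have a1 : n * η + x + η = ((n + 1 : ℤ) : ℂ) * η + x := by push_cast; ring
      have a2 : n * η + x - η = ((n - 1 : ℤ) : ℂ) * η + x := by push_cast; ring
      have b1 : (fun j : ℤ => f (n + (j + 1)) x) = fun j => f (n + 1 + j) x := by
        funext j; rw [add_comm j, add_assoc]
      have b2 : (fun j : ℤ => f (n + (j - 1)) x) = fun j => f (n - 1 + j) x := by
        funext j; rw [show n + (j - 1) = n - 1 + j by ring]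
      rw [a1, a2, b1, b2]
    have hG' : ∀ n x, G (-n) x = G n (-x) := h2
    have hodd : ∀ n x, (wordOp τ η (α :: w) t ((-n : ℤ) * η + x) fun j => f (-n + j) x) =
        wordOp τ η (α :: w) t (n * η + -x) fun j => f (n + j) (-x) := by
      intro n x
      rw [key, key, show -n + 1 = -(n - 1) by ring, show -n - 1 = -(n + 1) by ring, hG', hG']
      push_cast
      rw [show -(n : ℂ) * η + x = -(n * η + -x) by ring, neg_neg]
      ring
    refine ⟨fun n => ?_, hodd⟩
    have dα := differentiable_theta hτ α
    have d0 := differentiable_theta hτ 0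
    rw [funext (key n)]
    -- The denominator θ₁(2u) vanishes, among the multiples of η, only at u = 0. There the symmetry
    -- of the family makes the combined numerator of the two terms odd, so that its zero cancels the
    -- simple zero of the denominator.
    by_cases hn : n = 0
    · subst hn
      have hnum : RegularAt (fun x => theta τ α (2 * x - t + η) * G 1 x -
          theta τ α (-2 * x - t + η) * G (-1) x) 0 := by
        have c1 : Differentiable ℂ fun x => theta τ α (2 * x - t + η) := by fun_prop
        have c2 : Differentiable ℂ fun x => theta τ α (-2 * x - t + η) := by fun_prop
        exact ((RegularAt.of_analyticAt (c1.analyticAt 0)).mul (h1 1)).sub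
          ((RegularAt.of_analyticAt (c2.analyticAt 0)).mul (h1 (-1)))
      have hden : Differentiable ℂ fun x => theta τ 0 (2 * x) := by fun_prop
      have hder : deriv (fun x => theta τ 0 (2 * x)) 0 ≠ 0 := by
        have := (d0 (2 * 0)).hasDerivAt.comp (0 : ℂ) ((hasDerivAt_id (0 : ℂ)).const_mul 2)
        have e := this.deriv
        simp only [mul_zero, mul_one] at e
        rw [show (fun x => theta τ 0 (2 * x)) = theta τ 0 ∘ HMul.hMul 2 from rfl, e]
        exact mul_ne_zero (deriv_theta_ne_zero hτ) two_ne_zero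
      have := hnum.div_of_odd (fun x => ?_) (hden.analyticAt 0) (by simp [theta_zero_zero]) hder
      · refine this.congr (Eventually.of_forall fun x => ?_)
        have h0' : theta τ 0 (2 * -x) = -theta τ 0 (2 * x) := by
          rw [mul_neg, theta_neg]; simp
        simp only [stepCoeff, Int.cast_zero, zero_mul, zero_add, zero_sub, h0']
        rw [show 2 * -x - t + η = -2 * x - t + η by ring]
        simp only [div_eq_mul_inv, inv_neg]
        ring
      · have e1 : G (-1) (-x) = G 1 x := by rw [hG', neg_neg]
        have e2 : G 1 (-x) = G (-1) x := by rw [hG']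
        rw [e1, e2, mul_neg, neg_mul_neg, neg_mul]
        ring
    · have hden : Differentiable ℂ fun x => theta τ 0 (2 * (n * η + x)) := by fun_prop
      have hden' : Differentiable ℂ fun x => theta τ 0 (2 * -(n * η + x)) := by fun_prop
      have c1 : Differentiable ℂ fun x => theta τ α (2 * (n * η + x) - t + η) := by fun_prop
      have c2 : Differentiable ℂ fun x => theta τ α (2 * -(n * η + x) - t + η) := by fun_prop
      have z1 : theta τ 0 (2 * (n * η + 0)) ≠ 0 := by simpa using hη n hn
      have z2 : theta τ 0 (2 * -(n * η + 0)) ≠ 0 := by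
        rw [mul_neg, theta_neg]; simpa using hη n hn
      exact ((RegularAt.of_analyticAt ((c1.analyticAt 0).div (hden.analyticAt 0) z1)).mul
        (h1 (n + 1))).add ((RegularAt.of_analyticAt ((c2.analyticAt 0).div
          (hden'.analyticAt 0) z2)).mul (h1 (n - 1)))

/-- The diagonal coefficient has at most simple poles at the multiples of `η`. -/
lemma regularAt_mul_wordCoeff (hτ : 0 < τ.im)
    (hη : ∀ n : ℤ, n ≠ 0 → theta τ 0 (2 * (n * η)) ≠ 0) (w : List (Fin 4)) (t : ℂ) (p : ℤ) :
    RegularAt (fun x => x * wordCoeff τ η w 0 (p * η + x) t) 0 := by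
  -- The test family is supported at pη and -pη, with germs g(x) and g(-x). Its image at pη involves
  -- only the displacements 0 and -2p.
  have main : ∀ g : ℂ → ℂ, RegularAt g 0 → RegularAt (fun x => g (-x)) 0 → p ≠ 0 →
      RegularAt (fun x => wordCoeff τ η w 0 (p * η + x) t * g x +
        wordCoeff τ η w (-2 * p) (p * η + x) t * g (-x)) 0 := by
    intro g hg hg' hp
    let f : ℤ → ℂ → ℂ := fun n x => if n = p then g x else if n = -p then g (-x) else 0
    have hs : ∀ n x, f (-n) x = f n (-x) := by
      intro n x
      simp only [f, neg_neg, neg_inj]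
      by_cases h1 : n = p
      · subst h1
        rw [if_neg (by omega), if_pos rfl, if_pos rfl]
      · by_cases h2 : n = -p
        · subst h2
          rw [if_pos (by simp), if_neg (by omega), if_pos rfl]
        · rw [if_neg (by omega), if_neg (by omega), if_neg h1, if_neg h2]
    have hf : ∀ n, RegularAt (f n) 0 := by
      intro n
      by_cases h1 : n = p
      · simpa [f, h1] using hg
      · by_cases h2 : n = -p
        · subst h2
          simpa [f, h1] using hg'
        · simpa [f, h1, h2] using RegularAt.const 0
    refine ((regularAt_wordOp hτ hη w t hf hs).1 p).congr (Eventually.of_forall fun x => ?_)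
    simp only [wordOp]
    rw [finsum_eq_sum_of_support_subset (s := {0, -2 * p})]
    · rw [Finset.sum_pair (by omega)]
      simp only [f, add_zero, if_true]
      rw [if_neg (by omega), if_pos (by omega)]
    · intro j hj
      simp only [Function.mem_support, f] at hj
      simp only [Finset.coe_insert, Finset.coe_singleton, Set.mem_insert_iff,
        Set.mem_singleton_iff]
      by_contra h
      exact hj (by rw [if_neg (by omega), if_neg (by omega), mul_zero])
  have hid : RegularAt (fun x => x) 0 := RegularAt.of_analyticAt analyticAt_id
  by_cases hp : p = 0
  · subst hp
    let f : ℤ → ℂ → ℂ := fun n x => if n = 0 then 1 else 0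
    have hf : ∀ n, RegularAt (f n) 0 := fun n => RegularAt.const _
    have h := (regularAt_wordOp hτ hη w t hf (fun n x => by simp [f])).1 0
    refine hid.mul (h.congr (Eventually.of_forall fun x => ?_))
    simp only [wordOp, f, zero_add]
    rw [finsum_eq_single _ (0 : ℤ) (fun j hj => by simp [hj])]
    simp
  -- Let c₀ and c' be the coefficients with displacements 0 and -2p. The choices g = 1 and g = x
  -- show that c₀ + c' and x(c₀ - c') are regular; x times the first plus the second is 2x c₀.
  · have h1 := main (fun _ => 1) (RegularAt.const 1) (RegularAt.const 1) hp
    have h2 := main (fun x => x) hid hid.neg hp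
    refine (((hid.mul h1).add h2).mul (RegularAt.const (1 / 2))).congr
      (Eventually.of_forall fun x => ?_)
    ring

lemma regularAt_wordCoeff_zero (hτ : 0 < τ.im)
    (hη : ∀ n : ℤ, n ≠ 0 → theta τ 0 (2 * (n * η)) ≠ 0) (w : List (Fin 4)) (t : ℂ) :
    RegularAt (fun x => wordCoeff τ η w 0 x t) 0 := by
  let f : ℤ → ℂ → ℂ := fun n x => if n = 0 then 1 else 0
  have hf : ∀ n, RegularAt (f n) 0 := fun n => RegularAt.const _
  have h := (regularAt_wordOp hτ hη w t hf (fun n x => by simp [f])).1 0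
  refine h.congr (Eventually.of_forall fun x => ?_)
  simp only [wordOp, f, zero_add]
  rw [finsum_eq_single _ (0 : ℤ) (fun j hj => by simp [hj])]
  simp

/-- The diagonal coefficient is regular at `pη` if `2|p|` exceeds the length of the word. -/
lemma regularAt_wordCoeff (hτ : 0 < τ.im)
    (hη : ∀ n : ℤ, n ≠ 0 → theta τ 0 (2 * (n * η)) ≠ 0) (w : List (Fin 4)) (t : ℂ) {p : ℤ}
    (hp : (w.length : ℤ) < 2 * |p|) :
    RegularAt (fun x => wordCoeff τ η w 0 (p * η + x) t) 0 := by
  let f : ℤ → ℂ → ℂ := fun n x => if n = p ∨ n = -p then 1 else 0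
  have hf : ∀ n, RegularAt (f n) 0 := fun n => RegularAt.const _
  have h := (regularAt_wordOp hτ hη w t hf (fun n x => by
    simp only [f]; congr 1; exact propext (by omega))).1 p
  refine h.congr (Eventually.of_forall fun x => ?_)
  simp only [wordOp, f]
  rw [finsum_eq_single _ (0 : ℤ)]
  · simp
  -- The mirror point -pη lies at the distance 2|p|, which a word of this length cannot bridge, so
  -- the family supported at ±pη sees only the diagonal coefficient.
  · intro j hj
    by_cases h2 : p + j = -p
    · rw [wordCoeff_eq_zero, zero_mul]
      rw [show j = -(2 * p) by omega, abs_neg, abs_mul]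
      simpa using hp
    · rw [if_neg (by omega), mul_zero]

end Poles

end EightVertex

end

noncomputable section
namespace EightVertex
open Filter Topology Function

/-! ### The partial fraction expansion of the diagonal coefficient -/

section Expansion

variable {τ η : ℂ}

/-- The logarithmic derivative of `θ₁`. -/
def logTheta (τ x : ℂ) : ℂ := deriv (theta τ 0) x / theta τ 0 x

lemma logTheta_add_one (x : ℂ) : logTheta τ (x + 1) = logTheta τ x := by
  have h : (fun z => theta τ 0 (z + 1)) = fun z => -theta τ 0 z :=
    funext fun z => by rw [theta_add_one]; simp [charA]
  have hd : deriv (theta τ 0) (x + 1) = -deriv (theta τ 0) x := by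
    rw [← deriv_comp_add_const (theta τ 0) 1 x, h, deriv.fun_neg]
  rw [logTheta, hd, congrFun h x, neg_div_neg_eq, logTheta]

lemma logTheta_neg (x : ℂ) : logTheta τ (-x) = -logTheta τ x := by
  have h : (fun z => theta τ 0 (-z)) = fun z => -theta τ 0 z :=
    funext fun z => by rw [theta_neg]; simp
  have hd : -deriv (theta τ 0) (-x) = -deriv (theta τ 0) x := by
    rw [← deriv_comp_neg (theta τ 0) x, h, deriv.fun_neg]
  rw [logTheta, neg_inj.1 hd, congrFun h x, div_neg, logTheta]

lemma logTheta_add_tau (hτ : 0 < τ.im) {x : ℂ} (hx : theta τ 0 x ≠ 0) :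
    logTheta τ (x + τ) = logTheta τ x - 2 * Real.pi * I := by
  have hd := differentiable_theta hτ 0
  have h : (fun z => theta τ 0 (z + τ)) =
      fun z => -exp (-Real.pi * I * (τ + 2 * z)) * theta τ 0 z :=
    funext fun z => by rw [theta_add_tau]; simp [charB]
  have he : HasDerivAt (fun z => -exp (-Real.pi * I * (τ + 2 * z)))
      (-(exp (-Real.pi * I * (τ + 2 * x)) * (-Real.pi * I * (2 * 1)))) x :=
    (((hasDerivAt_id x).const_mul 2).const_add τ |>.const_mul (-Real.pi * I)).cexp.neg
  have hder := (he.mul (hd x).hasDerivAt).deriv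
  have e : deriv (theta τ 0) (x + τ) = deriv (fun z => theta τ 0 (z + τ)) x :=
    (deriv_comp_add_const (theta τ 0) τ x).symm
  rw [logTheta, logTheta, e, h, congrFun h x]
  rw [show (fun z => -exp (-Real.pi * I * (τ + 2 * z)) * theta τ 0 z) =
    (fun z => -exp (-Real.pi * I * (τ + 2 * z))) * theta τ 0 from rfl, hder]
  have hne := exp_ne_zero (-Real.pi * I * (τ + 2 * x))
  generalize exp (-Real.pi * I * (τ + 2 * x)) = E at hne ⊢
  field_simp
  ring

lemma analyticAt_logTheta (hτ : 0 < τ.im) {x : ℂ} (hx : theta τ 0 x ≠ 0) :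
    AnalyticAt ℂ (logTheta τ) x :=
  ((differentiable_theta hτ 0).analyticAt x).deriv.div ((differentiable_theta hτ 0).analyticAt x) hx

lemma analyticAt_logTheta_comp (hτ : 0 < τ.im) {v : ℂ → ℂ} (hv : Differentiable ℂ v) {x : ℂ}
    (hx : theta τ 0 (v x) ≠ 0) : AnalyticAt ℂ (fun z => logTheta τ (v z)) x :=
  (analyticAt_logTheta hτ hx).comp (hv.analyticAt x)

lemma meromorphic_logTheta_comp (hτ : 0 < τ.im) {v : ℂ → ℂ} (hv : Differentiable ℂ v) :
    Meromorphic fun z => logTheta τ (v z) := by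
  have hd := differentiable_theta hτ 0
  have h1 : Differentiable ℂ fun z => theta τ 0 (v z) := by fun_prop
  have h2 : Differentiable ℂ fun z => deriv (theta τ 0) (v z) := by
    have : Differentiable ℂ (deriv (theta τ 0)) := fun x =>
      (hd.analyticAt x).deriv.differentiableAt
    fun_prop
  exact (meromorphic_of_differentiable h2).div (meromorphic_of_differentiable h1)

lemma eventually_theta_affine_ne_zero (hτ : 0 < τ.im) {c : ℂ} (hc : c ≠ 0) (d z : ℂ) :
    ∀ᶠ u in 𝓝[≠] z, theta τ 0 (c * u + d) ≠ 0 := by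
  have ht : Tendsto (fun u : ℂ => c * u + d) (𝓝[≠] z) (𝓝[≠] (c * z + d)) := by
    refine tendsto_nhdsWithin_iff.2 ⟨?_, ?_⟩
    · have : ContinuousAt (fun u : ℂ => c * u + d) z := by fun_prop
      exact this.tendsto.mono_left nhdsWithin_le_nhds
    · filter_upwards [self_mem_nhdsWithin] with x hx
      simp only [Set.mem_compl_iff, Set.mem_singleton_iff] at hx ⊢
      exact fun h => hx (mul_left_cancel₀ hc (add_right_cancel h))
  exact ht.eventually (eventually_theta_ne_zero hτ _)

/-- The elementary function with poles at `±pη`. -/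
def zetaDiff (τ η : ℂ) (p : ℕ) (u : ℂ) : ℂ :=
  logTheta τ (2 * u + 2 * p * η) - logTheta τ (2 * u - 2 * p * η)

lemma zetaDiff_neg (p : ℕ) (u : ℂ) : zetaDiff τ η p (-u) = zetaDiff τ η p u := by
  rw [zetaDiff, zetaDiff, show 2 * -u + 2 * p * η = -(2 * u - 2 * p * η) by ring,
    show 2 * -u - 2 * p * η = -(2 * u + 2 * p * η) by ring, logTheta_neg, logTheta_neg]
  ring

lemma zetaDiff_add_half (p : ℕ) (u : ℂ) : zetaDiff τ η p (u + 1 / 2) = zetaDiff τ η p u := by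
  rw [zetaDiff, zetaDiff, show 2 * (u + 1 / 2) + 2 * p * η = 2 * u + 2 * p * η + 1 by ring,
    show 2 * (u + 1 / 2) - 2 * p * η = 2 * u - 2 * p * η + 1 by ring, logTheta_add_one,
    logTheta_add_one]

lemma zetaDiff_add_half_tau (hτ : 0 < τ.im) (p : ℕ) :
    EqM (fun u => zetaDiff τ η p (u + τ / 2)) (zetaDiff τ η p) := by
  intro z
  filter_upwards [eventually_theta_affine_ne_zero hτ two_ne_zero (2 * p * η) z,
    eventually_theta_affine_ne_zero hτ two_ne_zero (-(2 * p * η)) z] with u h1 h2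
  rw [← sub_eq_add_neg] at h2
  rw [zetaDiff, zetaDiff, show 2 * (u + τ / 2) + 2 * p * η = 2 * u + 2 * p * η + τ by ring,
    show 2 * (u + τ / 2) - 2 * p * η = 2 * u - 2 * p * η + τ by ring, logTheta_add_tau hτ h1,
    logTheta_add_tau hτ h2]
  ring

lemma meromorphic_zetaDiff (hτ : 0 < τ.im) (p : ℕ) : Meromorphic (zetaDiff τ η p) :=
  (meromorphic_logTheta_comp hτ (v := fun u => 2 * u + 2 * p * η) (by fun_prop)).sub
    (meromorphic_logTheta_comp hτ (v := fun u => 2 * u - 2 * p * η) (by fun_prop))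

/-- A simple pole at `0` is cancelled by a multiple of `logTheta`. -/
lemma exists_regularAt_sub_logTheta (hτ : 0 < τ.im) {f : ℂ → ℂ}
    (hf : RegularAt (fun x => x * f x) 0) :
    ∃ c : ℂ, RegularAt (fun x => f x - c * logTheta τ (2 * x)) 0 := by
  have hd := differentiable_theta hτ 0
  have hd' : Differentiable ℂ (deriv (theta τ 0)) := fun x =>
    (hd.analyticAt x).deriv.differentiableAt
  have hden : Differentiable ℂ fun x => theta τ 0 (2 * x) := by fun_prop
  have hden' : Differentiable ℂ fun x => deriv (theta τ 0) (2 * x) := by fun_prop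
  have hder : deriv (fun x => theta τ 0 (2 * x)) 0 ≠ 0 := by
    have := (hd (2 * 0)).hasDerivAt.comp (0 : ℂ) ((hasDerivAt_id (0 : ℂ)).const_mul 2)
    have e := this.deriv
    simp only [mul_zero, mul_one] at e
    rw [show (fun x => theta τ 0 (2 * x)) = theta τ 0 ∘ HMul.hMul 2 from rfl, e]
    exact mul_ne_zero (deriv_theta_ne_zero hτ) two_ne_zero
  have hq : RegularAt (fun x => theta τ 0 (2 * x) / x) 0 :=
    RegularAt.div_of_apply_eq_zero (hden.analyticAt 0) (by simp [theta_zero_zero]) analyticAt_id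
      rfl (by simp [show deriv (fun x : ℂ => x) 0 = 1 from deriv_id 0])
  obtain ⟨k, hk, e⟩ := hf.mul hq
  -- Here k extends f(x) θ₁(2x) over 0. The constant makes k(x) - c θ₁'(2x) vanish at 0, so that it
  -- remains regular after division by θ₁(2x).
  refine ⟨k 0 / deriv (theta τ 0) 0, ?_⟩
  have hnum : AnalyticAt ℂ
      (fun x => k x - k 0 / deriv (theta τ 0) 0 * deriv (theta τ 0) (2 * x)) 0 :=
    hk.sub (analyticAt_const.mul (hden'.analyticAt 0))
  refine (RegularAt.div_of_apply_eq_zero hnum ?_ (hden.analyticAt 0)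
    (by simp [theta_zero_zero]) hder).congr ?_
  · have := deriv_theta_ne_zero hτ
    simp only [mul_zero]
    field_simp
    ring
  · have hne : ∀ᶠ x in 𝓝[≠] (0 : ℂ), theta τ 0 (2 * x) ≠ 0 := by
      simpa using eventually_theta_affine_ne_zero hτ two_ne_zero 0 0
    filter_upwards [e, hne, self_mem_nhdsWithin] with x hx hx' hx0
    simp only [Set.mem_compl_iff, Set.mem_singleton_iff] at hx0
    rw [← hx, logTheta]
    generalize theta τ 0 (2 * x) = y at hx' ⊢
    generalize deriv (theta τ 0) (2 * x) = y'
    generalize k 0 / deriv (theta τ 0) 0 = c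
    field_simp

/-- The partial fraction expansion of the diagonal coefficient of a word. -/
lemma exists_wordCoeff_expansion (hτ : 0 < τ.im)
    (hη : ∀ n : ℤ, n ≠ 0 → theta τ 0 (2 * (n * η)) ≠ 0) (w : List (Fin 4))
    (hA : wordProd charA w = 1) (hB : wordProd charB w = 1) (t : ℂ) :
    ∃ (c : ℂ) (r : ℕ → ℂ), ∀ u : ℂ, (∀ n : ℤ, theta τ 0 (2 * (u + n * η)) ≠ 0) →
      wordCoeff τ η w 0 u t = c + ∑ p ∈ Finset.Icc 1 w.length, r p * zetaDiff τ η p u := by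
  -- The coefficient r_p is chosen to cancel the pole at -pη. The pole at pη is then cancelled
  -- automatically, because both the diagonal coefficient and `zetaDiff` are even.
  have hr : ∀ p : ℕ, ∃ c : ℂ, RegularAt
      (fun x => wordCoeff τ η w 0 (-(p * η) + x) t - c * logTheta τ (2 * x)) 0 := fun p => by
    have h := regularAt_mul_wordCoeff hτ hη w t (-p)
    push_cast at h
    simp only [neg_mul] at h
    exact exists_regularAt_sub_logTheta hτ h
  choose r hr using hr
  set A : ℂ → ℂ := fun u =>
    wordCoeff τ η w 0 u t - ∑ p ∈ Finset.Icc 1 w.length, r p * zetaDiff τ η p u with hAdef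
  have hAneg : ∀ u, A (-u) = A u := by
    intro u
    have := wordCoeff_neg (τ := τ) (η := η) w 0 u t
    rw [neg_zero] at this
    simp only [hAdef, this, zetaDiff_neg]
  have hAmer : Meromorphic A := by
    refine (meromorphic_wordCoeff hτ w 0 (u := fun z => z) (t := fun _ => t) (by fun_prop)
      (by fun_prop)).sub ?_
    exact Meromorphic.fun_sum fun p _ => (Meromorphic.const _).mul (meromorphic_zetaDiff hτ p)
  have hA1 : EqM (fun u => A (u + 1 / 2)) A := EqM.of_eq fun u => by
    simp only [hAdef, wordCoeff_add_half, hA, one_mul, zetaDiff_add_half]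
  have hA2 : EqM (fun u => A (u + τ / 2)) A := by
    intro z
    have h := (eventually_all_finset (Finset.Icc 1 w.length)
      (p := fun p u => zetaDiff τ η p (u + τ / 2) = zetaDiff τ η p u) (l := 𝓝[≠] z)).2
      fun p _ => zetaDiff_add_half_tau hτ p z
    filter_upwards [h] with u hu
    simp only [hAdef, wordCoeff_add_half_tau, hB]
    rw [Finset.sum_congr rfl fun p hp => by rw [hu p hp]]
    simp
  have hreg : ∀ (n q : ℤ), n + q ≠ 0 →
      RegularAt (fun x => logTheta τ (2 * (n * η + x) + 2 * q * η)) 0 := by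
    intro n q hnq
    refine RegularAt.of_analyticAt (analyticAt_logTheta_comp hτ (by fun_prop) ?_)
    have := hη (n + q) hnq
    push_cast at this
    rwa [show 2 * (n * η + 0) + 2 * q * η = 2 * ((n + q) * η) by ring]
  have hz : ∀ (n : ℤ) (p : ℕ), (p : ℤ) ≠ n → (p : ℤ) ≠ -n →
      RegularAt (fun x => zetaDiff τ η p (n * η + x)) 0 := by
    intro n p h1 h2
    refine ((hreg n p (by omega)).sub (hreg n (-p) (by omega))).congr
      (Eventually.of_forall fun x => ?_)
    simp only [zetaDiff]
    push_cast
    rw [show 2 * (n * η + x) + 2 * -(p : ℂ) * η = 2 * (n * η + x) - 2 * p * η by ring]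
  -- Three ranges: at 0 the coefficient is regular itself; for 1 ≤ p ≤ length the term with r_p
  -- removes the pole and the other terms are regular; for larger p there is no pole.
  have hAneg' : ∀ p : ℕ, RegularAt (fun x => A (((-p : ℤ) : ℂ) * η + x)) 0 := by
    intro p
    by_cases hp0 : p = 0
    · subst hp0
      simp only [Nat.cast_zero, neg_zero, Int.cast_zero, zero_mul, zero_add]
      refine (regularAt_wordCoeff_zero hτ hη w t).sub (RegularAt.sum _ fun q hq => ?_)
      have := hz 0 q (by rw [Finset.mem_Icc] at hq; omega) (by rw [Finset.mem_Icc] at hq; omega)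
      simp only [Int.cast_zero, zero_mul, zero_add] at this
      exact (RegularAt.const _).mul this
    by_cases hp : p ≤ w.length
    · have hmem : p ∈ Finset.Icc 1 w.length := Finset.mem_Icc.2 ⟨by omega, hp⟩
      have h1 : RegularAt (fun x => ∑ q ∈ (Finset.Icc 1 w.length).erase p,
          r q * zetaDiff τ η q (((-p : ℤ) : ℂ) * η + x)) 0 :=
        RegularAt.sum _ fun q hq => (RegularAt.const _).mul (hz _ q
          (by rw [Finset.mem_erase, Finset.mem_Icc] at hq; omega)
          (by rw [Finset.mem_erase, Finset.mem_Icc] at hq; omega))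
      have h2 := (RegularAt.const (z := 0) (r p)).mul (hreg (-p) (-p) (by omega))
      refine (((hr p).add h2).sub h1).congr (Eventually.of_forall fun x => ?_)
      simp only [hAdef, ← Finset.add_sum_erase _ _ hmem]
      simp only [zetaDiff]
      push_cast
      rw [show 2 * (-(p : ℂ) * η + x) + 2 * p * η = 2 * x by ring,
        show 2 * (-(p : ℂ) * η + x) - 2 * p * η = 2 * (-(p : ℂ) * η + x) + 2 * -(p : ℂ) * η by ring,
        ← neg_mul]
      ring
    · refine (regularAt_wordCoeff hτ hη w t ?_).sub (RegularAt.sum _ fun q hq =>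
        (RegularAt.const _).mul (hz _ q ?_ ?_))
      · simp only [abs_neg, Nat.abs_cast]
        omega
      all_goals rw [Finset.mem_Icc] at hq; omega
  have hAint : ∀ n : ℤ, RegularAt (fun x => A (n * η + x)) 0 := by
    intro n
    rcases le_total n 0 with h | h
    · obtain ⟨p, hp⟩ := Int.eq_ofNat_of_zero_le (Int.neg_nonneg_of_nonpos h)
      have : n = -p := by omega
      rw [this]
      exact hAneg' p
    · obtain ⟨p, rfl⟩ := Int.eq_ofNat_of_zero_le h
      refine (hAneg' p).comp_neg.congr (Eventually.of_forall fun x => ?_)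
      change A _ = A _
      rw [← hAneg]
      push_cast
      congr 1
      ring
  have hAan : ∀ z : ℂ, (∀ n : ℤ, theta τ 0 (2 * (z + n * η)) ≠ 0) → AnalyticAt ℂ A z := by
    intro z hz
    refine (analyticAt_wordCoeff hτ w 0 (u := fun z => z) (t := fun _ => t) (by fun_prop)
      (by fun_prop) hz).sub ?_
    refine Finset.analyticAt_fun_sum _ fun p _ => analyticAt_const.mul ?_
    refine (analyticAt_logTheta_comp hτ (v := fun u => 2 * u + 2 * p * η) (by fun_prop) ?_).sub
      (analyticAt_logTheta_comp hτ (v := fun u => 2 * u - 2 * p * η) (by fun_prop) ?_)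
    · have := hz p
      push_cast at this
      rwa [show 2 * z + 2 * p * η = 2 * (z + p * η) by ring]
    · have := hz (-p)
      push_cast at this
      rwa [show 2 * z - 2 * p * η = 2 * (z + -p * η) by ring]
  have hshift : ∀ z c, EqM (fun u => A (u + c)) A →
      meromorphicOrderAt A (z + c) = meromorphicOrderAt A z := by
    intro z c h
    rw [← meromorphicOrderAt_comp_add_const_eq_meromorphicOrderAt]
    exact h.meromorphicOrderAt_eq z
  have hord : ∀ z, 0 ≤ meromorphicOrderAt A z := by
    intro z
    by_cases hzn : ∀ n : ℤ, theta τ 0 (2 * (z + n * η)) ≠ 0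
    · exact (hAan z hzn).meromorphicOrderAt_nonneg
    · push Not at hzn
      obtain ⟨n, hn⟩ := hzn
      obtain ⟨a, b, hab⟩ := exists_lattice_of_theta_eq_zero hτ hn
      have hz : z = (2 * (((-n : ℤ) : ℂ) * η) + (a + b * τ)) / 2 := by
        push_cast; linear_combination hab / 2
      -- A has the half periods 1/2 and τ/2, so its order as a function of v = 2u is periodic under
      -- the lattice. Every possible pole is thereby moved to a multiple of η.
      have := apply_add_lattice (τ := τ) (f := fun v => meromorphicOrderAt A (v / 2))
        (fun v => by simp only [add_div]; exact hshift _ _ hA1)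
        (fun v => by simp only [add_div]; exact hshift _ _ hA2) (2 * (((-n : ℤ) : ℂ) * η)) a b
      rw [hz, this, mul_div_cancel_left₀ _ two_ne_zero]
      have h0 := (hAint (-n)).order_nonneg
      rw [show (fun x => A (((-n : ℤ) : ℂ) * η + x)) = A ∘ fun x => x + ((-n : ℤ) : ℂ) * η from
        funext fun x => by simp [add_comm], meromorphicOrderAt_comp_add_const_eq_meromorphicOrderAt,
        zero_add] at h0
      exact h0
  have hp1 : EqM (fun u => A (u + 1)) A := by
    refine EqM.trans ?_ hA1
    have := hA1.comp_add (1 / 2)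
    simpa [add_assoc, ← two_mul] using this
  have hp2 : EqM (fun u => A (u + τ)) A := by
    refine EqM.trans ?_ hA2
    have := hA2.comp_add (τ / 2)
    simpa [add_assoc] using this
  obtain ⟨c, hc⟩ := exists_eqM_const hτ hAmer hord hp1 hp2
  refine ⟨c, r, fun u hu => ?_⟩
  have hcu : A u - c = 0 := by
    refine eq_zero_of_eqM_zero (f := fun u => A u - c) (fun z => ?_) ?_
    · filter_upwards [hc z] with x hx
      simp [hx]
    · exact ((hAan u hu).continuousAt).sub continuousAt_const
  simp only [hAdef] at hcu
  linear_combination hcu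

end Expansion

/-- The coefficients in a linear combination of finitely many functions can be chosen as
combinations of values of the linear combination. -/
lemma exists_coefficient_functional {X ι : Type*} [Fintype ι] (e : ι → X → ℂ) :
    ∃ c : ι → X →₀ ℂ, ∀ (a : ι → ℂ) (x : X),
      ∑ p, ((c p).sum fun y b => b * ∑ q, a q * e q y) * e p x = ∑ p, a p * e p x := by
  classical
  let Φ : (ι → ℂ) →ₗ[ℂ] (X → ℂ) :=
    { toFun := fun a x => ∑ q, a q * e q x
      map_add' := fun a b => by ext x; simp [add_mul, Finset.sum_add_distrib]
      map_smul' := fun s a => by ext x; simp [mul_assoc, Finset.mul_sum] }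
  obtain ⟨s, hs⟩ := Φ.rangeRestrict.exists_rightInverse_of_surjective Φ.range_rangeRestrict
  let lam : ι → Module.Dual ℂ (ι → ℂ) := fun p => LinearMap.proj p ∘ₗ s ∘ₗ Φ.rangeRestrict
  let ev : X → Module.Dual ℂ (ι → ℂ) := fun x => LinearMap.proj x ∘ₗ Φ
  -- The functional `lam p` annihilates the kernel of Φ, which is the common kernel of the
  -- evaluations. In finite dimension it is therefore a finite combination of evaluations.
  have hmem : ∀ p, lam p ∈ Submodule.span ℂ (Set.range ev) := by
    intro p
    rw [← Subspace.dualCoannihilator_dualAnnihilator_eq (W := Submodule.span ℂ (Set.range ev)),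
      Submodule.mem_dualAnnihilator]
    intro a ha
    rw [Submodule.mem_dualCoannihilator] at ha
    have h0 : Φ.rangeRestrict a = 0 := by
      ext x
      exact ha (ev x) (Submodule.subset_span ⟨x, rfl⟩)
    simp [lam, h0]
  choose c hc using fun p => Finsupp.mem_span_range_iff_exists_finsupp.1 (hmem p)
  refine ⟨c, fun a x => ?_⟩
  have h1 : ∀ p, ((c p).sum fun y b => b * ∑ q, a q * e q y) = s (Φ.rangeRestrict a) p := by
    intro p
    have := congrArg (fun l : Module.Dual ℂ (ι → ℂ) => l a) (hc p)
    simp only [Finsupp.sum, LinearMap.coe_sum, Finset.sum_apply, LinearMap.smul_apply] at this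
    exact this
  simp only [h1]
  have h2 := LinearMap.congr_fun hs (Φ.rangeRestrict a)
  exact congrFun (congrArg Subtype.val h2) x

section Expansion

variable {τ η : ℂ}

/-- The coefficients of the partial fraction expansions, as functions of `t` and of the word. -/
lemma exists_wordCoeff_expansion_family (hτ : 0 < τ.im)
    (hη : ∀ n : ℤ, n ≠ 0 → theta τ 0 (2 * (n * η)) ≠ 0) (m : ℕ) :
    ∃ r : ℕ → List (Fin 4) → ℂ → ℂ,
      (∀ p w, Differentiable ℂ (r p w)) ∧
      (∀ p w t, r p (w.map permA) (t + 1 / 2) = wordProd sgnA w * r p w t) ∧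
      (∀ p w t, r p (w.map permB) (t + τ / 2) = (wordProd sgnB w)⁻¹ *
        exp (-(Real.pi * I * (w.length * (t + τ / 4)))) * r p w t) ∧
      ∀ w, w.length = m → wordProd charA w = 1 → wordProd charB w = 1 →
        ∀ t u : ℂ, (∀ n : ℤ, theta τ 0 (2 * (u + n * η)) ≠ 0) →
          wordCoeff τ η w 0 u t = r 0 w t + ∑ p ∈ Finset.Icc 1 m, r p w t * zetaDiff τ η p u := by
  let X := {u : ℂ // ∀ n : ℤ, theta τ 0 (2 * (u + n * η)) ≠ 0}
  let e : Fin (m + 1) → X → ℂ := fun p u => if p = 0 then 1 else zetaDiff τ η p u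
  obtain ⟨c, hc⟩ := exists_coefficient_functional e
  let c' : ℕ → X →₀ ℂ := fun p => if h : p < m + 1 then c ⟨p, h⟩ else 0
  have hsum : ∀ (s : ℕ → ℂ) (u : X), ∑ q : Fin (m + 1), s q * e q u =
      s 0 + ∑ p ∈ Finset.Icc 1 m, s p * zetaDiff τ η p u := by
    intro s u
    rw [Fin.sum_univ_succ]
    simp only [e, if_true, Fin.succ_ne_zero, if_false, Fin.val_zero, mul_one, Fin.val_succ]
    rw [Fin.sum_univ_eq_sum_range (fun p => s (p + 1) * zetaDiff τ η (p + 1) u) m,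
      Finset.range_eq_Ico, Finset.sum_Ico_add' (fun p => s p * zetaDiff τ η p u) 0 m 1, zero_add]
    rfl
  -- The coefficients are fixed finite combinations, independent of t and w, of values of the
  -- diagonal coefficient at generic points y. Hence they are entire in t and inherit its laws under
  -- half periods, whose factors do not depend on y when j = 0.
  refine ⟨fun p w t => (c' p).sum fun y b => b * wordCoeff τ η w 0 y t, ?_, ?_, ?_, ?_⟩
  · intro p w
    simp only [Finsupp.sum]
    exact Differentiable.fun_sum fun y _ =>
      (differentiable_const _).mul (differentiable_wordCoeff hτ w 0 y)
  · intro p w t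
    simp only [Finsupp.sum, Finset.mul_sum, wordCoeff_permA]
    exact Finset.sum_congr rfl fun y _ => by ring
  · intro p w t
    simp only [Finsupp.sum, Finset.mul_sum, wordCoeff_permB]
    refine Finset.sum_congr rfl fun y _ => ?_
    rw [show (Real.pi : ℂ) * I * (2 * ((0 : ℤ) : ℂ) * (y : ℂ) + η * ((0 : ℤ) : ℂ) ^ 2 -
      w.length * (t + τ / 4)) = -(Real.pi * I * (w.length * (t + τ / 4))) by push_cast; ring]
    ring
  · intro w hw hA hB t u hu
    obtain ⟨s₀, s, hs⟩ := exists_wordCoeff_expansion hτ hη w hA hB t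
    have hs' : ∀ y : X, wordCoeff τ η w 0 y t =
        ∑ q : Fin (m + 1), (if (q : ℕ) = 0 then s₀ else s q) * e q y := by
      intro y
      rw [hsum (fun q => if q = 0 then s₀ else s q) y, hs y y.2, hw, if_pos rfl]
      congr 1
      refine Finset.sum_congr rfl fun p hp => ?_
      rw [Finset.mem_Icc] at hp
      rw [if_neg (by omega)]
    have h := hc (fun q : Fin (m + 1) => if (q : ℕ) = 0 then s₀ else s q) ⟨u, hu⟩
    rw [← hs'] at h
    simp only [← hs'] at h
    rw [← h, ← hsum (fun p => (c' p).sum fun y b => b * wordCoeff τ η w 0 y t) ⟨u, hu⟩]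
    refine Finset.sum_congr rfl fun q _ => ?_
    rw [show c' q = c q from dif_pos q.2]

end Expansion

end EightVertex

end

noncomputable section
namespace EightVertex
open Filter Topology Function

/-! ### The trace of a word by interpolation -/

section TraceSum

variable {τ η : ℂ}

/-- The interpolation nodes `y - Kη, y - Kη + 2η, …, y + Kη - 2η`. -/
def node (η : ℂ) (K : ℕ) (y : ℂ) (q : ℕ) : ℂ := y - K * η + 2 * q * η

/-- The point `u` is not a half period up to multiples of `η`. -/
def Generic (τ η u : ℂ) : Prop := ∀ n : ℤ, theta τ 0 (2 * (u + n * η)) ≠ 0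

lemma Generic.add {u : ℂ} (h : Generic τ η u) (n : ℤ) : Generic τ η (u + n * η) := by
  intro m
  have := h (n + m)
  push_cast at this
  rwa [add_assoc, ← add_mul]

lemma Generic.node {y : ℂ} (h : Generic τ η y) (K q : ℕ) : Generic τ η (node η K y q) := by
  have := h.add (2 * q - K)
  push_cast at this
  rwa [EightVertex.node, show y - K * η + 2 * q * η = y + (2 * q - K) * η by ring]

lemma Generic.neg_add {y : ℂ} (h : Generic τ η y) (m : ℤ) : Generic τ η (m * η - y) := by
  intro n
  have := h (-(m + n))
  push_cast at this
  rw [show 2 * (m * η - y + n * η) = -(2 * (y + -(m + n) * η)) by ring, theta_neg]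
  simpa using this

lemma genericPoints_node (hη : ∀ n : ℤ, n ≠ 0 → theta τ 0 (2 * (n * η)) ≠ 0) {y : ℂ}
    (hy : Generic τ η y) (K : ℕ) : GenericPoints τ K (node η K y) := by
  intro q _
  refine ⟨by simpa using hy.node K q 0, fun l _ hql => mul_ne_zero ?_ ?_⟩
  · have := hη (l - q) (by omega)
    push_cast at this
    rwa [node, node, show y - K * η + 2 * l * η - (y - K * η + 2 * q * η) = 2 * ((l - q) * η) by
      ring]
  · have := hy (l + q - K)
    push_cast at this
    rwa [node, node, show y - K * η + 2 * l * η + (y - K * η + 2 * q * η) =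
      2 * (y + (l + q - K) * η) by ring]

/-- The trace of a word, without its normalisation, in terms of interpolation at the nodes. -/
def traceSum (τ η : ℂ) (w : List (Fin 4)) (K : ℕ) (y : ℂ) : ℂ :=
  ∑ l ∈ Finset.range K, wordOp τ η w (K * η) (node η K y l)
    fun j => lagrange τ K (node η K y) l (node η K y l + j * η)

/-- The left side does not contain y, so this also expresses that the interpolated sum is
independent of the nodes. Only the formula for the action is used, so the choice of φ is immaterial.
-/
lemma repTrace_wordGen (hτ : 0 < τ.im) (hη : ∀ n : ℤ, n ≠ 0 → theta τ 0 (2 * (n * η)) ≠ 0)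
    {k : ℕ} (hφ : ∃ φ, IsSeriesA τ η k φ) {y : ℂ} (hy : Generic τ η y) (w : List (Fin 4)) :
    repTrace τ η k (wordGen τ η w) = wordNorm τ η w * traceSum τ η w (k + 1) y := by
  have hη2 : theta τ 0 (2 * η) ≠ 0 := by simpa using hη 1 one_ne_zero
  rw [repTrace, dif_pos hφ, trace_repSpace hτ (genericPoints_node hη hy (k + 1)), traceSum,
    Finset.mul_sum, Finset.sum_range]
  refine Finset.sum_congr rfl fun l _ => ?_
  rw [seriesA_apply_word hφ.choose_spec hη2 w _ (hy.node (k + 1) l)]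
  push_cast
  rfl

lemma thetaPair_add_half (a u : ℂ) : thetaPair τ (a + 1 / 2) (u + 1 / 2) = -thetaPair τ a u := by
  rw [thetaPair, thetaPair, add_sub_add_right_eq_sub, show u + 1 / 2 + (a + 1 / 2) = u + a + 1 by
    ring, theta_add_one]
  simp [charA]

lemma thetaPair_add_half_tau (a u : ℂ) : thetaPair τ (a + τ / 2) (u + τ / 2) =
    -exp (-Real.pi * I * (τ + 2 * (u + a))) * thetaPair τ a u := by
  rw [thetaPair, thetaPair, add_sub_add_right_eq_sub, show u + τ / 2 + (a + τ / 2) = u + a + τ by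
    ring, theta_add_tau]
  simp only [charB, Matrix.cons_val_zero]
  ring

/-- All nodes move by the half period and the interpolation ratios are unchanged. Compared with the
independence of y, this forces the trace of a word with nontrivial character to vanish. -/
lemma traceSum_add_half (w : List (Fin 4)) (K : ℕ) (y : ℂ) :
    traceSum τ η w K (y + 1 / 2) = wordProd charA w * traceSum τ η w K y := by
  have hn : ∀ q, node η K (y + 1 / 2) q = node η K y q + 1 / 2 := fun q => by
    rw [node, node]; ring
  rw [traceSum, traceSum, Finset.mul_sum]
  refine Finset.sum_congr rfl fun l _ => ?_
  rw [wordOp_eq_sum, wordOp_eq_sum, Finset.mul_sum]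
  refine Finset.sum_congr rfl fun j _ => ?_
  rw [hn, wordCoeff_add_half, mul_assoc]
  congr 2
  rw [lagrange, lagrange]
  refine Finset.prod_congr rfl fun q _ => ?_
  rw [hn, hn, thetaPair_add_half, add_right_comm, thetaPair_add_half, neg_div_neg_eq]

lemma traceSum_add_half_tau (w : List (Fin 4)) (K : ℕ) (y : ℂ) :
    traceSum τ η w K (y + τ / 2) = wordProd charB w * traceSum τ η w K y := by
  have hn : ∀ q, node η K (y + τ / 2) q = node η K y q + τ / 2 := fun q => by
    rw [node, node]; ring
  rw [traceSum, traceSum, Finset.mul_sum]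
  refine Finset.sum_congr rfl fun l hl => ?_
  rw [wordOp_eq_sum, wordOp_eq_sum, Finset.mul_sum]
  refine Finset.sum_congr rfl fun j _ => ?_
  -- Each of the K - 1 factors contributes e^{-2πijη}. Together they cancel the exponential of
  -- `wordCoeff_add_half_tau` at t = Kη.
  have hl' : lagrange τ K (node η K (y + τ / 2)) l (node η K (y + τ / 2) l + j * η) =
      exp (-(2 * Real.pi * I * j * (K * η - η))) *
        lagrange τ K (node η K y) l (node η K y l + j * η) := by
    have hcard : ((Finset.range K).erase l).card = K - 1 := by
      rw [Finset.card_erase_of_mem hl, Finset.card_range]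
    have hK : 1 ≤ K := by rw [Finset.mem_range] at hl; omega
    rw [lagrange, lagrange, show exp (-(2 * Real.pi * I * j * (K * η - η))) =
      exp (-(2 * Real.pi * I * j * η)) ^ ((Finset.range K).erase l).card by
        rw [hcard, ← exp_nat_mul, Nat.cast_sub hK]; congr 1; push_cast; ring,
      ← Finset.prod_const, ← Finset.prod_mul_distrib]
    refine Finset.prod_congr rfl fun q _ => ?_
    rw [hn, hn, thetaPair_add_half_tau, add_right_comm, thetaPair_add_half_tau,
      show exp (-Real.pi * I * (τ + 2 * (node η K y l + j * η + node η K y q))) =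
        exp (-(2 * Real.pi * I * j * η)) *
          exp (-Real.pi * I * (τ + 2 * (node η K y l + node η K y q))) by
        rw [← exp_add]; congr 1; ring]
    have hne := exp_ne_zero (-Real.pi * I * (τ + 2 * (node η K y l + node η K y q)))
    generalize exp (-Real.pi * I * (τ + 2 * (node η K y l + node η K y q))) = E at hne ⊢
    rw [neg_mul, neg_mul, neg_div_neg_eq, mul_comm _ E, mul_assoc, mul_div_mul_left _ _ hne,
      mul_div_assoc]
  rw [hl', hn, wordCoeff_add_half_tau, exp_neg]
  have hne := exp_ne_zero (2 * Real.pi * I * j * (K * η - η))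
  field_simp

/-- By parity only even displacements occur; these are multiples of the spacing 2η of the nodes. -/
lemma wordOp_eq_sum_even (w : List (Fin 4)) (hw : Even w.length) (t u : ℂ) (g : ℤ → ℂ) :
    wordOp τ η w t u g = wordCoeff τ η w 0 u t * g 0 + ∑ s ∈ Finset.Icc 1 w.length,
      (wordCoeff τ η w (2 * s) u t * g (2 * s) + wordCoeff τ η w (-(2 * s)) u t * g (-(2 * s))) := by
  have hsub : (Function.support fun j : ℤ => wordCoeff τ η w j u t * g j) ⊆
      ((insert 0 (((Finset.Icc 1 w.length).image fun s : ℕ => (2 * s : ℤ)) ∪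
        ((Finset.Icc 1 w.length).image fun s : ℕ => (-(2 * s) : ℤ))) : Finset ℤ) : Set ℤ) := by
    intro j hj
    simp only [Function.mem_support] at hj
    have h1 : |j| ≤ w.length := by
      by_contra h
      exact hj (by rw [wordCoeff_eq_zero w j u t (not_le.1 h), zero_mul])
    have h2 : Even (j + w.length) := by
      by_contra h
      exact hj (by rw [wordCoeff_eq_zero_of_parity w j u t h, zero_mul])
    rw [abs_le] at h1
    rw [Int.even_iff] at h2
    rw [Nat.even_iff] at hw
    simp only [Finset.coe_insert, Finset.coe_union, Finset.coe_image, Set.mem_insert_iff,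
      Set.mem_union, Set.mem_image, Finset.coe_Icc, Set.mem_Icc]
    rcases lt_trichotomy j 0 with h | h | h
    · exact Or.inr (Or.inr ⟨(-j / 2).toNat, by omega, by omega⟩)
    · exact Or.inl h
    · exact Or.inr (Or.inl ⟨(j / 2).toNat, by omega, by omega⟩)
  rw [wordOp, finsum_eq_sum_of_support_subset _ hsub, Finset.sum_insert, Finset.sum_union,
    Finset.sum_image, Finset.sum_image, Finset.sum_add_distrib]
  · intro a _ b _ h
    simp only at h
    omega
  · intro a _ b _ h
    simp only at h
    omega
  · rw [Finset.disjoint_left]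
    intro a ha hb
    simp only [Finset.mem_image, Finset.mem_Icc] at ha hb
    omega
  · simp only [Finset.mem_union, Finset.mem_image, Finset.mem_Icc]
    omega

/-- Telescoping: the quotient of a product of length K by its shift by s retains only s factors at
each end. This removes the dependence on the number of factors in the interpolation functions. -/
lemma prod_range_shift (h : ℕ → ℂ) (K s : ℕ) :
    (∏ q ∈ Finset.range K, h (q + s)) * ∏ n ∈ Finset.range s, h n =
      (∏ q ∈ Finset.range K, h q) * ∏ n ∈ Finset.range s, h (K + n) := by
  rw [← Finset.prod_range_add, mul_comm, add_comm K s, Finset.prod_range_add]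
  congr 1
  exact Finset.prod_congr rfl fun q _ => by rw [add_comm]

/-- `θ₁(2nη)` for `n ≠ 0`, and `1` for `n = 0`. -/
def thetaInt (τ η : ℂ) (n : ℤ) : ℂ := if n = 0 then 1 else theta τ 0 (2 * (n * η))

lemma thetaInt_ne_zero (hη : ∀ n : ℤ, n ≠ 0 → theta τ 0 (2 * (n * η)) ≠ 0) (n : ℤ) :
    thetaInt τ η n ≠ 0 := by
  unfold thetaInt
  split_ifs with h
  · exact one_ne_zero
  · exact hη n h

/-- The value of an interpolation function at a point beyond the last node. -/
def overshoot (τ η : ℂ) (s i : ℕ) (y t : ℂ) : ℂ :=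
  (∏ n ∈ Finset.range s, theta τ 0 (2 * t + 2 * (n - i) * η)) /
      (thetaInt τ η s * ∏ n ∈ Finset.range s, thetaInt τ η (n - i)) *
    ((∏ n ∈ Finset.range s, theta τ 0 (2 * y + 2 * t + 2 * (n - i - 1) * η)) /
      ∏ n ∈ Finset.range s, theta τ 0 (2 * y + 2 * (n - i - 1) * η)) *
    (theta τ 0 (2 * y + 2 * t - 4 * (i + 1) * η) /
      theta τ 0 (2 * y + 2 * t + 2 * (s - 2 * (i + 1)) * η))

/-- The right side depends on K only through Kη, with a number of factors fixed by s. Such a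
boundary contribution is the restriction of one meromorphic function of t to the points Kη. -/
lemma lagrange_overshoot (hη : ∀ n : ℤ, n ≠ 0 → theta τ 0 (2 * (n * η)) ≠ 0) {y : ℂ}
    (hy : Generic τ η y) {K s i : ℕ} (hi : i < s) (hs : s ≤ K) :
    lagrange τ K (node η K y) (K - 1 - i) (node η K y (K - 1 - i) + (2 * s : ℤ) * η) =
      overshoot τ η s i y (K * η) := by
  obtain ⟨l, hl⟩ : ∃ l, l = K - 1 - i := ⟨_, rfl⟩
  rw [← hl]
  have hlK : l ∈ Finset.range K := Finset.mem_range.2 (by omega)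
  have hlc : (l : ℂ) = K - 1 - i := by
    rw [hl, Nat.sub_sub, Nat.cast_sub (by omega)]; push_cast; ring
  set g : ℤ → ℂ := fun n => theta τ 0 (2 * (y + (n - K) * η)) with hg
  have hg0 : ∀ n, g n ≠ 0 := fun n => by
    have := hy (n - K)
    push_cast at this
    exact this
  have hf0 := thetaInt_ne_zero hη
  set f := thetaInt τ η with hf
  have hterm : ∀ q ∈ (Finset.range K).erase l,
      thetaPair τ (node η K y q) (node η K y l + (2 * s : ℤ) * η) /
        thetaPair τ (node η K y q) (node η K y l) =
      (f (l + s - q) * g (l + q + s)) / (f (l - q) * g (l + q)) := by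
    intro q hq
    rw [Finset.mem_erase, Finset.mem_range] at hq
    have h1 : f (l + s - q) = theta τ 0 (2 * ((l + s - q) * η)) := by
      rw [hf, thetaInt, if_neg (by omega)]; push_cast; rfl
    have h2 : f (l - q) = theta τ 0 (2 * ((l - q) * η)) := by
      rw [hf, thetaInt, if_neg (by omega)]; push_cast; rfl
    rw [h1, h2, hg, thetaPair, thetaPair]
    simp only [node]
    push_cast
    congr 3 <;> ring_nf
  have hreflect : ∀ a : ℤ, ∏ q ∈ Finset.range K, f (l + a - q) =
      ∏ q ∈ Finset.range K, f ((q : ℤ) - i + a) := by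
    intro a
    rw [← Finset.prod_range_reflect]
    refine Finset.prod_congr rfl fun q hq => ?_
    rw [Finset.mem_range] at hq
    congr 1
    omega
  have hF := prod_range_shift (fun n => f ((n : ℤ) - i)) K s
  have hG := prod_range_shift (fun n => g (l + n)) K s
  have hl1 : ∏ q ∈ Finset.range K, f (l + s - q) =
      ∏ q ∈ Finset.range K, f (((q + s : ℕ) : ℤ) - i) := by
    rw [hreflect]
    exact Finset.prod_congr rfl fun q _ => by congr 1; push_cast; ring
  have hl2 : ∏ q ∈ Finset.range K, f (l - q) = ∏ q ∈ Finset.range K, f ((q : ℤ) - i) := by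
    have := hreflect 0
    simpa using this
  have hl3 : ∏ q ∈ Finset.range K, g (l + q + s) =
      ∏ q ∈ Finset.range K, g (l + ((q + s : ℕ) : ℤ)) :=
    Finset.prod_congr rfl fun q _ => by congr 1; push_cast; ring
  have o1 : ∏ n ∈ Finset.range s, theta τ 0 (2 * (K * η) + 2 * (n - i) * η) =
      ∏ n ∈ Finset.range s, f (((K + n : ℕ) : ℤ) - i) :=
    Finset.prod_congr rfl fun n _ => by
      rw [hf, thetaInt, if_neg (by omega)]; push_cast; congr 1; ring
  have o2 : ∏ n ∈ Finset.range s, theta τ 0 (2 * y + 2 * (K * η) + 2 * (n - i - 1) * η) =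
      ∏ n ∈ Finset.range s, g (l + ((K + n : ℕ) : ℤ)) :=
    Finset.prod_congr rfl fun n _ => by
      rw [hg]; simp only; push_cast; rw [hlc]; congr 1; ring
  have o3 : ∏ n ∈ Finset.range s, theta τ 0 (2 * y + 2 * (n - i - 1) * η) =
      ∏ n ∈ Finset.range s, g (l + (n : ℤ)) :=
    Finset.prod_congr rfl fun n _ => by
      rw [hg]; simp only; push_cast; rw [hlc]; congr 1; ring
  have o4 : theta τ 0 (2 * y + 2 * (K * η) - 4 * (i + 1) * η) = g (l + l) := by
    rw [hg]; simp only; push_cast; rw [hlc]; congr 1; ring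
  have o5 : theta τ 0 (2 * y + 2 * (K * η) + 2 * (s - 2 * (i + 1)) * η) = g (l + l + s) := by
    rw [hg]; simp only; push_cast; rw [hlc]; congr 1; ring
  rw [overshoot, ← hf, o1, o2, o3, o4, o5, lagrange, Finset.prod_congr rfl hterm]
  -- The missing factor q = l is supplied in order to telescope full products. In that factor f(0)
  -- appears in the denominator, and the convention `thetaInt τ η 0 = 1` makes it harmless.
  have hfull := Finset.mul_prod_erase (Finset.range K)
    (fun q : ℕ => (f (l + s - q) * g (l + q + s)) / (f (l - q) * g (l + q))) hlK
  simp only [Finset.prod_div_distrib, Finset.prod_mul_distrib] at hfull ⊢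
  rw [hl1, hl2, hl3, show (l : ℤ) + s - l = s by ring, sub_self] at hfull
  have hf1 : f 0 = 1 := by simp [hf, thetaInt]
  rw [hf1, one_mul] at hfull
  have p1 := Finset.prod_ne_zero_iff.2 fun n (_ : n ∈ Finset.range s) => hf0 ((n : ℤ) - i)
  have p2 := Finset.prod_ne_zero_iff.2 fun n (_ : n ∈ Finset.range s) => hg0 (l + (n : ℤ))
  have p3 := Finset.prod_ne_zero_iff.2 fun n (_ : n ∈ Finset.range K) => hf0 ((n : ℤ) - i)
  have p4 := Finset.prod_ne_zero_iff.2 fun n (_ : n ∈ Finset.range K) => hg0 (l + (n : ℤ))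
  have q1 : (∏ q ∈ Finset.range K, f (((q + s : ℕ) : ℤ) - i)) =
      (∏ q ∈ Finset.range K, f ((q : ℤ) - i)) * (∏ n ∈ Finset.range s, f (((K + n : ℕ) : ℤ) - i)) /
        ∏ n ∈ Finset.range s, f ((n : ℤ) - i) := by
    rw [eq_div_iff p1]; exact hF
  have q2 : (∏ q ∈ Finset.range K, g (l + ((q + s : ℕ) : ℤ))) =
      (∏ q ∈ Finset.range K, g (l + (q : ℤ))) * (∏ n ∈ Finset.range s, g (l + ((K + n : ℕ) : ℤ))) /
        ∏ n ∈ Finset.range s, g (l + (n : ℤ)) := by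
    rw [eq_div_iff p2]; exact hG
  rw [q1, q2] at hfull
  have hne : f s * g (l + l + s) / g (l + l) ≠ 0 :=
    div_ne_zero (mul_ne_zero (hf0 _) (hg0 _)) (hg0 _)
  refine mul_left_cancel₀ hne (hfull.trans ?_)
  have a1 := hf0 s
  have a2 := hg0 (l + l)
  have a3 := hg0 (l + l + s)
  clear_value f g
  generalize (∏ q ∈ Finset.range K, f ((q : ℤ) - i)) = x1 at *
  generalize (∏ q ∈ Finset.range K, g (l + (q : ℤ))) = x2 at *
  generalize (∏ n ∈ Finset.range s, f ((n : ℤ) - i)) = x3 at *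
  generalize (∏ n ∈ Finset.range s, g (l + (n : ℤ))) = x4 at *
  generalize (∏ n ∈ Finset.range s, f (((K + n : ℕ) : ℤ) - i)) = x5 at *
  generalize (∏ n ∈ Finset.range s, g (l + ((K + n : ℕ) : ℤ))) = x6 at *
  generalize f s = x7 at *
  generalize g (l + l) = x8 at *
  generalize g (l + l + s) = x9 at *
  field_simp

/-- The contribution of a node near the end of the row to the trace. -/
def boundaryTerm (τ η : ℂ) (w : List (Fin 4)) (s i : ℕ) (y t : ℂ) : ℂ :=
  wordCoeff τ η w (2 * s) (y + t - 2 * (i + 1) * η) t * overshoot τ η s i y t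

/-- The displacement 2sη carries node l to node l + s, where the interpolation function of l
vanishes if l + s < K. Only the last s nodes contribute; i counts them from the end of the row. -/
lemma sum_upper (hη : ∀ n : ℤ, n ≠ 0 → theta τ 0 (2 * (n * η)) ≠ 0) (w : List (Fin 4)) {y : ℂ}
    (hy : Generic τ η y) {K s : ℕ} (hs0 : 1 ≤ s) (hs : s ≤ K) :
    ∑ l ∈ Finset.range K, wordCoeff τ η w (2 * s) (node η K y l) (K * η) *
        lagrange τ K (node η K y) l (node η K y l + (2 * s : ℤ) * η) =
      ∑ i ∈ Finset.range s, boundaryTerm τ η w s i y (K * η) := by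
  rw [← Finset.sum_range_reflect]
  obtain ⟨d, rfl⟩ := Nat.exists_eq_add_of_le hs
  rw [Finset.sum_range_add]
  have hzero : ∑ x ∈ Finset.range d, wordCoeff τ η w (2 * s)
      (node η (s + d) y (s + d - 1 - (s + x))) ((s + d : ℕ) * η) *
      lagrange τ (s + d) (node η (s + d) y) (s + d - 1 - (s + x))
        (node η (s + d) y (s + d - 1 - (s + x)) + (2 * s : ℤ) * η) = 0 := by
    refine Finset.sum_eq_zero fun x hx => ?_
    rw [Finset.mem_range] at hx
    rw [show node η (s + d) y (s + d - 1 - (s + x)) + (2 * s : ℤ) * η =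
      node η (s + d) y (s + d - 1 - (s + x) + s) by simp only [node]; push_cast; ring,
      lagrange_eq_zero (by omega) (by omega), mul_zero]
  rw [hzero, add_zero]
  refine Finset.sum_congr rfl fun i hi => ?_
  rw [Finset.mem_range] at hi
  rw [lagrange_overshoot hη hy hi hs, boundaryTerm]
  congr 2
  rw [node, Nat.sub_sub, Nat.cast_sub (by omega)]
  push_cast
  ring

/-- The reflection u ↦ -u maps the nodes for y, in reverse order, to the nodes for 2η - y. It
reduces displacements to the left to displacements to the right. -/
lemma lagrange_reflect {K l : ℕ} (hl : l < K) (y v : ℂ) :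
    lagrange τ K (node η K y) l v =
      lagrange τ K (node η K (2 * η - y)) (K - 1 - l) (-v) := by
  have hn : ∀ q < K, node η K (2 * η - y) (K - 1 - q) = -node η K y q := by
    intro q hq
    rw [node, node, Nat.sub_sub, Nat.cast_sub (by omega)]
    push_cast
    ring
  have hp : ∀ a u : ℂ, thetaPair τ (-a) (-u) = thetaPair τ a u := by
    intro a u
    rw [thetaPair, thetaPair, show -u - -a = -(u - a) by ring, show -u + -a = -(u + a) by ring,
      theta_neg, theta_neg]
    simp
  rw [lagrange, lagrange]
  refine Finset.prod_nbij' (fun q => K - 1 - q) (fun q => K - 1 - q) ?_ ?_ ?_ ?_ ?_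
  · intro q hq
    rw [Finset.mem_erase, Finset.mem_range] at hq ⊢
    omega
  · intro q hq
    rw [Finset.mem_erase, Finset.mem_range] at hq ⊢
    omega
  · intro q hq
    rw [Finset.mem_erase, Finset.mem_range] at hq
    omega
  · intro q hq
    rw [Finset.mem_erase, Finset.mem_range] at hq
    omega
  · intro q hq
    rw [Finset.mem_erase, Finset.mem_range] at hq
    rw [hn q hq.2, hn l hl, hp, hp]

lemma sum_lower (hη : ∀ n : ℤ, n ≠ 0 → theta τ 0 (2 * (n * η)) ≠ 0) (w : List (Fin 4)) {y : ℂ}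
    (hy : Generic τ η y) {K s : ℕ} (hs0 : 1 ≤ s) (hs : s ≤ K) :
    ∑ l ∈ Finset.range K, wordCoeff τ η w (-(2 * s)) (node η K y l) (K * η) *
        lagrange τ K (node η K y) l (node η K y l + (-(2 * s) : ℤ) * η) =
      ∑ i ∈ Finset.range s, boundaryTerm τ η w s i (2 * η - y) (K * η) := by
  have hy' : Generic τ η (2 * η - y) := by simpa using hy.neg_add 2
  rw [← sum_upper hη w hy' hs0 hs, ← Finset.sum_range_reflect]
  refine Finset.sum_congr rfl fun l hl => ?_
  rw [Finset.mem_range] at hl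
  have hn : node η K y (K - 1 - l) = -node η K (2 * η - y) l := by
    rw [node, node, Nat.sub_sub, Nat.cast_sub (by omega)]
    push_cast
    ring
  rw [lagrange_reflect (by omega), hn, wordCoeff_neg, show K - 1 - (K - 1 - l) = l by omega]
  congr 2
  push_cast
  ring

/-- Displacement zero gives the diagonal sum because each interpolation function is 1 at its own
node; nonzero displacements contribute only at the two ends of the row. The bound on K keeps s ≤ K
for all displacements of the word. -/
lemma traceSum_eq (hη : ∀ n : ℤ, n ≠ 0 → theta τ 0 (2 * (n * η)) ≠ 0) {w : List (Fin 4)}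
    (hw : Even w.length) {y : ℂ} (hy : Generic τ η y) {K : ℕ} (hK : w.length ≤ K) :
    traceSum τ η w K y = ∑ l ∈ Finset.range K, wordCoeff τ η w 0 (node η K y l) (K * η) +
      ∑ s ∈ Finset.Icc 1 w.length, ∑ i ∈ Finset.range s,
        (boundaryTerm τ η w s i y (K * η) + boundaryTerm τ η w s i (2 * η - y) (K * η)) := by
  simp only [traceSum, wordOp_eq_sum_even w hw, Finset.sum_add_distrib]
  congr 1
  · refine Finset.sum_congr rfl fun l hl => ?_
    rw [Finset.mem_range] at hl
    rw [Int.cast_zero, zero_mul, add_zero, lagrange_self (genericPoints_node hη hy K) hl, mul_one]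
  · rw [Finset.sum_comm, Finset.sum_comm (s := Finset.range K)]
    congr 1
    · refine Finset.sum_congr rfl fun s hs => ?_
      rw [Finset.mem_Icc] at hs
      exact sum_upper hη w hy hs.1 (hs.2.trans hK)
    · refine Finset.sum_congr rfl fun s hs => ?_
      rw [Finset.mem_Icc] at hs
      exact sum_lower hη w hy hs.1 (hs.2.trans hK)

/-- A function whose difference with step `4η` is `x ↦ Z(x+2pη) - Z(x-2pη)`, `Z = θ₁'/θ₁`. -/
def zetaSum (τ η : ℂ) (p : ℕ) (x : ℂ) : ℂ :=
  ∑ n ∈ Finset.range p, logTheta τ (x - 2 * p * η + 4 * n * η)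

/-- The doubled nodes have step 4η, which is the step of the difference equation for `zetaSum`, so
the sum telescopes. -/
lemma sum_zetaDiff (p K : ℕ) (y : ℂ) :
    ∑ l ∈ Finset.range K, zetaDiff τ η p (node η K y l) =
      zetaSum τ η p (2 * y + 2 * (K * η)) - zetaSum τ η p (2 * y - 2 * (K * η)) := by
  have h : ∀ x, zetaSum τ η p (x + 4 * η) - zetaSum τ η p x =
      logTheta τ (x + 2 * p * η) - logTheta τ (x - 2 * p * η) := by
    intro x
    have := Finset.sum_range_sub (fun n : ℕ => logTheta τ (x - 2 * p * η + 4 * n * η)) p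
    simp only [zetaSum, ← Finset.sum_sub_distrib]
    rw [show x + 2 * p * η = x - 2 * p * η + 4 * p * η by ring]
    simp only [Nat.cast_zero, mul_zero, zero_mul, add_zero] at this
    rw [← this]
    refine Finset.sum_congr rfl fun n _ => ?_
    push_cast
    ring_nf
  have := Finset.sum_range_sub (fun l : ℕ => zetaSum τ η p (2 * node η K y l)) K
  have e1 : 2 * node η K y K = 2 * y + 2 * (K * η) := by rw [node]; ring
  have e0 : 2 * node η K y 0 = 2 * y - 2 * (K * η) := by rw [node]; push_cast; ring
  rw [e1, e0] at this
  rw [← this]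
  refine Finset.sum_congr rfl fun l _ => ?_
  rw [zetaDiff, ← h]
  congr 2
  simp only [node]
  push_cast
  ring

end TraceSum

end EightVertex

end

noncomputable section
namespace EightVertex
open Filter Topology Function

/-! ### Half periods of the traces of words -/

section HalfPeriods

variable {τ η : ℂ}

lemma theta_int_mul_ne_zero (hτ : 0 < τ.im) (hη : ∀ a b : ℚ, η ≠ a + b * τ) (n : ℤ) (hn : n ≠ 0) :
    theta τ 0 (n * η) ≠ 0 := by
  refine theta_ne_zero hτ fun a b h => ?_
  have hn' : (n : ℂ) ≠ 0 := Int.cast_ne_zero.2 hn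
  refine hη (a / n) (b / n) ?_
  push_cast
  field_simp
  linear_combination h

lemma theta_two_int_mul_ne_zero (hτ : 0 < τ.im) (hη : ∀ a b : ℚ, η ≠ a + b * τ) (n : ℤ)
    (hn : n ≠ 0) : theta τ 0 (2 * (n * η)) ≠ 0 := by
  have := theta_int_mul_ne_zero hτ hη (2 * n) (by omega)
  push_cast at this
  rwa [← mul_assoc]

/-- The excluded points form a countable set. -/
lemma exists_generic (hτ : 0 < τ.im) : ∃ y, Generic τ η y := by
  have hc : (Set.range fun p : ℤ × ℤ × ℤ => ((p.1 + p.2.1 * τ) / 2 - p.2.2 * η : ℂ)).Countable :=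
    Set.countable_range _
  obtain ⟨y, hy⟩ := (hc.dense_compl ℝ).nonempty
  refine ⟨y, fun n h => hy ?_⟩
  obtain ⟨a, b, hab⟩ := exists_lattice_of_theta_eq_zero hτ h
  exact ⟨(a, b, n), by simp only; linear_combination -hab / 2⟩

/-- A function of trace form is determined by its values at the integers. -/
lemma HasTraceForm.eqM (hτ : 0 < τ.im) (hη : ∀ a b : ℚ, η ≠ a + b * τ) {m : ℕ} (hm : Even m)
    {F : ℂ → ℂ} (hF : HasTraceForm τ η m F) {β γ δ : ℂ → ℂ}
    (mβ : Meromorphic β) (mγ : Meromorphic γ) (mδ : Meromorphic δ)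
    (hβ1 : EqM (fun z => β (z + 1)) β) (hβτ : EqM (fun z => β (z + τ)) fun z => β z + δ z)
    (hγ1 : EqM (fun z => γ (z + 1)) γ) (hγτ : EqM (fun z => γ (z + τ)) γ)
    (hδ1 : EqM (fun z => δ (z + 1)) δ) (hδτ : EqM (fun z => δ (z + τ)) δ)
    (ha : ∀ᶠ K : ℕ in atTop,
      AnalyticAt ℂ β (K * η) ∧ AnalyticAt ℂ γ (K * η) ∧ AnalyticAt ℂ δ (K * η))
    (h : ∀ᶠ K : ℕ in atTop, F K = theta τ 0 (K * η) ^ m * (β (K * η) + K * γ (K * η))) :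
    EqM (fun t => F (t / η)) fun t => theta τ 0 t ^ m * (β t + t / η * γ t) := by
  have hη0 : η ≠ 0 := by simpa using hη 0 0
  obtain ⟨g₁, g₂, m1, h11, ⟨m2, h21, h2τ⟩, ⟨m3, h31, h3τ⟩, hg⟩ := hF.2 hm
  have m1' : Meromorphic g₁ := fun z => m1 z trivial
  have m2' : Meromorphic g₂ := fun z => m2 z trivial
  set g₃ : ℂ → ℂ := fun t => g₁ (t + τ) - g₁ t with hg₃
  have m3' : Meromorphic g₃ := fun z => m3 z trivial
  have h1τ : ∀ z, g₁ (z + τ) = g₁ z + g₃ z := fun z => by rw [hg₃]; ring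
  -- The common singular set is discrete and invariant under the lattice, so Kη avoids it for large
  -- K.
  let S : Set ℂ := {z | ¬ (AnalyticAt ℂ g₁ z ∧ AnalyticAt ℂ g₂ z ∧ AnalyticAt ℂ g₃ z)}
  have hS : ∀ p, ∀ᶠ z in 𝓝[≠] p, z ∉ S := by
    intro p
    filter_upwards [(m1' p).eventually_analyticAt, (m2' p).eventually_analyticAt,
      (m3' p).eventually_analyticAt] with z a b c
    simp only [S, Set.mem_ofPred_eq, not_not]
    exact ⟨a, b, c⟩
  have han : ∀ {g : ℂ → ℂ} {c : ℂ}, (∀ z, g (z + c) = g z) → ∀ z,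
      AnalyticAt ℂ g (z + c) ↔ AnalyticAt ℂ g z := by
    intro g c hgc z
    constructor
    · intro h
      have : AnalyticAt ℂ (g ∘ fun x => x + c) z := h.comp_of_eq (by fun_prop) rfl
      rwa [show (g ∘ fun x => x + c) = g from funext hgc] at this
    · intro h
      have : AnalyticAt ℂ (g ∘ fun x => x - c) (z + c) := h.comp_of_eq (by fun_prop) (by simp)
      rwa [show (g ∘ fun x => x - c) = g from funext fun x => by
        rw [comp_apply, ← hgc, sub_add_cancel]] at this
  have hS1 : ∀ z, (z + 1 ∈ S) = (z ∈ S) := fun z => by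
    simp only [S, Set.mem_ofPred_eq, han h11 z, han h21 z, han h31 z]
  have hS2 : ∀ z, (z + τ ∈ S) = (z ∈ S) := fun z => by
    simp only [S, Set.mem_ofPred_eq, han h2τ z, han h3τ z]
    -- The function g₁ is not τ-periodic, but its increment g₃ is; where g₃ is analytic, regularity
    -- of g₁ is transported by τ.
    have key : AnalyticAt ℂ g₃ z → (AnalyticAt ℂ g₁ (z + τ) ↔ AnalyticAt ℂ g₁ z) := by
      intro h3
      constructor
      · intro h
        have h' : AnalyticAt ℂ (g₁ ∘ fun x => x + τ) z := h.comp_of_eq (by fun_prop) rfl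
        have := h'.sub h3
        rwa [show (g₁ ∘ fun x => x + τ) - g₃ = g₁ from funext fun x => by
          simp [h1τ]] at this
      · intro h
        have : AnalyticAt ℂ ((g₁ + g₃) ∘ fun x => x - τ) (z + τ) :=
          (h.add h3).comp_of_eq (by fun_prop) (by simp)
        rwa [show ((g₁ + g₃) ∘ fun x => x - τ) = g₁ from funext fun x => by
          rw [comp_apply, Pi.add_apply, ← h1τ, sub_add_cancel]] at this
    apply propext
    tauto
  have hev := eventually_analyticAt_of_periodic hτ hη hS1 hS2 hS 0
  have e1 : ∀ {a b c d : ℂ → ℂ}, EqM a b → EqM c d → EqM (fun z => a z - c z) fun z => b z - d z :=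
    fun h h' z => (h z).sub (h' z)
  have hθ : ∀ᶠ K : ℕ in atTop, theta τ 0 (K * η) ≠ 0 := by
    filter_upwards [eventually_ge_atTop 1] with K hK
    simpa using theta_int_mul_ne_zero hτ hη K (by omega)
  -- Uniqueness is applied to the differences of the two decompositions. The sign of γ is opposite
  -- to that of g₂, which enters the trace form with a minus sign.
  obtain ⟨r1, r2⟩ := eqM_zero_of_traceForm hτ hη (g₁ := fun z => g₁ z - β z)
    (g₂ := fun z => g₂ z + γ z) (g₃ := fun z => g₃ z - δ z) (m1'.sub mβ) (m2'.add mγ)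
    (m3'.sub mδ) (e1 (EqM.of_eq h11) hβ1)
    ((e1 (EqM.of_eq h1τ) hβτ).trans (EqM.of_eq fun z => by ring))
    (fun z => (EqM.of_eq h21 z).add (hγ1 z)) (fun z => (EqM.of_eq h2τ z).add (hγτ z))
    (e1 (EqM.of_eq h31) hδ1) (e1 (EqM.of_eq h3τ) hδτ)
    (by
      filter_upwards [hev, ha] with K hK ⟨a, b, c⟩
      simp only [S, Set.mem_ofPred_eq, not_not, zero_add] at hK
      exact ⟨hK.1.sub a, hK.2.1.add b, hK.2.2.sub c⟩)
    (by
      filter_upwards [h, hθ] with K hK hθK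
      have h2 := hg (K * η) hθK
      rw [mul_div_cancel_right₀ _ hη0, hK] at h2
      have h3 := mul_left_cancel₀ (pow_ne_zero m hθK) h2
      linear_combination -h3)
  intro z
  filter_upwards [r1 z, r2 z, eventually_theta_ne_zero hτ z] with t h1 h2 h3
  simp only [Pi.zero_apply] at h1 h2
  rw [hg t h3]
  linear_combination theta τ 0 t ^ m * (h1 - t / η * h2)

lemma prod_theta_add_one (x : ℂ) (s : ℕ) :
    ∏ n ∈ Finset.range s, theta τ 0 (x + 2 * n * η + 1) =
      (-1) ^ s * ∏ n ∈ Finset.range s, theta τ 0 (x + 2 * n * η) := by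
  induction s with
  | zero => simp
  | succ s ih =>
    rw [Finset.prod_range_succ, Finset.prod_range_succ, ih, theta_add_one]
    simp only [charA, Matrix.cons_val_zero, pow_succ]
    ring

lemma prod_theta_add_tau (x : ℂ) (s : ℕ) :
    ∏ n ∈ Finset.range s, theta τ 0 (x + 2 * n * η + τ) =
      (-1) ^ s * exp (-(Real.pi * I * (s * τ + 2 * s * x + 2 * η * s * (s - 1)))) *
        ∏ n ∈ Finset.range s, theta τ 0 (x + 2 * n * η) := by
  induction s with
  | zero => simp
  | succ s ih =>
    rw [Finset.prod_range_succ, Finset.prod_range_succ, ih, theta_add_tau,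
      show exp (-(Real.pi * I * ((s + 1 : ℕ) * τ + 2 * (s + 1 : ℕ) * x +
        2 * η * (s + 1 : ℕ) * ((s + 1 : ℕ) - 1)))) =
        exp (-(Real.pi * I * (s * τ + 2 * s * x + 2 * η * s * (s - 1)))) *
        exp (-Real.pi * I * (τ + 2 * (x + 2 * s * η))) by
          rw [← exp_add]; congr 1; push_cast; ring]
    simp only [charB, Matrix.cons_val_zero, pow_succ]
    ring

lemma overshoot_add_half (s i : ℕ) (y t : ℂ) :
    overshoot τ η s i y (t + 1 / 2) = overshoot τ η s i y t := by
  have h1 : ∀ c : ℂ, (∏ n ∈ Finset.range s, theta τ 0 (c + 2 * (t + 1 / 2) + 2 * (n - i) * η)) =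
      (-1) ^ s * ∏ n ∈ Finset.range s, theta τ 0 (c + 2 * t + 2 * (n - i) * η) := by
    intro c
    rw [Finset.prod_congr rfl fun (n : ℕ) _ => by
        rw [show c + 2 * (t + 1 / 2) + 2 * (n - i) * η = c + 2 * t - 2 * i * η + 2 * n * η + 1 by ring],
      prod_theta_add_one]
    congr 1
    exact Finset.prod_congr rfl fun n _ => by congr 1; ring
  have h2 : ∀ u v : ℂ, theta τ 0 (2 * y + 2 * (t + 1 / 2) + u) = -theta τ 0 (2 * y + 2 * t + u) := by
    intro u v
    rw [show 2 * y + 2 * (t + 1 / 2) + u = 2 * y + 2 * t + u + 1 by ring, theta_add_one]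
    simp [charA]
  have hs : ((-1 : ℂ) ^ s) * (-1) ^ s = 1 := by rw [← mul_pow]; simp
  have key : ∀ p q p' q' x : ℂ, ((-1) ^ s * p) / q * (((-1) ^ s * p') / q') * x =
      p / q * (p' / q') * x := by
    intro p q p' q' x
    rw [mul_div_assoc, mul_div_assoc]
    linear_combination (p / q * (p' / q') * x) * hs
  have a1 := h1 0
  have a2 := h1 (2 * y - 2 * η)
  simp only [zero_add] at a1
  have b : ∀ t : ℂ, ∏ n ∈ Finset.range s, theta τ 0 (2 * y + 2 * t + 2 * (n - i - 1) * η) =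
      ∏ n ∈ Finset.range s, theta τ 0 (2 * y - 2 * η + 2 * t + 2 * (n - i) * η) := fun t =>
    Finset.prod_congr rfl fun n _ => by congr 1; ring
  rw [overshoot, overshoot, a1, b, a2, ← b, sub_eq_add_neg (2 * y + 2 * (t + 1 / 2)), h2 _ 0, h2 _ 0,
    neg_div_neg_eq, ← sub_eq_add_neg]
  generalize theta τ 0 (2 * y + 2 * t - 4 * (i + 1) * η) /
      theta τ 0 (2 * y + 2 * t + 2 * (s - 2 * (i + 1)) * η) = x
  exact key _ _ _ _ _

lemma overshoot_add_half_tau (s i : ℕ) (y t : ℂ) :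
    overshoot τ η s i y (t + τ / 2) = exp (-(Real.pi * I * (2 * s * τ + 8 * s * t + 4 * s * y +
      4 * η * s ^ 2 - 12 * η * s - 8 * i * η * s))) * overshoot τ η s i y t := by
  have h1 : ∀ c : ℂ, (∏ n ∈ Finset.range s, theta τ 0 (c + 2 * (t + τ / 2) + 2 * (n - i) * η)) =
      (-1) ^ s * exp (-(Real.pi * I * (s * τ + 2 * s * (c + 2 * t - 2 * i * η) +
        2 * η * s * (s - 1)))) *
        ∏ n ∈ Finset.range s, theta τ 0 (c + 2 * t + 2 * (n - i) * η) := by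
    intro c
    rw [Finset.prod_congr rfl fun (n : ℕ) _ => by
        rw [show c + 2 * (t + τ / 2) + 2 * (n - i) * η = c + 2 * t - 2 * i * η + 2 * n * η + τ by ring],
      prod_theta_add_tau]
    congr 1
    exact Finset.prod_congr rfl fun n _ => by congr 1; ring
  have h2 : ∀ u v : ℂ, theta τ 0 (2 * y + 2 * (t + τ / 2) + u) / theta τ 0 (2 * y + 2 * (t + τ / 2) + v) =
      exp (2 * Real.pi * I * (v - u)) *
        (theta τ 0 (2 * y + 2 * t + u) / theta τ 0 (2 * y + 2 * t + v)) := by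
    intro u v
    rw [show 2 * y + 2 * (t + τ / 2) + u = 2 * y + 2 * t + u + τ by ring,
      show 2 * y + 2 * (t + τ / 2) + v = 2 * y + 2 * t + v + τ by ring, theta_add_tau, theta_add_tau,
      show exp (-Real.pi * I * (τ + 2 * (2 * y + 2 * t + u))) = exp (2 * Real.pi * I * (v - u)) *
        exp (-Real.pi * I * (τ + 2 * (2 * y + 2 * t + v))) by rw [← exp_add]; congr 1; ring]
    have hne := exp_ne_zero (-Real.pi * I * (τ + 2 * (2 * y + 2 * t + v)))
    generalize exp (-Real.pi * I * (τ + 2 * (2 * y + 2 * t + v))) = E at hne ⊢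
    simp only [charB, Matrix.cons_val_zero]
    generalize theta τ 0 (2 * y + 2 * t + u) = p
    generalize theta τ 0 (2 * y + 2 * t + v) = q
    rw [show -1 * (exp (2 * Real.pi * I * (v - u)) * E) * p =
      (-1 * E) * (exp (2 * Real.pi * I * (v - u)) * p) by ring, mul_div_mul_left _ _ (by simpa using hne),
      mul_div_assoc]
  have hs : ((-1 : ℂ) ^ s) * (-1) ^ s = 1 := by rw [← mul_pow]; simp
  have key : ∀ p q p' q' x E1 E2 E3 : ℂ, ((-1) ^ s * E1 * p) / q * (((-1) ^ s * E2 * p') / q') *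
      (E3 * x) = E1 * E2 * E3 * (p / q * (p' / q') * x) := by
    intro p q p' q' x E1 E2 E3
    simp only [mul_div_assoc]
    linear_combination (E1 * E2 * E3 * (p / q * (p' / q') * x)) * hs
  have a1 := h1 0
  have a2 := h1 (2 * y - 2 * η)
  simp only [zero_add] at a1
  have b : ∀ t : ℂ, ∏ n ∈ Finset.range s, theta τ 0 (2 * y + 2 * t + 2 * (n - i - 1) * η) =
      ∏ n ∈ Finset.range s, theta τ 0 (2 * y - 2 * η + 2 * t + 2 * (n - i) * η) := fun t =>
    Finset.prod_congr rfl fun n _ => by congr 1; ring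
  rw [overshoot, overshoot, a1, b, a2, ← b, sub_eq_add_neg (2 * y + 2 * (t + τ / 2)), h2,
    ← sub_eq_add_neg]
  have hexp : exp (-(Real.pi * I * (2 * s * τ + 8 * s * t + 4 * s * y +
      4 * η * s ^ 2 - 12 * η * s - 8 * i * η * s))) =
      exp (-(Real.pi * I * (s * τ + 2 * s * (2 * t - 2 * i * η) + 2 * η * s * (s - 1)))) *
      exp (-(Real.pi * I * (s * τ + 2 * s * (2 * y - 2 * η + 2 * t - 2 * i * η) +
        2 * η * s * (s - 1)))) *
      exp (2 * Real.pi * I * (2 * (s - 2 * (i + 1)) * η - -(4 * (i + 1) * η))) := by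
    rw [← exp_add, ← exp_add]; congr 1; ring
  rw [hexp]
  generalize theta τ 0 (2 * y + 2 * t - 4 * (i + 1) * η) /
      theta τ 0 (2 * y + 2 * t + 2 * (s - 2 * (i + 1)) * η) = x
  generalize exp (-(Real.pi * I * (s * τ + 2 * s * (2 * t - 2 * i * η) + 2 * η * s * (s - 1)))) = E1
  generalize exp (-(Real.pi * I * (s * τ + 2 * s * (2 * y - 2 * η + 2 * t - 2 * i * η) +
        2 * η * s * (s - 1)))) = E2
  generalize exp (2 * Real.pi * I * (2 * (s - 2 * (i + 1)) * η - -(4 * (i + 1) * η))) = E3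
  exact key _ _ _ _ _ _ _ _

lemma boundaryTerm_permA {w : List (Fin 4)} (hA : wordProd charA w = 1) (s i : ℕ) (y t : ℂ) :
    boundaryTerm τ η (w.map permA) s i y (t + 1 / 2) =
      wordProd sgnA w * boundaryTerm τ η w s i y t := by
  rw [boundaryTerm, boundaryTerm, overshoot_add_half, wordCoeff_permA,
    show y + (t + 1 / 2) - 2 * (i + 1) * η = y + t - 2 * (i + 1) * η + 1 / 2 by ring,
    wordCoeff_add_half, hA, one_mul, mul_assoc]

/-- Three exponentials meet: from the permutation of the letters, from moving the node by τ/2, and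
from the overshoot. Their dependence on y, s and i cancels, and what is left is the factor of the
diagonal terms. Hence diagonal and boundary parts can be added. -/
lemma boundaryTerm_permB {w : List (Fin 4)} (hB : wordProd charB w = 1) (s i : ℕ) (y t : ℂ) :
    boundaryTerm τ η (w.map permB) s i y (t + τ / 2) = (wordProd sgnB w)⁻¹ *
      exp (-(Real.pi * I * (w.length * (t + τ / 4)))) * boundaryTerm τ η w s i y t := by
  rw [boundaryTerm, boundaryTerm, overshoot_add_half_tau, wordCoeff_permB,
    show y + (t + τ / 2) - 2 * (i + 1) * η = y + t - 2 * (i + 1) * η + τ / 2 by ring,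
    wordCoeff_add_half_tau, hB, one_mul]
  have he : exp (-(Real.pi * I * (w.length * (t + τ / 4)))) =
      exp (Real.pi * I * (2 * ((2 * s : ℤ) : ℂ) * (y + t - 2 * (i + 1) * η + τ / 2) +
        η * ((2 * s : ℤ) : ℂ) ^ 2 - w.length * (t + τ / 4))) *
      exp (2 * Real.pi * I * ((2 * s : ℤ) : ℂ) * (t - η)) *
      exp (-(Real.pi * I * (2 * s * τ + 8 * s * t + 4 * s * y +
        4 * η * s ^ 2 - 12 * η * s - 8 * i * η * s))) := by
    rw [← exp_add, ← exp_add]; congr 1; push_cast; ring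
  rw [he]
  ring

end HalfPeriods

end EightVertex

end

noncomputable section
namespace EightVertex
open Filter Topology Function

/-! ### Half-period families and the trace form -/

section Decomposition

variable {τ η : ℂ}

lemma zetaSum_add_one (p : ℕ) (x : ℂ) : zetaSum τ η p (x + 1) = zetaSum τ η p x :=
  Finset.sum_congr rfl fun n _ => by
    rw [show x + 1 - 2 * p * η + 4 * n * η = x - 2 * p * η + 4 * n * η + 1 by ring,
      logTheta_add_one]

lemma zetaSum_add_tau (hτ : 0 < τ.im) {p : ℕ} {x : ℂ}
    (h : ∀ n ∈ Finset.range p, theta τ 0 (x - 2 * p * η + 4 * n * η) ≠ 0) :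
    zetaSum τ η p (x + τ) = zetaSum τ η p x - p * (2 * Real.pi * I) := by
  rw [zetaSum, zetaSum, Finset.sum_congr rfl fun n hn => by
    rw [show x + τ - 2 * p * η + 4 * n * η = x - 2 * p * η + 4 * n * η + τ by ring,
      logTheta_add_tau hτ (h n hn)], Finset.sum_sub_distrib]
  simp

lemma meromorphic_zetaSum (hτ : 0 < τ.im) (p : ℕ) {v : ℂ → ℂ} (hv : Differentiable ℂ v) :
    Meromorphic fun t => zetaSum τ η p (v t) := by
  unfold zetaSum
  exact Meromorphic.fun_sum fun n _ => meromorphic_logTheta_comp hτ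
    (v := fun t => v t - 2 * p * η + 4 * n * η) (by fun_prop)

lemma analyticAt_zetaSum (hτ : 0 < τ.im) (p : ℕ) {v : ℂ → ℂ} (hv : Differentiable ℂ v) {t : ℂ}
    (h : ∀ n : ℤ, theta τ 0 (v t + 2 * n * η) ≠ 0) :
    AnalyticAt ℂ (fun t => zetaSum τ η p (v t)) t := by
  unfold zetaSum
  refine Finset.analyticAt_fun_sum _ fun n _ => analyticAt_logTheta_comp hτ
    (v := fun t => v t - 2 * p * η + 4 * n * η) (by fun_prop) ?_
  have := h (2 * n - p)
  push_cast at this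
  rwa [show v t - 2 * p * η + 4 * n * η = v t + 2 * (2 * n - p) * η by ring]

lemma meromorphic_overshoot (hτ : 0 < τ.im) (s i : ℕ) (y : ℂ) :
    Meromorphic (overshoot τ η s i y) := by
  have hd := differentiable_theta hτ 0
  have d1 : Differentiable ℂ fun t => ∏ n ∈ Finset.range s, theta τ 0 (2 * t + 2 * (n - i) * η) := by
    fun_prop
  have d2 : Differentiable ℂ fun t =>
      ∏ n ∈ Finset.range s, theta τ 0 (2 * y + 2 * t + 2 * (n - i - 1) * η) := by
    fun_prop
  have d3 : Differentiable ℂ fun t => theta τ 0 (2 * y + 2 * t - 4 * (i + 1) * η) := by fun_prop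
  have d4 : Differentiable ℂ fun t => theta τ 0 (2 * y + 2 * t + 2 * (s - 2 * (i + 1)) * η) := by
    fun_prop
  have m := @meromorphic_of_differentiable
  exact (((m d1).div (Meromorphic.const _)).mul ((m d2).div (Meromorphic.const _))).mul
    ((m d3).div (m d4))

lemma meromorphic_boundaryTerm (hτ : 0 < τ.im) (w : List (Fin 4)) (s i : ℕ) (y : ℂ) :
    Meromorphic (boundaryTerm τ η w s i y) :=
  (meromorphic_wordCoeff hτ w _ (u := fun t => y + t - 2 * (i + 1) * η) (t := fun t => t)
    (by fun_prop) (by fun_prop)).mul (meromorphic_overshoot hτ s i y)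

lemma analyticAt_boundaryTerm (hτ : 0 < τ.im) (w : List (Fin 4)) (s i : ℕ) {y : ℂ}
    (hy : Generic τ η y) (K : ℕ) : AnalyticAt ℂ (boundaryTerm τ η w s i y) (K * η) := by
  have hd := differentiable_theta hτ 0
  have d1 : Differentiable ℂ fun t => ∏ n ∈ Finset.range s, theta τ 0 (2 * t + 2 * (n - i) * η) := by
    fun_prop
  have d2 : Differentiable ℂ fun t =>
      ∏ n ∈ Finset.range s, theta τ 0 (2 * y + 2 * t + 2 * (n - i - 1) * η) := by
    fun_prop
  have d3 : Differentiable ℂ fun t => theta τ 0 (2 * y + 2 * t - 4 * (i + 1) * η) := by fun_prop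
  have d4 : Differentiable ℂ fun t => theta τ 0 (2 * y + 2 * t + 2 * (s - 2 * (i + 1)) * η) := by
    fun_prop
  refine (analyticAt_wordCoeff hτ w _ (u := fun t => y + t - 2 * (i + 1) * η) (t := fun t => t)
    (by fun_prop) (by fun_prop) ?_).mul ((((d1.analyticAt _).div_const).mul
      ((d2.analyticAt _).div_const)).mul ((d3.analyticAt _).div (d4.analyticAt _) ?_))
  · have := hy.add (K - 2 * (i + 1))
    push_cast at this
    rwa [show y + (K - 2 * (i + 1)) * η = y + K * η - 2 * (i + 1) * η by ring] at this
  · have := hy (K + (s - 2 * (i + 1)))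
    push_cast at this
    rwa [show 2 * y + 2 * (K * η) + 2 * (s - 2 * (i + 1)) * η =
      2 * (y + (K + (s - 2 * (i + 1))) * η) by ring]

/-- The word is neutral for the two half-period characters. -/
def Neutral (w : List (Fin 4)) : Prop := wordProd charA w = 1 ∧ wordProd charB w = 1

lemma wordProd_map (c : Fin 4 → ℂ) (p : Fin 4 → Fin 4) (w : List (Fin 4)) :
    wordProd c (w.map p) = wordProd (c ∘ p) w := by simp [wordProd]

lemma wordProd_neg (c : Fin 4 → ℂ) {w : List (Fin 4)} (hw : Even w.length) :
    wordProd (fun α => -c α) w = wordProd c w := by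
  have : ∀ v : List (Fin 4), wordProd (fun α => -c α) v = (-1) ^ v.length * wordProd c v := by
    intro v
    induction v with
    | nil => simp
    | cons α v ih => rw [wordProd_cons, wordProd_cons, ih, List.length_cons, pow_succ]; ring
  rw [this, hw.neg_one_pow, one_mul]

lemma wordProd_mul (c d : Fin 4 → ℂ) (w : List (Fin 4)) :
    wordProd c w * wordProd d w = wordProd (fun α => c α * d α) w := by
  simp [wordProd, List.prod_map_mul]

/-- Two half translations make a full one: letter by letter the product of the signs is -`charA`,
and the minus signs disappear for even length. -/
lemma wordProd_sgnA_permA {w : List (Fin 4)} (hw : Even w.length) :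
    wordProd sgnA (w.map permA) * wordProd sgnA w = wordProd charA w := by
  rw [wordProd_map, wordProd_mul, ← wordProd_neg _ hw]
  congr 1
  funext α
  fin_cases α <;> simp [sgnA, permA, charA]

lemma wordProd_sgnB_permB {w : List (Fin 4)} (hw : Even w.length) :
    wordProd sgnB (w.map permB) * wordProd sgnB w = wordProd charB w := by
  rw [wordProd_map, wordProd_mul, ← wordProd_neg _ hw]
  congr 1
  funext α
  fin_cases α <;> simp [sgnB, permB, charB]

/-- Permuting the letters changes the characters by at most one common sign per letter, which is
invisible for even length. -/
lemma neutral_permA {w : List (Fin 4)} (hw : Even w.length) : Neutral (w.map permA) ↔ Neutral w := by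
  have h1 : charA ∘ permA = charA := by
    funext α; fin_cases α <;> simp [charA, permA]
  have h2 : charB ∘ permA = fun α => -charB α := by
    funext α; fin_cases α <;> simp [charB, permA]
  rw [Neutral, Neutral, wordProd_map, wordProd_map, h1, h2, wordProd_neg _ hw]

lemma neutral_permB {w : List (Fin 4)} (hw : Even w.length) : Neutral (w.map permB) ↔ Neutral w := by
  have h1 : charA ∘ permB = fun α => -charA α := by
    funext α; fin_cases α <;> simp [charA, permB]
  have h2 : charB ∘ permB = charB := by
    funext α; fin_cases α <;> simp [charB, permB]
  rw [Neutral, Neutral, wordProd_map, wordProd_map, h1, h2, wordProd_neg _ hw]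

/-- The multiplier of a word for the translation by `τ/2`. -/
def multB (τ : ℂ) (w : List (Fin 4)) (t : ℂ) : ℂ :=
  (wordProd sgnB w)⁻¹ * exp (-(Real.pi * I * (w.length * (t + τ / 4))))

lemma wordProd_ne_zero {c : Fin 4 → ℂ} (hc : ∀ α, c α ≠ 0) (w : List (Fin 4)) :
    wordProd c w ≠ 0 := by
  simp [wordProd, List.prod_eq_zero_iff, hc]

lemma multB_ne_zero (w : List (Fin 4)) (t : ℂ) : multB τ w t ≠ 0 :=
  mul_ne_zero (inv_ne_zero (wordProd_ne_zero sgnB_ne_zero w)) (exp_ne_zero _)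

/-- The composite of the two half translations has the multiplier of θ₁^m under τ. Therefore
division by θ₁^m leads to elliptic functions. -/
lemma multB_mul {w : List (Fin 4)} (hw : Even w.length) (hB : wordProd charB w = 1) (t : ℂ) :
    multB τ (w.map permB) (t + τ / 2) * multB τ w t =
      exp (-Real.pi * I * (τ + 2 * t)) ^ w.length := by
  rw [multB, multB, mul_mul_mul_comm, ← mul_inv, wordProd_sgnB_permB hw, hB, inv_one, one_mul,
    ← exp_add, ← exp_nat_mul, List.length_map]
  congr 1
  ring

/-- A decomposition `B w + t C w` with simple behaviour under half periods; `B` jumps by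
`D w / 2` under `t ↦ t + τ/2`. -/
structure HalfPeriodFamily (τ : ℂ) (m : ℕ) (B C D : List (Fin 4) → ℂ → ℂ) : Prop where
  meroB : ∀ w, Meromorphic (B w)
  meroC : ∀ w, Meromorphic (C w)
  meroD : ∀ w, Meromorphic (D w)
  permA_B : ∀ w, w.length = m →
    EqM (fun t => B (w.map permA) (t + 1 / 2)) fun t => wordProd sgnA w * B w t
  permA_C : ∀ w, w.length = m →
    EqM (fun t => C (w.map permA) (t + 1 / 2)) fun t => wordProd sgnA w * C w t
  permA_D : ∀ w, w.length = m →
    EqM (fun t => D (w.map permA) (t + 1 / 2)) fun t => wordProd sgnA w * D w t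
  permB_B : ∀ w, w.length = m →
    EqM (fun t => B (w.map permB) (t + τ / 2)) fun t => multB τ w t * (B w t + 1 / 2 * D w t)
  permB_C : ∀ w, w.length = m →
    EqM (fun t => C (w.map permB) (t + τ / 2)) fun t => multB τ w t * C w t
  permB_D : ∀ w, w.length = m →
    EqM (fun t => D (w.map permB) (t + τ / 2)) fun t => multB τ w t * D w t

lemma map_permA_permA (w : List (Fin 4)) : (w.map permA).map permA = w := by
  rw [List.map_map, show permA ∘ permA = id from funext permA_permA, List.map_id]

lemma map_permB_permB (w : List (Fin 4)) : (w.map permB).map permB = w := by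
  rw [List.map_map, show permB ∘ permB = id from funext permB_permB, List.map_id]

lemma eqM_add_one_of_permA {m : ℕ} (hm : Even m) {X : List (Fin 4) → ℂ → ℂ}
    (hX : ∀ w, w.length = m →
      EqM (fun t => X (w.map permA) (t + 1 / 2)) fun t => wordProd sgnA w * X w t)
    {w : List (Fin 4)} (hw : w.length = m) (hA : wordProd charA w = 1) :
    EqM (fun t => X w (t + 1)) (X w) := by
  intro z
  have h1 := (hX (w.map permA) (by simpa using hw)).comp_add (1 / 2) z
  filter_upwards [h1, hX w hw z] with t h1 h2
  rw [map_permA_permA] at h1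
  rw [show t + 1 = t + 1 / 2 + 1 / 2 by ring, h1, h2, ← mul_assoc,
    wordProd_sgnA_permA (hw ▸ hm), hA, one_mul]

/-- Two half jumps add up to one jump by Y. With Y = 0 this covers the functions without jump. -/
lemma eqM_add_tau_of_permB {m : ℕ} (hm : Even m) {X Y : List (Fin 4) → ℂ → ℂ}
    (hX : ∀ w, w.length = m →
      EqM (fun t => X (w.map permB) (t + τ / 2)) fun t => multB τ w t * (X w t + 1 / 2 * Y w t))
    (hY : ∀ w, w.length = m →
      EqM (fun t => Y (w.map permB) (t + τ / 2)) fun t => multB τ w t * Y w t)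
    {w : List (Fin 4)} (hw : w.length = m) (hB : wordProd charB w = 1) :
    EqM (fun t => X w (t + τ))
      fun t => exp (-Real.pi * I * (τ + 2 * t)) ^ m * (X w t + Y w t) := by
  intro z
  have h1 := (hX (w.map permB) (by simpa using hw)).comp_add (τ / 2) z
  filter_upwards [h1, hX w hw z, hY w hw z] with t h1 h2 h3
  rw [map_permB_permB] at h1
  rw [show t + τ = t + τ / 2 + τ / 2 by ring, h1, h2, h3, ← hw, ← multB_mul (hw ▸ hm) hB]
  ring

/-- Division by θ₁^m matches the trace form: B/θ₁^m plays the role of g₁, -ηC/θ₁^m that of g₂, and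
D/θ₁^m is the increment of g₁ under τ. -/
lemma HasTraceForm.eqM_family (hτ : 0 < τ.im) (hη : ∀ a b : ℚ, η ≠ a + b * τ) {m : ℕ} (hm : Even m)
    {F : ℂ → ℂ} (hF : HasTraceForm τ η m F) {B C D : List (Fin 4) → ℂ → ℂ}
    (hfam : HalfPeriodFamily τ m B C D) {w : List (Fin 4)} (hw : w.length = m) (hn : Neutral w)
    (ha : ∀ᶠ K : ℕ in atTop,
      AnalyticAt ℂ (B w) (K * η) ∧ AnalyticAt ℂ (C w) (K * η) ∧ AnalyticAt ℂ (D w) (K * η))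
    (h : ∀ᶠ K : ℕ in atTop, F K = B w (K * η) + K * η * C w (K * η)) :
    EqM (fun t => F (t / η)) fun t => B w t + t * C w t := by
  have hη0 : η ≠ 0 := by simpa using hη 0 0
  have hd := differentiable_theta hτ 0
  have mθ : Meromorphic fun t => theta τ 0 t ^ m :=
    meromorphic_of_differentiable (by fun_prop)
  have hθ1 : ∀ t, theta τ 0 (t + 1) ^ m = theta τ 0 t ^ m := fun t => by
    rw [theta_add_one]
    simp [charA, hm.neg_pow]
  have hθτ : ∀ t, theta τ 0 (t + τ) ^ m = exp (-Real.pi * I * (τ + 2 * t)) ^ m * theta τ 0 t ^ m :=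
    fun t => by
      rw [theta_add_tau]
      simp only [charB, Matrix.cons_val_zero, neg_mul, one_mul, hm.neg_pow, mul_pow]
  have hθ : ∀ᶠ K : ℕ in atTop, theta τ 0 (K * η) ^ m ≠ 0 := by
    filter_upwards [eventually_ge_atTop 1] with K hK
    refine pow_ne_zero _ ?_
    simpa using theta_int_mul_ne_zero hτ hη K (by omega)
  have hdiv1 : ∀ {X : ℂ → ℂ}, EqM (fun t => X (t + 1)) X →
      EqM (fun t => X (t + 1) / theta τ 0 (t + 1) ^ m) fun t => X t / theta τ 0 t ^ m := by
    intro X hX z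
    filter_upwards [hX z] with t ht
    rw [ht, hθ1]
  have hdivτ : ∀ {X Y : ℂ → ℂ},
      EqM (fun t => X (t + τ)) (fun t => exp (-Real.pi * I * (τ + 2 * t)) ^ m * (X t + Y t)) →
      EqM (fun t => X (t + τ) / theta τ 0 (t + τ) ^ m)
        fun t => X t / theta τ 0 t ^ m + Y t / theta τ 0 t ^ m := by
    intro X Y hX z
    filter_upwards [hX z] with t ht
    rw [ht, hθτ, mul_div_mul_left _ _ (pow_ne_zero _ (exp_ne_zero _)), add_div]
  have hYC : ∀ {X : List (Fin 4) → ℂ → ℂ}, (∀ w, w.length = m →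
      EqM (fun t => X (w.map permB) (t + τ / 2)) fun t => multB τ w t * X w t) →
      EqM (fun t => X w (t + τ)) fun t => exp (-Real.pi * I * (τ + 2 * t)) ^ m * (X w t + 0) := by
    intro X hX
    refine eqM_add_tau_of_permB hm (X := X) (Y := fun _ _ => 0) ?_ ?_ hw hn.2
    · intro v hv
      simpa using hX v hv
    · intro v hv
      simpa using EqM.refl _
  have key := HasTraceForm.eqM hτ hη hm hF
    (β := fun t => B w t / theta τ 0 t ^ m) (γ := fun t => η * C w t / theta τ 0 t ^ m)
    (δ := fun t => D w t / theta τ 0 t ^ m)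
    ((hfam.meroB w).div mθ) (((Meromorphic.const η).mul (hfam.meroC w)).div mθ)
    ((hfam.meroD w).div mθ)
    (hdiv1 (eqM_add_one_of_permA hm hfam.permA_B hw hn.1))
    (hdivτ (eqM_add_tau_of_permB hm hfam.permB_B hfam.permB_D hw hn.2))
    (hdiv1 (X := fun t => η * C w t) fun z => by
      filter_upwards [eqM_add_one_of_permA hm hfam.permA_C hw hn.1 z] with t ht
      rw [ht])
    ((hdivτ (X := fun t => η * C w t) (Y := 0) fun z => by
      filter_upwards [hYC hfam.permB_C z] with t ht
      rw [ht, Pi.zero_apply]; ring).trans (EqM.of_eq fun t => by simp))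
    (hdiv1 (eqM_add_one_of_permA hm hfam.permA_D hw hn.1))
    ((hdivτ (Y := 0) (hYC hfam.permB_D)).trans (EqM.of_eq fun t => by simp))
    (by
      filter_upwards [ha, hθ] with K ⟨a, b, c⟩ hK
      have hθa : AnalyticAt ℂ (fun t => theta τ 0 t ^ m) (K * η) :=
        Differentiable.analyticAt (by fun_prop) _
      exact ⟨a.div hθa hK, (analyticAt_const.mul b).div hθa hK, c.div hθa hK⟩)
    (by
      filter_upwards [h, hθ] with K h hK
      rw [h]
      field_simp)
  refine key.trans fun z => ?_
  filter_upwards [eventually_theta_ne_zero hτ z] with t ht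
  have := pow_ne_zero m ht
  field_simp

end Decomposition

end EightVertex

end

noncomputable section
namespace EightVertex
open Filter Topology Function

/-! ### The decomposition of the interpolated traces -/

section TraceLaws

variable {τ η : ℂ}

/-- All ingredients of the interpolated trace are functions of t evaluated at Kη: expansion
coefficients, telescoped sums of θ₁'/θ₁, and boundary terms. The one explicit K multiplies the
constant term of the expansion and accounts for C. The base point y is generic and fixed once for
all words. -/
lemma exists_halfPeriodFamily (hτ : 0 < τ.im) (hη : ∀ a b : ℚ, η ≠ a + b * τ) {m : ℕ}
    (hm : Even m) :
    ∃ B C D : List (Fin 4) → ℂ → ℂ, HalfPeriodFamily τ m B C D ∧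
      (∀ w, ¬ Neutral w → B w = 0 ∧ C w = 0) ∧
      ∃ y, Generic τ η y ∧ ∀ w, w.length = m → Neutral w →
        (∀ K : ℕ, AnalyticAt ℂ (B w) (K * η) ∧ AnalyticAt ℂ (C w) (K * η) ∧
          AnalyticAt ℂ (D w) (K * η)) ∧
        ∀ K : ℕ, m ≤ K → traceSum τ η w K y = B w (K * η) + K * η * C w (K * η) := by
  classical
  have hη0 : η ≠ 0 := by simpa using hη 0 0
  have hη2 := theta_two_int_mul_ne_zero hτ hη
  obtain ⟨y, hy⟩ := exists_generic (η := η) hτ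
  have hy' : Generic τ η (2 * η - y) := by simpa using hy.neg_add 2
  obtain ⟨r, rd, rA, rB, re⟩ := exists_wordCoeff_expansion_family hτ hη2 m
  let Z : ℕ → ℂ → ℂ := fun p t => zetaSum τ η p (2 * y + 2 * t) - zetaSum τ η p (2 * y - 2 * t)
  let bd : List (Fin 4) → ℕ → ℕ → ℂ → ℂ := fun w s i t =>
    boundaryTerm τ η w s i y t + boundaryTerm τ η w s i (2 * η - y) t
  let B₀ : List (Fin 4) → ℂ → ℂ := fun w t => ∑ p ∈ Finset.Icc 1 m, r p w t * Z p t +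
    ∑ s ∈ Finset.Icc 1 m, ∑ i ∈ Finset.range s, bd w s i t
  -- The factor -8πi is twice the half-period increment -4πi p of Z_p, because B is to jump by D/2.
  let D₀ : List (Fin 4) → ℂ → ℂ := fun w t => -8 * Real.pi * I * ∑ p ∈ Finset.Icc 1 m, p * r p w t
  have hZm : ∀ p, Meromorphic (Z p) := fun p =>
    (meromorphic_zetaSum hτ p (v := fun t => 2 * y + 2 * t) (by fun_prop)).sub
      (meromorphic_zetaSum hτ p (v := fun t => 2 * y - 2 * t) (by fun_prop))
  have hrm : ∀ p w, Meromorphic (r p w) := fun p w => meromorphic_of_differentiable (rd p w)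
  have hB₀m : ∀ w, Meromorphic (B₀ w) := fun w =>
    (Meromorphic.fun_sum fun p _ => (hrm p w).mul (hZm p)).add
      (Meromorphic.fun_sum fun s _ => Meromorphic.fun_sum fun i _ =>
        (meromorphic_boundaryTerm hτ w s i y).add (meromorphic_boundaryTerm hτ w s i _))
  have hD₀m : ∀ w, Differentiable ℂ (D₀ w) := fun w =>
    (differentiable_const _).mul (Differentiable.fun_sum fun p _ =>
      (differentiable_const _).mul (rd p w))
  have hZ1 : ∀ p t, Z p (t + 1 / 2) = Z p t := by
    intro p t
    have := zetaSum_add_one (τ := τ) (η := η) p (2 * y - 2 * (t + 1 / 2))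
    rw [show 2 * y - 2 * (t + 1 / 2) + 1 = 2 * y - 2 * t by ring] at this
    simp only [Z]
    rw [← this, show 2 * y + 2 * (t + 1 / 2) = 2 * y + 2 * t + 1 by ring, zetaSum_add_one]
  -- The arguments 2y ± 2t move by ±τ, and each of the two sums of p terms contributes -2πi p.
  have hZτ : ∀ p, EqM (fun t => Z p (t + τ / 2)) fun t => Z p t - 4 * Real.pi * I * p := by
    intro p z
    have h1 := (eventually_all_finset (Finset.range p) (l := 𝓝[≠] z)
      (p := fun n t => theta τ 0 (2 * t + (2 * y - 2 * p * η + 4 * n * η)) ≠ 0)).2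
      fun n _ => eventually_theta_affine_ne_zero hτ two_ne_zero _ z
    have h2 := (eventually_all_finset (Finset.range p) (l := 𝓝[≠] z)
      (p := fun n t => theta τ 0 (-2 * t + (2 * y - τ - 2 * p * η + 4 * n * η)) ≠ 0)).2
      fun n _ => eventually_theta_affine_ne_zero hτ (by norm_num) _ z
    filter_upwards [h1, h2] with t h1 h2
    have e1 := zetaSum_add_tau (η := η) (p := p) hτ (x := 2 * y + 2 * t) fun n hn => by
      rw [show 2 * y + 2 * t - 2 * p * η + 4 * n * η = 2 * t + (2 * y - 2 * p * η + 4 * n * η) by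
        ring]
      exact h1 n hn
    have e2 := zetaSum_add_tau (η := η) (p := p) hτ (x := 2 * y - 2 * (t + τ / 2)) fun n hn => by
      rw [show 2 * y - 2 * (t + τ / 2) - 2 * p * η + 4 * n * η =
        -2 * t + (2 * y - τ - 2 * p * η + 4 * n * η) by ring]
      exact h2 n hn
    rw [show 2 * y - 2 * (t + τ / 2) + τ = 2 * y - 2 * t by ring] at e2
    simp only [Z]
    rw [show 2 * y + 2 * (t + τ / 2) = 2 * y + 2 * t + τ by ring, e1, e2]
    ring
  have hB₀A : ∀ w, w.length = m → Neutral w → ∀ t,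
      B₀ (w.map permA) (t + 1 / 2) = wordProd sgnA w * B₀ w t := by
    intro w _ hw t
    simp only [B₀, bd, rA, hZ1, boundaryTerm_permA hw.1, mul_add, Finset.mul_sum, mul_assoc]
  have rB' : ∀ p w t, r p (w.map permB) (t + τ / 2) = multB τ w t * r p w t := rB
  have hB₀B : ∀ w, w.length = m → Neutral w →
      EqM (fun t => B₀ (w.map permB) (t + τ / 2))
        fun t => multB τ w t * (B₀ w t + 1 / 2 * D₀ w t) := by
    intro w _ hw z
    have h1 := (eventually_all_finset (Finset.Icc 1 m) (l := 𝓝[≠] z)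
      (p := fun p t => Z p (t + τ / 2) = Z p t - 4 * Real.pi * I * p)).2 fun p _ => hZτ p z
    filter_upwards [h1] with t ht
    have hb : ∑ s ∈ Finset.Icc 1 m, ∑ i ∈ Finset.range s, bd (w.map permB) s i (t + τ / 2) =
        multB τ w t * ∑ s ∈ Finset.Icc 1 m, ∑ i ∈ Finset.range s, bd w s i t := by
      simp only [bd, boundaryTerm_permB hw.2, Finset.mul_sum, mul_add, multB]
    have hr : ∑ p ∈ Finset.Icc 1 m, r p (w.map permB) (t + τ / 2) * Z p (t + τ / 2) =
        multB τ w t * ∑ p ∈ Finset.Icc 1 m, r p w t * Z p t +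
          multB τ w t * (-4 * Real.pi * I * ∑ p ∈ Finset.Icc 1 m, p * r p w t) := by
      simp only [Finset.mul_sum]
      rw [← Finset.sum_add_distrib]
      refine Finset.sum_congr rfl fun p hp => ?_
      rw [ht p hp, rB']
      ring
    simp only [B₀, D₀]
    rw [hb, hr]
    ring
  -- The functions are extended by zero to words that are not neutral; this respects the laws
  -- because `permA` and `permB` preserve neutrality.
  have hite : ∀ (X : List (Fin 4) → ℂ → ℂ) (w : List (Fin 4)), Neutral w →
      (fun v => if Neutral v then X v else 0) w = X w := fun X w hw => if_pos hw
  have hite' : ∀ (X : List (Fin 4) → ℂ → ℂ) (w : List (Fin 4)), ¬ Neutral w →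
      (fun v => if Neutral v then X v else 0) w = 0 := fun X w hw => if_neg hw
  have mite : ∀ X : List (Fin 4) → ℂ → ℂ, (∀ w, Meromorphic (X w)) →
      ∀ w, Meromorphic ((fun v => if Neutral v then X v else 0) w) := by
    intro X hX w
    by_cases hw : Neutral w
    · rw [hite X w hw]; exact hX w
    · rw [hite' X w hw]; exact Meromorphic.const 0
  have Aite : ∀ X : List (Fin 4) → ℂ → ℂ, (∀ w, w.length = m → Neutral w → ∀ t,
      X (w.map permA) (t + 1 / 2) = wordProd sgnA w * X w t) → ∀ w, w.length = m →
      EqM (fun t => (fun v => if Neutral v then X v else 0) (w.map permA) (t + 1 / 2))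
        fun t => wordProd sgnA w * (fun v => if Neutral v then X v else 0) w t := by
    intro X hX w hwm
    have hwe : Even w.length := hwm ▸ hm
    by_cases hw : Neutral w
    · rw [hite X w hw, hite X _ ((neutral_permA hwe).2 hw)]
      exact EqM.of_eq (hX w hwm hw)
    · rw [hite' X w hw, hite' X _ (fun h => hw ((neutral_permA hwe).1 h))]
      exact EqM.of_eq fun t => by simp
  refine ⟨fun w => if Neutral w then B₀ w else 0,
    fun w => if Neutral w then (fun t => r 0 w t / η) else 0, fun w => if Neutral w then D₀ w else 0,
    ⟨mite B₀ hB₀m, mite _ fun w => (hrm 0 w).div (Meromorphic.const η),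
      mite D₀ fun w => meromorphic_of_differentiable (hD₀m w), Aite B₀ hB₀A, ?_, ?_, ?_, ?_, ?_⟩,
    fun w hw => ⟨if_neg hw, if_neg hw⟩, y, hy, fun w hwm hw => ?_⟩
  · refine Aite (fun w t => r 0 w t / η) fun w _ _ t => ?_
    rw [rA, mul_div_assoc]
  · refine Aite D₀ fun w _ _ t => ?_
    simp only [D₀, rA, Finset.mul_sum]
    exact Finset.sum_congr rfl fun p _ => by ring
  · intro w hwm
    have hwe : Even w.length := hwm ▸ hm
    by_cases hw : Neutral w
    · simp only [if_pos hw, if_pos ((neutral_permB hwe).2 hw)]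
      exact hB₀B w hwm hw
    · simp only [if_neg hw, if_neg (fun h => hw ((neutral_permB hwe).1 h))]
      exact EqM.of_eq fun t => by simp
  · intro w hwm
    have hwe : Even w.length := hwm ▸ hm
    by_cases hw : Neutral w
    · simp only [if_pos hw, if_pos ((neutral_permB hwe).2 hw)]
      exact EqM.of_eq fun t => by rw [rB', mul_div_assoc]
    · simp only [if_neg hw, if_neg (fun h => hw ((neutral_permB hwe).1 h))]
      exact EqM.of_eq fun t => by simp
  · intro w hwm
    have hwe : Even w.length := hwm ▸ hm
    by_cases hw : Neutral w
    · simp only [if_pos hw, if_pos ((neutral_permB hwe).2 hw)]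
      refine EqM.of_eq fun t => ?_
      simp only [D₀, rB', Finset.mul_sum]
      exact Finset.sum_congr rfl fun p _ => by ring
    · simp only [if_neg hw, if_neg (fun h => hw ((neutral_permB hwe).1 h))]
      exact EqM.of_eq fun t => by simp
  · simp only [if_pos hw]
    refine ⟨fun K => ⟨?_, ((rd 0 w).analyticAt _).div_const, (hD₀m w).analyticAt _⟩,
      fun K hK => ?_⟩
    · refine (Finset.analyticAt_fun_sum _ fun p _ => ((rd p w).analyticAt _).mul ?_).add
        (Finset.analyticAt_fun_sum _ fun s _ => Finset.analyticAt_fun_sum _ fun i _ =>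
          (analyticAt_boundaryTerm hτ w s i hy K).add (analyticAt_boundaryTerm hτ w s i hy' K))
      refine (analyticAt_zetaSum hτ p (v := fun t => 2 * y + 2 * t) (by fun_prop) fun n => ?_).sub
        (analyticAt_zetaSum hτ p (v := fun t => 2 * y - 2 * t) (by fun_prop) fun n => ?_)
      · have := hy (K + n)
        push_cast at this
        rwa [show 2 * y + 2 * (K * η) + 2 * n * η = 2 * (y + (K + n) * η) by ring]
      · have := hy (-K + n)
        push_cast at this
        rwa [show 2 * y - 2 * (K * η) + 2 * n * η = 2 * (y + (-K + n) * η) by ring]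
    · rw [traceSum_eq hη2 (hwm ▸ hm) hy (hwm ▸ hK), hwm]
      simp only [B₀, bd]
      rw [add_right_comm]
      congr 1
      -- The expansion is inserted at every node. The constant term is summed K times, which is K η
      -- · r₀/η.
      rw [Finset.sum_congr rfl fun l _ => re w hwm hw.1 hw.2 (K * η) _ (hy.node K l),
        Finset.sum_add_distrib, Finset.sum_const, Finset.card_range, Finset.sum_comm, add_comm,
        nsmul_eq_mul]
      congr 1
      · refine Finset.sum_congr rfl fun p _ => ?_
        rw [← Finset.mul_sum, sum_zetaDiff]
      · field_simp

end TraceLaws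

end EightVertex

end

noncomputable section
namespace EightVertex
open Filter Topology Function

/-! ### The functional `Tr` on words of even length -/

section TraceFunctional

variable {τ η : ℂ}

lemma wordGen_mem_homogeneous (w : List (Fin 4)) :
    wordGen τ η w ∈ homogeneous τ η w.length := by
  induction w with
  | nil =>
    simp only [wordGen, homogeneous, List.map_nil, List.prod_nil, List.length_nil, pow_zero,
      Submodule.mem_one]
    exact ⟨1, map_one _⟩
  | cons α w ih =>
    rw [show wordGen τ η (α :: w) = gen τ η α * wordGen τ η w by simp [wordGen], homogeneous,
      List.length_cons, pow_succ']
    exact Submodule.mul_mem_mul (Submodule.subset_span ⟨α, rfl⟩) ih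

lemma exists_const_of_elliptic (hτ : 0 < τ.im) {f g : ℂ → ℂ} (hf : Differentiable ℂ f)
    (hg1 : ∀ t, g (t + 1) = g t) (hgτ : ∀ t, g (t + τ) = g t) (hfg : EqM f g) :
    ∃ c, ∀ t, f t = c := by
  have h : ∀ c, (∀ t, g (t + c) = g t) → EqM (fun t => f (t + c)) f := fun c hc =>
    (hfg.comp_add c).trans ((EqM.of_eq hc).trans hfg.symm)
  obtain ⟨c, hc⟩ := exists_eqM_const hτ (meromorphic_of_differentiable hf)
    (fun z => (hf.analyticAt z).meromorphicOrderAt_nonneg) (h 1 hg1) (h τ hgτ)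
  exact ⟨c, fun t => congrFun (hc.eq_of_continuous hf.continuous continuous_const) t⟩

/-- A function of trace form of degree zero is affine. -/
lemma HasTraceForm.affine (hτ : 0 < τ.im) {F : ℂ → ℂ}
    (hF : HasTraceForm τ η 0 F) (hd : Differentiable ℂ F) :
    ∃ a b, ∀ t, F (t / η) = a * t + b := by
  obtain ⟨g₁, g₂, -, h11, ⟨-, h21, h2τ⟩, ⟨-, h31, h3τ⟩, hg⟩ := hF.2 Even.zero
  simp only [pow_zero, one_mul] at hg
  beta_reduce at h31 h3τ
  have hfd : Differentiable ℂ fun t => F (t / η) := hd.comp (by fun_prop)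
  have hθ : ∀ c z, ∀ᶠ t in 𝓝[≠] z, theta τ 0 (t + c) ≠ 0 := fun c z => by
    simpa using eventually_theta_affine_ne_zero hτ one_ne_zero c z
  -- The increments of F(t/η) under 1 and τ are entire, and they agree with elliptic functions off
  -- the zeros of θ₁. So both are constants, and F is affine.
  obtain ⟨c, hc⟩ := exists_const_of_elliptic hτ (f := fun t => F ((t + 1) / η) - F (t / η))
    (g := fun t => -(1 / η) * g₂ t) (by fun_prop) (fun t => by rw [h21]) (fun t => by rw [h2τ])
    (fun z => by
      filter_upwards [hθ 0 z, hθ 1 z] with t ht ht1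
      rw [add_zero] at ht
      rw [hg _ ht, hg _ ht1, h11, h21]
      ring)
  obtain ⟨d, hd'⟩ := exists_const_of_elliptic hτ (f := fun t => F ((t + τ) / η) - F (t / η))
    (g := fun t => (g₁ (t + τ) - g₁ t) - τ / η * g₂ t) (by fun_prop)
    (fun t => by rw [h31, h21]) (fun t => by rw [h3τ, h2τ])
    (fun z => by
      filter_upwards [hθ 0 z, hθ τ z] with t ht htτ
      rw [add_zero] at ht
      rw [hg _ ht, hg _ htτ, h2τ]
      ring)
  obtain ⟨b, hb, -⟩ := exists_affine_of_add_const hτ hfd (c₁ := c) (c₂ := d)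
    (fun t => by linear_combination hc t) (fun t => by linear_combination hd' t)
  exact ⟨c, b, hb⟩

/-- Either all representations `π^{(k)}` exist, or none of them. -/
lemma seriesA_dichotomy (hτ : 0 < τ.im) (hη : ∀ a b : ℚ, η ≠ a + b * τ)
    {T : Sklyanin τ η →ₗ[ℂ] (ℂ → ℂ)} (hT : IsTraceFunctional τ η T) :
    (∀ k, ∃ φ, IsSeriesA τ η k φ) ∨ ∀ k, ¬ ∃ φ, IsSeriesA τ η k φ := by
  have hη0 : η ≠ 0 := by simpa using hη 0 0
  obtain ⟨y, hy⟩ := exists_generic (η := η) hτ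
  -- The unit has degree zero, so Tr_λ 1 is affine in λ. At λ = k + 1 its value is the dimension k +
  -- 1 if π^{(k)} exists and the default 0 otherwise. An affine function that follows one of these
  -- alternatives at two points follows it everywhere, and the two never agree.
  obtain ⟨a, b, hab⟩ := (hT.2.2 0 1 (wordGen_mem_homogeneous [])).affine hτ (hT.1 1)
  have hv : ∀ k : ℕ, repTrace τ η k 1 = a * η * (k + 1) + b := by
    intro k
    rw [← hT.2.1, ← mul_div_cancel_right₀ ((k : ℂ) + 1) hη0, hab]
    ring_nf
    field_simp
  have h1 : ∀ k, (∃ φ, IsSeriesA τ η k φ) → a * η * (k + 1) + b = k + 1 := by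
    intro k hk
    rw [← hv, show (1 : Sklyanin τ η) = wordGen τ η [] by simp [wordGen],
      repTrace_wordGen hτ (theta_two_int_mul_ne_zero hτ hη) hk hy]
    have hs : ∀ l ∈ Finset.range (k + 1), wordOp τ η [] ((k + 1 : ℕ) * η) (node η (k + 1) y l)
        (fun j => lagrange τ (k + 1) (node η (k + 1) y) l (node η (k + 1) y l + j * η)) = 1 := by
      intro l hl
      rw [wordOp_nil, Int.cast_zero, zero_mul, add_zero]
      exact lagrange_self (genericPoints_node (theta_two_int_mul_ne_zero hτ hη) hy _)
        (Finset.mem_range.1 hl)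
    rw [traceSum, Finset.sum_congr rfl hs]
    simp [wordNorm]
  have h0 : ∀ k, (¬ ∃ φ, IsSeriesA τ η k φ) → a * η * (k + 1) + b = 0 := by
    intro k hk
    rw [← hv, repTrace, dif_neg hk]
  have hk0 : ∀ k : ℕ, (k : ℂ) + 1 ≠ 0 := fun k => by exact_mod_cast Nat.succ_ne_zero k
  have all : ∀ k l : ℕ, k ≠ l → (∃ φ, IsSeriesA τ η k φ) → (∃ φ, IsSeriesA τ η l φ) →
      ∀ n, ∃ φ, IsSeriesA τ η n φ := by
    intro k l hkl hk hl n
    by_contra hn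
    have e1 := h1 k hk
    have e2 := h1 l hl
    have e3 := h0 n hn
    have hkl' : (k : ℂ) - l ≠ 0 := sub_ne_zero.2 (Nat.cast_injective.ne hkl)
    have ha : a * η = 1 := by
      have : (a * η - 1) * ((k : ℂ) - l) = 0 := by linear_combination e1 - e2
      exact sub_eq_zero.1 ((mul_eq_zero.1 this).resolve_right hkl')
    rw [ha] at e1 e3
    exact hk0 n (by linear_combination e3 - e1)
  have none : ∀ k l : ℕ, k ≠ l → (¬ ∃ φ, IsSeriesA τ η k φ) → (¬ ∃ φ, IsSeriesA τ η l φ) →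
      ∀ n, ¬ ∃ φ, IsSeriesA τ η n φ := by
    intro k l hkl hk hl n hn
    have e1 := h0 k hk
    have e2 := h0 l hl
    have e3 := h1 n hn
    have hkl' : (k : ℂ) - l ≠ 0 := sub_ne_zero.2 (Nat.cast_injective.ne hkl)
    have ha : a * η = 0 := by
      have : (a * η) * ((k : ℂ) - l) = 0 := by linear_combination e1 - e2
      exact (mul_eq_zero.1 this).resolve_right hkl'
    rw [ha] at e1 e3
    exact hk0 n (by linear_combination e1 - e3)
  -- Among k = 0, 1, 2 two have the same status, and they decide for all k.
  by_cases c0 : ∃ φ, IsSeriesA τ η 0 φ <;> by_cases c1 : ∃ φ, IsSeriesA τ η 1 φ <;>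
    by_cases c2 : ∃ φ, IsSeriesA τ η 2 φ
  · exact Or.inl (all 0 1 (by decide) c0 c1)
  · exact Or.inl (all 0 1 (by decide) c0 c1)
  · exact Or.inl (all 0 2 (by decide) c0 c2)
  · exact Or.inr (none 1 2 (by decide) c1 c2)
  · exact Or.inl (all 1 2 (by decide) c1 c2)
  · exact Or.inr (none 0 2 (by decide) c0 c2)
  · exact Or.inr (none 0 1 (by decide) c0 c1)
  · exact Or.inr (none 0 1 (by decide) c0 c1)

lemma Generic.add_half {y : ℂ} (h : Generic τ η y) : Generic τ η (y + 1 / 2) := by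
  intro n
  rw [show 2 * (y + 1 / 2 + n * η) = 2 * (y + n * η) + 1 by ring, theta_add_one]
  simpa [charA] using h n

lemma Generic.add_half_tau {y : ℂ} (h : Generic τ η y) : Generic τ η (y + τ / 2) := by
  intro n
  rw [show 2 * (y + τ / 2 + n * η) = 2 * (y + n * η) + τ by ring, theta_add_tau]
  simpa [charB] using h n

/-- The trace of a word vanishes if the word is not neutral. -/
lemma repTrace_eq_zero (hτ : 0 < τ.im) (hη : ∀ a b : ℚ, η ≠ a + b * τ) {k : ℕ}
    (hφ : ∃ φ, IsSeriesA τ η k φ) {w : List (Fin 4)} (hw : ¬ Neutral w) :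
    repTrace τ η k (wordGen τ η w) = 0 := by
  have hη2 := theta_two_int_mul_ne_zero hτ hη
  obtain ⟨y, hy⟩ := exists_generic (η := η) hτ
  have e0 := repTrace_wordGen hτ hη2 hφ hy w
  -- The same trace is computed with the nodes moved by a half period, which multiplies the sum by a
  -- character. A nonzero trace makes both characters trivial.
  have e1 := repTrace_wordGen hτ hη2 hφ hy.add_half w
  have e2 := repTrace_wordGen hτ hη2 hφ hy.add_half_tau w
  rw [traceSum_add_half, mul_left_comm, ← e0] at e1
  rw [traceSum_add_half_tau, mul_left_comm, ← e0] at e2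
  by_contra h
  exact hw ⟨mul_right_cancel₀ h (by rw [one_mul]; exact e1.symm),
    mul_right_cancel₀ h (by rw [one_mul]; exact e2.symm)⟩

/-- Each theta function is a half-period translate of θ₁ up to nonvanishing factors, so a zero at η
would give η ∈ ℚ + ℚτ. -/
lemma theta_eta_ne_zero (hτ : 0 < τ.im) (hη : ∀ a b : ℚ, η ≠ a + b * τ) (α : Fin 4) :
    theta τ α η ≠ 0 := by
  have key : ∀ a b : ℚ, theta τ 0 (η + (a + b * τ)) ≠ 0 := by
    intro a b
    refine theta_ne_zero hτ fun c d h => hη (c - a) (d - b) ?_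
    push_cast
    linear_combination h
  have hA : ∀ z : ℂ, theta τ 0 (z + 1 / 2) ≠ 0 → theta τ 1 z ≠ 0 := by
    intro z h h0
    have := theta_add_half τ 0 z
    rw [show permA 0 = 1 from rfl, h0, mul_zero] at this
    exact h this
  have hB : ∀ z : ℂ, theta τ 0 (z + τ / 2) ≠ 0 → theta τ 3 z ≠ 0 := by
    intro z h h0
    have := theta_add_half_tau τ 0 z
    rw [show permB 0 = 3 from rfl, h0, mul_zero] at this
    exact h this
  fin_cases α
  · simpa using key 0 0
  · refine hA η ?_
    have := key (1 / 2) 0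
    push_cast at this
    simpa using this
  · intro h0
    have h1 := theta_add_half_tau τ 1 η
    rw [show permB 1 = 2 from rfl] at h1
    have h0' : theta τ 2 η = 0 := h0
    rw [h0', mul_zero] at h1
    refine hA (η + τ / 2) ?_ h1
    have := key (1 / 2) (1 / 2)
    push_cast at this
    rwa [show η + τ / 2 + 1 / 2 = η + (1 / 2 + 1 / 2 * τ) by ring]
  · refine hB η ?_
    have := key 0 (1 / 2)
    push_cast at this
    rwa [show η + τ / 2 = η + (0 + 1 / 2 * τ) by ring]

lemma wordNorm_ne_zero (hτ : 0 < τ.im) (hη : ∀ a b : ℚ, η ≠ a + b * τ) (w : List (Fin 4)) :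
    wordNorm τ η w ≠ 0 := by
  refine wordProd_ne_zero (fun α => ?_) w
  have h2 : theta τ 0 (2 * η) ≠ 0 := by simpa using theta_two_int_mul_ne_zero hτ hη 1 one_ne_zero
  refine div_ne_zero (mul_ne_zero ?_ (theta_eta_ne_zero hτ hη α)) h2
  unfold sqrtEps
  split_ifs <;> simp

lemma halfPeriodFamily_zero (m : ℕ) :
    HalfPeriodFamily τ m (fun _ _ => 0) (fun _ _ => 0) fun _ _ => 0 := by
  have h0 : Meromorphic fun _ : ℂ => (0 : ℂ) := Meromorphic.const 0
  constructor
  iterate 3 exact fun _ => h0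
  all_goals exact fun _ _ => EqM.of_eq fun _ => by simp

/-- The values at large integers are traces, known from interpolation, and a function of trace form
is determined by them. The zero family serves the degenerate cases. -/
lemma exists_eqM_Tr (hτ : 0 < τ.im) (hη : ∀ a b : ℚ, η ≠ a + b * τ) {m : ℕ} (hm : Even m) :
    ∃ B C D, HalfPeriodFamily τ m B C D ∧ ∀ w, w.length = m →
      EqM (fun t => (wordNorm τ η w)⁻¹ * Tr τ η (wordGen τ η w) (t / η))
        (fun t => B w t + t * C w t) ∧
      (¬ Neutral w → B w = 0 ∧ C w = 0) := by
  -- Without such a functional, `Tr` is zero by definition and the zero family represents it.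
  by_cases hT : ∃ T, IsTraceFunctional τ η T
  swap
  · refine ⟨_, _, _, halfPeriodFamily_zero m, fun w _ => ⟨EqM.of_eq fun t => ?_, fun _ => ⟨rfl, rfl⟩⟩⟩
    rw [Tr, dif_neg hT]
    simp
  have hTr : IsTraceFunctional τ η (Tr τ η) := by
    rw [Tr, dif_pos hT]; exact hT.choose_spec
  have hform : ∀ w : List (Fin 4), w.length = m →
      HasTraceForm τ η m fun z => (wordNorm τ η w)⁻¹ * Tr τ η (wordGen τ η w) z := by
    intro w hw
    have := hTr.2.2 m ((wordNorm τ η w)⁻¹ • wordGen τ η w)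
      (Submodule.smul_mem _ _ (hw ▸ wordGen_mem_homogeneous w))
    rwa [map_smul] at this
  have hval : ∀ (w : List (Fin 4)), ∀ K : ℕ, 1 ≤ K →
      Tr τ η (wordGen τ η w) K = repTrace τ η (K - 1) (wordGen τ η w) := by
    intro w K hK
    rw [← hTr.2.1, Nat.cast_sub hK]
    simp
  have hzero : ∀ w : List (Fin 4), w.length = m →
      (∀ k, repTrace τ η k (wordGen τ η w) = 0) →
      EqM (fun t => (wordNorm τ η w)⁻¹ * Tr τ η (wordGen τ η w) (t / η)) fun _ => 0 := by
    intro w hw h0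
    have h00 : Meromorphic fun _ : ℂ => (0 : ℂ) := Meromorphic.const 0
    refine ((hform w hw).eqM hτ hη hm (β := fun _ => 0) (γ := fun _ => 0) (δ := fun _ => 0)
      h00 h00 h00 (EqM.refl _) (EqM.of_eq fun _ => by simp) (EqM.refl _) (EqM.refl _) (EqM.refl _)
      (EqM.refl _) (Eventually.of_forall fun K =>
        ⟨analyticAt_const, analyticAt_const, analyticAt_const⟩) ?_).trans
      (EqM.of_eq fun _ => by simp)
    filter_upwards [eventually_ge_atTop 1] with K hK
    rw [hval w K hK, h0]
    simp
  -- If no representation exists, every `repTrace` has the default value 0, and uniqueness makes the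
  -- functional vanish on words of length m.
  rcases seriesA_dichotomy hτ hη hTr with hφ | hφ
  · obtain ⟨B, C, D, hfam, hnn, y, hy, hB⟩ := exists_halfPeriodFamily hτ hη hm
    refine ⟨B, C, D, hfam, fun w hw => ⟨?_, hnn w⟩⟩
    by_cases hn : Neutral w
    · obtain ⟨ha, ht⟩ := hB w hw hn
      refine (hform w hw).eqM_family hτ hη hm hfam hw hn (Eventually.of_forall ha) ?_
      filter_upwards [eventually_ge_atTop (max m 1)] with K hK
      have hK1 : 1 ≤ K := (le_max_right _ _).trans hK
      rw [hval w K hK1, repTrace_wordGen hτ (theta_two_int_mul_ne_zero hτ hη) (hφ _) hy,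
        inv_mul_cancel_left₀ (wordNorm_ne_zero hτ hη w), Nat.sub_add_cancel hK1,
        ht K ((le_max_left _ _).trans hK)]
    · rw [(hnn w hn).1, (hnn w hn).2]
      refine (hzero w hw fun k => repTrace_eq_zero hτ hη (hφ k) hn).trans (EqM.of_eq fun t => ?_)
      simp
  · refine ⟨_, _, _, halfPeriodFamily_zero m, fun w hw => ⟨(hzero w hw fun k => ?_).trans
      (EqM.of_eq fun t => by simp), fun _ => ⟨rfl, rfl⟩⟩⟩
    rw [repTrace, dif_neg (hφ k)]

lemma charA_wordProd_sq (w : List (Fin 4)) : wordProd charA w * wordProd charA w = 1 := by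
  rw [wordProd_mul, funext charA_sq]
  simp [wordProd]

lemma differentiable_Tr (A : Sklyanin τ η) : Differentiable ℂ (Tr τ η A) := by
  by_cases hT : ∃ T, IsTraceFunctional τ η T
  · rw [Tr, dif_pos hT]; exact hT.choose_spec.1 A
  · rw [Tr, dif_neg hT]; exact differentiable_const 0

/-- The traces of words of even length: `Tr_{t/η}` of a word is a multiple of `B(t) + t C(t)`, with
entire functions that are invariant under half periods up to a jump of `B`. -/
theorem exists_entire_family (hτ : 0 < τ.im) (hη : ∀ a b : ℚ, η ≠ a + b * τ) {m : ℕ}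
    (hm : Even m) :
    ∃ B C D : List (Fin 4) → ℂ → ℂ,
      (∀ w, Differentiable ℂ (B w)) ∧ (∀ w, Differentiable ℂ (C w)) ∧
      ∀ w, w.length = m → ∀ t,
        Tr τ η (wordGen τ η w) (t / η) = wordNorm τ η w * (B w t + t * C w t) ∧
        (B (w.map permA) (t + 1 / 2) = wordProd sgnA w * B w t ∧
        C (w.map permA) (t + 1 / 2) = wordProd sgnA w * C w t ∧
        D (w.map permA) (t + 1 / 2) = wordProd sgnA w * D w t) ∧
        B (w.map permB) (t + τ / 2) = multB τ w t * (B w t + 1 / 2 * D w t) ∧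
        C (w.map permB) (t + τ / 2) = multB τ w t * C w t ∧
        D (w.map permB) (t + τ / 2) = multB τ w t * D w t ∧
        (¬ Neutral w → B w t = 0 ∧ C w t = 0 ∧ D w t = 0) := by
  obtain ⟨B₀, C₀, D₀, hfam, hF₀⟩ := exists_eqM_Tr hτ hη hm
  have hη0 : η ≠ 0 := by simpa using hη 0 0
  set F : List (Fin 4) → ℂ → ℂ := fun w t =>
    (wordNorm τ η w)⁻¹ * Tr τ η (wordGen τ η w) (t / η) with hFdef
  have hF : ∀ w, w.length = m → EqM (F w) fun t => B₀ w t + t * C₀ w t :=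
    fun w hw => (hF₀ w hw).1
  have hFd : ∀ w, Differentiable ℂ (F w) := by
    intro w
    have := differentiable_Tr (τ := τ) (η := η) (wordGen τ η w)
    simp only [hFdef]
    fun_prop
  -- For every word, neutral or not, B₀ and C₀ have period 2, since the square of the character is
  -- 1. So both can be recovered from the entire function F by a difference with step 2, and D from
  -- B by its half-period law. This gives entire representatives of the meromorphic family.
  let C : List (Fin 4) → ℂ → ℂ := fun w t => (F w (t + 2) - F w t) / 2
  let B : List (Fin 4) → ℂ → ℂ := fun w t => F w t - t * C w t
  let D : List (Fin 4) → ℂ → ℂ := fun w t =>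
    2 * ((multB τ w t)⁻¹ * B (w.map permB) (t + τ / 2) - B w t)
  have hCd : ∀ w, Differentiable ℂ (C w) := fun w => by
    have := hFd w
    simp only [C]
    fun_prop
  have hBd : ∀ w, Differentiable ℂ (B w) := fun w => by
    have := hFd w
    have := hCd w
    simp only [B]
    fun_prop
  have hmd : ∀ w, Differentiable ℂ (multB τ w) := fun w => by
    unfold multB
    fun_prop
  have hDd : ∀ w, Differentiable ℂ (D w) := fun w => by
    have h1 := hBd w
    have h2 := hBd (w.map permB)
    have h3 : Differentiable ℂ fun t => (multB τ w t)⁻¹ := (hmd w).inv (multB_ne_zero w)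
    simp only [D]
    fun_prop
  have per2 : ∀ {X : List (Fin 4) → ℂ → ℂ}, (∀ w, w.length = m →
      EqM (fun t => X (w.map permA) (t + 1 / 2)) fun t => wordProd sgnA w * X w t) →
      ∀ w, w.length = m → EqM (fun t => X w (t + 2)) (X w) := by
    intro X hX w hw
    have h1 : EqM (fun t => X w (t + 1)) fun t => wordProd charA w * X w t := by
      intro z
      have h1 := (hX (w.map permA) (by simpa using hw)).comp_add (1 / 2) z
      filter_upwards [h1, hX w hw z] with t h1 h2
      rw [map_permA_permA] at h1
      rw [show t + 1 = t + 1 / 2 + 1 / 2 by ring, h1, h2, ← mul_assoc,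
        wordProd_sgnA_permA (hw ▸ hm)]
    intro z
    filter_upwards [h1.comp_add 1 z, h1 z] with t h2 h3
    rw [show t + 2 = t + 1 + 1 by ring, h2, h3, ← mul_assoc, charA_wordProd_sq, one_mul]
  have eC : ∀ w, w.length = m → EqM (C w) (C₀ w) := by
    intro w hw z
    filter_upwards [hF w hw z, (hF w hw).comp_add 2 z, per2 hfam.permA_B w hw z,
      per2 hfam.permA_C w hw z] with t h1 h2 h3 h4
    simp only [C]
    rw [h1, h2, h3, h4]
    ring
  have eB : ∀ w, w.length = m → EqM (B w) (B₀ w) := by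
    intro w hw z
    filter_upwards [hF w hw z, eC w hw z] with t h1 h2
    simp only [B]
    rw [h1, h2]
    ring
  have hmap : ∀ {p : Fin 4 → Fin 4} {w : List (Fin 4)}, w.length = m → (w.map p).length = m :=
    fun h => by simpa using h
  have eD : ∀ w, w.length = m → EqM (D w) (D₀ w) := by
    intro w hw z
    filter_upwards [eB w hw z, (eB (w.map permB) (hmap hw)).comp_add (τ / 2) z,
      hfam.permB_B w hw z] with t h1 h2 h3
    simp only [D]
    rw [h1, h2, h3, inv_mul_cancel_left₀ (multB_ne_zero w t)]
    ring
  -- The laws hold off a discrete set for the meromorphic family; continuity extends them to all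
  -- points for the entire representatives.
  have tr : ∀ {X X₀ : List (Fin 4) → ℂ → ℂ} {p : Fin 4 → Fin 4} {c : ℂ} {M : ℂ → ℂ},
      (∀ w, Differentiable ℂ (X w)) → (∀ w, w.length = m → EqM (X w) (X₀ w)) →
      Differentiable ℂ M → ∀ w, w.length = m →
      EqM (fun t => X₀ (w.map p) (t + c)) (fun t => M t * X₀ w t) →
      ∀ t, X (w.map p) (t + c) = M t * X w t := by
    intro X X₀ p c M hX e hM w hw h t
    have e' : EqM (fun t => X (w.map p) (t + c)) fun t => M t * X w t :=
      ((e _ (hmap hw)).comp_add c).trans (h.trans fun z => by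
        filter_upwards [e w hw z] with t ht
        rw [ht])
    have hX1 := (hX (w.map p)).continuous
    have hX2 := (hX w).continuous
    have hM' := hM.continuous
    exact congrFun (e'.eq_of_continuous (by fun_prop) (by fun_prop)) t
  refine ⟨B, C, D, hBd, hCd, fun w hw t => ⟨?_, ⟨?_, ?_, ?_⟩, ?_, ?_, ?_, fun hn => ?_⟩⟩
  · simp only [B, sub_add_cancel, hFdef]
    rw [mul_inv_cancel_left₀ (wordNorm_ne_zero hτ hη w)]
  · exact tr (M := fun _ => wordProd sgnA w) hBd eB (by fun_prop) w hw (hfam.permA_B w hw) t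
  · exact tr (M := fun _ => wordProd sgnA w) hCd eC (by fun_prop) w hw (hfam.permA_C w hw) t
  · exact tr (M := fun _ => wordProd sgnA w) hDd eD (by fun_prop) w hw (hfam.permA_D w hw) t
  · simp only [D]
    have := multB_ne_zero (τ := τ) w t
    generalize multB τ w t = M at this ⊢
    field_simp
    ring
  · exact tr hCd eC (hmd w) w hw (hfam.permB_C w hw) t
  · exact tr hDd eD (hmd w) w hw (hfam.permB_D w hw) t
  · have hX0 : ∀ {X X₀ : List (Fin 4) → ℂ → ℂ} {v : List (Fin 4)}, Differentiable ℂ (X v) →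
        EqM (X v) (X₀ v) → X₀ v = 0 → ∀ t, X v t = 0 := fun hd e h0 t =>
      congrFun ((e.trans (h0 ▸ EqM.refl _)).eq_of_continuous hd.continuous continuous_const) t
    have hB0 := hX0 (hBd w) (eB w hw) ((hF₀ w hw).2 hn).1
    have hn' : ¬ Neutral (w.map permB) := fun h => hn ((neutral_permB (hw ▸ hm)).1 h)
    refine ⟨hB0 t, hX0 (hCd w) (eC w hw) ((hF₀ w hw).2 hn).2 t, ?_⟩
    simp only [D]
    rw [hB0, hX0 (hBd (w.map permB)) (eB _ (hmap hw)) ((hF₀ _ (hmap hw)).2 hn').1]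
    simp

end TraceFunctional

end EightVertex

end

noncomputable section
namespace EightVertex

/-! ### Operators on tensor products -/

section Tensor

variable {ι : Type} [Fintype ι] [DecidableEq ι]

/-- The tensor product of operators on the components. -/
def tensorOp (A : ι → Matrix (Fin 2) (Fin 2) ℂ) : Matrix (ι → Fin 2) (ι → Fin 2) ℂ :=
  fun a b => ∏ x, A x (a x) (b x)

lemma tensorOp_mul (A B : ι → Matrix (Fin 2) (Fin 2) ℂ) :
    tensorOp A * tensorOp B = tensorOp fun x => A x * B x := by
  ext a b
  simp only [Matrix.mul_apply, tensorOp, ← Finset.prod_mul_distrib]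
  rw [Finset.prod_univ_sum]
  simp

lemma tensorOp_one : tensorOp (fun _ : ι => (1 : Matrix (Fin 2) (Fin 2) ℂ)) = 1 := by
  ext a b
  simp only [tensorOp, Matrix.one_apply]
  by_cases h : a = b
  · simp [h]
  · rw [if_neg h]
    obtain ⟨x, hx⟩ := Function.ne_iff.1 h
    exact Finset.prod_eq_zero (Finset.mem_univ x) (if_neg hx)

lemma sigma_eq_tensorOp (α : Fin 4) (x : ι) :
    sigma α x = tensorOp fun y => if y = x then pauli α else 1 := by
  ext a b
  simp only [sigma, tensorOp]
  rw [← Finset.mul_prod_erase Finset.univ _ (Finset.mem_univ x), if_pos rfl]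
  split_ifs with h
  · rw [Finset.prod_eq_one, mul_one]
    intro y hy
    rw [if_neg (Finset.ne_of_mem_erase hy), h y (Finset.ne_of_mem_erase hy), Matrix.one_apply_eq]
  · push Not at h
    obtain ⟨y, hy, hab⟩ := h
    rw [Finset.prod_eq_zero (i := y) (by simp [hy]), mul_zero]
    rw [if_neg hy, Matrix.one_apply_ne hab]

lemma perm_mul_tensorOp (x y : ι) (A : ι → Matrix (Fin 2) (Fin 2) ℂ) :
    perm x y * tensorOp A = (tensorOp fun z => A (Equiv.swap x y z)) * perm x y := by
  ext a b
  simp only [Matrix.mul_apply, perm, tensorOp, ite_mul, one_mul, zero_mul, mul_ite, mul_one,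
    mul_zero]
  have h : ∀ c : ι → Fin 2, a = c ∘ Equiv.swap x y ↔ c = a ∘ Equiv.swap x y := by
    intro c
    constructor <;> rintro rfl <;> funext z <;> simp
  simp only [h, Finset.sum_ite_eq', Finset.mem_univ, if_true]
  refine Fintype.prod_equiv (Equiv.swap x y) _ _ fun z => ?_
  simp

lemma tensorOp_smul_single (A : ι → Matrix (Fin 2) (Fin 2) ℂ) (x : ι) (c : ℂ) :
    (tensorOp fun y => if y = x then c • A y else A y) = c • tensorOp A := by
  ext a b
  simp only [tensorOp, Matrix.smul_apply, smul_eq_mul]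
  rw [← Finset.mul_prod_erase Finset.univ _ (Finset.mem_univ x),
    ← Finset.mul_prod_erase Finset.univ (fun y => A y (a y) (b y)) (Finset.mem_univ x), if_pos rfl,
    Matrix.smul_apply, smul_eq_mul, mul_assoc]
  congr 2
  refine Finset.prod_congr rfl fun y hy => ?_
  rw [if_neg (Finset.ne_of_mem_erase hy)]

lemma pauli_mul_self (α : Fin 4) : pauli α * pauli α = 1 := by
  fin_cases α <;> ext i j <;> fin_cases i <;> fin_cases j <;>
    simp [pauli, Matrix.mul_apply, Fin.sum_univ_two]

/-- The operator `σ^β` at all components in a set. -/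
def sigmaOn (β : Fin 4) (s : ι → Prop) [DecidablePred s] : Matrix (ι → Fin 2) (ι → Fin 2) ℂ :=
  tensorOp fun x => if s x then pauli β else 1

lemma sigmaOn_mul_self (β : Fin 4) (s : ι → Prop) [DecidablePred s] :
    sigmaOn β s * sigmaOn β s = 1 := by
  rw [sigmaOn, tensorOp_mul, ← tensorOp_one]
  congr 1
  funext x
  split_ifs
  · exact pauli_mul_self β
  · exact one_mul 1

lemma sigmaOn_mul (β : Fin 4) (s s' u : ι → Prop) [DecidablePred s] [DecidablePred s']
    [DecidablePred u] (h : ∀ x, u x ↔ (s x ∧ ¬ s' x ∨ ¬ s x ∧ s' x)) :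
    sigmaOn β s * sigmaOn β s' = sigmaOn β u := by
  rw [sigmaOn, sigmaOn, sigmaOn, tensorOp_mul]
  congr 1
  funext x
  have := h x
  by_cases h1 : s x <;> by_cases h2 : s' x <;> simp [h1, h2, this, pauli_mul_self]

lemma sigmaOn_congr (β : Fin 4) {s u : ι → Prop} [DecidablePred s] [DecidablePred u]
    (h : ∀ x, s x ↔ u x) : sigmaOn β s = sigmaOn β u := by
  rw [sigmaOn, sigmaOn]
  congr 1
  funext x
  simp only [h x]

lemma sigmaOn_false (β : Fin 4) {s : ι → Prop} [DecidablePred s] (h : ∀ x, ¬ s x) :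
    sigmaOn β s = 1 := by
  rw [sigmaOn, ← tensorOp_one]
  congr 1
  funext x
  rw [if_neg (h x)]

lemma sigma_eq_sigmaOn (β : Fin 4) (x : ι) : sigma β x = sigmaOn β fun y => y = x :=
  sigma_eq_tensorOp β x

lemma perm_mul_sigmaOn (β : Fin 4) (x y : ι) (s u : ι → Prop) [DecidablePred s] [DecidablePred u]
    (h : ∀ z, u z ↔ s (Equiv.swap x y z)) :
    perm x y * sigmaOn β s = sigmaOn β u * perm x y := by
  rw [sigmaOn, perm_mul_tensorOp, sigmaOn]
  congr 2
  funext z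
  simp only [h z]

/-- The sign in the commutation of `σ^β` and `σ^α`. -/
def pauliSign (β α : Fin 4) : ℂ := if β = 0 ∨ α = 0 ∨ α = β then 1 else -1

lemma pauliSign_one : pauliSign 1 = charA := by
  funext α; fin_cases α <;> simp [pauliSign, charA]

lemma pauliSign_three : pauliSign 3 = charB := by
  funext α; fin_cases α <;> simp [pauliSign, charB]

lemma pauli_mul_pauli_comm (β α : Fin 4) :
    pauli β * pauli α = pauliSign β α • (pauli α * pauli β) := by
  fin_cases β <;> fin_cases α <;> ext i j <;> fin_cases i <;> fin_cases j <;>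
    simp [pauli, pauliSign, Matrix.mul_apply, Fin.sum_univ_two]

lemma sigmaOn_mul_sigma_of_mem (β α : Fin 4) (s : ι → Prop) [DecidablePred s] {x : ι} (hx : s x) :
    sigmaOn β s * sigma α x = pauliSign β α • (sigma α x * sigmaOn β s) := by
  rw [sigma_eq_tensorOp, sigmaOn, tensorOp_mul, tensorOp_mul, ← tensorOp_smul_single _ x]
  congr 1
  funext y
  by_cases hy : y = x
  · subst hy
    simp only [if_true, hx]
    exact pauli_mul_pauli_comm β α
  · simp [hy]

lemma sigmaOn_mul_sigma_of_notMem (β α : Fin 4) (s : ι → Prop) [DecidablePred s] {x : ι}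
    (hx : ¬ s x) : sigmaOn β s * sigma α x = sigma α x * sigmaOn β s := by
  rw [sigma_eq_tensorOp, sigmaOn, tensorOp_mul, tensorOp_mul]
  congr 1
  funext y
  by_cases hy : y = x
  · subst hy
    simp [hx]
  · simp [hy]

/-- Away from x and y both sides act as the identity, and on the two factors the identity is a
comparison of 16 entries. -/
lemma perm_eq_sum {x y : ι} (hxy : x ≠ y) :
    perm x y = (1 / 2 : ℂ) • ∑ α : Fin 4, sigma α x * sigma α y := by
  ext a b
  have hs : ∀ α : Fin 4, (sigma α x * sigma α y) a b =
      pauli α (a x) (b x) * (pauli α (a y) (b y) *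
        ∏ z ∈ (Finset.univ.erase x).erase y, (1 : Matrix (Fin 2) (Fin 2) ℂ) (a z) (b z)) := by
    intro α
    rw [sigma_eq_tensorOp, sigma_eq_tensorOp, tensorOp_mul, tensorOp,
      ← Finset.mul_prod_erase Finset.univ _ (Finset.mem_univ x),
      ← Finset.mul_prod_erase (Finset.univ.erase x) _ (Finset.mem_erase.2 ⟨hxy.symm, Finset.mem_univ y⟩)]
    simp only [if_true, hxy, hxy.symm, if_false, mul_one, one_mul]
    congr 2
    refine Finset.prod_congr rfl fun z hz => ?_
    simp only [Finset.mem_erase] at hz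
    simp [hz.1, hz.2.1]
  have hp : (perm x y : Matrix (ι → Fin 2) (ι → Fin 2) ℂ) a b =
      (if a x = b y then 1 else 0) * ((if a y = b x then 1 else 0) *
        ∏ z ∈ (Finset.univ.erase x).erase y, (1 : Matrix (Fin 2) (Fin 2) ℂ) (a z) (b z)) := by
    rw [perm]
    by_cases h : a = b ∘ Equiv.swap x y
    · rw [if_pos h, Finset.prod_eq_one]
      · simp [h]
      · intro z hz
        simp only [Finset.mem_erase] at hz
        rw [h, Function.comp_apply, Equiv.swap_apply_of_ne_of_ne hz.2.1 hz.1, Matrix.one_apply_eq]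
    · rw [if_neg h]
      by_cases h1 : a x = b y
      · by_cases h2 : a y = b x
        · obtain ⟨z, hz⟩ := Function.ne_iff.1 h
          have hzx : z ≠ x := by rintro rfl; simp [h1] at hz
          have hzy : z ≠ y := by rintro rfl; simp [h2] at hz
          rw [Function.comp_apply, Equiv.swap_apply_of_ne_of_ne hzx hzy] at hz
          have h0 : ∏ z ∈ (Finset.univ.erase x).erase y,
              (1 : Matrix (Fin 2) (Fin 2) ℂ) (a z) (b z) = 0 :=
            Finset.prod_eq_zero (i := z) (by simp [hzx, hzy]) (Matrix.one_apply_ne hz)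
          rw [h0]
          simp
        · simp [h2]
      · simp [h1]
  rw [hp, Matrix.smul_apply, Matrix.sum_apply, Finset.sum_congr rfl fun α _ => hs α]
  simp only [← mul_assoc, ← Finset.sum_mul]
  rw [smul_eq_mul, ← mul_assoc]
  congr 1
  generalize a x = p
  generalize a y = q
  generalize b x = r
  generalize b y = s
  rw [Fin.sum_univ_four]
  fin_cases p <;> fin_cases q <;> fin_cases r <;> fin_cases s <;>
    simp [pauli] <;> norm_num

lemma sigma_mul_sigma_eq_tensorOp {x y : ι} (hxy : x ≠ y) (α : Fin 4) :
    sigma α x * sigma α y =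
      tensorOp fun z => if z = x then pauli α else if z = y then pauli α else 1 := by
  simp only [sigma_eq_tensorOp, tensorOp_mul]
  congr 1
  funext z
  by_cases h1 : z = x
  · subst h1
    simp [hxy]
  · simp [h1]

lemma tensorOp_pair_apply {x y : ι} (hxy : x ≠ y) (A B : Matrix (Fin 2) (Fin 2) ℂ)
    (a b : ι → Fin 2) :
    tensorOp (fun z => if z = x then A else if z = y then B else 1) a b =
      A (a x) (b x) * B (a y) (b y) *
        ∏ z ∈ (Finset.univ.erase x).erase y, (1 : Matrix (Fin 2) (Fin 2) ℂ) (a z) (b z) := by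
  rw [tensorOp, ← Finset.mul_prod_erase Finset.univ _ (Finset.mem_univ x),
    ← Finset.mul_prod_erase (Finset.univ.erase x) _
      (Finset.mem_erase.2 ⟨hxy.symm, Finset.mem_univ y⟩), mul_assoc]
  simp only [if_true, hxy.symm, if_false]
  congr 2
  refine Finset.prod_congr rfl fun z hz => ?_
  simp only [Finset.mem_erase] at hz
  simp [hz.1, hz.2.1]

/-- The singlet is odd under `σ^α_x σ^α_y`. -/
lemma sigma_mul_sigma_mul_projMinus {α : Fin 4} (hα : α ≠ 0) {x y : ι} (hxy : x ≠ y) :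
    sigma α x * sigma α y * projMinus x y = -projMinus x y := by
  have h2 : ∀ β : Fin 4, sigma α x * sigma α y * (sigma β x * sigma β y) =
      tensorOp fun z => if z = x then pauli α * pauli β else if z = y then pauli α * pauli β
        else 1 := by
    intro β
    rw [sigma_mul_sigma_eq_tensorOp hxy, sigma_mul_sigma_eq_tensorOp hxy, tensorOp_mul]
    congr 1
    funext z
    by_cases h1 : z = x
    · simp [h1]
    · by_cases h2 : z = y
      · simp [h2, hxy.symm]
      · simp [h1, h2]
  have h1 : (1 : Matrix (ι → Fin 2) (ι → Fin 2) ℂ) =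
      tensorOp fun z => if z = x then 1 else if z = y then 1 else 1 := by
    simp [tensorOp_one]
  -- This is (σ^α_x σ^α_y + 1)(1 - P_{xy}) = 0 rearranged: the range of 1 - P_{xy} is the singlet.
  -- With P expanded in Pauli matrices it is checked on 16 entries.
  have key : sigma α x * sigma α y + 1 =
      perm x y + sigma α x * sigma α y * perm x y := by
    rw [perm_eq_sum hxy, Matrix.mul_smul, ← smul_add, Finset.mul_sum, ← Finset.sum_add_distrib,
      Finset.sum_congr rfl fun β _ => congrArg₂ (· + ·) (sigma_mul_sigma_eq_tensorOp hxy β) (h2 β),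
      sigma_mul_sigma_eq_tensorOp hxy, h1]
    ext a b
    simp only [Matrix.add_apply, Matrix.smul_apply, Matrix.sum_apply, tensorOp_pair_apply hxy]
    simp only [← add_mul, ← Finset.sum_mul, smul_eq_mul, ← mul_assoc]
    congr 1
    generalize a x = p
    generalize a y = q
    generalize b x = r
    generalize b y = s
    rw [Fin.sum_univ_four]
    fin_cases α
    · exact absurd rfl hα
    all_goals
      fin_cases p <;> fin_cases q <;> fin_cases r <;> fin_cases s <;>
        simp [pauli, Matrix.mul_apply, Fin.sum_univ_two] <;> norm_num
  rw [projMinus, Matrix.mul_smul, mul_sub, mul_one, ← smul_neg]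
  congr 1
  rw [neg_sub, sub_eq_sub_iff_add_eq_add, key]

end Tensor

end EightVertex

end

noncomputable section
namespace EightVertex

/-! ### Expansion of products of `L` operators -/

section Expansion

variable {ι : Type} [Fintype ι] [DecidableEq ι]

/-- The rescaled Pauli matrices `√ε_α σ^α_x`. -/
def rescaledSigma (α : Fin 4) (x : ι) : Matrix (ι → Fin 2) (ι → Fin 2) ℂ :=
  sqrtEps α • sigma α x

/-- The image of a product of `L` operators under a functional with values `F` on the words. -/
def wordExpansion (τ : ℂ) : List (ι × ℂ) → (List (Fin 4) → ℂ) →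
    Matrix (ι → Fin 2) (ι → Fin 2) ℂ
  | [], F => F [] • 1
  | q :: l, F => ∑ α : Fin 4, theta τ α q.2 •
      (rescaledSigma α q.1 * wordExpansion τ l fun w => F (α :: w))

lemma wordExpansion_congr (τ : ℂ) (l : List (ι × ℂ)) {F G : List (Fin 4) → ℂ}
    (h : ∀ w, w.length = l.length → F w = G w) :
    wordExpansion τ l F = wordExpansion τ l G := by
  induction l generalizing F G with
  | nil => simp only [wordExpansion]; rw [h [] rfl]
  | cons q l ih =>
    simp only [wordExpansion]
    refine Finset.sum_congr rfl fun α _ => ?_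
    rw [ih fun w hw => h (α :: w) (by simp [hw])]

lemma wordExpansion_smul (τ : ℂ) (l : List (ι × ℂ)) (c : ℂ) (F : List (Fin 4) → ℂ) :
    wordExpansion τ l (fun w => c * F w) = c • wordExpansion τ l F := by
  induction l generalizing F with
  | nil => simp only [wordExpansion, smul_smul]
  | cons q l ih =>
    simp only [wordExpansion, Finset.smul_sum]
    refine Finset.sum_congr rfl fun α _ => ?_
    rw [ih, Matrix.mul_smul, smul_comm]

lemma wordExpansion_add (τ : ℂ) (l : List (ι × ℂ)) (F G : List (Fin 4) → ℂ) :
    wordExpansion τ l (fun w => F w + G w) = wordExpansion τ l F + wordExpansion τ l G := by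
  induction l generalizing F G with
  | nil => simp only [wordExpansion, add_smul]
  | cons q l ih =>
    simp only [wordExpansion, ← Finset.sum_add_distrib]
    refine Finset.sum_congr rfl fun α _ => ?_
    rw [ih, mul_add, smul_add]

/-- The argument (v - η)/2 is chosen so that the theta functions in L are evaluated at v. The factor
θ_{α+1}(η) in the denominator of L cancels against the one in `genNorm`, which leaves √ε_α
θ_{α+1}(v) σ^α/(2θ₁(2η)) per letter. -/
lemma map_Lop_prod {τ η : ℂ} (hη : ∀ α, theta τ α η ≠ 0) (l : List (ι × ℂ))
    (Λ : Sklyanin τ η →ₗ[ℂ] ℂ) (F : List (Fin 4) → ℂ)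
    (h : ∀ w, w.length = l.length → Λ (wordGen τ η w) = wordNorm τ η w * F w) :
    ((l.map fun q => Lop τ η q.1 ((q.2 - η) / 2)).prod).map Λ =
      (1 / (2 * theta τ 0 (2 * η))) ^ l.length • wordExpansion τ l F := by
  induction l generalizing Λ F with
  | nil =>
    ext a b
    have h0 := h [] rfl
    simp only [wordGen, wordNorm, List.map_nil, List.prod_nil, one_mul] at h0
    simp only [List.map_nil, List.prod_nil, Matrix.map_apply, wordExpansion, Matrix.smul_apply,
      Matrix.one_apply, List.length_nil, pow_zero, one_smul]
    split_ifs
    · simpa using h0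
    · simp
  | cons q l ih =>
    -- The first generator is absorbed into the functional as left multiplication; the induction
    -- therefore runs over all functionals.
    have hα : ∀ α : Fin 4,
        ((l.map fun q => Lop τ η q.1 ((q.2 - η) / 2)).prod).map
          (Λ ∘ₗ LinearMap.mulLeft ℂ (gen τ η α)) =
        genNorm τ η α • ((1 / (2 * theta τ 0 (2 * η))) ^ l.length •
          wordExpansion τ l fun w => F (α :: w)) := by
      intro α
      rw [ih _ (fun w => genNorm τ η α * F (α :: w)), wordExpansion_smul, smul_comm]
      intro w hw
      have := h (α :: w) (by simp [hw])
      simp only [wordGen, wordNorm, List.map_cons, List.prod_cons] at this ⊢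
      simp only [LinearMap.comp_apply, LinearMap.mulLeft_apply]
      rw [this]
      ring
    ext a b
    rw [List.map_cons, List.prod_cons, Matrix.map_apply, Matrix.mul_apply, map_sum]
    have hc : ∀ c, Λ (Lop τ η q.1 ((q.2 - η) / 2) a c *
        (l.map fun q => Lop τ η q.1 ((q.2 - η) / 2)).prod c b) =
        ∑ α : Fin 4, (1 / 2 * (theta τ α q.2 / theta τ α η)) * (sigma α q.1 a c *
          (((l.map fun q => Lop τ η q.1 ((q.2 - η) / 2)).prod).map
          (Λ ∘ₗ LinearMap.mulLeft ℂ (gen τ η α))) c b) := by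
      intro c
      rw [Lop, smul_mul_assoc, map_smul, Finset.sum_mul, map_sum, Finset.smul_sum]
      refine Finset.sum_congr rfl fun α _ => ?_
      rw [smul_mul_assoc, map_smul, Matrix.map_apply, LinearMap.comp_apply,
        LinearMap.mulLeft_apply, show 2 * ((q.2 - η) / 2) + η = q.2 by ring]
      simp only [smul_eq_mul]
      ring
    rw [Finset.sum_congr rfl fun c _ => hc c, Finset.sum_comm]
    rw [Matrix.smul_apply, wordExpansion, Matrix.sum_apply, Finset.smul_sum]
    refine Finset.sum_congr rfl fun α _ => ?_
    rw [← Finset.mul_sum, ← Matrix.mul_apply, hα, rescaledSigma, Matrix.mul_smul, Matrix.mul_smul,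
      Matrix.smul_mul]
    simp only [Matrix.smul_apply, smul_eq_mul, genNorm, List.length_cons]
    have h1 := hη α
    by_cases h2 : theta τ 0 (2 * η) = 0
    · simp [h2]
    · rw [pow_succ]
      generalize (1 / (2 * theta τ 0 (2 * η))) ^ l.length = e
      field_simp

/-- In every factor the sum over letters is re-indexed by π, which produces σ^β at the site of that
factor. As the sites are distinct, these matrices commute with the operators at the other sites and
collect on the left. -/
lemma wordExpansion_shift_mem (τ : ℂ) (β : Fin 4) (π : Fin 4 → Fin 4) (hπ : ∀ α, π (π α) = α)
    (χ : Fin 4 → ℂ) (u : ℂ) (q : ℂ → ℂ)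
    (hstep : ∀ α v (x : ι), (theta τ (π α) (v + u) * χ α) • rescaledSigma (π α) x =
      (q v * theta τ α v) • (sigma β x * rescaledSigma α x))
    (l : List (ι × ℂ)) (hl : (l.map Prod.fst).Nodup) (F F' : List (Fin 4) → ℂ)
    (hF : ∀ w, w.length = l.length → F' (w.map π) = wordProd χ w * F w) :
    wordExpansion τ (l.map fun p => (p.1, p.2 + u)) F' =
      (l.map fun p => q p.2).prod •
        (sigmaOn β (fun x => x ∈ l.map Prod.fst) * wordExpansion τ l F) := by
  induction l generalizing F F' with
  | nil =>
    rw [sigmaOn_false β (by simp)]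
    have := hF [] rfl
    simp only [wordProd, List.map_nil, List.prod_nil, one_mul] at this
    simp [wordExpansion, this]
  | cons p l ih =>
    simp only [List.map_cons, List.nodup_cons] at hl
    have hs : sigma β p.1 * sigmaOn β (fun x => x ∈ l.map Prod.fst) =
        sigmaOn β fun x => x ∈ (p :: l).map Prod.fst := by
      rw [sigma_eq_sigmaOn]
      refine sigmaOn_mul β _ _ _ fun x => ?_
      simp only [List.map_cons, List.mem_cons]
      by_cases hx : x = p.1
      · subst hx; simp [hl.1]
      · simp [hx]
    simp only [List.map_cons, wordExpansion, List.prod_cons]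
    rw [← hs, ← Equiv.sum_comp (Function.Involutive.toPerm π hπ), Finset.mul_sum,
      Finset.smul_sum]
    refine Finset.sum_congr rfl fun α _ => ?_
    have hpi : Function.Involutive.toPerm π hπ α = π α := rfl
    rw [hpi, ih hl.2 (fun w => χ α * F (α :: w)) (fun w => F' (π α :: w)), wordExpansion_smul]
    · have h1 : sigma β p.1 * sigmaOn β (fun x => x ∈ l.map Prod.fst) *
          (theta τ α p.2 • (rescaledSigma α p.1 * wordExpansion τ l fun w => F (α :: w))) =
          theta τ α p.2 • (sigma β p.1 * rescaledSigma α p.1 *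
            (sigmaOn β (fun x => x ∈ l.map Prod.fst) * wordExpansion τ l fun w => F (α :: w))) := by
        rw [Matrix.mul_smul, ← mul_assoc, mul_assoc (sigma β p.1), rescaledSigma, Matrix.mul_smul,
          sigmaOn_mul_sigma_of_notMem β α _ hl.1]
        simp only [Matrix.mul_smul, Matrix.smul_mul, mul_assoc]
      rw [h1]
      have h2 := hstep α p.2 p.1
      have h3 : theta τ (π α) (p.2 + u) • (rescaledSigma (π α) p.1 *
          ((l.map fun p => q p.2).prod • (sigmaOn β (fun x => x ∈ l.map Prod.fst) *
            χ α • wordExpansion τ l fun w => F (α :: w)))) =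
          (l.map fun p => q p.2).prod • (((theta τ (π α) (p.2 + u) * χ α) •
            rescaledSigma (π α) p.1) * (sigmaOn β (fun x => x ∈ l.map Prod.fst) *
              wordExpansion τ l fun w => F (α :: w))) := by
        simp only [Matrix.mul_smul, Matrix.smul_mul, smul_smul]
        congr 1
        ring
      rw [h3, h2, Matrix.smul_mul, smul_smul, smul_smul]
      congr 1
      ring
    · intro w hw
      have := hF (α :: w) (by simp [hw])
      simp only [List.map_cons, wordProd, List.prod_cons] at this ⊢
      rw [this]
      ring

/-- A translation of all arguments acting on the words by an involution. -/
lemma wordExpansion_shift (τ : ℂ) (β : Fin 4) (π : Fin 4 → Fin 4) (hπ : ∀ α, π (π α) = α)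
    (χ : Fin 4 → ℂ) (u : ℂ) (q : ℂ → ℂ)
    (hstep : ∀ α v (x : ι), (theta τ (π α) (v + u) * χ α) • rescaledSigma (π α) x =
      (q v * theta τ α v) • (sigma β x * rescaledSigma α x))
    (l : List (ι × ℂ)) (hl : (l.map Prod.fst).Nodup) (s : ι → Prop) [DecidablePred s]
    (hs : ∀ x, s x ↔ x ∈ l.map Prod.fst) (F F' : List (Fin 4) → ℂ)
    (hF : ∀ w, w.length = l.length → F' (w.map π) = wordProd χ w * F w) :
    wordExpansion τ (l.map fun p => (p.1, p.2 + u)) F' =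
      (l.map fun p => q p.2).prod • (sigmaOn β s * wordExpansion τ l F) := by
  rw [wordExpansion_shift_mem τ β π hπ χ u q hstep l hl F F' hF, sigmaOn_congr β hs]

/-- A change of the arguments amounting to a conjugation. -/
lemma wordExpansion_conj (τ : ℂ) (U : Matrix (ι → Fin 2) (ι → Fin 2) ℂ) (hU : U * U = 1)
    (φ : ι × ℂ → ℂ) (c : ι × ℂ → ℂ) (l : List (ι × ℂ))
    (h : ∀ α, ∀ p ∈ l, theta τ α (φ p) • rescaledSigma α p.1 =
      (c p * theta τ α p.2) • (U * rescaledSigma α p.1 * U)) (F : List (Fin 4) → ℂ) :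
    wordExpansion τ (l.map fun p => (p.1, φ p)) F =
      (l.map c).prod • (U * wordExpansion τ l F * U) := by
  induction l generalizing F with
  | nil => simp [wordExpansion, hU]
  | cons p l ih =>
    simp only [List.map_cons, wordExpansion, List.prod_cons, Finset.mul_sum, Finset.sum_mul,
      Finset.smul_sum]
    refine Finset.sum_congr rfl fun α _ => ?_
    have h1 : theta τ α (φ p) • (rescaledSigma α p.1 * ((l.map c).prod •
        (U * (wordExpansion τ l fun w => F (α :: w)) * U))) =
        (l.map c).prod • ((theta τ α (φ p) • rescaledSigma α p.1) *
          (U * (wordExpansion τ l fun w => F (α :: w)) * U)) := by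
      rw [Matrix.mul_smul, smul_comm, Matrix.smul_mul]
    rw [ih fun α p hp => h α p (List.mem_cons_of_mem _ hp), h1, h α p List.mem_cons_self,
      Matrix.smul_mul, Matrix.mul_smul, Matrix.smul_mul, smul_smul, smul_smul]
    have : U * rescaledSigma α p.1 * U * (U * (wordExpansion τ l fun w => F (α :: w)) * U) =
        U * (rescaledSigma α p.1 * wordExpansion τ l fun w => F (α :: w)) * U := by
      calc _ = U * rescaledSigma α p.1 * (U * U) * (wordExpansion τ l fun w => F (α :: w)) * U := by
            simp only [mul_assoc]
        _ = _ := by rw [hU, mul_one]; simp only [mul_assoc]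
    rw [this]
    congr 1
    ring

/-- The commutation with an operator multiplying the Pauli matrices by signs. -/
lemma mul_wordExpansion (τ : ℂ) (S : Matrix (ι → Fin 2) (ι → Fin 2) ℂ) (χ : Fin 4 → ℂ)
    (l : List (ι × ℂ)) (h : ∀ α, ∀ p ∈ l, S * sigma α p.1 = χ α • (sigma α p.1 * S))
    (F : List (Fin 4) → ℂ) :
    S * wordExpansion τ l F = wordExpansion τ l (fun w => wordProd χ w * F w) * S := by
  induction l generalizing F with
  | nil => simp [wordExpansion, wordProd]
  | cons p l ih =>
    simp only [wordExpansion, Finset.mul_sum, Finset.sum_mul]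
    refine Finset.sum_congr rfl fun α _ => ?_
    have h1 := ih (fun α p hp => h α p (List.mem_cons_of_mem _ hp)) fun w => F (α :: w)
    have h2 : (wordExpansion τ l fun w => wordProd χ (α :: w) * F (α :: w)) =
        χ α • wordExpansion τ l fun w => wordProd χ w * F (α :: w) := by
      rw [← wordExpansion_smul]
      congr 1
      funext w
      simp only [wordProd, List.map_cons, List.prod_cons]
      ring
    rw [h2, Matrix.mul_smul, Matrix.smul_mul, ← mul_assoc, rescaledSigma, Matrix.mul_smul,
      h α p List.mem_cons_self]
    simp only [Matrix.mul_smul, Matrix.smul_mul, mul_assoc, h1]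
    rw [smul_comm (χ α)]

lemma mul_wordExpansion_of_commute (τ : ℂ) (S : Matrix (ι → Fin 2) (ι → Fin 2) ℂ)
    (l : List (ι × ℂ)) (h : ∀ α, ∀ p ∈ l, S * sigma α p.1 = sigma α p.1 * S)
    (F : List (Fin 4) → ℂ) :
    S * wordExpansion τ l F = wordExpansion τ l F * S := by
  rw [mul_wordExpansion τ S (fun _ => 1) l fun α p hp => by rw [one_smul, h α p hp]]
  congr 2
  funext w
  simp [wordProd]

end Expansion

end EightVertex

end

noncomputable section
namespace EightVertex

/-! ### Left multiplication of the rescaled Pauli matrices by σ¹ and σ³ -/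

section

variable {ι : Type} [Fintype ι] [DecidableEq ι]

lemma smul_sigma_eq_sigma_mul_sigma {α β γ : Fin 4} {c : ℂ}
    (h : c • pauli γ = pauli β * pauli α) (x : ι) :
    c • sigma γ x = sigma β x * sigma α x := by
  simp only [sigma_eq_tensorOp]
  rw [tensorOp_mul, ← tensorOp_smul_single _ x]
  congr 1
  funext y
  by_cases hy : y = x <;> simp [hy, h]

lemma sqrtEps_permA_smul_pauli (α : Fin 4) :
    (charA α * sqrtEps α * sqrtEps (permA α)) • pauli (permA α) =
      (sqrtEps α * sqrtEps α) • (pauli 1 * pauli α) := by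
  fin_cases α <;> ext i j <;> fin_cases i <;> fin_cases j <;>
    simp [pauli, sqrtEps, charA, permA]

lemma sqrtEps_permB_smul_pauli (α : Fin 4) :
    (sqrtEps α * sqrtEps (permB α)) • pauli (permB α) =
      (sqrtEps α * sqrtEps α) • (pauli 3 * pauli α) := by
  fin_cases α <;> ext i j <;> fin_cases i <;> fin_cases j <;>
    simp [pauli, sqrtEps, permB]

lemma sqrtEps_ne_zero (α : Fin 4) : sqrtEps α ≠ 0 := by
  fin_cases α <;> simp [sqrtEps]

/-- The factors √ε_α absorb the imaginary units of the products of Pauli matrices, so that σ¹ acts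
as a permutation up to signs. -/
lemma rescaledSigma_permA (α : Fin 4) (x : ι) :
    charA α • rescaledSigma (permA α) x = sigma 1 x * rescaledSigma α x := by
  have h0 := sqrtEps_ne_zero α
  have h1 : (charA α * sqrtEps (permA α) * (sqrtEps α)⁻¹) • pauli (permA α) =
      pauli 1 * pauli α := by
    have := sqrtEps_permA_smul_pauli α
    have h2 := congrArg (fun M => (sqrtEps α * sqrtEps α)⁻¹ • M) this
    simp only [smul_smul] at h2
    rw [inv_mul_cancel₀ (by simp [h0]), one_smul] at h2
    rw [← h2]
    congr 1
    field_simp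
  rw [rescaledSigma, rescaledSigma, Matrix.mul_smul, ← smul_sigma_eq_sigma_mul_sigma h1 x,
    smul_smul, smul_smul]
  congr 1
  field_simp

/-- For σ³ no sign at all remains. The phases in the theta translation by τ/2 are all carried by
`sgnB`. -/
lemma rescaledSigma_permB (α : Fin 4) (x : ι) :
    rescaledSigma (permB α) x = sigma 3 x * rescaledSigma α x := by
  have h0 := sqrtEps_ne_zero α
  have h1 : (sqrtEps (permB α) * (sqrtEps α)⁻¹) • pauli (permB α) =
      pauli 3 * pauli α := by
    have := sqrtEps_permB_smul_pauli α
    have h2 := congrArg (fun M => (sqrtEps α * sqrtEps α)⁻¹ • M) this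
    simp only [smul_smul] at h2
    rw [inv_mul_cancel₀ (by simp [h0]), one_smul] at h2
    rw [← h2]
    congr 1
    field_simp
  rw [rescaledSigma, rescaledSigma, Matrix.mul_smul, ← smul_sigma_eq_sigma_mul_sigma h1 x,
    smul_smul]
  congr 1
  field_simp

end

/-- The half period `u` acts on the theta functions and on the Pauli matrices by `β` and `π`. -/
structure IsHalfPeriod (τ u : ℂ) (β : Fin 4) (π : Fin 4 → Fin 4) (χ : Fin 4 → ℂ)
    (q q' : ℂ → ℂ) : Prop where
  ne_zero : β ≠ 0
  invol : ∀ α, π (π α) = α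
  step : ∀ {N : ℕ} (α : Fin 4) (v : ℂ) (x : Site N),
    (theta τ (π α) (v + u) * χ α) • rescaledSigma (π α) x =
      (q v * theta τ α v) • (sigma β x * rescaledSigma α x)
  neutral : ∀ w, Neutral w → wordProd (pauliSign β) w = 1
  back_ne_zero : ∀ v, q' v ≠ 0
  back : ∀ α v, theta τ α (v - 2 * u) = q' v * pauliSign β α * theta τ α v

/-- The translation by u permutes the letters and corresponds to left multiplication by σ^β, whereas
the translation by -2u only multiplies by a sign, namely the one in the commutation of σ^β with σ^α.
-/
lemma isHalfPeriod_half (τ : ℂ) :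
    IsHalfPeriod τ (1 / 2) 1 permA sgnA (fun _ => -1) (fun _ => -1) where
  ne_zero := by decide
  invol := permA_permA
  step := by
    intro N α v x
    have h : sgnA (permA α) * sgnA α = -1 * charA α := by
      fin_cases α <;> simp [sgnA, permA, charA]
    rw [theta_add_half, permA_permA, mul_right_comm, h, ← rescaledSigma_permA, smul_smul]
    congr 1
    ring
  neutral := fun w hw => by rw [pauliSign_one]; exact hw.1
  back_ne_zero := fun v => by norm_num
  back := by
    intro α v
    have h := theta_add_one τ α (v - 1)
    rw [sub_add_cancel] at h
    rw [pauliSign_one, show (2 : ℂ) * (1 / 2) = 1 by norm_num, h]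
    linear_combination (-theta τ α (v - 1)) * charA_sq α

lemma isHalfPeriod_half_tau (τ : ℂ) :
    IsHalfPeriod τ (τ / 2) 3 permB (fun α => (sgnB α)⁻¹)
      (fun v => exp (-Real.pi * I * (τ / 4 + v))) (fun v => -exp (Real.pi * I * (2 * v - τ))) where
  ne_zero := by decide
  invol := permB_permB
  step := by
    intro N α v x
    have h : sgnB (permB α) * (sgnB α)⁻¹ = 1 := by
      fin_cases α <;> simp [sgnB, permB]
    rw [theta_add_half_tau, permB_permB, ← rescaledSigma_permB]
    congr 1
    linear_combination (exp (-Real.pi * I * (τ / 4 + v)) * theta τ α v) * h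
  neutral := fun w hw => by rw [pauliSign_three]; exact hw.2
  back_ne_zero := fun v => neg_ne_zero.2 (exp_ne_zero _)
  back := by
    intro α v
    have h := theta_add_tau τ α (v - τ)
    rw [sub_add_cancel] at h
    have he : exp (Real.pi * I * (2 * v - τ)) * exp (-Real.pi * I * (τ + 2 * (v - τ))) = 1 := by
      rw [← exp_add, ← exp_zero]
      congr 1
      ring
    rw [pauliSign_three, show (2 : ℂ) * (τ / 2) = τ by ring, h]
    linear_combination (-theta τ α (v - τ)) * charB_sq α -
      charB α ^ 2 * theta τ α (v - τ) * he

/-! ### The base transfer matrix -/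

section Base

variable {N : ℕ}

/-- The index of a site. -/
def siteIndex : Site N → Fin (N + 2) := Sum.elim id id

@[simp] lemma siteIndex_site (p : Fin (N + 2)) : siteIndex (site p) = p := rfl

@[simp] lemma siteIndex_bar (p : Fin (N + 2)) : siteIndex (bar p) = p := rfl

/-- `σ^β_p σ^β_{p̄}` for all `p` in a set. -/
def sigmaIndex (β : Fin 4) (s : Fin (N + 2) → Prop) [DecidablePred s] : Op N :=
  sigmaOn β fun x => s (siteIndex x)

lemma sigmaPair_eq_sigmaIndex (β : Fin 4) (p : Fin (N + 2)) :
    sigmaPair β p = sigmaIndex β fun q => q = p := by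
  rw [sigmaPair, sigma_eq_sigmaOn, sigma_eq_sigmaOn]
  refine sigmaOn_mul β _ _ _ fun x => ?_
  rcases x with x | x <;> simp [siteIndex]

lemma sigmaIndex_mul_self (β : Fin 4) (s : Fin (N + 2) → Prop) [DecidablePred s] :
    sigmaIndex β s * sigmaIndex β s = 1 := sigmaOn_mul_self β _

lemma sigmaIndex_mul (β : Fin 4) (s s' u : Fin (N + 2) → Prop) [DecidablePred s]
    [DecidablePred s'] [DecidablePred u] (h : ∀ x, u x ↔ (s x ∧ ¬ s' x ∨ ¬ s x ∧ s' x)) :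
    sigmaIndex β s * sigmaIndex β s' = sigmaIndex β u :=
  sigmaOn_mul β _ _ _ fun x => h (siteIndex x)

lemma sigmaIndex_comm (β : Fin 4) (s s' : Fin (N + 2) → Prop) [DecidablePred s]
    [DecidablePred s'] :
    sigmaIndex β s * sigmaIndex β s' = sigmaIndex β s' * sigmaIndex β s := by
  rw [sigmaIndex_mul β s s' (fun x => s x ∧ ¬ s' x ∨ ¬ s x ∧ s' x) fun x => Iff.rfl,
    sigmaIndex_mul β s' s (fun x => s x ∧ ¬ s' x ∨ ¬ s x ∧ s' x) fun x => by tauto]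

lemma sigmaPair_mul_self (β : Fin 4) (p : Fin (N + 2)) :
    sigmaPair β p * sigmaPair β p = 1 := by
  rw [sigmaPair_eq_sigmaIndex, sigmaIndex_mul_self]

lemma perm_mul_sigmaIndex (β : Fin 4) (s : Fin (N + 2) → Prop) [DecidablePred s] {x y : Site N}
    (h : s (siteIndex x) ↔ s (siteIndex y)) :
    perm x y * sigmaIndex β s = sigmaIndex β s * perm x y := by
  refine perm_mul_sigmaOn β x y _ _ fun z => ?_
  by_cases hx : z = x
  · rw [hx, Equiv.swap_apply_left, h]
  · by_cases hy : z = y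
    · rw [hy, Equiv.swap_apply_right, h]
    · rw [Equiv.swap_apply_of_ne_of_ne hx hy]

lemma projMinus_mul_sigmaIndex (β : Fin 4) (s : Fin (N + 2) → Prop) [DecidablePred s]
    (p : Fin (N + 2)) :
    projMinus (site p) (bar p) * sigmaIndex β s = sigmaIndex β s * projMinus (site p) (bar p) := by
  rw [projMinus, Matrix.smul_mul, Matrix.mul_smul, sub_mul, mul_sub, one_mul, mul_one,
    perm_mul_sigmaIndex β s (x := site p) (y := bar p) Iff.rfl]

lemma sigmaPair_mul_projMinus {β : Fin 4} (hβ : β ≠ 0) (p : Fin (N + 2)) :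
    sigmaPair β p * projMinus (site p) (bar p) = -projMinus (site p) (bar p) :=
  sigma_mul_sigma_mul_projMinus hβ (by simp)

/-- `P₁₂ 𝒫⁻_{11̄} 𝒫⁻_{22̄}`. -/
def singletProj (N : ℕ) : Op N :=
  perm (site 0) (site 1) * projMinus (site 0) (bar 0) * projMinus (site 1) (bar 1)

/-- Both members of each pair p, p̄ carry σ^β, so the projectors commute with the product; for the
transposition of the sites 1 and 2 the set must treat them alike. -/
lemma singletProj_mul_sigmaIndex (β : Fin 4) (s : Fin (N + 2) → Prop) [DecidablePred s]
    (h : s 0 ↔ s 1) : singletProj N * sigmaIndex β s = sigmaIndex β s * singletProj N := by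
  rw [singletProj, mul_assoc, projMinus_mul_sigmaIndex, ← mul_assoc, mul_assoc (perm _ _),
    projMinus_mul_sigmaIndex, ← mul_assoc,
    perm_mul_sigmaIndex β s (x := site 0) (y := site 1) h]
  simp only [mul_assoc]

lemma singletProj_mul_sigmaPair {β : Fin 4} (hβ : β ≠ 0) {p : Fin (N + 2)} (hp : p = 0 ∨ p = 1) :
    singletProj N * sigmaPair β p = -singletProj N := by
  have h := fun p => sigmaPair_mul_projMinus hβ p (N := N)
  simp only [sigmaPair_eq_sigmaIndex] at h ⊢
  rcases hp with rfl | rfl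
  · rw [singletProj, mul_assoc, projMinus_mul_sigmaIndex, ← mul_assoc, mul_assoc (perm _ _),
      projMinus_mul_sigmaIndex, h, mul_neg, neg_mul]
  · rw [singletProj, mul_assoc, projMinus_mul_sigmaIndex, h, mul_neg]

/-- The product of both pairs is symmetric under the transposition, so it may be moved to the right,
where each pair gives -1. A single pair on the left could not be moved this way. -/
lemma sigmaPair_mul_sigmaPair_mul_singletProj {β : Fin 4} (hβ : β ≠ 0) :
    sigmaPair β 0 * (sigmaPair β 1 * singletProj N) = singletProj N := by
  have h01 : sigmaPair β 0 * sigmaPair β 1 = sigmaIndex β fun q : Fin (N + 2) => q = 0 ∨ q = 1 := by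
    rw [sigmaPair_eq_sigmaIndex, sigmaPair_eq_sigmaIndex]
    refine sigmaIndex_mul β _ _ _ fun x => ?_
    by_cases h0 : x = 0
    · simp [h0]
    · simp [h0]
  rw [← mul_assoc, h01, ← singletProj_mul_sigmaIndex β _ (by simp), ← h01, ← mul_assoc,
    singletProj_mul_sigmaPair hβ (Or.inl rfl), neg_mul, singletProj_mul_sigmaPair hβ (Or.inr rfl),
    neg_neg]

/-- The sites of the auxiliary `L` operators. -/
def chainSites (N : ℕ) : List (Site N) :=
  (List.finRange (N + 2)).tail.map bar ++ (List.finRange (N + 2)).tail.reverse.map site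

lemma finRange_tail : (List.finRange (N + 2)).tail = (List.finRange (N + 1)).map Fin.succ := by
  rw [List.finRange_succ, List.tail_cons]

lemma mem_finRange_tail {p : Fin (N + 2)} : p ∈ (List.finRange (N + 2)).tail ↔ p ≠ 0 := by
  rw [finRange_tail]
  simp [Fin.exists_succ_eq]

lemma mem_chainSites {x : Site N} : x ∈ chainSites N ↔ siteIndex x ≠ 0 := by
  rw [chainSites, List.mem_append, List.mem_map, List.mem_map]
  simp only [List.mem_reverse, mem_finRange_tail]
  rcases x with x | x <;> simp [siteIndex]

lemma nodup_chainSites : (chainSites N).Nodup := by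
  have h : ((List.finRange (N + 2)).tail).Nodup := (List.nodup_finRange _).tail
  refine List.Nodup.append ?_ ?_ ?_
  · exact h.map fun a b hab => Sum.inr_injective hab
  · exact (List.nodup_reverse.2 h).map fun a b hab => Sum.inl_injective hab
  · intro x hx hy
    simp only [List.mem_map] at hx hy
    obtain ⟨p, _, rfl⟩ := hx
    obtain ⟨p', _, hp⟩ := hy
    exact Sum.inl_ne_inr hp

lemma length_chainSites : (chainSites N).length = 2 * (N + 1) := by
  simp [chainSites]
  ring

lemma prod_chainSites (f : Site N → ℂ) :
    ((chainSites N).map f).prod = f (bar 1) * f (site 1) *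
      ∏ p : Fin N, (f (bar p.succ.succ) * f (site p.succ.succ)) := by
  have h : ∀ g : Fin (N + 2) → ℂ, ((List.finRange (N + 2)).tail.map g).prod =
      g 1 * ∏ p : Fin N, g p.succ.succ := by
    intro g
    rw [finRange_tail, List.map_map, ← List.ofFn_eq_map, List.prod_ofFn, Fin.prod_univ_succ]
    rfl
  rw [chainSites, List.map_append, List.prod_append, List.map_map, List.map_map,
    List.map_reverse, List.prod_reverse, h, h, Finset.prod_mul_distrib]
  simp only [Function.comp_apply]
  ring

/-- The arguments of the theta functions in the `L` operators. -/
def siteArg (η : ℂ) (t : Fin (N + 2) → ℂ) : Site N → ℂ :=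
  Sum.elim (fun p => t 0 + t 1 - 2 * t p + η) (fun p => t 0 + t 1 - 2 * t p - η)

/-- The prefactor of `X̂_n`. -/
def prefactor (τ η : ℂ) (t : Fin (N + 2) → ℂ) : ℂ :=
  1 / (bracket τ η (t 0 - t 1) *
      ∏ p ∈ Finset.univ.filter (fun p : Fin (N + 2) => p ≠ 0 ∧ p ≠ 1),
        (bracket τ η (t 0 - t p) * bracket τ η (t 1 - t p)))

/-- The monodromy matrix with the values of a functional on the words replaced by `F`. -/
def chainExpansion (τ η : ℂ) (t : Fin (N + 2) → ℂ) (F : List (Fin 4) → ℂ) : Op N :=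
  wordExpansion τ ((chainSites N).map fun x => (x, siteArg η t x)) F

/-- With z = (t₁+t₂)/2 the theta arguments 2(z - t_p) + η and 2(z - t_p - η) + η are the values of
`siteArg` at p and p̄. -/
lemma map_monodromy (τ : ℂ) {η : ℂ} (hη : ∀ α, theta τ α η ≠ 0) (t : Fin (N + 2) → ℂ)
    (Λ : Sklyanin τ η →ₗ[ℂ] ℂ) (F : List (Fin 4) → ℂ)
    (h : ∀ w, w.length = 2 * (N + 1) → Λ (wordGen τ η w) = wordNorm τ η w * F w) :
    (monodromy τ η ((t 0 + t 1) / 2) t).map Λ =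
      (1 / (2 * theta τ 0 (2 * η))) ^ (2 * (N + 1)) • chainExpansion τ η t F := by
  have h1 : monodromy τ η ((t 0 + t 1) / 2) t =
      (((chainSites N).map fun x => (x, siteArg η t x)).map fun q =>
        Lop τ η q.1 ((q.2 - η) / 2)).prod := by
    rw [monodromy, chainSites, List.map_append, List.map_append, List.prod_append]
    simp only [List.map_map]
    congr 3
    · funext p
      simp only [Function.comp_apply, siteArg, Sum.elim_inr]
      congr 1
      ring
    · funext p
      simp only [Function.comp_apply, siteArg, Sum.elim_inl]
      congr 1
      ring
  rw [h1, map_Lop_prod hη _ Λ F (by simpa [length_chainSites] using h), List.length_map,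
    length_chainSites, chainExpansion]

end Base

end EightVertex

end

noncomputable section
namespace EightVertex

/-! ### Half-period translations of the base transfer matrix -/

section Base

variable {N : ℕ} {τ η u : ℂ} {β : Fin 4} {π : Fin 4 → Fin 4} {χ : Fin 4 → ℂ} {q q' : ℂ → ℂ}

lemma prod_chainSites_ite {k : Fin (N + 2)} (hk : k ≠ 0) (g : Site N → ℂ) :
    ((chainSites N).map fun x => if siteIndex x = k then g x else 1).prod =
      g (bar k) * g (site k) := by
  obtain ⟨k, rfl⟩ := Fin.exists_succ_eq.2 hk
  have h : ∀ f : Fin (N + 2) → ℂ,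
      ((List.finRange (N + 2)).tail.map fun p => if p = k.succ then f p else 1).prod =
        f k.succ := by
    intro f
    rw [finRange_tail, List.map_map, ← List.ofFn_eq_map, List.prod_ofFn,
      Finset.prod_eq_single k]
    · simp
    · intro p _ hp
      simp [hp]
    · simp
  rw [chainSites, List.map_append, List.prod_append, List.map_map, List.map_map,
    List.map_reverse, List.prod_reverse]
  exact congrArg₂ (· * ·) (h fun p => g (bar p)) (h fun p => g (site p))

lemma map_fst_chainSites (v : Site N → ℂ) :
    ((chainSites N).map fun x => (x, v x)).map Prod.fst = chainSites N := by
  rw [List.map_map]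
  exact List.map_id _

lemma IsHalfPeriod.wordExpansion_chain (H : IsHalfPeriod τ u β π χ q q') (v : Site N → ℂ)
    {F F' : List (Fin 4) → ℂ}
    (hF : ∀ w, w.length = 2 * (N + 1) → F' (w.map π) = wordProd χ w * F w) :
    wordExpansion τ ((chainSites N).map fun x => (x, v x + u)) F' =
      ((chainSites N).map fun x => q (v x)).prod • (sigmaIndex β (fun p => p ≠ 0) *
        wordExpansion τ ((chainSites N).map fun x => (x, v x)) F) := by
  have h := wordExpansion_shift τ β π H.invol χ u q (H.step (N := N))
    ((chainSites N).map fun x => (x, v x)) (by rw [map_fst_chainSites]; exact nodup_chainSites)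
    (fun x => siteIndex x ≠ 0) (fun x => by rw [map_fst_chainSites, mem_chainSites]) F F' (by simpa [length_chainSites] using hF)
  simp only [List.map_map, Function.comp_def] at h
  exact h

lemma sigmaIndex_mul_sigma (β α : Fin 4) (s : Fin (N + 2) → Prop) [DecidablePred s] (x : Site N) :
    sigmaIndex β s * sigma α x =
      (if s (siteIndex x) then pauliSign β α else 1) • (sigma α x * sigmaIndex β s) := by
  split_ifs with h
  · exact sigmaOn_mul_sigma_of_mem β α _ h
  · rw [one_smul]
    exact sigmaOn_mul_sigma_of_notMem β α _ h

lemma IsHalfPeriod.wordExpansion_back (H : IsHalfPeriod τ u β π χ q q') (v : Site N → ℂ)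
    {k : Fin (N + 2)} (hk : k ≠ 0) (F : List (Fin 4) → ℂ) :
    wordExpansion τ ((chainSites N).map fun x =>
        (x, if siteIndex x = k then v x - 2 * u else v x)) F =
      (q' (v (bar k)) * q' (v (site k))) • (sigmaPair β k *
        wordExpansion τ ((chainSites N).map fun x => (x, v x)) F * sigmaPair β k) := by
  have h := wordExpansion_conj τ (sigmaPair β k) (sigmaPair_mul_self β k)
    (fun p => if siteIndex p.1 = k then p.2 - 2 * u else p.2)
    (fun p => if siteIndex p.1 = k then q' p.2 else 1)
    ((chainSites N).map fun x => (x, v x)) (fun α p _ => ?_) F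
  · rw [← prod_chainSites_ite hk fun x => q' (v x)]
    simpa only [List.map_map, Function.comp_def] using h
  · rw [rescaledSigma, Matrix.mul_smul, Matrix.smul_mul, sigmaPair_eq_sigmaIndex,
      sigmaIndex_mul_sigma, Matrix.smul_mul, mul_assoc, sigmaIndex_mul_self, mul_one, smul_smul,
      smul_smul, smul_smul]
    congr 1
    split_ifs
    · rw [H.back]
      ring
    · ring

/-- The word functions supported on the neutral words of length `2(N+1)`. -/
def NeutralSupport (N : ℕ) (F : List (Fin 4) → ℂ) : Prop :=
  ∀ w, w.length = 2 * (N + 1) → ¬ Neutral w → F w = 0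

/-- Moving σ^β at all chain sites past a word multiplies its term by the character of the word,
which is 1 for the neutral words that alone contribute. -/
lemma IsHalfPeriod.sigmaIndex_mul_chainExpansion (H : IsHalfPeriod τ u β π χ q q')
    {F : List (Fin 4) → ℂ} (hF : NeutralSupport N F) (t : Fin (N + 2) → ℂ) :
    sigmaIndex β (fun p => p ≠ 0) * chainExpansion τ η t F =
      chainExpansion τ η t F * sigmaIndex β fun p => p ≠ 0 := by
  rw [chainExpansion, mul_wordExpansion τ _ (pauliSign β)]
  · congr 1
    refine wordExpansion_congr τ _ fun w hw => ?_
    by_cases hn : Neutral w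
    · rw [H.neutral w hn, one_mul]
    · rw [hF w (by simpa [length_chainSites] using hw) hn, mul_zero]
  · intro α p hp
    obtain ⟨x, hx, rfl⟩ := List.mem_map.1 hp
    rw [sigmaIndex_mul_sigma, if_pos (mem_chainSites.1 hx)]

lemma sigmaPair_zero_mul_chainExpansion (β : Fin 4) (F : List (Fin 4) → ℂ)
    (t : Fin (N + 2) → ℂ) :
    sigmaPair β 0 * chainExpansion τ η t F = chainExpansion τ η t F * sigmaPair β 0 := by
  refine mul_wordExpansion_of_commute τ _ _ (fun α p hp => ?_) F
  obtain ⟨x, hx, rfl⟩ := List.mem_map.1 hp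
  rw [sigmaPair_eq_sigmaIndex, sigmaIndex_mul_sigma, if_neg (mem_chainSites.1 hx), one_smul]

/-- The transfer matrix with the values of a functional on the words replaced by `F`. -/
def transfer (τ η : ℂ) (t : Fin (N + 2) → ℂ) (F : List (Fin 4) → ℂ) : Op N :=
  (prefactor τ η t * (1 / (2 * theta τ 0 (2 * η))) ^ (2 * (N + 1))) •
    (chainExpansion τ η t F * singletProj N)

lemma transfer_smul (τ η : ℂ) (t : Fin (N + 2) → ℂ) (c : ℂ) (F : List (Fin 4) → ℂ) :
    transfer τ η t (fun w => c * F w) = c • transfer τ η t F := by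
  rw [transfer, transfer, chainExpansion, wordExpansion_smul, Matrix.smul_mul, smul_comm]
  rfl

lemma transfer_add (τ η : ℂ) (t : Fin (N + 2) → ℂ) (F G : List (Fin 4) → ℂ) :
    transfer τ η t (fun w => F w + G w) = transfer τ η t F + transfer τ η t G := by
  rw [transfer, transfer, transfer, chainExpansion, wordExpansion_add, add_mul, smul_add]
  rfl

lemma Xbase_eq_transfer (τ : ℂ) {η : ℂ} (hη : ∀ α, theta τ α η ≠ 0) (t : Fin (N + 2) → ℂ)
    (F : List (Fin 4) → ℂ)
    (h : ∀ w, w.length = 2 * (N + 1) →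
      Tr τ η (wordGen τ η w) ((t 0 - t 1) / η) = wordNorm τ η w * F w) :
    Xbase τ η t = transfer τ η t F := by
  have h1 := map_monodromy τ hη t
    (LinearMap.proj ((t 0 - t 1) / η) ∘ₗ Tr τ η) F h
  have h2 : (⇑((LinearMap.proj ((t 0 - t 1) / η) : (ℂ → ℂ) →ₗ[ℂ] ℂ) ∘ₗ Tr τ η) :
      Sklyanin τ η → ℂ) = fun A => Tr τ η A ((t 0 - t 1) / η) := rfl
  rw [h2] at h1
  rw [Xbase, h1, transfer, singletProj, prefactor, Matrix.smul_mul, Matrix.smul_mul,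
    Matrix.smul_mul, smul_smul, mul_assoc, mul_assoc, mul_assoc]

lemma sigmaPair_zero_mul_one (β : Fin 4) :
    sigmaPair β 0 * sigmaIndex β (fun p : Fin (N + 2) => p ≠ 0 ∧ p ≠ 1) * sigmaPair β 1 =
      sigmaPair β 0 * sigmaIndex β fun p => p ≠ 0 := by
  rw [mul_assoc]
  congr 1
  rw [sigmaPair_eq_sigmaIndex]
  refine sigmaIndex_mul β _ _ _ fun x => ?_
  by_cases h : x = 1
  · simp [h]
  · simp [h]

/-- Together the two factors contain all pairs. The pairs 1 and 2 jointly act trivially on the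
singlets, and the remaining ones commute with them. -/
lemma IsHalfPeriod.sigmaIndex_mul_singletProj (H : IsHalfPeriod τ u β π χ q q') :
    sigmaPair β 0 * (sigmaIndex β (fun p => p ≠ 0) * singletProj N) =
      singletProj N * sigmaIndex β fun p => p ≠ 0 ∧ p ≠ 1 := by
  rw [← mul_assoc, ← sigmaPair_zero_mul_one, sigmaPair_eq_sigmaIndex, sigmaIndex_comm,
    ← sigmaPair_eq_sigmaIndex, mul_assoc, mul_assoc,
    sigmaPair_mul_sigmaPair_mul_singletProj H.ne_zero, singletProj_mul_sigmaIndex β _ (by simp)]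

lemma siteArg_shift_zero (η a : ℂ) (t : Fin (N + 2) → ℂ) {x : Site N} (hx : x ∈ chainSites N) :
    siteArg η (shift 0 a t) x = siteArg η t x + a := by
  rw [mem_chainSites] at hx
  rcases x with x | x
  all_goals
    simp only [siteIndex, Sum.elim_inl, Sum.elim_inr, id] at hx
    simp only [siteArg, shift, Sum.elim_inl, Sum.elim_inr, Function.update_self,
      Function.update_of_ne hx, Function.update_of_ne (one_ne_zero : (1 : Fin (N + 2)) ≠ 0)]
    ring

/-- At the sites 2 and 2̄ the argument moves by -a, elsewhere by a. Writing -a as a - 2a separates a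
common translation of all sites from a full-period translation at one pair. -/
lemma siteArg_shift_one (η a : ℂ) (t : Fin (N + 2) → ℂ) (x : Site N) :
    siteArg η (shift 1 a t) x =
      if siteIndex x = 1 then siteArg η t x + a - 2 * a else siteArg η t x + a := by
  rcases x with x | x
  all_goals
    by_cases hx : x = 1
    · subst hx
      simp only [siteArg, shift, siteIndex, id, Sum.elim_inl, Sum.elim_inr, Function.update_self,
        Function.update_of_ne (zero_ne_one : (0 : Fin (N + 2)) ≠ 1), if_true]
      ring
    · simp only [siteArg, shift, siteIndex, id, Sum.elim_inl, Sum.elim_inr, Function.update_self,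
        Function.update_of_ne hx,
        Function.update_of_ne (zero_ne_one : (0 : Fin (N + 2)) ≠ 1), hx, if_false]
      ring

lemma siteArg_shift_of_ne (η a : ℂ) (t : Fin (N + 2) → ℂ) {k : Fin (N + 2)} (h0 : k ≠ 0)
    (h1 : k ≠ 1) (x : Site N) :
    siteArg η (shift k a t) x =
      if siteIndex x = k then siteArg η t x - 2 * a else siteArg η t x := by
  rcases x with x | x
  all_goals
    by_cases hx : x = k
    · subst hx
      simp only [siteArg, shift, siteIndex, id, Sum.elim_inl, Sum.elim_inr, Function.update_self,
        Function.update_of_ne h0.symm, Function.update_of_ne h1.symm, if_true]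
      ring
    · simp only [siteArg, shift, siteIndex, id, Sum.elim_inl, Sum.elim_inr,
        Function.update_of_ne hx,
        Function.update_of_ne h0.symm, Function.update_of_ne h1.symm, hx, if_false]

lemma IsHalfPeriod.chainExpansion_shift_zero (H : IsHalfPeriod τ u β π χ q q')
    (t : Fin (N + 2) → ℂ) {F F' : List (Fin 4) → ℂ}
    (hF : ∀ w, w.length = 2 * (N + 1) → F' (w.map π) = wordProd χ w * F w) :
    chainExpansion τ η (shift 0 u t) F' =
      ((chainSites N).map fun x => q (siteArg η t x)).prod •
        (sigmaIndex β (fun p => p ≠ 0) * chainExpansion τ η t F) := by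
  rw [chainExpansion, chainExpansion, ← H.wordExpansion_chain _ hF]
  congr 1
  exact List.map_congr_left fun x hx => by rw [siteArg_shift_zero η u t hx]

lemma IsHalfPeriod.chainExpansion_shift_one (H : IsHalfPeriod τ u β π χ q q')
    (t : Fin (N + 2) → ℂ) {F F' : List (Fin 4) → ℂ}
    (hF : ∀ w, w.length = 2 * (N + 1) → F' (w.map π) = wordProd χ w * F w) :
    chainExpansion τ η (shift 1 u t) F' =
      (q' (siteArg η t (bar 1) + u) * q' (siteArg η t (site 1) + u) *
        ((chainSites N).map fun x => q (siteArg η t x)).prod) •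
        (sigmaPair β 1 * (sigmaIndex β (fun p => p ≠ 0) * chainExpansion τ η t F) *
          sigmaPair β 1) := by
  have h : chainExpansion τ η (shift 1 u t) F' =
      wordExpansion τ ((chainSites N).map fun x =>
        (x, if siteIndex x = 1 then siteArg η t x + u - 2 * u else siteArg η t x + u)) F' := by
    rw [chainExpansion]
    congr 1
    exact List.map_congr_left fun x _ => by rw [siteArg_shift_one]
  rw [h, H.wordExpansion_back (fun x => siteArg η t x + u) one_ne_zero, H.wordExpansion_chain _ hF,
    Matrix.mul_smul, Matrix.smul_mul, smul_smul]
  rfl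

lemma IsHalfPeriod.chainExpansion_shift_of_ne (H : IsHalfPeriod τ u β π χ q q')
    (t : Fin (N + 2) → ℂ) (F : List (Fin 4) → ℂ) {k : Fin (N + 2)} (h0 : k ≠ 0) (h1 : k ≠ 1) :
    chainExpansion τ η (shift k u t) F =
      (q' (siteArg η t (bar k)) * q' (siteArg η t (site k))) •
        (sigmaPair β k * chainExpansion τ η t F * sigmaPair β k) := by
  rw [chainExpansion, chainExpansion, ← H.wordExpansion_back _ h0]
  congr 1
  exact List.map_congr_left fun x _ => by rw [siteArg_shift_of_ne η u t h0 h1]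

/-- The pair at site 1 commutes with the chain, which does not contain it, and meets the σ^β
produced by the translation at the singlets. The hypothesis `hc` balances the scalars of the
brackets, the theta functions and the trace. -/
lemma IsHalfPeriod.transfer_shift_zero (H : IsHalfPeriod τ u β π χ q q')
    (t : Fin (N + 2) → ℂ) {F F' : List (Fin 4) → ℂ} {c : ℂ} (hn : NeutralSupport N F)
    (hF : ∀ w, w.length = 2 * (N + 1) → F' (w.map π) = wordProd χ w * (c * F w))
    (hc : prefactor τ η (shift 0 u t) * (((chainSites N).map fun x => q (siteArg η t x)).prod * c) =
      (-1) ^ (N + 1) * prefactor τ η t) :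
    sigmaPair β 0 * transfer τ η (shift 0 u t) F' =
      (-1 : ℂ) ^ (N + 1) • (transfer τ η t F * sigmaIndex β fun p => p ≠ 0 ∧ p ≠ 1) := by
  have h1 : chainExpansion τ η t (fun w => c * F w) = c • chainExpansion τ η t F :=
    wordExpansion_smul τ _ c F
  rw [transfer, transfer, H.chainExpansion_shift_zero t hF, h1, Matrix.mul_smul, Matrix.smul_mul,
    Matrix.mul_smul, Matrix.mul_smul, H.sigmaIndex_mul_chainExpansion hn]
  have h2 : sigmaPair β 0 * (chainExpansion τ η t F * sigmaIndex β (fun p => p ≠ 0) *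
      singletProj N) = chainExpansion τ η t F * singletProj N *
        sigmaIndex β fun p => p ≠ 0 ∧ p ≠ 1 := by
    rw [mul_assoc, ← mul_assoc (sigmaPair β 0), sigmaPair_zero_mul_chainExpansion, mul_assoc,
      H.sigmaIndex_mul_singletProj, mul_assoc]
  simp only [Matrix.mul_smul, Matrix.smul_mul, smul_smul, h2]
  congr 1
  linear_combination (1 / (2 * theta τ 0 (2 * η))) ^ (2 * (N + 1)) * hc

/-- The conjugation at the pair 2 leaves one σ^β pair on each side of the chain. The left one
cancels; the right one acts on the singlets exactly as the pair at site 1, which reduces the matrix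
part to the previous case. -/
lemma IsHalfPeriod.transfer_shift_one (H : IsHalfPeriod τ u β π χ q q')
    (t : Fin (N + 2) → ℂ) {F F' : List (Fin 4) → ℂ} {c : ℂ} (hn : NeutralSupport N F)
    (hF : ∀ w, w.length = 2 * (N + 1) → F' (w.map π) = wordProd χ w * (c * F w))
    (hc : prefactor τ η (shift 1 u t) *
      (q' (siteArg η t (bar 1) + u) * q' (siteArg η t (site 1) + u) *
        ((chainSites N).map fun x => q (siteArg η t x)).prod * c) =
      (-1) ^ (N + 1) * prefactor τ η t) :
    sigmaPair β 1 * transfer τ η (shift 1 u t) F' =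
      (-1 : ℂ) ^ (N + 1) • (transfer τ η t F * sigmaIndex β fun p => p ≠ 0 ∧ p ≠ 1) := by
  have h1 : chainExpansion τ η t (fun w => c * F w) = c • chainExpansion τ η t F :=
    wordExpansion_smul τ _ c F
  have h3 : sigmaPair β 1 * singletProj N = sigmaPair β 0 * singletProj N := by
    conv_rhs => rw [← sigmaPair_mul_sigmaPair_mul_singletProj H.ne_zero, ← mul_assoc,
      sigmaPair_mul_self, one_mul]
  rw [transfer, transfer, H.chainExpansion_shift_one t hF, h1]
  have h2 : sigmaPair β 1 * ((sigmaPair β 1 * (sigmaIndex β (fun p => p ≠ 0) *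
      chainExpansion τ η t F) * sigmaPair β 1) * singletProj N) =
      chainExpansion τ η t F * singletProj N * sigmaIndex β fun p => p ≠ 0 ∧ p ≠ 1 := by
    rw [mul_assoc, ← mul_assoc (sigmaPair β 1), ← mul_assoc (sigmaPair β 1) (sigmaPair β 1),
      sigmaPair_mul_self, one_mul, h3, H.sigmaIndex_mul_chainExpansion hn, mul_assoc,
      mul_assoc (chainExpansion τ η t F), ← H.sigmaIndex_mul_singletProj, ← mul_assoc (sigmaPair β 0),
      ← mul_assoc (sigmaIndex β _), sigmaPair_eq_sigmaIndex, sigmaIndex_comm]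
  simp only [Matrix.mul_smul, Matrix.smul_mul, smul_smul, h2]
  congr 1
  linear_combination (1 / (2 * theta τ 0 (2 * η))) ^ (2 * (N + 1)) * hc

lemma IsHalfPeriod.transfer_shift_of_ne (H : IsHalfPeriod τ u β π χ q q')
    (t : Fin (N + 2) → ℂ) (F : List (Fin 4) → ℂ) {k : Fin (N + 2)} (h0 : k ≠ 0) (h1 : k ≠ 1)
    (hc : prefactor τ η (shift k u t) * (q' (siteArg η t (bar k)) * q' (siteArg η t (site k))) =
      prefactor τ η t) :
    sigmaPair β k * transfer τ η (shift k u t) F = transfer τ η t F * sigmaPair β k := by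
  rw [transfer, transfer, H.chainExpansion_shift_of_ne t F h0 h1]
  have h2 : sigmaPair β k * (sigmaPair β k * chainExpansion τ η t F * sigmaPair β k *
      singletProj N) = chainExpansion τ η t F * singletProj N * sigmaPair β k := by
    rw [mul_assoc, mul_assoc, ← mul_assoc (sigmaPair β k) (sigmaPair β k), sigmaPair_mul_self,
      one_mul, mul_assoc, sigmaPair_eq_sigmaIndex,
      singletProj_mul_sigmaIndex β _ (by simp [h0.symm, h1.symm])]
  simp only [Matrix.mul_smul, Matrix.smul_mul, smul_smul, h2]
  congr 1
  linear_combination (1 / (2 * theta τ 0 (2 * η))) ^ (2 * (N + 1)) * hc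

end Base

end EightVertex

end

noncomputable section
namespace EightVertex

/-! ### Scalar factors of the base transfer matrix -/

section Base

variable {N : ℕ} {τ η : ℂ}

/-- The translation by `u` multiplies `[x]` by `-e x`, and that by `-u` by `-e' x`. -/
structure BracketShift (τ η u : ℂ) (e e' : ℂ → ℂ) : Prop where
  ne_zero : ∀ x, e x ≠ 0
  ne_zero' : ∀ x, e' x ≠ 0
  add : ∀ x, bracket τ η (x + u) = -e x * bracket τ η x
  sub : ∀ x, bracket τ η (x - u) = -e' x * bracket τ η x

lemma bracketShift_half (τ η : ℂ) : BracketShift τ η (1 / 2) (fun _ => 1) (fun _ => 1) := by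
  have h : ∀ x, bracket τ η (x + 1 / 2) = -1 * bracket τ η x := by
    intro x
    rw [bracket, bracket, show 2 * (x + 1 / 2) = 2 * x + 1 by ring, theta_add_one]
    simp [charA]
    ring
  refine ⟨fun _ => one_ne_zero, fun _ => one_ne_zero, h, fun x => ?_⟩
  have := h (x - 1 / 2)
  rw [sub_add_cancel] at this
  rw [this]
  ring

lemma bracketShift_half_tau (τ η : ℂ) :
    BracketShift τ η (τ / 2) (fun x => exp (-Real.pi * I * (τ + 4 * x)))
      (fun x => exp (Real.pi * I * (4 * x - τ))) := by
  have h : ∀ x, bracket τ η (x + τ / 2) =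
      -exp (-Real.pi * I * (τ + 4 * x)) * bracket τ η x := by
    intro x
    rw [bracket, bracket, show 2 * (x + τ / 2) = 2 * x + τ by ring, theta_add_tau,
      show τ + 2 * (2 * x) = τ + 4 * x by ring]
    simp [charB]
    ring
  refine ⟨fun _ => exp_ne_zero _, fun _ => exp_ne_zero _, h, fun x => ?_⟩
  have h1 := h (x - τ / 2)
  have he : exp (Real.pi * I * (4 * x - τ)) * exp (-Real.pi * I * (τ + 4 * (x - τ / 2))) = 1 := by
    rw [← exp_add, ← exp_zero]
    congr 1
    ring
  rw [sub_add_cancel] at h1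
  rw [h1]
  linear_combination (-bracket τ η (x - τ / 2)) * he

lemma prefactor_eq (τ η : ℂ) (t : Fin (N + 2) → ℂ) :
    prefactor τ η t = (bracket τ η (t 0 - t 1))⁻¹ *
      ∏ p : Fin N, ((bracket τ η (t 0 - t p.succ.succ))⁻¹ *
        (bracket τ η (t 1 - t p.succ.succ))⁻¹) := by
  have h1 : ∀ p : Fin N, p.succ.succ ≠ (1 : Fin (N + 2)) := fun p h => by
    simpa using congrArg Fin.val h
  rw [prefactor, one_div, mul_inv, Finset.prod_filter, Fin.prod_univ_succ, Fin.prod_univ_succ]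
  simp [h1, Finset.prod_mul_distrib, mul_comm]

lemma succ_succ_ne_one (p : Fin N) : p.succ.succ ≠ (1 : Fin (N + 2)) := fun h => by
  simpa using congrArg Fin.val h

variable {u : ℂ} {e e' : ℂ → ℂ}

/-- Exactly N + 1 brackets contain t₁, and each changes its sign. This is the origin of (-1)^{n-1}.
-/
lemma BracketShift.prefactor_shift_zero (h : BracketShift τ η u e e') (t : Fin (N + 2) → ℂ) :
    prefactor τ η (shift 0 u t) * (e (t 0 - t 1) * ∏ p : Fin N, e (t 0 - t p.succ.succ)) =
      (-1) ^ (N + 1) * prefactor τ η t := by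
  rw [prefactor_eq, prefactor_eq, mul_mul_mul_comm, ← Finset.prod_mul_distrib, pow_succ',
    mul_mul_mul_comm]
  congr 1
  · simp only [shift, Function.update_self,
      Function.update_of_ne (one_ne_zero : (1 : Fin (N + 2)) ≠ 0)]
    rw [show t 0 + u - t 1 = t 0 - t 1 + u by ring, h.add]
    have := h.ne_zero (t 0 - t 1)
    by_cases hb : bracket τ η (t 0 - t 1) = 0
    · simp [hb]
    · field_simp
  · rw [show ((-1 : ℂ)) ^ N = ∏ _p : Fin N, (-1 : ℂ) by simp, ← Finset.prod_mul_distrib]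
    refine Finset.prod_congr rfl fun p _ => ?_
    simp only [shift, Function.update_self, Function.update_of_ne (Fin.succ_ne_zero _),
      Function.update_of_ne (one_ne_zero : (1 : Fin (N + 2)) ≠ 0)]
    rw [show t 0 + u - t p.succ.succ = t 0 - t p.succ.succ + u by ring, h.add, mul_inv, inv_neg]
    have := h.ne_zero (t 0 - t p.succ.succ)
    field_simp

lemma BracketShift.prefactor_shift_one (h : BracketShift τ η u e e') (t : Fin (N + 2) → ℂ) :
    prefactor τ η (shift 1 u t) * (e' (t 0 - t 1) * ∏ p : Fin N, e (t 1 - t p.succ.succ)) =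
      (-1) ^ (N + 1) * prefactor τ η t := by
  rw [prefactor_eq, prefactor_eq, mul_mul_mul_comm, ← Finset.prod_mul_distrib, pow_succ',
    mul_mul_mul_comm]
  congr 1
  · simp only [shift, Function.update_self,
      Function.update_of_ne (zero_ne_one : (0 : Fin (N + 2)) ≠ 1)]
    rw [show t 0 - (t 1 + u) = t 0 - t 1 - u by ring, h.sub, mul_inv, inv_neg]
    have := h.ne_zero' (t 0 - t 1)
    field_simp
  · rw [show ((-1 : ℂ)) ^ N = ∏ _p : Fin N, (-1 : ℂ) by simp, ← Finset.prod_mul_distrib]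
    refine Finset.prod_congr rfl fun p _ => ?_
    simp only [shift, Function.update_self, Function.update_of_ne (succ_succ_ne_one _),
      Function.update_of_ne (zero_ne_one : (0 : Fin (N + 2)) ≠ 1)]
    rw [show t 1 + u - t p.succ.succ = t 1 - t p.succ.succ + u by ring, h.add, mul_inv, inv_neg]
    have := h.ne_zero (t 1 - t p.succ.succ)
    field_simp

/-- Two brackets contain t_k, so their signs cancel. -/
lemma BracketShift.prefactor_shift_of_ne (h : BracketShift τ η u e e') (t : Fin (N + 2) → ℂ)
    {k : Fin (N + 2)} (h0 : k ≠ 0) (h1 : k ≠ 1) :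
    prefactor τ η (shift k u t) * (e' (t 0 - t k) * e' (t 1 - t k)) = prefactor τ η t := by
  obtain ⟨k, rfl⟩ := Fin.exists_succ_eq.2 h0
  obtain ⟨k, rfl⟩ := Fin.exists_succ_eq.2 (show k ≠ 0 from fun hk => h1 (by rw [hk]; rfl))
  rw [prefactor_eq, prefactor_eq, ← Finset.mul_prod_erase _ _ (Finset.mem_univ k),
    ← Finset.mul_prod_erase Finset.univ (fun p : Fin N => (bracket τ η (t 0 - t p.succ.succ))⁻¹ *
        (bracket τ η (t 1 - t p.succ.succ))⁻¹) (Finset.mem_univ k)]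
  have hp : ∏ p ∈ Finset.univ.erase k,
      ((bracket τ η (shift k.succ.succ u t 0 - shift k.succ.succ u t p.succ.succ))⁻¹ *
        (bracket τ η (shift k.succ.succ u t 1 - shift k.succ.succ u t p.succ.succ))⁻¹) =
      ∏ p ∈ Finset.univ.erase k, ((bracket τ η (t 0 - t p.succ.succ))⁻¹ *
        (bracket τ η (t 1 - t p.succ.succ))⁻¹) := by
    refine Finset.prod_congr rfl fun p hp => ?_
    have : p.succ.succ ≠ k.succ.succ := by
      simpa using Finset.ne_of_mem_erase hp
    simp only [shift, Function.update_of_ne this, Function.update_of_ne h0.symm,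
      Function.update_of_ne h1.symm]
  rw [hp]
  simp only [shift, Function.update_self, Function.update_of_ne h0.symm,
      Function.update_of_ne h1.symm, sub_add_eq_sub_sub, h.sub, mul_inv, inv_neg]
  have := h.ne_zero' (t 0 - t k.succ.succ)
  have := h.ne_zero' (t 1 - t k.succ.succ)
  field_simp

/-- The transfer matrix with the values of a functional replaced by `X`. -/
def familyTransfer (τ η : ℂ) (X : List (Fin 4) → ℂ → ℂ) (t : Fin (N + 2) → ℂ) : Op N :=
  transfer τ η t fun w => X w (t 0 - t 1)

lemma shift_zero_sub (a : ℂ) (t : Fin (N + 2) → ℂ) :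
    shift 0 a t 0 - shift 0 a t 1 = t 0 - t 1 + a := by
  simp only [shift, Function.update_self,
    Function.update_of_ne (one_ne_zero : (1 : Fin (N + 2)) ≠ 0)]
  ring

lemma shift_one_sub (a : ℂ) (t : Fin (N + 2) → ℂ) :
    shift 1 a t 0 - shift 1 a t 1 = t 0 - t 1 - a := by
  simp only [shift, Function.update_self,
    Function.update_of_ne (zero_ne_one : (0 : Fin (N + 2)) ≠ 1)]
  ring

lemma shift_of_ne_sub (a : ℂ) (t : Fin (N + 2) → ℂ) {k : Fin (N + 2)} (h0 : k ≠ 0) (h1 : k ≠ 1) :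
    shift k a t 0 - shift k a t 1 = t 0 - t 1 := by
  simp only [shift, Function.update_of_ne h0.symm, Function.update_of_ne h1.symm]

lemma familyTransfer_half_zero {X : List (Fin 4) → ℂ → ℂ}
    (hX : ∀ w, w.length = 2 * (N + 1) → ∀ t, X (w.map permA) (t + 1 / 2) = wordProd sgnA w * X w t)
    (hn : ∀ w, w.length = 2 * (N + 1) → ∀ t, ¬ Neutral w → X w t = 0) (t : Fin (N + 2) → ℂ) :
    sigmaPair 1 0 * familyTransfer τ η X (shift 0 (1 / 2) t) =
      (-1 : ℂ) ^ (N + 1) • (familyTransfer τ η X t * sigmaIndex 1 fun p => p ≠ 0 ∧ p ≠ 1) := by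
  refine (isHalfPeriod_half τ).transfer_shift_zero (η := η) t (c := 1)
    (fun w hw h => hn w hw _ h) (fun w hw => ?_) ?_
  · rw [shift_zero_sub, hX w hw, one_mul]
  · rw [← (bracketShift_half τ η).prefactor_shift_zero t]
    simp [length_chainSites, pow_mul]

/-- The translation of t₂ lowers t₁₂, so the law of X is used backwards, at t₁₂ - 1/2 and for the
permuted word. For neutral words the two sign products are inverse to each other. -/
lemma familyTransfer_half_one {X : List (Fin 4) → ℂ → ℂ}
    (hX : ∀ w, w.length = 2 * (N + 1) → ∀ t, X (w.map permA) (t + 1 / 2) = wordProd sgnA w * X w t)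
    (hn : ∀ w, w.length = 2 * (N + 1) → ∀ t, ¬ Neutral w → X w t = 0) (t : Fin (N + 2) → ℂ) :
    sigmaPair 1 1 * familyTransfer τ η X (shift 1 (1 / 2) t) =
      (-1 : ℂ) ^ (N + 1) • (familyTransfer τ η X t * sigmaIndex 1 fun p => p ≠ 0 ∧ p ≠ 1) := by
  refine (isHalfPeriod_half τ).transfer_shift_one (η := η) t (c := 1)
    (fun w hw h => hn w hw _ h) (fun w hw => ?_) ?_
  · have hev : Even w.length := by rw [hw]; exact even_two_mul _
    rw [shift_one_sub, one_mul]
    by_cases h : Neutral w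
    · have h1 := hX (w.map permA) (by simpa using hw) (t 0 - t 1 - 1 / 2)
      rw [map_permA_permA, sub_add_cancel] at h1
      have h2 := wordProd_sgnA_permA hev
      rw [h.1] at h2
      rw [h1]
      linear_combination (-X (w.map permA) (t 0 - t 1 - 1 / 2)) * h2
    · rw [hn w hw _ h, hn (w.map permA) (by simpa using hw) _ (by rwa [neutral_permA hev]),
        mul_zero]
  · rw [← (bracketShift_half τ η).prefactor_shift_one t]
    simp [length_chainSites, pow_mul]

lemma familyTransfer_half_of_ne (X : List (Fin 4) → ℂ → ℂ) (t : Fin (N + 2) → ℂ)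
    {k : Fin (N + 2)} (h0 : k ≠ 0) (h1 : k ≠ 1) :
    sigmaPair 1 k * familyTransfer τ η X (shift k (1 / 2) t) =
      familyTransfer τ η X t * sigmaPair 1 k := by
  rw [familyTransfer, familyTransfer, shift_of_ne_sub _ t h0 h1]
  refine (isHalfPeriod_half τ).transfer_shift_of_ne (η := η) t _ h0 h1 ?_
  rw [← (bracketShift_half τ η).prefactor_shift_of_ne t h0 h1]
  norm_num

lemma familyTransfer_half_tau_of_ne (X : List (Fin 4) → ℂ → ℂ) (t : Fin (N + 2) → ℂ)
    {k : Fin (N + 2)} (h0 : k ≠ 0) (h1 : k ≠ 1) :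
    sigmaPair 3 k * familyTransfer τ η X (shift k (τ / 2) t) =
      familyTransfer τ η X t * sigmaPair 3 k := by
  rw [familyTransfer, familyTransfer, shift_of_ne_sub _ t h0 h1]
  refine (isHalfPeriod_half_tau τ).transfer_shift_of_ne (η := η) t _ h0 h1 ?_
  rw [← (bracketShift_half_tau τ η).prefactor_shift_of_ne t h0 h1, neg_mul_neg, ← exp_add,
    ← exp_add]
  congr 2
  simp only [siteArg, Sum.elim_inl, Sum.elim_inr]
  ring

lemma wordProd_inv (c : Fin 4 → ℂ) (w : List (Fin 4)) :
    wordProd (fun α => (c α)⁻¹) w = (wordProd c w)⁻¹ := by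
  induction w with
  | nil => simp
  | cons α w ih => rw [wordProd_cons, wordProd_cons, ih, mul_inv]

lemma multB_eq (τ : ℂ) {w : List (Fin 4)} (hw : w.length = 2 * (N + 1)) (s : ℂ) :
    multB τ w s = wordProd (fun α => (sgnB α)⁻¹) w *
      exp (-(Real.pi * I * (2 * s + τ / 2))) ^ (N + 1) := by
  rw [multB, wordProd_inv, ← exp_nat_mul, hw]
  congr 2
  push_cast
  ring

lemma familyTransfer_half_tau_zero {X X' : List (Fin 4) → ℂ → ℂ}
    (hX : ∀ w, w.length = 2 * (N + 1) → ∀ t, X' (w.map permB) (t + τ / 2) = multB τ w t * X w t)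
    (hn : ∀ w, w.length = 2 * (N + 1) → ∀ t, ¬ Neutral w → X w t = 0) (t : Fin (N + 2) → ℂ) :
    sigmaPair 3 0 * familyTransfer τ η X' (shift 0 (τ / 2) t) =
      (-1 : ℂ) ^ (N + 1) • (familyTransfer τ η X t * sigmaIndex 3 fun p => p ≠ 0 ∧ p ≠ 1) := by
  refine (isHalfPeriod_half_tau τ).transfer_shift_zero (η := η) t
    (c := exp (-(Real.pi * I * (2 * (t 0 - t 1) + τ / 2))) ^ (N + 1))
    (fun w hw h => hn w hw _ h) (fun w hw => ?_) ?_
  · rw [shift_zero_sub, hX w hw, multB_eq τ hw, mul_assoc]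
  · rw [← (bracketShift_half_tau τ η).prefactor_shift_zero t]
    congr 1
    rw [prod_chainSites, pow_succ', mul_mul_mul_comm, ← exp_add, ← exp_add]
    congr 1
    · congr 1
      simp only [siteArg, Sum.elim_inl, Sum.elim_inr]
      ring
    · rw [← Fin.prod_const, ← Finset.prod_mul_distrib]
      refine Finset.prod_congr rfl fun p _ => ?_
      rw [← exp_add, ← exp_add]
      congr 1
      simp only [siteArg, Sum.elim_inl, Sum.elim_inr]
      ring

/-- Since t₁₂ is lowered, the law is inverted: the family X' in the translated matrix is the target
of the law and X its source. This exchange reverses the sign of the jump compared with t₁. -/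
lemma familyTransfer_half_tau_one {X X' : List (Fin 4) → ℂ → ℂ}
    (hX : ∀ w, w.length = 2 * (N + 1) → ∀ t, X (w.map permB) (t + τ / 2) = multB τ w t * X' w t)
    (hn : ∀ w, w.length = 2 * (N + 1) → ∀ t, ¬ Neutral w → X w t = 0)
    (hn' : ∀ w, w.length = 2 * (N + 1) → ∀ t, ¬ Neutral w → X' w t = 0) (t : Fin (N + 2) → ℂ) :
    sigmaPair 3 1 * familyTransfer τ η X' (shift 1 (τ / 2) t) =
      (-1 : ℂ) ^ (N + 1) • (familyTransfer τ η X t * sigmaIndex 3 fun p => p ≠ 0 ∧ p ≠ 1) := by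
  refine (isHalfPeriod_half_tau τ).transfer_shift_one (η := η) t
    (c := exp (Real.pi * I * (2 * (t 0 - t 1) - τ / 2)) ^ (N + 1))
    (fun w hw h => hn w hw _ h) (fun w hw => ?_) ?_
  · have hev : Even w.length := by rw [hw]; exact even_two_mul _
    rw [shift_one_sub]
    by_cases h : Neutral w
    · have h1 := hX (w.map permB) (by simpa using hw) (t 0 - t 1 - τ / 2)
      have h3 := multB_eq (N := N) τ (w := w.map permB) (by simpa using hw) (t 0 - t 1 - τ / 2)
      rw [map_permB_permB, sub_add_cancel, h3] at h1
      have h2 : wordProd (fun α => (sgnB α)⁻¹) w * wordProd (fun α => (sgnB α)⁻¹) (w.map permB) =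
          1 := by
        rw [wordProd_inv, wordProd_inv, ← mul_inv, mul_comm, wordProd_sgnB_permB hev, h.2, inv_one]
      have h4 : exp (Real.pi * I * (2 * (t 0 - t 1) - τ / 2)) ^ (N + 1) *
          exp (-(Real.pi * I * (2 * (t 0 - t 1 - τ / 2) + τ / 2))) ^ (N + 1) = 1 := by
        rw [← mul_pow, ← exp_add]
        convert one_pow _ using 2
        rw [← exp_zero]
        congr 1
        ring
      rw [h1]
      linear_combination (-X' (w.map permB) (t 0 - t 1 - τ / 2)) * h2 -
        wordProd (fun α => (sgnB α)⁻¹) w * wordProd (fun α => (sgnB α)⁻¹) (w.map permB) *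
        X' (w.map permB) (t 0 - t 1 - τ / 2) * h4
    · rw [hn w hw _ h, hn' (w.map permB) (by simpa using hw) _ (by rwa [neutral_permB hev]),
        mul_zero, mul_zero]
  · rw [← (bracketShift_half_tau τ η).prefactor_shift_one t]
    congr 1
    rw [prod_chainSites, pow_succ']
    rw [show ∀ a b c d e f g : ℂ, a * b * (c * d * e) * (f * g) = (a * b * (c * d) * f) * (e * g)
      by intros; ring, neg_mul_neg]
    simp only [← exp_add]
    congr 1
    · congr 1
      simp only [siteArg, Sum.elim_inl, Sum.elim_inr]
      ring
    · rw [← Fin.prod_const, ← Finset.prod_mul_distrib]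
      refine Finset.prod_congr rfl fun p _ => ?_
      rw [← exp_add]
      congr 1
      simp only [siteArg, Sum.elim_inl, Sum.elim_inr]
      ring

end Base

end EightVertex

end

noncomputable section
namespace EightVertex

/-! ### Quasi-periodicity of the `R` matrices -/

section Rmatrix

variable {ι : Type} [Fintype ι] [DecidableEq ι]

/-- The operator `r_{xy}(t)`. -/
def rmat (τ η : ℂ) (x y : ι) (t : ℂ) : Matrix (ι → Fin 2) (ι → Fin 2) ℂ :=
  (1 / 2 : ℂ) • ∑ α : Fin 4, (theta τ α (2 * t + η) / theta τ α η) • (sigma α x * sigma α y)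

lemma Rmat_eq_smul_rmat (τ η : ℂ) (ρ : ℂ → ℂ) (x y : ι) (t : ℂ) :
    Rmat τ η ρ x y t = (ρ t / bracket τ η (t + η)) • rmat τ η x y t := rfl

lemma pauliSign_mul_self (β α : Fin 4) : pauliSign β α * pauliSign β α = 1 := by
  rw [pauliSign]; split_ifs <;> norm_num

lemma sigma_mul_sigma_of_ne (β α : Fin 4) {x y : ι} (h : x ≠ y) :
    sigma β x * sigma α y = sigma α y * sigma β x := by
  rw [sigma_eq_sigmaOn β x]
  exact sigmaOn_mul_sigma_of_notMem β α _ h.symm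

lemma sigma_mul_sigma_self (β α : Fin 4) (x : ι) :
    sigma β x * sigma α x = pauliSign β α • (sigma α x * sigma β x) := by
  rw [sigma_eq_sigmaOn β x]
  exact sigmaOn_mul_sigma_of_mem β α _ rfl

lemma sigma_sq (β : Fin 4) (x : ι) : sigma β x * sigma β x = 1 := by
  rw [sigma_eq_sigmaOn]
  exact sigmaOn_mul_self β _

lemma sigma_conj_sigma_mul_sigma (β α : Fin 4) {x y : ι} (h : x ≠ y) :
    sigma β x * (sigma α x * sigma α y) * sigma β x =
      pauliSign β α • (sigma α x * sigma α y) := by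
  rw [← mul_assoc, sigma_mul_sigma_self, Matrix.smul_mul, Matrix.smul_mul, mul_assoc (sigma α x),
    sigma_mul_sigma_of_ne β α h, mul_assoc, mul_assoc, sigma_sq, mul_one]

lemma sigma_mul_sigma_comm (α : Fin 4) {x y : ι} (h : x ≠ y) :
    sigma α x * sigma α y = sigma α y * sigma α x := sigma_mul_sigma_of_ne α α h

/-- Conjugation by σ^β at either site multiplies the term σ^α_x σ^α_y by the same sign, so it may be
performed at x or at y. -/
lemma rmat_conj (τ η : ℂ) (β : Fin 4) {x y : ι} (h : x ≠ y) {t t' c : ℂ}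
    (hc : ∀ α, theta τ α (2 * t' + η) = c * pauliSign β α * theta τ α (2 * t + η)) :
    rmat τ η x y t' = c • (sigma β x * rmat τ η x y t * sigma β x) ∧
    rmat τ η x y t' = c • (sigma β y * rmat τ η x y t * sigma β y) := by
  have h1 : ∀ z, (z = x ∨ z = y) → ∀ α, sigma β z * (sigma α x * sigma α y) * sigma β z =
      pauliSign β α • (sigma α x * sigma α y) := by
    rintro z (rfl | rfl) α
    · exact sigma_conj_sigma_mul_sigma β α h
    · rw [sigma_mul_sigma_comm α h]
      exact sigma_conj_sigma_mul_sigma β α h.symm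
  have h2 : ∀ z, (z = x ∨ z = y) →
      rmat τ η x y t' = c • (sigma β z * rmat τ η x y t * sigma β z) := by
    intro z hz
    rw [rmat, rmat, Matrix.mul_smul, Matrix.smul_mul, smul_comm c, Finset.mul_sum, Finset.sum_mul,
      Finset.smul_sum (r := c)]
    congr 1
    refine Finset.sum_congr rfl fun α _ => ?_
    rw [Matrix.mul_smul, Matrix.smul_mul, h1 z hz, smul_smul, smul_smul, hc]
    congr 1
    ring
  exact ⟨h2 x (Or.inl rfl), h2 y (Or.inr rfl)⟩

/-- The `R` matrix is regular and nonzero at `s` and at its translates by `± u`. -/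
structure GoodArg (τ η : ℂ) (ρ : ℂ → ℂ) (u s : ℂ) : Prop where
  rho : ρ s ≠ 0
  rho_add : ρ (s + u) ≠ 0
  rho_sub : ρ (s - u) ≠ 0
  br : bracket τ η (s + η) ≠ 0

variable {N : ℕ} {τ η u : ℂ} {β : Fin 4} {π : Fin 4 → Fin 4} {χ : Fin 4 → ℂ} {q q' e e' : ℂ → ℂ}

/-- The theta argument 2s + η moves by the full period ±2u, which multiplies each term by a common
scalar and the commutation sign. The scalar, which includes the values of ρ, need only be nonzero.
-/
lemma IsHalfPeriod.Rmat_conj (H : IsHalfPeriod τ u β π χ q q') (K : BracketShift τ η u e e')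
    {ρ : ℂ → ℂ} {s s' : ℂ} (hg : GoodArg τ η ρ u s) (hs : s' = s + u ∨ s' = s - u)
    {x y : ι} (h : x ≠ y) :
    ∃ c : ℂ, c ≠ 0 ∧
      Rmat τ η ρ x y s' = c • (sigma β x * Rmat τ η ρ x y s * sigma β x) ∧
      Rmat τ η ρ x y s' = c • (sigma β y * Rmat τ η ρ x y s * sigma β y) := by
  obtain ⟨c, hc, hrho, hbr, hth⟩ : ∃ c : ℂ, c ≠ 0 ∧ ρ s' ≠ 0 ∧ bracket τ η (s' + η) ≠ 0 ∧
      ∀ α, theta τ α (2 * s' + η) = c * pauliSign β α * theta τ α (2 * s + η) := by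
    rcases hs with rfl | rfl
    · refine ⟨(q' (2 * s + η + 2 * u))⁻¹, inv_ne_zero (H.back_ne_zero _), hg.rho_add, ?_,
        fun α => ?_⟩
      · rw [show s + u + η = s + η + u by ring, K.add]
        exact mul_ne_zero (neg_ne_zero.2 (K.ne_zero _)) hg.br
      · have h1 := H.back α (2 * s + η + 2 * u)
        rw [add_sub_cancel_right] at h1
        rw [h1, show 2 * (s + u) + η = 2 * s + η + 2 * u by ring]
        have h2 := H.back_ne_zero (2 * s + η + 2 * u)
        have h3 := pauliSign_mul_self β α
        field_simp
        linear_combination (-theta τ α (2 * s + η + 2 * u)) * h3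
    · refine ⟨q' (2 * s + η), H.back_ne_zero _, hg.rho_sub, ?_, fun α => ?_⟩
      · rw [show s - u + η = s + η - u by ring, K.sub]
        exact mul_ne_zero (neg_ne_zero.2 (K.ne_zero' _)) hg.br
      · rw [← H.back, show 2 * (s - u) + η = 2 * s + η - 2 * u by ring]
  obtain ⟨h1, h2⟩ := rmat_conj τ η β h hth
  have h3 := hg.rho
  have h4 := hg.br
  refine ⟨ρ s' / bracket τ η (s' + η) * c * (ρ s / bracket τ η (s + η))⁻¹, ?_, ?_, ?_⟩
  · exact mul_ne_zero (mul_ne_zero (div_ne_zero hrho hbr) hc) (inv_ne_zero (div_ne_zero h3 h4))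
  · rw [Rmat_eq_smul_rmat, Rmat_eq_smul_rmat, h1, Matrix.mul_smul, Matrix.smul_mul, smul_smul,
      smul_smul, mul_assoc _ _ (ρ s / bracket τ η (s + η)), inv_mul_cancel₀ (div_ne_zero h3 h4),
      mul_one]
  · rw [Rmat_eq_smul_rmat, Rmat_eq_smul_rmat, h2, Matrix.mul_smul, Matrix.smul_mul, smul_smul,
      smul_smul, mul_assoc _ _ (ρ s / bracket τ η (s + η)), inv_mul_cancel₀ (div_ne_zero h3 h4),
      mul_one]

lemma perm_mul_sigma_left (β : Fin 4) (x y : ι) :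
    perm x y * sigma β y = sigma β x * perm x y := by
  rw [sigma_eq_sigmaOn, sigma_eq_sigmaOn]
  refine perm_mul_sigmaOn β x y _ _ fun z => ?_
  rw [Equiv.swap_apply_eq_iff, Equiv.swap_apply_right]

lemma perm_mul_sigma_right (β : Fin 4) (x y : ι) :
    perm x y * sigma β x = sigma β y * perm x y := by
  rw [sigma_eq_sigmaOn, sigma_eq_sigmaOn]
  refine perm_mul_sigmaOn β x y _ _ fun z => ?_
  rw [Equiv.swap_apply_eq_iff, Equiv.swap_apply_left]

lemma perm_mul_sigma_of_ne (β : Fin 4) {x y z : ι} (hx : z ≠ x) (hy : z ≠ y) :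
    perm x y * sigma β z = sigma β z * perm x y := by
  rw [sigma_eq_sigmaOn]
  refine perm_mul_sigmaOn β x y _ _ fun w => ?_
  rw [Equiv.swap_apply_eq_iff, Equiv.swap_apply_of_ne_of_ne hx hy]

/-- `M'` is up to a nonzero factor the conjugate of `M` by `σ^β` at `x` and `x'`. -/
def Intertwines (β : Fin 4) (x x' : ι) (M M' : Matrix (ι → Fin 2) (ι → Fin 2) ℂ) : Prop :=
  ∃ c : ℂ, c ≠ 0 ∧ M' = c • (sigma β x * M * sigma β x')

lemma Intertwines.mul {x x' x'' : ι} {M M' L L' : Matrix (ι → Fin 2) (ι → Fin 2) ℂ}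
    (h : Intertwines β x x' M M') (h' : Intertwines β x' x'' L L') :
    Intertwines β x x'' (M * L) (M' * L') := by
  obtain ⟨c, hc, rfl⟩ := h
  obtain ⟨c', hc', rfl⟩ := h'
  refine ⟨c * c', mul_ne_zero hc hc', ?_⟩
  rw [Matrix.smul_mul, Matrix.mul_smul, smul_smul]
  congr 1
  calc _ = sigma β x * M * (sigma β x' * sigma β x') * L * sigma β x'' := by
        simp only [mul_assoc]
    _ = _ := by rw [sigma_sq, mul_one]; simp only [mul_assoc]

lemma intertwines_one (β : Fin 4) (x : ι) : Intertwines β x x 1 1 :=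
  ⟨1, one_ne_zero, by rw [mul_one, sigma_sq, one_smul]⟩

/-- The position after one factor is the position before the next, so the inner matrices σ^β cancel
in pairs. -/
lemma Intertwines.list_prod {f f' : ℕ → Matrix (ι → Fin 2) (ι → Fin 2) ℂ} {loc : ℕ → ι} (n : ℕ)
    (h : ∀ m < n, Intertwines β (loc (m + 1)) (loc m) (f m) (f' m)) :
    Intertwines β (loc n) (loc 0) (((List.range n).reverse.map f).prod)
      (((List.range n).reverse.map f').prod) := by
  induction n with
  | zero => exact intertwines_one β _
  | succ n ih =>
    rw [List.range_succ, List.reverse_append, List.reverse_singleton, List.singleton_append,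
      List.map_cons, List.prod_cons, List.map_cons, List.prod_cons]
    exact (h n (Nat.lt_succ_self n)).mul (ih fun m hm => h m (Nat.lt_succ_of_lt hm))

/-- The line `k` enters the `R` matrix of the lines `p` and `q` at `b` and leaves it at `a`. -/
structure Crossing {κ : Type} (k p q : κ) (x y a b : ι) : Prop where
  left : k = p → a = x ∧ b = y
  right : k = q → a = y ∧ b = x
  off : k ≠ p → k ≠ q → a = b ∧ a ≠ x ∧ a ≠ y

lemma sigma_mul_Rmat_of_ne (β : Fin 4) (τ η : ℂ) (ρ : ℂ → ℂ) {x y z : ι} (hx : z ≠ x)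
    (hy : z ≠ y) (t : ℂ) : sigma β z * Rmat τ η ρ x y t = Rmat τ η ρ x y t * sigma β z := by
  rw [Rmat, Matrix.mul_smul, Matrix.smul_mul, Matrix.mul_smul, Matrix.smul_mul, Finset.mul_sum,
    Finset.sum_mul]
  congr 2
  refine Finset.sum_congr rfl fun α _ => ?_
  rw [Matrix.mul_smul, Matrix.smul_mul, ← mul_assoc, sigma_mul_sigma_of_ne β α hx, mul_assoc,
    sigma_mul_sigma_of_ne β α hy, mul_assoc]

/-- If the line takes part in the crossing, the translation conjugates R by σ^β at the site where
the line enters, and the transposition in Ř moves the left factor to the site where it leaves.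
Otherwise nothing is translated, and σ^β at a third site commutes with Ř. -/
lemma IsHalfPeriod.intertwines_Rcheck (H : IsHalfPeriod τ u β π χ q q')
    (K : BracketShift τ η u e e') {ρ : ℂ → ℂ} {t : Fin (N + 2) → ℂ} {k p r : Fin (N + 2)}
    (hpr : p ≠ r) (hg : GoodArg τ η ρ u (t p - t r)) {x y a b : ι} (hxy : x ≠ y)
    (hk : Crossing k p r x y a b) :
    Intertwines β a b (Rcheck τ η ρ x y (t p - t r))
      (Rcheck τ η ρ x y (shift k u t p - shift k u t r)) := by
  by_cases h1 : k = p
  · subst h1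
    obtain ⟨rfl, rfl⟩ := hk.left rfl
    obtain ⟨c, hc, -, hR⟩ := H.Rmat_conj (s' := shift k u t k - shift k u t r) K hg
      (Or.inl (by simp only [shift, Function.update_self, Function.update_of_ne hpr.symm]; ring)) hxy
    refine ⟨c, hc, ?_⟩
    rw [Rcheck, Rcheck, hR, Matrix.mul_smul, ← mul_assoc, ← mul_assoc, perm_mul_sigma_left]
    simp only [mul_assoc]
  · by_cases h2 : k = r
    · subst h2
      obtain ⟨rfl, rfl⟩ := hk.right rfl
      obtain ⟨c, hc, hR, -⟩ := H.Rmat_conj (s' := shift k u t p - shift k u t k) K hg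
        (Or.inr (by simp only [shift, Function.update_self, Function.update_of_ne hpr]; ring)) hxy
      refine ⟨c, hc, ?_⟩
      rw [Rcheck, Rcheck, hR, Matrix.mul_smul, ← mul_assoc, ← mul_assoc, perm_mul_sigma_right]
      simp only [mul_assoc]
    · obtain ⟨rfl, hx, hy⟩ := hk.off h1 h2
      refine ⟨1, one_ne_zero, ?_⟩
      simp only [shift, Function.update_of_ne (Ne.symm h1), Function.update_of_ne (Ne.symm h2)]
      rw [one_smul, Rcheck, ← mul_assoc, ← perm_mul_sigma_of_ne β hx hy, mul_assoc, mul_assoc,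
        ← sigma_mul_Rmat_of_ne β τ η ρ hx hy, ← mul_assoc (sigma β a), sigma_sq, one_mul]

/-- Each term σ^α_x σ^α_y acquires the commutation sign twice. -/
lemma sigmaOn_true_mul_Rcheck (β : Fin 4) (τ η : ℂ) (ρ : ℂ → ℂ) {x y : ι} (t : ℂ) :
    Commute (sigmaOn β fun _ : ι => True) (Rcheck τ η ρ x y t) := by
  have h : ∀ α : Fin 4, Commute (sigmaOn β fun _ : ι => True) (sigma α x * sigma α y) := by
    intro α
    rw [Commute, SemiconjBy, ← mul_assoc, sigmaOn_mul_sigma_of_mem β α _ trivial, Matrix.smul_mul,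
      mul_assoc, sigmaOn_mul_sigma_of_mem β α _ trivial, Matrix.mul_smul, smul_smul,
      pauliSign_mul_self, one_smul, mul_assoc]
  refine Commute.mul_right ?_ ?_
  · exact (perm_mul_sigmaOn β x y (fun _ => True) (fun _ => True) fun z => Iff.rfl).symm
  · rw [Rmat]
    refine (Commute.smul_right ?_ _).smul_right _
    exact Commute.sum_right _ _ _ fun α _ => (h α).smul_right _

end Rmatrix

end EightVertex

end

noncomputable section
namespace EightVertex

/-! ### Lines through the product ℝ -/

section Rprod

variable {N : ℕ} {τ η u : ℂ} {β : Fin 4} {π : Fin 4 → Fin 4} {χ : Fin 4 → ℂ} {q q' e e' : ℂ → ℂ}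

/-- The position of the line `k` when the line `i` has been moved to the position `m`. -/
def firstLoc (i m k : ℕ) : ℕ := if k = i then m else if m ≤ k ∧ k < i then k + 1 else k

/-- The position of the line `k` when the line `i` is at the position `0` and the line `j` has been
moved to the position `m > i`. -/
def secondLoc (i j m k : ℕ) : ℕ :=
  if k = i then 0 else if k < i then k + 1 else if k = j then m else
    if m ≤ k ∧ k < j then k + 1 else k

/-- The position of the line `k` when the line `i` is at the position `0` and the line `j` has been
moved to the position `m + 1 ≤ i + 1`. -/
def thirdLoc (i j m k : ℕ) : ℕ :=
  if k = i then 0 else if k = j then m + 1 else if k < i then (if m ≤ k then k + 2 else k + 1) else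
    if k < j then k + 1 else k

lemma eq_ofNat_iff {k : Fin (N + 2)} {m : ℕ} (hm : m < N + 2) :
    k = Fin.ofNat (N + 2) m ↔ k.val = m := by
  rw [Fin.ext_iff, Fin.val_ofNat, Nat.mod_eq_of_lt hm]

lemma crossing_ofNat {f : Fin (N + 2) → Site N} (hf : Function.Injective f)
    {k p : Fin (N + 2)} {m x y a b : ℕ} (hx : x < N + 2) (hy : y < N + 2) (ha : a < N + 2)
    (hm : m < N + 2)
    (h : (k.val = p.val → a = x ∧ b = y) ∧ (k.val = m → a = y ∧ b = x) ∧
      (k.val ≠ p.val → k.val ≠ m → a = b ∧ a ≠ x ∧ a ≠ y)) :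
    Crossing k p (Fin.ofNat (N + 2) m) (f (Fin.ofNat (N + 2) x)) (f (Fin.ofNat (N + 2) y))
      (f (Fin.ofNat (N + 2) a)) (f (Fin.ofNat (N + 2) b)) := by
  have hne : ∀ {z w : ℕ}, z < N + 2 → w < N + 2 → z ≠ w →
      f (Fin.ofNat (N + 2) z) ≠ f (Fin.ofNat (N + 2) w) := by
    intro z w hz hw h h'
    have := congrArg Fin.val (hf h')
    simp only [Fin.val_ofNat, Nat.mod_eq_of_lt hz, Nat.mod_eq_of_lt hw] at this
    exact h this
  obtain ⟨h1, h2, h3⟩ := h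
  refine ⟨fun h => ?_, fun h => ?_, fun h h' => ?_⟩
  · obtain ⟨rfl, rfl⟩ := h1 (congrArg Fin.val h)
    exact ⟨rfl, rfl⟩
  · obtain ⟨rfl, rfl⟩ := h2 ((eq_ofNat_iff hm).1 h)
    exact ⟨rfl, rfl⟩
  · obtain ⟨rfl, hax, hay⟩ := h3 (fun e => h (Fin.ext e)) fun e => h' ((eq_ofNat_iff hm).2 e)
    exact ⟨rfl, hne ha hx hax, hne ha hy hay⟩

lemma Crossing.swap {κ ι : Type} {k p r : κ} {x y a b : ι} (h : Crossing k p r x y a b) :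
    Crossing k r p y x a b :=
  ⟨h.right, h.left, fun h1 h2 => ⟨(h.off h2 h1).1, (h.off h2 h1).2.2, (h.off h2 h1).2.1⟩⟩

lemma crossing_firstLoc {f : Fin (N + 2) → Site N} (hf : Function.Injective f)
    (i k : Fin (N + 2)) {m : ℕ} (hm : m < i) :
    Crossing k i (Fin.ofNat (N + 2) m) (f (Fin.ofNat (N + 2) (m + 1))) (f (Fin.ofNat (N + 2) m))
      (f (Fin.ofNat (N + 2) (firstLoc i (m + 1) k))) (f (Fin.ofNat (N + 2) (firstLoc i m k))) := by
  have hi := i.isLt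
  have hk := k.isLt
  refine crossing_ofNat hf (by omega) (by omega) ?_ (by omega) ?_
  · unfold firstLoc
    split_ifs <;> omega
  · unfold firstLoc
    split_ifs <;> omega

lemma crossing_secondLoc {f : Fin (N + 2) → Site N} (hf : Function.Injective f)
    {i j : Fin (N + 2)} (hij : i < j) (k : Fin (N + 2)) {m : ℕ} (hm : m < j) (hm' : i < m) :
    Crossing k j (Fin.ofNat (N + 2) m) (f (Fin.ofNat (N + 2) (m + 1))) (f (Fin.ofNat (N + 2) m))
      (f (Fin.ofNat (N + 2) (secondLoc i j (m + 1) k)))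
      (f (Fin.ofNat (N + 2) (secondLoc i j m k))) := by
  have hj := j.isLt
  have hk := k.isLt
  have hij' : i.val < j.val := hij
  refine crossing_ofNat hf (by omega) (by omega) ?_ (by omega) ?_
  · unfold secondLoc
    split_ifs <;> omega
  · unfold secondLoc
    split_ifs <;> omega

lemma crossing_thirdLoc {f : Fin (N + 2) → Site N} (hf : Function.Injective f)
    {i j : Fin (N + 2)} (hij : i < j) (k : Fin (N + 2)) {m : ℕ} (hm : m < i) :
    Crossing k j (Fin.ofNat (N + 2) m) (f (Fin.ofNat (N + 2) (m + 2)))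
      (f (Fin.ofNat (N + 2) (m + 1)))
      (f (Fin.ofNat (N + 2) (thirdLoc i j (m + 1) k)))
      (f (Fin.ofNat (N + 2) (thirdLoc i j m k))) := by
  have hj := j.isLt
  have hk := k.isLt
  have hij' : i.val < j.val := hij
  refine crossing_ofNat hf (by omega) (by omega) ?_ (by omega) ?_
  · unfold thirdLoc
    split_ifs <;> omega
  · unfold thirdLoc
    split_ifs <;> omega

/-- Together with `secondLoc_self` and `thirdLoc_self` this matches the positions where consecutive
chains meet: a line k enters on the left at k and ends on the right at the final position of
`thirdLoc`. -/
lemma firstLoc_self (i k : ℕ) : firstLoc i i k = k := by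
  unfold firstLoc
  split_ifs <;> omega

lemma secondLoc_self {i j : ℕ} (hij : i < j) (k : ℕ) : secondLoc i j j k = firstLoc i 0 k := by
  unfold firstLoc secondLoc
  split_ifs <;> omega

lemma thirdLoc_self {i j : ℕ} (hij : i < j) (k : ℕ) :
    thirdLoc i j i k = secondLoc i j (i + 1) k := by
  unfold secondLoc thirdLoc
  split_ifs <;> omega

lemma site_injective : Function.Injective (site : Fin (N + 2) → Site N) := Sum.inl_injective

lemma bar_injective : Function.Injective (bar : Fin (N + 2) → Site N) := Sum.inr_injective

/-- The six chains of `ℝ`, for the unbarred and the barred sites. -/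
def unbarredChain (τ η : ℂ) (ρ : ℂ → ℂ) (i j : Fin (N + 2)) (t : Fin (N + 2) → ℂ) : Op N :=
  ((List.range i.val).reverse.map fun m => Rcheck τ η ρ (site (Fin.ofNat (N + 2) (m + 1)))
    (site (Fin.ofNat (N + 2) m)) (t i - t (Fin.ofNat (N + 2) m))).prod *
  ((List.range (j.val - (i.val + 1))).reverse.map fun m =>
    Rcheck τ η ρ (site (Fin.ofNat (N + 2) (i.val + 1 + m + 1)))
      (site (Fin.ofNat (N + 2) (i.val + 1 + m)))
      (t j - t (Fin.ofNat (N + 2) (i.val + 1 + m)))).prod *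
  ((List.range i.val).reverse.map fun m => Rcheck τ η ρ (site (Fin.ofNat (N + 2) (m + 2)))
    (site (Fin.ofNat (N + 2) (m + 1))) (t j - t (Fin.ofNat (N + 2) m))).prod

/-- The chains of `ℝ` for the barred sites. -/
def barredChain (τ η : ℂ) (ρ : ℂ → ℂ) (i j : Fin (N + 2)) (t : Fin (N + 2) → ℂ) : Op N :=
  ((List.range i.val).reverse.map fun m => Rcheck τ η ρ (bar (Fin.ofNat (N + 2) m))
    (bar (Fin.ofNat (N + 2) (m + 1))) (t (Fin.ofNat (N + 2) m) - t i)).prod *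
  ((List.range (j.val - (i.val + 1))).reverse.map fun m =>
    Rcheck τ η ρ (bar (Fin.ofNat (N + 2) (i.val + 1 + m)))
      (bar (Fin.ofNat (N + 2) (i.val + 1 + m + 1)))
      (t (Fin.ofNat (N + 2) (i.val + 1 + m)) - t j)).prod *
  ((List.range i.val).reverse.map fun m => Rcheck τ η ρ (bar (Fin.ofNat (N + 2) (m + 1)))
    (bar (Fin.ofNat (N + 2) (m + 2))) (t (Fin.ofNat (N + 2) m) - t j)).prod

lemma Rprod_eq (τ η : ℂ) (ρ : ℂ → ℂ) (i j : Fin (N + 2)) (t : Fin (N + 2) → ℂ) :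
    Rprod τ η ρ i j t = unbarredChain τ η ρ i j t * barredChain τ η ρ i j t := by
  simp only [Rprod, unbarredChain, barredChain, List.range'_eq_map_range, ← List.map_reverse,
    List.map_map, Function.comp_def, mul_assoc]

lemma IsHalfPeriod.intertwines_unbarredChain (H : IsHalfPeriod τ u β π χ q q')
    (K : BracketShift τ η u e e') {ρ : ℂ → ℂ} {t : Fin (N + 2) → ℂ}
    (hg : ∀ p r, p ≠ r → GoodArg τ η ρ u (t p - t r)) {i j : Fin (N + 2)} (hij : i < j)
    (k : Fin (N + 2)) :
    Intertwines β (site k) (site (Fin.ofNat (N + 2) (thirdLoc i j 0 k)))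
      (unbarredChain τ η ρ i j t) (unbarredChain τ η ρ i j (shift k u t)) := by
  have hi := i.isLt
  have hj := j.isLt
  have hij' : i.val < j.val := hij
  have h1 := Intertwines.list_prod (β := β)
    (loc := fun m => (site (Fin.ofNat (N + 2) (firstLoc i m k)) : Site N))
    (f := fun m => Rcheck τ η ρ (site (Fin.ofNat (N + 2) (m + 1))) (site (Fin.ofNat (N + 2) m))
      (t i - t (Fin.ofNat (N + 2) m)))
    (f' := fun m => Rcheck τ η ρ (site (Fin.ofNat (N + 2) (m + 1))) (site (Fin.ofNat (N + 2) m))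
      (shift k u t i - shift k u t (Fin.ofNat (N + 2) m)))
    i.val (fun m hm => by
      have hne : i ≠ Fin.ofNat (N + 2) m := by rw [Ne, eq_ofNat_iff (by omega)]; omega
      have hc := crossing_firstLoc site_injective i k hm
      have hxy : (site (Fin.ofNat (N + 2) (m + 1)) : Site N) ≠ site (Fin.ofNat (N + 2) m) := by
        rw [Ne, site_injective.eq_iff, eq_ofNat_iff (by omega), Fin.val_ofNat,
          Nat.mod_eq_of_lt (by omega)]
        omega
      exact H.intertwines_Rcheck K hne (hg _ _ hne) hxy hc)
  have h2 := Intertwines.list_prod (β := β)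
    (loc := fun m => (site (Fin.ofNat (N + 2) (secondLoc i j (i.val + 1 + m) k)) : Site N))
    (f := fun m => Rcheck τ η ρ (site (Fin.ofNat (N + 2) (i.val + 1 + m + 1))) (site (Fin.ofNat (N + 2) (i.val + 1 + m)))
      (t j - t (Fin.ofNat (N + 2) (i.val + 1 + m))))
    (f' := fun m => Rcheck τ η ρ (site (Fin.ofNat (N + 2) (i.val + 1 + m + 1))) (site (Fin.ofNat (N + 2) (i.val + 1 + m)))
      (shift k u t j - shift k u t (Fin.ofNat (N + 2) (i.val + 1 + m))))
    (j.val - (i.val + 1)) (fun m hm => by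
      have hne : j ≠ Fin.ofNat (N + 2) (i.val + 1 + m) := by rw [Ne, eq_ofNat_iff (by omega)]; omega
      have hc := crossing_secondLoc site_injective hij k (m := i.val + 1 + m) (by omega) (by omega)
      have hxy : (site (Fin.ofNat (N + 2) (i.val + 1 + m + 1)) : Site N) ≠ site (Fin.ofNat (N + 2) (i.val + 1 + m)) := by
        rw [Ne, site_injective.eq_iff, eq_ofNat_iff (by omega), Fin.val_ofNat,
          Nat.mod_eq_of_lt (by omega)]
        omega
      exact H.intertwines_Rcheck K hne (hg _ _ hne) hxy hc)
  have h3 := Intertwines.list_prod (β := β)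
    (loc := fun m => (site (Fin.ofNat (N + 2) (thirdLoc i j m k)) : Site N))
    (f := fun m => Rcheck τ η ρ (site (Fin.ofNat (N + 2) (m + 2))) (site (Fin.ofNat (N + 2) (m + 1)))
      (t j - t (Fin.ofNat (N + 2) m)))
    (f' := fun m => Rcheck τ η ρ (site (Fin.ofNat (N + 2) (m + 2))) (site (Fin.ofNat (N + 2) (m + 1)))
      (shift k u t j - shift k u t (Fin.ofNat (N + 2) m)))
    i.val (fun m hm => by
      have hne : j ≠ Fin.ofNat (N + 2) m := by rw [Ne, eq_ofNat_iff (by omega)]; omega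
      have hc := crossing_thirdLoc site_injective hij k hm
      have hxy : (site (Fin.ofNat (N + 2) (m + 2)) : Site N) ≠ site (Fin.ofNat (N + 2) (m + 1)) := by
        rw [Ne, site_injective.eq_iff, eq_ofNat_iff (by omega), Fin.val_ofNat,
          Nat.mod_eq_of_lt (by omega)]
        omega
      exact H.intertwines_Rcheck K hne (hg _ _ hne) hxy hc)
  rw [firstLoc_self, Fin.ofNat_eq_cast, Fin.cast_val_eq_self] at h1
  rw [show i.val + 1 + (j.val - (i.val + 1)) = j.val by omega, secondLoc_self hij', add_zero,
    ← thirdLoc_self hij'] at h2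
  exact (h1.mul h2).mul h3

/-- In the barred chains the two sites and the two spectral parameters of each crossing are
interchanged simultaneously. The same position functions therefore apply after `Crossing.swap`. -/
lemma IsHalfPeriod.intertwines_barredChain (H : IsHalfPeriod τ u β π χ q q')
    (K : BracketShift τ η u e e') {ρ : ℂ → ℂ} {t : Fin (N + 2) → ℂ}
    (hg : ∀ p r, p ≠ r → GoodArg τ η ρ u (t p - t r)) {i j : Fin (N + 2)} (hij : i < j)
    (k : Fin (N + 2)) :
    Intertwines β (bar k) (bar (Fin.ofNat (N + 2) (thirdLoc i j 0 k)))
      (barredChain τ η ρ i j t) (barredChain τ η ρ i j (shift k u t)) := by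
  have hi := i.isLt
  have hj := j.isLt
  have hij' : i.val < j.val := hij
  have h1 := Intertwines.list_prod (β := β)
    (loc := fun m => (bar (Fin.ofNat (N + 2) (firstLoc i m k)) : Site N))
    (f := fun m => Rcheck τ η ρ (bar (Fin.ofNat (N + 2) m)) (bar (Fin.ofNat (N + 2) (m + 1)))
      (t (Fin.ofNat (N + 2) m) - t i))
    (f' := fun m => Rcheck τ η ρ (bar (Fin.ofNat (N + 2) m)) (bar (Fin.ofNat (N + 2) (m + 1)))
      (shift k u t (Fin.ofNat (N + 2) m) - shift k u t i))
    i.val (fun m hm => by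
      have hne : i ≠ Fin.ofNat (N + 2) m := by rw [Ne, eq_ofNat_iff (by omega)]; omega
      have hc := crossing_firstLoc bar_injective i k hm
      have hxy : (bar (Fin.ofNat (N + 2) (m + 1)) : Site N) ≠ bar (Fin.ofNat (N + 2) m) := by
        rw [Ne, bar_injective.eq_iff, eq_ofNat_iff (by omega), Fin.val_ofNat,
          Nat.mod_eq_of_lt (by omega)]
        omega
      exact H.intertwines_Rcheck K hne.symm (hg _ _ hne.symm) hxy.symm hc.swap)
  have h2 := Intertwines.list_prod (β := β)
    (loc := fun m => (bar (Fin.ofNat (N + 2) (secondLoc i j (i.val + 1 + m) k)) : Site N))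
    (f := fun m => Rcheck τ η ρ (bar (Fin.ofNat (N + 2) (i.val + 1 + m))) (bar (Fin.ofNat (N + 2) (i.val + 1 + m + 1)))
      (t (Fin.ofNat (N + 2) (i.val + 1 + m)) - t j))
    (f' := fun m => Rcheck τ η ρ (bar (Fin.ofNat (N + 2) (i.val + 1 + m))) (bar (Fin.ofNat (N + 2) (i.val + 1 + m + 1)))
      (shift k u t (Fin.ofNat (N + 2) (i.val + 1 + m)) - shift k u t j))
    (j.val - (i.val + 1)) (fun m hm => by
      have hne : j ≠ Fin.ofNat (N + 2) (i.val + 1 + m) := by rw [Ne, eq_ofNat_iff (by omega)]; omega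
      have hc := crossing_secondLoc bar_injective hij k (m := i.val + 1 + m) (by omega) (by omega)
      have hxy : (bar (Fin.ofNat (N + 2) (i.val + 1 + m + 1)) : Site N) ≠ bar (Fin.ofNat (N + 2) (i.val + 1 + m)) := by
        rw [Ne, bar_injective.eq_iff, eq_ofNat_iff (by omega), Fin.val_ofNat,
          Nat.mod_eq_of_lt (by omega)]
        omega
      exact H.intertwines_Rcheck K hne.symm (hg _ _ hne.symm) hxy.symm hc.swap)
  have h3 := Intertwines.list_prod (β := β)
    (loc := fun m => (bar (Fin.ofNat (N + 2) (thirdLoc i j m k)) : Site N))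
    (f := fun m => Rcheck τ η ρ (bar (Fin.ofNat (N + 2) (m + 1))) (bar (Fin.ofNat (N + 2) (m + 2)))
      (t (Fin.ofNat (N + 2) m) - t j))
    (f' := fun m => Rcheck τ η ρ (bar (Fin.ofNat (N + 2) (m + 1))) (bar (Fin.ofNat (N + 2) (m + 2)))
      (shift k u t (Fin.ofNat (N + 2) m) - shift k u t j))
    i.val (fun m hm => by
      have hne : j ≠ Fin.ofNat (N + 2) m := by rw [Ne, eq_ofNat_iff (by omega)]; omega
      have hc := crossing_thirdLoc bar_injective hij k hm
      have hxy : (bar (Fin.ofNat (N + 2) (m + 2)) : Site N) ≠ bar (Fin.ofNat (N + 2) (m + 1)) := by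
        rw [Ne, bar_injective.eq_iff, eq_ofNat_iff (by omega), Fin.val_ofNat,
          Nat.mod_eq_of_lt (by omega)]
        omega
      exact H.intertwines_Rcheck K hne.symm (hg _ _ hne.symm) hxy.symm hc.swap)
  rw [firstLoc_self, Fin.ofNat_eq_cast, Fin.cast_val_eq_self] at h1
  rw [show i.val + 1 + (j.val - (i.val + 1)) = j.val by omega, secondLoc_self hij', add_zero,
    ← thirdLoc_self hij'] at h2
  exact (h1.mul h2).mul h3

/-- The position of the line `k` after the action of `ℝ`. -/
def linePos (i j k : Fin (N + 2)) : Fin (N + 2) := Fin.ofNat (N + 2) (thirdLoc i j 0 k)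

lemma commute_sigma_Rcheck (β : Fin 4) (τ η : ℂ) (ρ : ℂ → ℂ) {x y z : Site N} (hx : z ≠ x)
    (hy : z ≠ y) (t : ℂ) : Commute (sigma β z) (Rcheck τ η ρ x y t) :=
  Commute.mul_right (perm_mul_sigma_of_ne β hx hy).symm (sigma_mul_Rmat_of_ne β τ η ρ hx hy t)

lemma commute_unbarredChain (M : Op N) (ρ : ℂ → ℂ) (i j : Fin (N + 2)) (t : Fin (N + 2) → ℂ)
    (h : ∀ p r s, Commute M (Rcheck τ η ρ (site p) (site r) s)) :
    Commute M (unbarredChain τ η ρ i j t) := by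
  refine Commute.mul_right (Commute.mul_right ?_ ?_) ?_
  all_goals
    refine Commute.list_prod_right _ _ fun R hR => ?_
    obtain ⟨m, -, rfl⟩ := List.mem_map.1 hR
    exact h _ _ _

lemma commute_barredChain (M : Op N) (ρ : ℂ → ℂ) (i j : Fin (N + 2)) (t : Fin (N + 2) → ℂ)
    (h : ∀ p r s, Commute M (Rcheck τ η ρ (bar p) (bar r) s)) :
    Commute M (barredChain τ η ρ i j t) := by
  refine Commute.mul_right (Commute.mul_right ?_ ?_) ?_
  all_goals
    refine Commute.list_prod_right _ _ fun R hR => ?_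
    obtain ⟨m, -, rfl⟩ := List.mem_map.1 hR
    exact h _ _ _

lemma commute_sigmaIndex_Rprod (β : Fin 4) (ρ : ℂ → ℂ) (i j : Fin (N + 2))
    (t : Fin (N + 2) → ℂ) :
    Commute (sigmaIndex β fun _ => True) (Rprod τ η ρ i j t) := by
  rw [Rprod_eq]
  exact Commute.mul_right
    (commute_unbarredChain _ ρ i j t fun _ _ _ => sigmaOn_true_mul_Rcheck β τ η ρ _)
    (commute_barredChain _ ρ i j t fun _ _ _ => sigmaOn_true_mul_Rcheck β τ η ρ _)

lemma conj_mul_conj {A B : Op N} (β : Fin 4) (k l : Fin (N + 2))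
    (h1 : ∀ p, Commute (sigma β (bar p)) A) (h2 : ∀ p, Commute (sigma β (site p)) B) :
    sigma β (site k) * A * sigma β (site l) * (sigma β (bar k) * B * sigma β (bar l)) =
      sigmaPair β k * (A * B) * sigmaPair β l := by
  have h3 : sigma β (site l) * sigma β (bar k) = sigma β (bar k) * sigma β (site l) :=
    sigma_mul_sigma_of_ne β β (by simp)
  calc _ = sigma β (site k) * A * (sigma β (site l) * sigma β (bar k)) * B * sigma β (bar l) := by
        simp only [mul_assoc]
    _ = sigma β (site k) * (A * sigma β (bar k)) * (sigma β (site l) * B) * sigma β (bar l) := by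
        rw [h3]; simp only [mul_assoc]
    _ = _ := by
        rw [← (h1 k).eq, (h2 _).eq, sigmaPair, sigmaPair]; simp only [mul_assoc]

/-- The unbarred and barred chains act on different sites, so the two conjugations combine into one
by pairs. The value of c is irrelevant because it cancels in ℝ Y ℝ⁻¹. -/
lemma IsHalfPeriod.Rprod_shift (H : IsHalfPeriod τ u β π χ q q')
    (K : BracketShift τ η u e e') {ρ : ℂ → ℂ} {t : Fin (N + 2) → ℂ}
    (hg : ∀ p r, p ≠ r → GoodArg τ η ρ u (t p - t r)) {i j : Fin (N + 2)} (hij : i < j)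
    (k : Fin (N + 2)) :
    ∃ c : ℂ, c ≠ 0 ∧ Rprod τ η ρ i j (shift k u t) =
      c • (sigmaPair β k * Rprod τ η ρ i j t * sigmaPair β (linePos i j k)) := by
  obtain ⟨c, hc, h⟩ : Intertwines β (site k) (site (linePos i j k)) _ _ :=
    H.intertwines_unbarredChain K hg hij k
  obtain ⟨c', hc', h'⟩ : Intertwines β (bar k) (bar (linePos i j k)) _ _ :=
    H.intertwines_barredChain K hg hij k
  refine ⟨c * c', mul_ne_zero hc hc', ?_⟩
  rw [Rprod_eq, Rprod_eq, h, h', Matrix.smul_mul, Matrix.mul_smul, smul_smul, conj_mul_conj]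
  · exact fun p => commute_unbarredChain _ ρ i j t fun _ _ s =>
      commute_sigma_Rcheck β τ η ρ Sum.inr_ne_inl Sum.inr_ne_inl s
  · exact fun p => commute_barredChain _ ρ i j t fun _ _ s =>
      commute_sigma_Rcheck β τ η ρ Sum.inl_ne_inr Sum.inl_ne_inr s

end Rprod

end EightVertex

end

noncomputable section
namespace EightVertex

/-! ### Reordering of the variables and conjugation by ℝ -/

section Lines

variable {N : ℕ} {τ η u : ℂ} {β : Fin 4} {π : Fin 4 → Fin 4} {χ : Fin 4 → ℂ} {q q' e e' : ℂ → ℂ}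

/-- The list `i, j, 1, …, î, …, ĵ, …, n`. -/
def lineList (i j : Fin (N + 2)) : List (Fin (N + 2)) :=
  i :: j :: (List.finRange (N + 2)).filter (fun q => q ≠ i ∧ q ≠ j)

lemma finRange_eq_map_ofNat (n : ℕ) :
    List.finRange (n + 1) = (List.range (n + 1)).map (Fin.ofNat (n + 1)) := by
  apply List.ext_getElem
  · simp
  · intro m h1 h2
    ext
    simp only [List.length_finRange] at h1
    simp [Nat.mod_eq_of_lt h1]

lemma filter_finRange {i j : Fin (N + 2)} (hij : i < j) :
    (List.finRange (N + 2)).filter (fun q => q ≠ i ∧ q ≠ j) =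
      (List.range' 0 i.val ++ (List.range' (i.val + 1) (j.val - (i.val + 1)) ++
        List.range' (j.val + 1) (N + 1 - j.val))).map (Fin.ofNat (N + 2)) := by
  have hi := i.isLt
  have hj := j.isLt
  have hij' : i.val < j.val := hij
  have h : List.range (N + 2) = List.range' 0 i.val ++ (i.val :: (List.range' (i.val + 1)
      (j.val - (i.val + 1)) ++ (j.val :: List.range' (j.val + 1) (N + 1 - j.val)))) := by
    have h1 : j.val :: List.range' (j.val + 1) (N + 1 - j.val) =
        List.range' j.val (N + 1 - j.val + 1) := rfl
    have h2 : List.range' (i.val + 1) (j.val - (i.val + 1)) ++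
        List.range' j.val (N + 1 - j.val + 1) = List.range' (i.val + 1) (N + 1 - i.val) := by
      have := List.range'_append_1 (s := i.val + 1) (m := j.val - (i.val + 1))
        (n := N + 1 - j.val + 1)
      rw [show i.val + 1 + (j.val - (i.val + 1)) = j.val by omega,
        show j.val - (i.val + 1) + (N + 1 - j.val + 1) = N + 1 - i.val by omega] at this
      exact this
    have h3 : i.val :: List.range' (i.val + 1) (N + 1 - i.val) =
        List.range' i.val (N + 1 - i.val + 1) := rfl
    have h4 := List.range'_append_1 (s := 0) (m := i.val) (n := N + 1 - i.val + 1)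
    rw [h1, h2, h3, List.range_eq_range']
    rw [zero_add, show i.val + (N + 1 - i.val + 1) = N + 2 by omega] at h4
    exact h4.symm
  have hf : ∀ l : List ℕ, (∀ m ∈ l, m < N + 2 ∧ m ≠ i.val ∧ m ≠ j.val) →
      (l.map (Fin.ofNat (N + 2))).filter (fun q => q ≠ i ∧ q ≠ j) =
        l.map (Fin.ofNat (N + 2)) := by
    intro l hl
    rw [List.filter_eq_self]
    intro p hp
    obtain ⟨m, hm, rfl⟩ := List.mem_map.1 hp
    obtain ⟨h1, h2, h3⟩ := hl m hm
    have hne : ∀ p : Fin (N + 2), m ≠ p.val → Fin.ofNat (N + 2) m ≠ p := fun p hmp h' =>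
      hmp (((eq_ofNat_iff h1).1 h'.symm).symm)
    simp only [decide_eq_true_eq]
    exact ⟨hne i h2, hne j h3⟩
  have hv : ∀ p : Fin (N + 2), Fin.ofNat (N + 2) p.val = p := fun p =>
    ((eq_ofNat_iff p.isLt).2 rfl).symm
  rw [finRange_eq_map_ofNat, h]
  simp only [List.map_append, List.map_cons, List.filter_append, hv]
  rw [hf (List.range' 0 i.val), List.filter_cons_of_neg (by simp), List.filter_append,
    hf (List.range' (i.val + 1) _), List.filter_cons_of_neg (by simp),
    hf (List.range' (j.val + 1) _)]
  all_goals
    intro m hm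
    rw [List.mem_range'_1] at hm
    omega

/-- This is the compatibility of ℝ with the reordering of the variables: the position to which ℝ
leads the line k is the place of k in the list i, j, 1, …, n. -/
lemma lineList_getElem? {i j : Fin (N + 2)} (hij : i < j) (k : Fin (N + 2)) :
    (lineList i j)[(linePos i j k).val]? = some k := by
  have hi := i.isLt
  have hj := j.isLt
  have hk := k.isLt
  have hij' : i.val < j.val := hij
  have hv : ∀ p : Fin (N + 2), Fin.ofNat (N + 2) p.val = p := fun p =>
    ((eq_ofNat_iff p.isLt).2 rfl).symm
  have hlt : thirdLoc i j 0 k < N + 2 := by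
    unfold thirdLoc
    split_ifs <;> omega
  rw [linePos, Fin.val_ofNat, Nat.mod_eq_of_lt hlt, lineList, filter_finRange hij]
  rcases lt_trichotomy k.val i.val with h | h | h
  · rw [show thirdLoc i j 0 k = k.val + 1 + 1 by unfold thirdLoc; split_ifs <;> omega,
      List.getElem?_cons_succ, List.getElem?_cons_succ, List.getElem?_map,
      List.getElem?_append_left (by simpa using h), List.getElem?_range' h]
    simp
  · rw [show thirdLoc i j 0 k = 0 by unfold thirdLoc; split_ifs <;> omega]
    simp [Fin.ext_iff, h]
  · rcases lt_trichotomy k.val j.val with h' | h' | h'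
    · rw [show thirdLoc i j 0 k = i.val + (k.val - i.val - 1) + 1 + 1 by
          unfold thirdLoc; split_ifs <;> omega,
        List.getElem?_cons_succ, List.getElem?_cons_succ, List.getElem?_map,
        List.getElem?_append_right (by simp), List.length_range', Nat.add_sub_cancel_left,
        List.getElem?_append_left (by rw [List.length_range']; omega),
        List.getElem?_range' (by omega)]
      simp only [one_mul, Option.map_some]
      rw [show i.val + 1 + (k.val - i.val - 1) = k.val by omega, hv]
    · rw [show thirdLoc i j 0 k = 1 by unfold thirdLoc; split_ifs <;> omega]
      simp [Fin.ext_iff, h']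
    · rw [show thirdLoc i j 0 k = i.val + (j.val - (i.val + 1) + (k.val - j.val - 1)) + 1 + 1 by
          unfold thirdLoc; split_ifs <;> omega,
        List.getElem?_cons_succ, List.getElem?_cons_succ, List.getElem?_map,
        List.getElem?_append_right (by simp), List.length_range', Nat.add_sub_cancel_left,
        List.getElem?_append_right (by simp), List.length_range', Nat.add_sub_cancel_left,
        List.getElem?_range' (by omega)]
      simp only [one_mul, Option.map_some]
      rw [show j.val + 1 + (k.val - j.val - 1) = k.val by omega, hv]

lemma reorder_linePos {i j : Fin (N + 2)} (hij : i < j) (t : Fin (N + 2) → ℂ)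
    (k : Fin (N + 2)) : reorder i j t (linePos i j k) = t k := by
  have h := lineList_getElem? hij k
  rw [reorder, ← lineList, List.getD_eq_getElem?_getD, List.getElem?_map, h]
  rfl

lemma linePos_injective {i j : Fin (N + 2)} (hij : i < j) :
    Function.Injective (linePos i j) := by
  intro k l h
  have h1 := lineList_getElem? hij k
  rw [h, lineList_getElem? hij l] at h1
  exact (Option.some.inj h1).symm

lemma reorder_shift {i j : Fin (N + 2)} (hij : i < j) (t : Fin (N + 2) → ℂ) (k : Fin (N + 2))
    (a : ℂ) : reorder i j (shift k a t) = shift (linePos i j k) a (reorder i j t) := by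
  funext p
  obtain ⟨r, rfl⟩ := Finite.surjective_of_injective (linePos_injective hij) p
  rw [reorder_linePos hij]
  by_cases h : r = k
  · subst h
    simp only [shift, Function.update_self, reorder_linePos hij]
  · simp only [shift, Function.update_of_ne h, reorder_linePos hij,
      Function.update_of_ne ((linePos_injective hij).ne h)]

lemma linePos_left {i j : Fin (N + 2)} : linePos i j i = 0 := by
  rw [linePos, thirdLoc, if_pos rfl]
  rfl

lemma linePos_right {i j : Fin (N + 2)} (hij : i < j) : linePos i j j = 1 := by
  have hij' : i.val < j.val := hij
  rw [linePos, thirdLoc, if_neg (by omega), if_pos rfl]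
  rfl

/-- `ℝ Y ℝ⁻¹` for the transfer matrix `Y` obtained from the functions `X` of the words. -/
def lineTransfer (τ η : ℂ) (ρ : ℂ → ℂ) (i j : Fin (N + 2)) (X : List (Fin 4) → ℂ → ℂ)
    (t : Fin (N + 2) → ℂ) : Op N :=
  Rprod τ η ρ i j t * familyTransfer τ η X (reorder i j t) * (Rprod τ η ρ i j t)⁻¹

/-- Only c, U and V have to be invertible; with the default inverse of singular matrices the formula
holds for every M, so the determinant of ℝ plays no role. -/
lemma inv_smul_conj {ι : Type} [Fintype ι] [DecidableEq ι] {c : ℂ} (hc : c ≠ 0)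
    {U V : Matrix ι ι ℂ} (hU : U * U = 1) (hV : V * V = 1) (M : Matrix ι ι ℂ) :
    (c • (U * M * V))⁻¹ = c⁻¹ • (V * M⁻¹ * U) := by
  have h1 : c • (U * M * V) = (c • U) * (M * V) := by
    rw [Matrix.smul_mul, mul_assoc]
  have h2 : (c • U)⁻¹ = c⁻¹ • U := by
    apply Matrix.inv_eq_left_inv
    rw [Matrix.smul_mul, Matrix.mul_smul, smul_smul, inv_mul_cancel₀ hc, one_smul, hU]
  rw [h1, Matrix.mul_inv_rev, Matrix.mul_inv_rev, h2, Matrix.mul_smul,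
    Matrix.inv_eq_left_inv hV]

/-- The σ^β pair on the left cancels the outer pair of the translated ℝ. The inner pairs at the
position of the line meet the translated base matrix, whose laws are known. -/
lemma IsHalfPeriod.lineTransfer_shift (H : IsHalfPeriod τ u β π χ q q')
    (K : BracketShift τ η u e e') {ρ : ℂ → ℂ} {t : Fin (N + 2) → ℂ}
    (hg : ∀ p r, p ≠ r → GoodArg τ η ρ u (t p - t r)) {i j : Fin (N + 2)} (hij : i < j)
    (k : Fin (N + 2)) (X : List (Fin 4) → ℂ → ℂ) :
    sigmaPair β k * lineTransfer τ η ρ i j X (shift k u t) =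
      Rprod τ η ρ i j t * (sigmaPair β (linePos i j k) *
        familyTransfer τ η X (shift (linePos i j k) u (reorder i j t))) *
        (sigmaPair β (linePos i j k) * (Rprod τ η ρ i j t)⁻¹ * sigmaPair β k) := by
  obtain ⟨c, hc, hR⟩ := H.Rprod_shift K hg hij k
  rw [lineTransfer, hR, inv_smul_conj hc (sigmaPair_mul_self β k) (sigmaPair_mul_self β _),
    reorder_shift hij]
  generalize Rprod τ η ρ i j t = R
  generalize familyTransfer τ η X (shift (linePos i j k) u (reorder i j t)) = Y
  simp only [Matrix.mul_smul, Matrix.smul_mul, smul_smul, inv_mul_cancel₀ hc, one_smul]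
  have h := sigmaPair_mul_self (N := N) β k
  calc _ = (sigmaPair β k * sigmaPair β k) * (R * (sigmaPair β (linePos i j k) * Y) *
      (sigmaPair β (linePos i j k) * R⁻¹ * sigmaPair β k)) := by simp only [mul_assoc]
    _ = _ := by rw [h, one_mul]

lemma IsHalfPeriod.lineTransfer_shift_of_ne (H : IsHalfPeriod τ u β π χ q q')
    (K : BracketShift τ η u e e') {ρ : ℂ → ℂ} {t : Fin (N + 2) → ℂ}
    (hg : ∀ p r, p ≠ r → GoodArg τ η ρ u (t p - t r)) {i j : Fin (N + 2)} (hij : i < j)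
    (k : Fin (N + 2)) (X X' : List (Fin 4) → ℂ → ℂ)
    (h : sigmaPair β (linePos i j k) *
        familyTransfer τ η X' (shift (linePos i j k) u (reorder i j t)) =
      familyTransfer τ η X (reorder i j t) * sigmaPair β (linePos i j k)) :
    sigmaPair β k * lineTransfer τ η ρ i j X' (shift k u t) =
      lineTransfer τ η ρ i j X t * sigmaPair β k := by
  rw [H.lineTransfer_shift K hg hij, h, lineTransfer]
  have h := sigmaPair_mul_self (N := N) β (linePos i j k)
  generalize Rprod τ η ρ i j t = R
  generalize familyTransfer τ η X (reorder i j t) = Y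
  calc _ = R * Y * (sigmaPair β (linePos i j k) * sigmaPair β (linePos i j k)) * R⁻¹ *
        sigmaPair β k := by simp only [mul_assoc]
    _ = _ := by rw [h, mul_one]

lemma familyTransfer_mul_sigmaPair (H : IsHalfPeriod τ u β π χ q q')
    (X : List (Fin 4) → ℂ → ℂ) (t : Fin (N + 2) → ℂ) {p : Fin (N + 2)} (hp : p = 0 ∨ p = 1) :
    familyTransfer τ η X t * sigmaPair β p = -familyTransfer τ η X t := by
  rw [familyTransfer, transfer, Matrix.smul_mul, mul_assoc, singletProj_mul_sigmaPair H.ne_zero hp,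
    mul_neg, smul_neg]

lemma sigmaIndex_mul_Rprod_inv (β : Fin 4) (ρ : ℂ → ℂ) (i j : Fin (N + 2))
    (t : Fin (N + 2) → ℂ) :
    sigmaIndex β (fun _ => True) * (Rprod τ η ρ i j t)⁻¹ =
      (Rprod τ η ρ i j t)⁻¹ * sigmaIndex β fun _ => True := by
  have h := congrArg (·⁻¹) (commute_sigmaIndex_Rprod (τ := τ) (η := η) β ρ i j t).eq
  simp only [Matrix.mul_inv_rev] at h
  rw [Matrix.inv_eq_left_inv (sigmaIndex_mul_self (N := N) β fun _ => True)] at h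
  exact h.symm

/-- The pairs other than 1 and 2, multiplied by the pair at the position of the line, equal all
pairs times the pair o at the other of the two positions. The pair o is absorbed by the singlets
with the sign -1, which turns (-1)^{n-1} into (-1)^n; the product over all sites commutes with ℝ⁻¹;
and the final pair at k removes k from it. -/
lemma IsHalfPeriod.lineTransfer_shift_of_mem (H : IsHalfPeriod τ u β π χ q q')
    (K : BracketShift τ η u e e') {ρ : ℂ → ℂ} {t : Fin (N + 2) → ℂ}
    (hg : ∀ p r, p ≠ r → GoodArg τ η ρ u (t p - t r)) {i j : Fin (N + 2)} (hij : i < j)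
    {k : Fin (N + 2)} (hk : linePos i j k = 0 ∨ linePos i j k = 1)
    (X X' : List (Fin 4) → ℂ → ℂ)
    (h : sigmaPair β (linePos i j k) *
        familyTransfer τ η X' (shift (linePos i j k) u (reorder i j t)) =
      (-1 : ℂ) ^ (N + 1) •
        (familyTransfer τ η X (reorder i j t) * sigmaIndex β fun p => p ≠ 0 ∧ p ≠ 1)) :
    sigmaPair β k * lineTransfer τ η ρ i j X' (shift k u t) =
      (-1 : ℂ) ^ (N + 2) • (lineTransfer τ η ρ i j X t * sigmaIndex β fun p => p ≠ k) := by
  obtain ⟨o, ho, hS⟩ : ∃ o : Fin (N + 2), (o = 0 ∨ o = 1) ∧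
      sigmaIndex β (fun p => p ≠ 0 ∧ p ≠ 1) * sigmaPair β (linePos i j k) =
        sigmaPair β o * sigmaIndex β fun _ => True := by
    rcases hk with hk | hk
    · refine ⟨1, Or.inr rfl, ?_⟩
      rw [hk, sigmaPair_eq_sigmaIndex, sigmaPair_eq_sigmaIndex,
        sigmaIndex_mul β (fun p => p = 1) (fun _ => True) (fun p => p ≠ 1) (by simp)]
      refine sigmaIndex_mul β _ _ _ fun x => ?_
      by_cases hx : x = 0 <;> simp [hx]
    · refine ⟨0, Or.inl rfl, ?_⟩
      rw [hk, sigmaPair_eq_sigmaIndex, sigmaPair_eq_sigmaIndex,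
        sigmaIndex_mul β (fun p => p = 0) (fun _ => True) (fun p => p ≠ 0) (by simp)]
      refine sigmaIndex_mul β _ _ _ fun x => ?_
      by_cases hx : x = 1 <;> simp [hx]
  have hk' : sigmaIndex β (fun _ => True) * sigmaPair β k = sigmaIndex β fun p => p ≠ k := by
    rw [sigmaPair_eq_sigmaIndex]
    exact sigmaIndex_mul β _ _ _ (by simp)
  have hRi := sigmaIndex_mul_Rprod_inv (τ := τ) (η := η) β ρ i j t
  have hY := familyTransfer_mul_sigmaPair (η := η) H X (reorder i j t) ho
  rw [H.lineTransfer_shift K hg hij, h, lineTransfer]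
  generalize Rprod τ η ρ i j t = R at hRi ⊢
  generalize familyTransfer τ η X (reorder i j t) = Y at hY ⊢
  rw [Matrix.mul_smul, Matrix.smul_mul]
  have h1 : R * (Y * sigmaIndex β fun p => p ≠ 0 ∧ p ≠ 1) *
      (sigmaPair β (linePos i j k) * R⁻¹ * sigmaPair β k) =
      -(R * Y * R⁻¹ * sigmaIndex β fun p => p ≠ k) := by
    calc _ = R * Y * (sigmaIndex β (fun p => p ≠ 0 ∧ p ≠ 1) * sigmaPair β (linePos i j k)) *
          R⁻¹ * sigmaPair β k := by simp only [mul_assoc]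
      _ = R * (Y * sigmaPair β o) * (sigmaIndex β (fun _ => True) * R⁻¹) * sigmaPair β k := by
          rw [hS]; simp only [mul_assoc]
      _ = -(R * Y * R⁻¹ * (sigmaIndex β (fun _ => True) * sigmaPair β k)) := by
          rw [hY, hRi]; simp only [mul_assoc, mul_neg, neg_mul]
      _ = _ := by rw [hk']
  rw [h1, smul_neg, ← neg_smul]
  congr 1
  ring

end Lines

end EightVertex

end

noncomputable section
namespace EightVertex

/-! ### The laws at regular points -/

section Laws

variable {N : ℕ} {τ η : ℂ} {ρ : ℂ → ℂ} {i j : Fin (N + 2)} {t : Fin (N + 2) → ℂ}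

lemma theta_two_eta_ne_zero (hτ : 0 < τ.im) (hη : ∀ a b : ℚ, η ≠ a + b * τ) :
    theta τ 0 (2 * η) ≠ 0 := by
  have := theta_two_int_mul_ne_zero hτ hη 1 one_ne_zero
  simpa using this

lemma bracket_ne_zero_iff (h : theta τ 0 (2 * η) ≠ 0) (x : ℂ) :
    bracket τ η x ≠ 0 ↔ theta τ 0 (2 * x) ≠ 0 := by
  rw [bracket, Ne, div_eq_zero_iff, not_or]
  exact ⟨fun h => h.1, fun h' => ⟨h', h⟩⟩

lemma Regular.goodArg (ht : Regular τ η ρ t) (h : theta τ 0 (2 * η) ≠ 0) {u : ℂ} {a b : ℤ}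
    (hu : u = (a + b * τ) / 2) (p r : Fin (N + 2)) (hpr : p ≠ r) :
    GoodArg τ η ρ u (t p - t r) := by
  obtain ⟨-, h2, h3⟩ := ht p r hpr
  refine ⟨?_, ?_, ?_, (bracket_ne_zero_iff h _).2 h2⟩
  · simpa using h3 0 0
  · rw [hu]
    exact h3 a b
  · have := h3 (-a) (-b)
    rw [show t p - t r + (((-a : ℤ) : ℂ) + ((-b : ℤ) : ℂ) * τ) / 2 = t p - t r - u by
      rw [hu]; push_cast; ring] at this
    exact this

lemma Regular.goodArg_half (ht : Regular τ η ρ t) (h : theta τ 0 (2 * η) ≠ 0)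
    (p r : Fin (N + 2)) (hpr : p ≠ r) : GoodArg τ η ρ (1 / 2) (t p - t r) :=
  ht.goodArg h (a := 1) (b := 0) (by simp) p r hpr

lemma Regular.goodArg_half_tau (ht : Regular τ η ρ t) (h : theta τ 0 (2 * η) ≠ 0)
    (p r : Fin (N + 2)) (hpr : p ≠ r) : GoodArg τ η ρ (τ / 2) (t p - t r) :=
  ht.goodArg h (a := 0) (b := 1) (by simp) p r hpr

lemma BracketShift.regular_shift {u : ℂ} {e e' : ℂ → ℂ} (K : BracketShift τ η u e e')
    (h : theta τ 0 (2 * η) ≠ 0) {a b : ℤ} (hu : u = (a + b * τ) / 2) (ht : Regular τ η ρ t)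
    (k : Fin (N + 2)) : Regular τ η ρ (shift k u t) := by
  intro p r hpr
  obtain ⟨h1, h2, h3⟩ := ht p r hpr
  rw [← bracket_ne_zero_iff h] at h1 h2
  rw [← bracket_ne_zero_iff h, ← bracket_ne_zero_iff h]
  by_cases hp : k = p
  · subst hp
    have hs : shift k u t k - shift k u t r = t k - t r + u := by
      simp only [shift, Function.update_self, Function.update_of_ne hpr.symm]
      ring
    rw [hs]
    refine ⟨?_, ?_, fun c d => ?_⟩
    · rw [K.add]
      exact mul_ne_zero (neg_ne_zero.2 (K.ne_zero _)) h1
    · rw [show t k - t r + u + η = t k - t r + η + u by ring, K.add]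
      exact mul_ne_zero (neg_ne_zero.2 (K.ne_zero _)) h2
    · have := h3 (a + c) (b + d)
      rw [hu]
      push_cast at this
      convert this using 2
      ring
  · by_cases hr : k = r
    · subst hr
      have hs : shift k u t p - shift k u t k = t p - t k - u := by
        simp only [shift, Function.update_self, Function.update_of_ne hpr]
        ring
      rw [hs]
      refine ⟨?_, ?_, fun c d => ?_⟩
      · rw [K.sub]
        exact mul_ne_zero (neg_ne_zero.2 (K.ne_zero' _)) h1
      · rw [show t p - t k - u + η = t p - t k + η - u by ring, K.sub]
        exact mul_ne_zero (neg_ne_zero.2 (K.ne_zero' _)) h2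
      · have := h3 (c - a) (d - b)
        rw [hu]
        push_cast at this
        convert this using 2
        ring
    · simp only [shift, Function.update_of_ne (Ne.symm hp), Function.update_of_ne (Ne.symm hr)]
      exact ⟨h1, h2, h3⟩

lemma Regular.shift_half (ht : Regular τ η ρ t) (h : theta τ 0 (2 * η) ≠ 0) (k : Fin (N + 2)) :
    Regular τ η ρ (shift k (1 / 2) t) :=
  (bracketShift_half τ η).regular_shift h (a := 1) (b := 0) (by simp) ht k

lemma Regular.shift_half_tau (ht : Regular τ η ρ t) (h : theta τ 0 (2 * η) ≠ 0)
    (k : Fin (N + 2)) : Regular τ η ρ (shift k (τ / 2) t) :=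
  (bracketShift_half_tau τ η).regular_shift h (a := 0) (b := 1) (by simp) ht k

/-- Functions of the words representing the functional `Tr` on the products of `2(N+1)`
generators, with their laws under half periods. -/
structure IsTraceFamily (τ η : ℂ) (N : ℕ) (B C D : List (Fin 4) → ℂ → ℂ) : Prop where
  differentiable_left : ∀ w, Differentiable ℂ (B w)
  differentiable_right : ∀ w, Differentiable ℂ (C w)
  trace : ∀ w, w.length = 2 * (N + 1) → ∀ t,
    Tr τ η (wordGen τ η w) (t / η) = wordNorm τ η w * (B w t + t * C w t)
  half : ∀ w, w.length = 2 * (N + 1) → ∀ t,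
    B (w.map permA) (t + 1 / 2) = wordProd sgnA w * B w t ∧
    C (w.map permA) (t + 1 / 2) = wordProd sgnA w * C w t ∧
    D (w.map permA) (t + 1 / 2) = wordProd sgnA w * D w t
  half_tau : ∀ w, w.length = 2 * (N + 1) → ∀ t,
    B (w.map permB) (t + τ / 2) = multB τ w t * (B w t + 1 / 2 * D w t) ∧
    C (w.map permB) (t + τ / 2) = multB τ w t * C w t ∧
    D (w.map permB) (t + τ / 2) = multB τ w t * D w t
  neutral : ∀ w, w.length = 2 * (N + 1) → ∀ t, ¬ Neutral w → B w t = 0 ∧ C w t = 0 ∧ D w t = 0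

lemma exists_isTraceFamily (hτ : 0 < τ.im) (hη : ∀ a b : ℚ, η ≠ a + b * τ) (N : ℕ) :
    ∃ B C D, IsTraceFamily τ η N B C D := by
  obtain ⟨B, C, D, hB, hC, h⟩ := exists_entire_family hτ hη (even_two_mul (N + 1))
  exact ⟨B, C, D, hB, hC, fun w hw t => (h w hw t).1, fun w hw t => (h w hw t).2.1,
    fun w hw t => ⟨(h w hw t).2.2.1, (h w hw t).2.2.2.1, (h w hw t).2.2.2.2.1⟩,
    fun w hw t => (h w hw t).2.2.2.2.2⟩

lemma familyTransfer_add_smul (c : ℂ) (X Y : List (Fin 4) → ℂ → ℂ) (t : Fin (N + 2) → ℂ) :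
    familyTransfer τ η (fun w s => X w s + c * Y w s) t =
      familyTransfer τ η X t + c • familyTransfer τ η Y t := by
  rw [familyTransfer, transfer_add, transfer_smul]
  rfl

lemma lineTransfer_add_smul (c : ℂ) (X Y : List (Fin 4) → ℂ → ℂ) (t : Fin (N + 2) → ℂ) :
    lineTransfer τ η ρ i j (fun w s => X w s + c * Y w s) t =
      lineTransfer τ η ρ i j X t + c • lineTransfer τ η ρ i j Y t := by
  rw [lineTransfer, lineTransfer, lineTransfer, familyTransfer_add_smul, mul_add, add_mul,
    Matrix.mul_smul, Matrix.smul_mul]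

/-- The first two reordered variables are t_i and t_j, so the trace is taken at t_{ij}/η and the
explicit factor t in B + tC becomes t_{ij}. -/
lemma Xij_eq_lineTransfer (hτ : 0 < τ.im) (hη : ∀ a b : ℚ, η ≠ a + b * τ)
    {B C D : List (Fin 4) → ℂ → ℂ} (F : IsTraceFamily τ η N B C D) (hij : i < j)
    (t : Fin (N + 2) → ℂ) :
    Xij τ η ρ i j t = lineTransfer τ η ρ i j B t +
      (t i - t j) • lineTransfer τ η ρ i j C t := by
  have h0 : reorder i j t 0 = t i := by
    have := reorder_linePos hij t i
    rwa [linePos_left] at this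
  have h1 : reorder i j t 1 = t j := by
    have := reorder_linePos hij t j
    rwa [linePos_right hij] at this
  rw [Xij, min_eq_left hij.le, max_eq_right hij.le,
    Xbase_eq_transfer τ (theta_eta_ne_zero hτ hη) (reorder i j t) _
      (fun w hw => F.trace w hw _), transfer_add, lineTransfer, lineTransfer, h0, h1,
    transfer_smul, mul_add, add_mul, Matrix.mul_smul, Matrix.smul_mul, familyTransfer,
    familyTransfer, h0, h1]

lemma lineTransfer_half_of_ne (ht : Regular τ η ρ t) (h : theta τ 0 (2 * η) ≠ 0) (hij : i < j)
    {k : Fin (N + 2)} (hi : k ≠ i) (hj : k ≠ j) (X : List (Fin 4) → ℂ → ℂ) :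
    sigmaPair 1 k * lineTransfer τ η ρ i j X (shift k (1 / 2) t) =
      lineTransfer τ η ρ i j X t * sigmaPair 1 k := by
  refine (isHalfPeriod_half τ).lineTransfer_shift_of_ne (bracketShift_half τ η)
    (ht.goodArg_half h) hij k X X (familyTransfer_half_of_ne X _ ?_ ?_)
  · rw [← linePos_left (i := i) (j := j)]
    exact (linePos_injective hij).ne hi
  · rw [← linePos_right hij]
    exact (linePos_injective hij).ne hj

lemma lineTransfer_half_tau_of_ne (ht : Regular τ η ρ t) (h : theta τ 0 (2 * η) ≠ 0) (hij : i < j)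
    {k : Fin (N + 2)} (hi : k ≠ i) (hj : k ≠ j) (X : List (Fin 4) → ℂ → ℂ) :
    sigmaPair 3 k * lineTransfer τ η ρ i j X (shift k (τ / 2) t) =
      lineTransfer τ η ρ i j X t * sigmaPair 3 k := by
  refine (isHalfPeriod_half_tau τ).lineTransfer_shift_of_ne (bracketShift_half_tau τ η)
    (ht.goodArg_half_tau h) hij k X X (familyTransfer_half_tau_of_ne X _ ?_ ?_)
  · rw [← linePos_left (i := i) (j := j)]
    exact (linePos_injective hij).ne hi
  · rw [← linePos_right hij]
    exact (linePos_injective hij).ne hj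

lemma lineTransfer_half_of_mem (ht : Regular τ η ρ t) (h : theta τ 0 (2 * η) ≠ 0) (hij : i < j)
    {k : Fin (N + 2)} (hk : k = i ∨ k = j) {X : List (Fin 4) → ℂ → ℂ}
    (hX : ∀ w, w.length = 2 * (N + 1) → ∀ t, X (w.map permA) (t + 1 / 2) = wordProd sgnA w * X w t)
    (hn : ∀ w, w.length = 2 * (N + 1) → ∀ t, ¬ Neutral w → X w t = 0) :
    sigmaPair 1 k * lineTransfer τ η ρ i j X (shift k (1 / 2) t) =
      (-1 : ℂ) ^ (N + 2) • (lineTransfer τ η ρ i j X t * sigmaIndex 1 fun p => p ≠ k) := by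
  have hp : linePos i j k = 0 ∨ linePos i j k = 1 := by
    rcases hk with rfl | rfl
    · exact Or.inl linePos_left
    · exact Or.inr (linePos_right hij)
  refine (isHalfPeriod_half τ).lineTransfer_shift_of_mem (bracketShift_half τ η)
    (ht.goodArg_half h) hij hp X X ?_
  rcases hp with hp | hp
  · rw [hp]
    exact familyTransfer_half_zero hX hn _
  · rw [hp]
    exact familyTransfer_half_one hX hn _

lemma lineTransfer_half_tau_left (ht : Regular τ η ρ t) (h : theta τ 0 (2 * η) ≠ 0) (hij : i < j)
    {X X' : List (Fin 4) → ℂ → ℂ}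
    (hX : ∀ w, w.length = 2 * (N + 1) → ∀ t, X' (w.map permB) (t + τ / 2) = multB τ w t * X w t)
    (hn : ∀ w, w.length = 2 * (N + 1) → ∀ t, ¬ Neutral w → X w t = 0) :
    sigmaPair 3 i * lineTransfer τ η ρ i j X' (shift i (τ / 2) t) =
      (-1 : ℂ) ^ (N + 2) • (lineTransfer τ η ρ i j X t * sigmaIndex 3 fun p => p ≠ i) := by
  refine (isHalfPeriod_half_tau τ).lineTransfer_shift_of_mem (bracketShift_half_tau τ η)
    (ht.goodArg_half_tau h) hij (Or.inl linePos_left) X X' ?_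
  rw [linePos_left]
  exact familyTransfer_half_tau_zero hX hn _

lemma lineTransfer_half_tau_right (ht : Regular τ η ρ t) (h : theta τ 0 (2 * η) ≠ 0) (hij : i < j)
    {X X' : List (Fin 4) → ℂ → ℂ}
    (hX : ∀ w, w.length = 2 * (N + 1) → ∀ t, X (w.map permB) (t + τ / 2) = multB τ w t * X' w t)
    (hn : ∀ w, w.length = 2 * (N + 1) → ∀ t, ¬ Neutral w → X w t = 0)
    (hn' : ∀ w, w.length = 2 * (N + 1) → ∀ t, ¬ Neutral w → X' w t = 0) :
    sigmaPair 3 j * lineTransfer τ η ρ i j X' (shift j (τ / 2) t) =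
      (-1 : ℂ) ^ (N + 2) • (lineTransfer τ η ρ i j X t * sigmaIndex 3 fun p => p ≠ j) := by
  refine (isHalfPeriod_half_tau τ).lineTransfer_shift_of_mem (bracketShift_half_tau τ η)
    (ht.goodArg_half_tau h) hij (Or.inr (linePos_right hij)) X X' ?_
  rw [linePos_right hij]
  exact familyTransfer_half_tau_one hX hn hn' _

end Laws

end EightVertex

end

noncomputable section
namespace EightVertex

/-! ### The components X̂₁, X̂₂, X̂₃ -/

section Components

variable {N : ℕ} {τ η : ℂ} {ρ : ℂ → ℂ} {i j : Fin (N + 2)} {t : Fin (N + 2) → ℂ}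
  {B C D : List (Fin 4) → ℂ → ℂ}

lemma shift_shift (k : Fin (N + 2)) (a b : ℂ) (t : Fin (N + 2) → ℂ) :
    shift k a (shift k b t) = shift k (b + a) t := by
  simp only [shift, Function.update_idem, Function.update_self, add_assoc]

/-- Two half-period translations give a full one; the involutions on both sides and the sign square
to 1. -/
lemma eq_of_half_twice {σ S M₀ M₁ M₂ : Op N} {c : ℂ} (hσ : σ * σ = 1) (hS : S * S = 1)
    (hc : c * c = 1) (h₂ : σ * M₂ = c • (M₁ * S)) (h₁ : σ * M₁ = c • (M₀ * S)) : M₂ = M₀ := by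
  calc M₂ = σ * (σ * M₂) := by rw [← mul_assoc, hσ, one_mul]
    _ = c • ((σ * M₁) * S) := by rw [h₂, Matrix.mul_smul, mul_assoc]
    _ = M₀ := by rw [h₁, Matrix.smul_mul, smul_smul, hc, one_smul, mul_assoc, hS, mul_one]

/-- The transfer matrix of the pair `{i, j}` obtained from the functions `X` of the words. -/
def pairTransfer (τ η : ℂ) (ρ : ℂ → ℂ) (i j : Fin (N + 2)) (X : List (Fin 4) → ℂ → ℂ)
    (t : Fin (N + 2) → ℂ) : Op N :=
  lineTransfer τ η ρ (min i j) (max i j) X t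

/-- The sign of the ordered pair `(i, j)`. -/
def pairSign (i j : Fin (N + 2)) : ℂ := if i < j then 1 else -1

/-- The jump coefficient of the line `k ∈ {i, j}`. -/
def jumpCoeff (i j k : Fin (N + 2)) : ℂ := (if k = i then 1 / 2 else -1 / 2) * pairSign i j

lemma min_lt_max' (hij : i ≠ j) : min i j < max i j := min_lt_max.2 hij

lemma pairTransfer_half_of_ne (ht : Regular τ η ρ t) (h : theta τ 0 (2 * η) ≠ 0) (hij : i ≠ j)
    {k : Fin (N + 2)} (hi : k ≠ i) (hj : k ≠ j) (X : List (Fin 4) → ℂ → ℂ) :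
    sigmaPair 1 k * pairTransfer τ η ρ i j X (shift k (1 / 2) t) =
      pairTransfer τ η ρ i j X t * sigmaPair 1 k := by
  refine lineTransfer_half_of_ne ht h (min_lt_max' hij) ?_ ?_ X
  · rcases min_choice i j with hm | hm <;> rwa [hm]
  · rcases max_choice i j with hm | hm <;> rwa [hm]

lemma pairTransfer_half_tau_of_ne (ht : Regular τ η ρ t) (h : theta τ 0 (2 * η) ≠ 0)
    (hij : i ≠ j) {k : Fin (N + 2)} (hi : k ≠ i) (hj : k ≠ j) (X : List (Fin 4) → ℂ → ℂ) :
    sigmaPair 3 k * pairTransfer τ η ρ i j X (shift k (τ / 2) t) =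
      pairTransfer τ η ρ i j X t * sigmaPair 3 k := by
  refine lineTransfer_half_tau_of_ne ht h (min_lt_max' hij) ?_ ?_ X
  · rcases min_choice i j with hm | hm <;> rwa [hm]
  · rcases max_choice i j with hm | hm <;> rwa [hm]

lemma eq_min_or_eq_max {k : Fin (N + 2)} (hk : k = i ∨ k = j) : k = min i j ∨ k = max i j := by
  rcases le_total i j with h | h
  · rwa [min_eq_left h, max_eq_right h]
  · rw [min_eq_right h, max_eq_left h]
    exact hk.symm

lemma pairTransfer_half_of_mem (ht : Regular τ η ρ t) (h : theta τ 0 (2 * η) ≠ 0) (hij : i ≠ j)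
    {k : Fin (N + 2)} (hk : k = i ∨ k = j) {X : List (Fin 4) → ℂ → ℂ}
    (hX : ∀ w, w.length = 2 * (N + 1) → ∀ t, X (w.map permA) (t + 1 / 2) = wordProd sgnA w * X w t)
    (hn : ∀ w, w.length = 2 * (N + 1) → ∀ t, ¬ Neutral w → X w t = 0) :
    sigmaPair 1 k * pairTransfer τ η ρ i j X (shift k (1 / 2) t) =
      (-1 : ℂ) ^ (N + 2) • (pairTransfer τ η ρ i j X t * sigmaIndex 1 fun p => p ≠ k) :=
  lineTransfer_half_of_mem ht h (min_lt_max' hij) (eq_min_or_eq_max hk) hX hn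

lemma pairTransfer_half_tau_of_mem (ht : Regular τ η ρ t) (h : theta τ 0 (2 * η) ≠ 0)
    (hij : i ≠ j) {k : Fin (N + 2)} (hk : k = i ∨ k = j) {X : List (Fin 4) → ℂ → ℂ}
    (hX : ∀ w, w.length = 2 * (N + 1) → ∀ t, X (w.map permB) (t + τ / 2) = multB τ w t * X w t)
    (hn : ∀ w, w.length = 2 * (N + 1) → ∀ t, ¬ Neutral w → X w t = 0) :
    sigmaPair 3 k * pairTransfer τ η ρ i j X (shift k (τ / 2) t) =
      (-1 : ℂ) ^ (N + 2) • (pairTransfer τ η ρ i j X t * sigmaIndex 3 fun p => p ≠ k) := by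
  rcases eq_min_or_eq_max hk with rfl | rfl
  · exact lineTransfer_half_tau_left ht h (min_lt_max' hij) hX hn
  · exact lineTransfer_half_tau_right ht h (min_lt_max' hij) hX hn hn

/-- The B part depends on the difference with the smaller index first, so +1/2 belongs to the
smaller index, whichever of i and j it is. The coefficient relative to (i, j) is compensated by
`pairSign`. -/
lemma jumpCoeff_min (hij : i ≠ j) : jumpCoeff i j (min i j) = 1 / 2 := by
  rw [jumpCoeff, pairSign]
  rcases lt_or_gt_of_ne hij with h | h
  · rw [min_eq_left h.le, if_pos rfl, if_pos h, mul_one]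
  · rw [min_eq_right h.le, if_neg hij.symm, if_neg h.not_gt]
    norm_num

lemma jumpCoeff_max (hij : i ≠ j) : jumpCoeff i j (max i j) = -1 / 2 := by
  rw [jumpCoeff, pairSign]
  rcases lt_or_gt_of_ne hij with h | h
  · rw [max_eq_right h.le, if_neg hij.symm, if_pos h, mul_one]
  · rw [max_eq_left h.le, if_pos rfl, if_neg h.not_gt]
    norm_num

lemma IsTraceFamily.pairTransfer_half_tau (F : IsTraceFamily τ η N B C D)
    (ht : Regular τ η ρ t) (h : theta τ 0 (2 * η) ≠ 0)
    (hij : i ≠ j) {k : Fin (N + 2)} (hk : k = i ∨ k = j) :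
    sigmaPair 3 k * pairTransfer τ η ρ i j B (shift k (τ / 2) t) =
      (-1 : ℂ) ^ (N + 2) • ((pairTransfer τ η ρ i j B t +
        jumpCoeff i j k • pairTransfer τ η ρ i j D t) * sigmaIndex 3 fun p => p ≠ k) := by
  have hn : ∀ c : ℂ, ∀ w, w.length = 2 * (N + 1) → ∀ t, ¬ Neutral w → B w t + c * D w t = 0 := by
    intro c w hw t hnw
    obtain ⟨h1, -, h3⟩ := F.neutral w hw t hnw
    rw [h1, h3, mul_zero, add_zero]
  have hn' : ∀ w, w.length = 2 * (N + 1) → ∀ t, ¬ Neutral w → B w t = 0 := fun w hw t hnw =>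
    (F.neutral w hw t hnw).1
  simp only [pairTransfer]
  rw [← lineTransfer_add_smul]
  rcases eq_min_or_eq_max hk with rfl | rfl
  · rw [jumpCoeff_min hij]
    exact lineTransfer_half_tau_left ht h (min_lt_max' hij)
      (fun w hw t => (F.half_tau w hw t).1) (hn _)
  · rw [jumpCoeff_max hij]
    -- For the larger index the law runs backwards: B - D/2 is taken by the half translation to the
    -- multiple of B, because its own jump D/2 cancels.
    refine lineTransfer_half_tau_right ht h (min_lt_max' hij) (fun w hw t => ?_) (hn _) hn'
    obtain ⟨h1, -, h3⟩ := F.half_tau w hw t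
    rw [h1, h3]
    ring

lemma neg_one_pow_mul_self (n : ℕ) : (-1 : ℂ) ^ n * (-1) ^ n = 1 := by
  rw [← mul_pow, neg_one_mul, neg_neg, one_pow]

lemma pairTransfer_add_one (ht : Regular τ η ρ t) (h : theta τ 0 (2 * η) ≠ 0) (hij : i ≠ j)
    (k : Fin (N + 2)) {X : List (Fin 4) → ℂ → ℂ}
    (hX : ∀ w, w.length = 2 * (N + 1) → ∀ t, X (w.map permA) (t + 1 / 2) = wordProd sgnA w * X w t)
    (hn : ∀ w, w.length = 2 * (N + 1) → ∀ t, ¬ Neutral w → X w t = 0) :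
    pairTransfer τ η ρ i j X (shift k 1 t) = pairTransfer τ η ρ i j X t := by
  have hs : shift k 1 t = shift k (1 / 2) (shift k (1 / 2) t) := by
    rw [shift_shift]
    norm_num
  rw [hs]
  by_cases hk : k = i ∨ k = j
  · exact eq_of_half_twice (sigmaPair_mul_self 1 k) (sigmaIndex_mul_self 1 fun p => p ≠ k)
      (neg_one_pow_mul_self (N + 2)) (pairTransfer_half_of_mem (ht.shift_half h k) h hij hk hX hn)
      (pairTransfer_half_of_mem ht h hij hk hX hn)
  · push Not at hk
    refine eq_of_half_twice (M₁ := pairTransfer τ η ρ i j X (shift k (1 / 2) t)) (c := 1)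
      (sigmaPair_mul_self 1 k) (sigmaPair_mul_self 1 k)
      (mul_one 1) ?_ ?_
    · rw [one_smul]
      exact pairTransfer_half_of_ne (ht.shift_half h k) h hij hk.1 hk.2 X
    · rw [one_smul]
      exact pairTransfer_half_of_ne ht h hij hk.1 hk.2 X

lemma pairTransfer_add_tau_of_ne (ht : Regular τ η ρ t) (h : theta τ 0 (2 * η) ≠ 0) (hij : i ≠ j)
    {k : Fin (N + 2)} (hi : k ≠ i) (hj : k ≠ j) (X : List (Fin 4) → ℂ → ℂ) :
    pairTransfer τ η ρ i j X (shift k τ t) = pairTransfer τ η ρ i j X t := by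
  have hs : shift k τ t = shift k (τ / 2) (shift k (τ / 2) t) := by
    rw [shift_shift, add_halves]
  rw [hs]
  refine eq_of_half_twice (M₁ := pairTransfer τ η ρ i j X (shift k (τ / 2) t)) (c := 1)
    (sigmaPair_mul_self 3 k) (sigmaPair_mul_self 3 k)
    (mul_one 1) ?_ ?_
  · rw [one_smul]
    exact pairTransfer_half_tau_of_ne (ht.shift_half_tau h k) h hij hi hj X
  · rw [one_smul]
    exact pairTransfer_half_tau_of_ne ht h hij hi hj X

lemma pairTransfer_add_tau (ht : Regular τ η ρ t) (h : theta τ 0 (2 * η) ≠ 0) (hij : i ≠ j)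
    (k : Fin (N + 2)) {X : List (Fin 4) → ℂ → ℂ}
    (hX : ∀ w, w.length = 2 * (N + 1) → ∀ t, X (w.map permB) (t + τ / 2) = multB τ w t * X w t)
    (hn : ∀ w, w.length = 2 * (N + 1) → ∀ t, ¬ Neutral w → X w t = 0) :
    pairTransfer τ η ρ i j X (shift k τ t) = pairTransfer τ η ρ i j X t := by
  have hs : shift k τ t = shift k (τ / 2) (shift k (τ / 2) t) := by
    rw [shift_shift, add_halves]
  by_cases hk : k = i ∨ k = j
  · rw [hs]
    exact eq_of_half_twice (sigmaPair_mul_self 3 k) (sigmaIndex_mul_self 3 fun p => p ≠ k)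
      (neg_one_pow_mul_self (N + 2))
      (pairTransfer_half_tau_of_mem (ht.shift_half_tau h k) h hij hk hX hn)
      (pairTransfer_half_tau_of_mem ht h hij hk hX hn)
  · push Not at hk
    exact pairTransfer_add_tau_of_ne ht h hij hk.1 hk.2 X

/-- Two half jumps of ±D/2 in the same direction add up, since D itself has no jump. -/
lemma IsTraceFamily.pairTransfer_add_tau_left (F : IsTraceFamily τ η N B C D)
    (ht : Regular τ η ρ t) (h : theta τ 0 (2 * η) ≠ 0) (hij : i ≠ j) :
    pairTransfer τ η ρ i j B (shift i τ t) =
      pairTransfer τ η ρ i j B t + pairSign i j • pairTransfer τ η ρ i j D t := by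
  have hs : shift i τ t = shift i (τ / 2) (shift i (τ / 2) t) := by
    rw [shift_shift, add_halves]
  rw [hs]
  have hi : i = i ∨ i = j := Or.inl rfl
  refine eq_of_half_twice (sigmaPair_mul_self 3 i) (sigmaIndex_mul_self 3 fun p => p ≠ i)
    (neg_one_pow_mul_self (N + 2)) (F.pairTransfer_half_tau (ht.shift_half_tau h i) h hij hi) ?_
  rw [mul_add, F.pairTransfer_half_tau ht h hij hi, Matrix.mul_smul,
    pairTransfer_half_tau_of_mem ht h hij hi (fun w hw t => (F.half_tau w hw t).2.2)
      (fun w hw t hnw => (F.neutral w hw t hnw).2.2), smul_comm, ← smul_add,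
    ← Matrix.smul_mul, ← add_mul, add_assoc, ← add_smul]
  congr 4
  rw [jumpCoeff, if_pos rfl]
  ring

lemma IsTraceFamily.Xij_eq (F : IsTraceFamily τ η N B C D) (hτ : 0 < τ.im)
    (hη : ∀ a b : ℚ, η ≠ a + b * τ) (hij : i ≠ j) (t : Fin (N + 2) → ℂ) :
    Xij τ η ρ i j t = pairTransfer τ η ρ i j B t +
      (pairSign i j * (t i - t j)) • pairTransfer τ η ρ i j C t := by
  rcases lt_or_gt_of_ne hij with h | h
  · rw [Xij_eq_lineTransfer hτ hη F h, pairTransfer, pairTransfer, min_eq_left h.le,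
      max_eq_right h.le, pairSign, if_pos h, one_mul]
  · rw [show Xij τ η ρ i j t = Xij τ η ρ j i t by rw [Xij, Xij, min_comm, max_comm],
      Xij_eq_lineTransfer hτ hη F h, pairTransfer, pairTransfer, min_eq_right h.le,
      max_eq_left h.le, pairSign, if_neg h.not_gt]
    congr 2
    ring

/-- The B and C parts have period 1, so only the explicit factor t_{ij} changes. -/
lemma IsTraceFamily.diff_one (F : IsTraceFamily τ η N B C D) (hτ : 0 < τ.im)
    (hη : ∀ a b : ℚ, η ≠ a + b * τ) (hij : i ≠ j) (ht : Regular τ η ρ t) :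
    diff i 1 (Xij τ η ρ i j) t = pairSign i j • pairTransfer τ η ρ i j C t := by
  have h := theta_two_eta_ne_zero hτ hη
  rw [diff, F.Xij_eq hτ hη hij, F.Xij_eq hτ hη hij,
    pairTransfer_add_one ht h hij i (fun w hw t => (F.half w hw t).1)
      (fun w hw t hnw => (F.neutral w hw t hnw).1),
    pairTransfer_add_one ht h hij i (fun w hw t => (F.half w hw t).2.1)
      (fun w hw t hnw => (F.neutral w hw t hnw).2.1), add_sub_add_left_eq_sub, ← sub_smul]
  congr 1
  simp only [shift, Function.update_self, Function.update_of_ne hij.symm]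
  ring

lemma IsTraceFamily.diff_tau (F : IsTraceFamily τ η N B C D) (hτ : 0 < τ.im)
    (hη : ∀ a b : ℚ, η ≠ a + b * τ) (hij : i ≠ j) (ht : Regular τ η ρ t) :
    diff i τ (Xij τ η ρ i j) t = pairSign i j • pairTransfer τ η ρ i j D t +
      τ • (pairSign i j • pairTransfer τ η ρ i j C t) := by
  have h := theta_two_eta_ne_zero hτ hη
  rw [diff, F.Xij_eq hτ hη hij, F.Xij_eq hτ hη hij, F.pairTransfer_add_tau_left ht h hij,
    pairTransfer_add_tau ht h hij i (fun w hw t => (F.half_tau w hw t).2.1)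
      (fun w hw t hnw => (F.neutral w hw t hnw).2.1)]
  simp only [shift, Function.update_self, Function.update_of_ne hij.symm]
  module

/-- The differences defining X̂₁, X̂₂, X̂₃ are designed to isolate the parts of X̂ built from B, C
and D. Here t_{ij} Δ₁ removes the C part. -/
lemma IsTraceFamily.Xhat_zero (F : IsTraceFamily τ η N B C D) (hτ : 0 < τ.im)
    (hη : ∀ a b : ℚ, η ≠ a + b * τ) (hij : i ≠ j) (ht : Regular τ η ρ t) :
    Xhat τ η ρ 0 i j t = (cConst τ η)⁻¹ • pairTransfer τ η ρ i j B t := by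
  simp only [Xhat]
  rw [F.diff_one hτ hη hij ht, F.Xij_eq hτ hη hij]
  congr 1
  module

lemma IsTraceFamily.Xhat_one (F : IsTraceFamily τ η N B C D) (hτ : 0 < τ.im)
    (hη : ∀ a b : ℚ, η ≠ a + b * τ) (hij : i ≠ j) (ht : Regular τ η ρ t) :
    Xhat τ η ρ 1 i j t =
      ((cConst τ η)⁻¹ * (-η * pairSign i j)) • pairTransfer τ η ρ i j C t := by
  simp only [Xhat]
  rw [F.diff_one hτ hη hij ht, smul_smul, smul_smul, mul_assoc]

lemma IsTraceFamily.Xhat_two (F : IsTraceFamily τ η N B C D) (hτ : 0 < τ.im)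
    (hη : ∀ a b : ℚ, η ≠ a + b * τ) (hij : i ≠ j) (ht : Regular τ η ρ t) :
    Xhat τ η ρ 2 i j t =
      ((cConst τ η)⁻¹ * pairSign i j) • pairTransfer τ η ρ i j D t := by
  simp only [Xhat]
  rw [F.diff_one hτ hη hij ht, F.diff_tau hτ hη hij ht, add_sub_cancel_right, smul_smul]

lemma prod_map_sigmaPair (β : Fin 4) (l : List (Fin (N + 2))) (hl : l.Nodup) :
    (l.map (sigmaPair β)).prod = sigmaIndex β fun p => p ∈ l := by
  induction l with
  | nil => rw [sigmaIndex, sigmaOn_false β (by simp), List.map_nil, List.prod_nil]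
  | cons p l ih =>
    rw [List.nodup_cons] at hl
    rw [List.map_cons, List.prod_cons, ih hl.2, sigmaPair_eq_sigmaIndex]
    refine sigmaIndex_mul β _ _ _ fun x => ?_
    rw [List.mem_cons]
    by_cases hx : x = p
    · subst hx
      simp [hl.1]
    · simp [hx]

lemma sigmaProd_filter (β : Fin 4) (s : Fin (N + 2) → Prop) [DecidablePred s] :
    sigmaProd β (Finset.univ.filter s) = sigmaIndex β s := by
  rw [sigmaProd, prod_map_sigmaPair β _ ((List.nodup_finRange _).filter _)]
  exact sigmaOn_congr β fun x => by simp

end Components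

end EightVertex

end

noncomputable section
namespace EightVertex

/-! ### Meromorphy of the transfer matrices -/

section MeromorphicMatrix

variable {ι : Type}

/-- All entries of the matrix function are meromorphic. -/
def MatMeromorphic (M : ℂ → Matrix ι ι ℂ) : Prop := ∀ r s, Meromorphic fun z => M z r s

lemma matMeromorphic_const (M : Matrix ι ι ℂ) : MatMeromorphic fun _ => M :=
  fun _ _ _ => MeromorphicAt.const _ _

lemma MatMeromorphic.add {M L : ℂ → Matrix ι ι ℂ} (hM : MatMeromorphic M)
    (hL : MatMeromorphic L) : MatMeromorphic fun z => M z + L z :=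
  fun r s z => (hM r s z).add (hL r s z)

lemma MatMeromorphic.sub {M L : ℂ → Matrix ι ι ℂ} (hM : MatMeromorphic M)
    (hL : MatMeromorphic L) : MatMeromorphic fun z => M z - L z :=
  fun r s z => (hM r s z).sub (hL r s z)

lemma MatMeromorphic.smul {c : ℂ → ℂ} {M : ℂ → Matrix ι ι ℂ} (hc : Meromorphic c)
    (hM : MatMeromorphic M) : MatMeromorphic fun z => c z • M z :=
  fun r s z => (hc z).mul (hM r s z)

lemma MatMeromorphic.const_smul (c : ℂ) {M : ℂ → Matrix ι ι ℂ}
    (hM : MatMeromorphic M) : MatMeromorphic fun z => c • M z :=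
  fun r s z => (MeromorphicAt.const c z).mul (hM r s z)

lemma MatMeromorphic.sum {κ : Type} (S : Finset κ) {M : κ → ℂ → Matrix ι ι ℂ}
    (hM : ∀ k, MatMeromorphic (M k)) : MatMeromorphic fun z => ∑ k ∈ S, M k z := by
  intro r s z
  simp only [Matrix.sum_apply]
  exact MeromorphicAt.fun_sum fun k _ => hM k r s z

variable [Fintype ι]

lemma MatMeromorphic.mul {M L : ℂ → Matrix ι ι ℂ} (hM : MatMeromorphic M)
    (hL : MatMeromorphic L) : MatMeromorphic fun z => M z * L z := by
  intro r s z
  simp only [Matrix.mul_apply]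
  exact MeromorphicAt.fun_sum fun k _ => (hM r k z).mul (hL k s z)

variable [DecidableEq ι]

lemma MatMeromorphic.list_prod {κ : Type} (l : List κ) {M : κ → ℂ → Matrix ι ι ℂ}
    (hM : ∀ k, MatMeromorphic (M k)) : MatMeromorphic fun z => (l.map fun k => M k z).prod := by
  induction l with
  | nil => exact matMeromorphic_const 1
  | cons k l ih =>
    simp only [List.map_cons, List.prod_cons]
    exact (hM k).mul ih

lemma MatMeromorphic.det {M : ℂ → Matrix ι ι ℂ} (hM : MatMeromorphic M) :
    Meromorphic fun z => (M z).det := by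
  intro z
  simp only [Matrix.det_apply']
  exact MeromorphicAt.fun_sum fun g _ => (MeromorphicAt.const _ z).mul
    (MeromorphicAt.fun_prod fun x _ => hM _ _ z)

/-- By the adjugate formula the entries are quotients of polynomials in the entries; no generic
invertibility is needed, as the default value 0 is meromorphic too. -/
lemma MatMeromorphic.inv {M : ℂ → Matrix ι ι ℂ} (hM : MatMeromorphic M) :
    MatMeromorphic fun z => (M z)⁻¹ := by
  simp only [Matrix.inv_def, Ring.inverse_eq_inv]
  refine MatMeromorphic.smul (fun z => (hM.det z).inv) fun r s => ?_
  simp only [Matrix.adjugate_apply]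
  refine MatMeromorphic.det fun a b => ?_
  simp only [Matrix.updateRow_apply]
  split_ifs
  · exact fun z => MeromorphicAt.const _ z
  · exact hM a b

lemma meromorphic_comp {f g : ℂ → ℂ} (hf : Meromorphic f) (hg : Differentiable ℂ g) :
    Meromorphic fun z => f (g z) :=
  fun z => (hf (g z)).comp_analyticAt (hg.analyticAt z)

variable {τ η : ℂ} {ρ : ℂ → ℂ}

lemma meromorphic_theta (hτ : 0 < τ.im) (α : Fin 4) : Meromorphic (theta τ α) :=
  meromorphic_of_differentiable (differentiable_theta hτ α)

lemma meromorphic_bracket (hτ : 0 < τ.im) : Meromorphic (bracket τ η) := fun z =>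
  (meromorphic_comp (meromorphic_theta hτ 0) (g := fun z => 2 * z) (by fun_prop) z).div
    (MeromorphicAt.const _ z)

lemma matMeromorphic_Rcheck (hτ : 0 < τ.im) (hρ : Meromorphic ρ) (x y : ι) {s : ℂ → ℂ}
    (hs : Differentiable ℂ s) : MatMeromorphic fun z => Rcheck τ η ρ x y (s z) := by
  simp only [Rcheck, Rmat]
  refine (matMeromorphic_const _).mul (MatMeromorphic.smul (fun z => ?_)
    (MatMeromorphic.const_smul _ (MatMeromorphic.sum _ fun α => MatMeromorphic.smul (fun z => ?_)
      (matMeromorphic_const _))))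
  · exact (meromorphic_comp hρ hs z).div
      (meromorphic_comp (meromorphic_bracket hτ) (g := fun z => s z + η) (by fun_prop) z)
  · exact (meromorphic_comp (meromorphic_theta hτ α) (g := fun z => 2 * s z + η) (by fun_prop)
      z).div (MeromorphicAt.const _ z)

lemma matMeromorphic_wordExpansion (hτ : 0 < τ.im) (l : List ι) {v : ι → ℂ → ℂ}
    (hv : ∀ x, Differentiable ℂ (v x)) {G : List (Fin 4) → ℂ → ℂ}
    (hG : ∀ w, Differentiable ℂ (G w)) :
    MatMeromorphic fun z => wordExpansion τ (l.map fun x => (x, v x z)) fun w => G w z := by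
  induction l generalizing G with
  | nil => exact (matMeromorphic_const 1).smul (meromorphic_of_differentiable (hG []))
  | cons x l ih =>
    simp only [List.map_cons, wordExpansion]
    refine MatMeromorphic.sum Finset.univ (M := fun α z => theta τ α (v x z) •
      (rescaledSigma α x * wordExpansion τ (l.map fun x => (x, v x z)) fun w => G (α :: w) z))
      fun α => ?_
    exact (((matMeromorphic_const (rescaledSigma α x)).mul (ih fun w => hG (α :: w)))).smul
      (meromorphic_comp (meromorphic_theta hτ α) (hv x))

end MeromorphicMatrix

section MeromorphicTransfer

variable {N : ℕ} {τ η : ℂ} {ρ : ℂ → ℂ} {i j : Fin (N + 2)} {T : ℂ → Fin (N + 2) → ℂ}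
  {B C D : List (Fin 4) → ℂ → ℂ}

lemma matMeromorphic_Rprod (hτ : 0 < τ.im) (hρ : Meromorphic ρ) (i j : Fin (N + 2))
    (hT : ∀ p, Differentiable ℂ fun z => T z p) :
    MatMeromorphic fun z => Rprod τ η ρ i j (T z) := by
  simp only [Rprod_eq, unbarredChain, barredChain]
  have h : ∀ p r, Differentiable ℂ fun z => T z p - T z r := fun p r => (hT p).sub (hT r)
  refine MatMeromorphic.mul (MatMeromorphic.mul (MatMeromorphic.mul ?_ ?_) ?_)
    (MatMeromorphic.mul (MatMeromorphic.mul ?_ ?_) ?_)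
  all_goals exact MatMeromorphic.list_prod _ fun m => matMeromorphic_Rcheck hτ hρ _ _ (h _ _)

lemma matMeromorphic_familyTransfer (hτ : 0 < τ.im)
    (hT : ∀ p, Differentiable ℂ fun z => T z p) {X : List (Fin 4) → ℂ → ℂ}
    (hX : ∀ w, Differentiable ℂ (X w)) :
    MatMeromorphic fun z => familyTransfer τ η X (T z) := by
  have hb : ∀ p r, Meromorphic fun z => bracket τ η (T z p - T z r) := fun p r =>
    meromorphic_comp (meromorphic_bracket hτ) ((hT p).sub (hT r))
  simp only [familyTransfer, transfer, chainExpansion, prefactor]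
  refine MatMeromorphic.smul (fun z => ?_) (MatMeromorphic.mul
    (matMeromorphic_wordExpansion hτ _ (fun x => ?_) fun w => ?_) (matMeromorphic_const _))
  · refine MeromorphicAt.mul (MeromorphicAt.div (MeromorphicAt.const _ z)
      ((hb _ _ z).mul (MeromorphicAt.fun_prod fun p _ => (hb _ _ z).mul (hb _ _ z))))
      (MeromorphicAt.const _ z)
  · rcases x with x | x
    · exact (((hT 0).add (hT 1)).sub ((hT x).const_mul 2)).add_const η
    · exact (((hT 0).add (hT 1)).sub ((hT x).const_mul 2)).sub_const η
  · exact (hX w).comp ((hT 0).sub (hT 1))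

lemma matMeromorphic_pairTransfer (hτ : 0 < τ.im) (hρ : Meromorphic ρ) (hij : i ≠ j)
    (hT : ∀ p, Differentiable ℂ fun z => T z p) {X : List (Fin 4) → ℂ → ℂ}
    (hX : ∀ w, Differentiable ℂ (X w)) :
    MatMeromorphic fun z => pairTransfer τ η ρ i j X (T z) := by
  have hR := matMeromorphic_Rprod (η := η) hτ hρ (min i j) (max i j) hT
  refine (hR.mul (matMeromorphic_familyTransfer hτ (fun p => ?_) hX)).mul hR.inv
  obtain ⟨r, rfl⟩ :=
    Finite.surjective_of_injective (linePos_injective (min_lt_max' hij)) p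
  simp only [reorder_linePos (min_lt_max' hij)]
  exact hT r

lemma IsTraceFamily.matMeromorphic_Xij (F : IsTraceFamily τ η N B C D) (hτ : 0 < τ.im)
    (hη : ∀ a b : ℚ, η ≠ a + b * τ) (hρ : Meromorphic ρ) (hij : i ≠ j)
    (hT : ∀ p, Differentiable ℂ fun z => T z p) :
    MatMeromorphic fun z => Xij τ η ρ i j (T z) := by
  simp only [F.Xij_eq hτ hη hij]
  refine (matMeromorphic_pairTransfer hτ hρ hij hT F.differentiable_left).add
    ((matMeromorphic_pairTransfer hτ hρ hij hT F.differentiable_right).smul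
      (meromorphic_of_differentiable ?_))
  exact ((hT i).sub (hT j)).const_mul _

lemma differentiable_shift (hT : ∀ p, Differentiable ℂ fun z => T z p) (k : Fin (N + 2)) (a : ℂ)
    (p : Fin (N + 2)) : Differentiable ℂ fun z => shift k a (T z) p := by
  by_cases h : p = k
  · subst h
    simp only [shift, Function.update_self]
    exact (hT p).add_const a
  · simp only [shift, Function.update_of_ne h]
    exact hT p

lemma IsTraceFamily.matMeromorphic_Xhat (F : IsTraceFamily τ η N B C D) (hτ : 0 < τ.im)
    (hη : ∀ a b : ℚ, η ≠ a + b * τ) (hρ : Meromorphic ρ) (hij : i ≠ j)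
    (hT : ∀ p, Differentiable ℂ fun z => T z p) (a : Fin 3) :
    MatMeromorphic fun z => Xhat τ η ρ a i j (T z) := by
  have h0 := F.matMeromorphic_Xij hτ hη hρ hij hT
  have hd : ∀ b, MatMeromorphic fun z => diff i b (Xij τ η ρ i j) (T z) := fun b =>
    (F.matMeromorphic_Xij hτ hη hρ hij (differentiable_shift hT i b)).sub h0
  refine MatMeromorphic.const_smul _ ?_
  match a with
  | 0 => exact h0.sub ((hd 1).smul (meromorphic_of_differentiable ((hT i).sub (hT j))))
  | 1 => exact (hd 1).const_smul _
  | 2 => exact (hd τ).sub ((hd 1).const_smul _)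

end MeromorphicTransfer

end EightVertex

end

noncomputable section
namespace EightVertex

/-! ### The transformation laws of the components -/

section Main

variable {N : ℕ} {τ η : ℂ} {ρ : ℂ → ℂ} {i j : Fin (N + 2)} {t : Fin (N + 2) → ℂ}
  {B C D : List (Fin 4) → ℂ → ℂ}

lemma IsTraceFamily.Xhat_half_of_ne (F : IsTraceFamily τ η N B C D) (hτ : 0 < τ.im)
    (hη : ∀ a b : ℚ, η ≠ a + b * τ) (hij : i ≠ j) (ht : Regular τ η ρ t) {k : Fin (N + 2)}
    (hi : k ≠ i) (hj : k ≠ j) (a : Fin 3) :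
    sigmaPair 1 k * Xhat τ η ρ a i j (shift k (1 / 2) t) =
      Xhat τ η ρ a i j t * sigmaPair 1 k := by
  have h := theta_two_eta_ne_zero hτ hη
  have ht' := ht.shift_half h k
  match a with
  | 0 => rw [F.Xhat_zero hτ hη hij ht', F.Xhat_zero hτ hη hij ht, Matrix.mul_smul,
      pairTransfer_half_of_ne ht h hij hi hj, Matrix.smul_mul]
  | 1 => rw [F.Xhat_one hτ hη hij ht', F.Xhat_one hτ hη hij ht, Matrix.mul_smul,
      pairTransfer_half_of_ne ht h hij hi hj, Matrix.smul_mul]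
  | 2 => rw [F.Xhat_two hτ hη hij ht', F.Xhat_two hτ hη hij ht, Matrix.mul_smul,
      pairTransfer_half_of_ne ht h hij hi hj, Matrix.smul_mul]

lemma IsTraceFamily.Xhat_half_tau_of_ne (F : IsTraceFamily τ η N B C D) (hτ : 0 < τ.im)
    (hη : ∀ a b : ℚ, η ≠ a + b * τ) (hij : i ≠ j) (ht : Regular τ η ρ t) {k : Fin (N + 2)}
    (hi : k ≠ i) (hj : k ≠ j) (a : Fin 3) :
    sigmaPair 3 k * Xhat τ η ρ a i j (shift k (τ / 2) t) =
      Xhat τ η ρ a i j t * sigmaPair 3 k := by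
  have h := theta_two_eta_ne_zero hτ hη
  have ht' := ht.shift_half_tau h k
  match a with
  | 0 => rw [F.Xhat_zero hτ hη hij ht', F.Xhat_zero hτ hη hij ht, Matrix.mul_smul,
      pairTransfer_half_tau_of_ne ht h hij hi hj, Matrix.smul_mul]
  | 1 => rw [F.Xhat_one hτ hη hij ht', F.Xhat_one hτ hη hij ht, Matrix.mul_smul,
      pairTransfer_half_tau_of_ne ht h hij hi hj, Matrix.smul_mul]
  | 2 => rw [F.Xhat_two hτ hη hij ht', F.Xhat_two hτ hη hij ht, Matrix.mul_smul,
      pairTransfer_half_tau_of_ne ht h hij hi hj, Matrix.smul_mul]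

lemma IsTraceFamily.Xhat_half_of_mem (F : IsTraceFamily τ η N B C D) (hτ : 0 < τ.im)
    (hη : ∀ a b : ℚ, η ≠ a + b * τ) (hij : i ≠ j) (ht : Regular τ η ρ t) {k : Fin (N + 2)}
    (hk : k = i ∨ k = j) (a : Fin 3) :
    sigmaPair 1 k * Xhat τ η ρ a i j (shift k (1 / 2) t) =
      Xhat τ η ρ a i j t * ((-1 : ℂ) ^ (N + 2) • sigmaIndex 1 fun p => p ≠ k) := by
  have h := theta_two_eta_ne_zero hτ hη
  have ht' := ht.shift_half h k
  match a with
  | 0 => rw [F.Xhat_zero hτ hη hij ht', F.Xhat_zero hτ hη hij ht, Matrix.mul_smul,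
      pairTransfer_half_of_mem ht h hij hk (fun w hw t => (F.half w hw t).1)
        (fun w hw t hnw => (F.neutral w hw t hnw).1), Matrix.smul_mul, Matrix.mul_smul]
  | 1 => rw [F.Xhat_one hτ hη hij ht', F.Xhat_one hτ hη hij ht, Matrix.mul_smul,
      pairTransfer_half_of_mem ht h hij hk (fun w hw t => (F.half w hw t).2.1)
        (fun w hw t hnw => (F.neutral w hw t hnw).2.1), Matrix.smul_mul, Matrix.mul_smul]
  | 2 => rw [F.Xhat_two hτ hη hij ht', F.Xhat_two hτ hη hij ht, Matrix.mul_smul,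
      pairTransfer_half_of_mem ht h hij hk (fun w hw t => (F.half w hw t).2.2)
        (fun w hw t hnw => (F.neutral w hw t hnw).2.2), Matrix.smul_mul, Matrix.mul_smul]

lemma IsTraceFamily.Xhat_half_tau_of_mem (F : IsTraceFamily τ η N B C D) (hτ : 0 < τ.im)
    (hη : ∀ a b : ℚ, η ≠ a + b * τ) (hij : i ≠ j) (ht : Regular τ η ρ t) {k : Fin (N + 2)}
    (hk : k = i ∨ k = j) (a : Fin 3) :
    sigmaPair 3 k * Xhat τ η ρ a i j (shift k (τ / 2) t) =
      (Xhat τ η ρ a i j t +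
        (if a = 0 then (if k = i then 1 / 2 else -1 / 2 : ℂ) • Xhat τ η ρ 2 i j t else 0)) *
        ((-1 : ℂ) ^ (N + 2) • sigmaIndex 3 fun p => p ≠ k) := by
  have h := theta_two_eta_ne_zero hτ hη
  have ht' := ht.shift_half_tau h k
  match a with
  | 0 =>
    rw [if_pos rfl, F.Xhat_zero hτ hη hij ht', F.Xhat_zero hτ hη hij ht, F.Xhat_two hτ hη hij ht,
      Matrix.mul_smul, F.pairTransfer_half_tau ht h hij hk, smul_comm, ← Matrix.smul_mul,
      Matrix.mul_smul, smul_add, smul_smul, smul_smul, jumpCoeff]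
    congr 4
    ring
  | 1 => rw [if_neg (by decide), add_zero, F.Xhat_one hτ hη hij ht', F.Xhat_one hτ hη hij ht,
      Matrix.mul_smul, pairTransfer_half_tau_of_mem ht h hij hk
        (fun w hw t => (F.half_tau w hw t).2.1)
        (fun w hw t hnw => (F.neutral w hw t hnw).2.1), Matrix.smul_mul, Matrix.mul_smul]
  | 2 => rw [if_neg (by decide), add_zero, F.Xhat_two hτ hη hij ht', F.Xhat_two hτ hη hij ht,
      Matrix.mul_smul, pairTransfer_half_tau_of_mem ht h hij hk
        (fun w hw t => (F.half_tau w hw t).2.2)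
        (fun w hw t hnw => (F.neutral w hw t hnw).2.2), Matrix.smul_mul, Matrix.mul_smul]

lemma Rprod_zero_one (t : Fin (N + 2) → ℂ) : Rprod τ η ρ 0 1 t = 1 := by
  simp [Rprod_eq, unbarredChain, barredChain]

/-- For the pair {1, 2} the product ℝ is trivial, so the singlet projectors stand at the right end
and absorb the pair. -/
lemma pairTransfer_mul_sigmaPair (h01 : i = 0 ∧ j = 1 ∨ i = 1 ∧ j = 0) {β : Fin 4} (hβ : β ≠ 0)
    {o : Fin (N + 2)} (ho : o = 0 ∨ o = 1) (X : List (Fin 4) → ℂ → ℂ) (t : Fin (N + 2) → ℂ) :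
    pairTransfer τ η ρ i j X t * sigmaPair β o = -pairTransfer τ η ρ i j X t := by
  have hm : min i j = 0 ∧ max i j = 1 := by
    rcases h01 with ⟨rfl, rfl⟩ | ⟨rfl, rfl⟩
    · exact ⟨min_eq_left (Fin.zero_le _), max_eq_right (Fin.zero_le _)⟩
    · exact ⟨min_eq_right (Fin.zero_le _), max_eq_left (Fin.zero_le _)⟩
  rw [pairTransfer, hm.1, hm.2, lineTransfer, Rprod_zero_one, inv_one, one_mul, mul_one,
    familyTransfer, transfer, Matrix.smul_mul, mul_assoc, singletProj_mul_sigmaPair hβ ho, mul_neg,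
    smul_neg]

lemma IsTraceFamily.Xhat_mul_sigmaPair (F : IsTraceFamily τ η N B C D) (hτ : 0 < τ.im)
    (hη : ∀ a b : ℚ, η ≠ a + b * τ) (hij : i ≠ j) (ht : Regular τ η ρ t)
    (h01 : i = 0 ∧ j = 1 ∨ i = 1 ∧ j = 0) {β : Fin 4} (hβ : β ≠ 0)
    {o : Fin (N + 2)} (ho : o = 0 ∨ o = 1) (a : Fin 3) :
    Xhat τ η ρ a i j t * sigmaPair β o = -Xhat τ η ρ a i j t := by
  match a with
  | 0 => rw [F.Xhat_zero hτ hη hij ht, Matrix.smul_mul, pairTransfer_mul_sigmaPair h01 hβ ho,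
      smul_neg]
  | 1 => rw [F.Xhat_one hτ hη hij ht, Matrix.smul_mul, pairTransfer_mul_sigmaPair h01 hβ ho,
      smul_neg]
  | 2 => rw [F.Xhat_two hτ hη hij ht, Matrix.smul_mul, pairTransfer_mul_sigmaPair h01 hβ ho,
      smul_neg]

/-- The product over p ≠ k contains the pair of the other index, which M absorbs with the sign -1.
This accounts for the exponents n and n - 1 in the two forms of the law. -/
lemma mul_sigmaIndex_of_pair {β : Fin 4} (hij : i ≠ j) {k : Fin (N + 2)} (hk : k = i ∨ k = j)
    {M : Op N} (hM : ∀ o, o = i ∨ o = j → M * sigmaPair β o = -M) :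
    M * ((-1 : ℂ) ^ (N + 2) • sigmaIndex β fun p => p ≠ k) =
      M * ((-1 : ℂ) ^ (N + 1) • sigmaIndex β fun p => p ≠ i ∧ p ≠ j) := by
  obtain ⟨o, ho, hS⟩ : ∃ o, (o = i ∨ o = j) ∧ sigmaIndex β (fun p => p ≠ k) =
      sigmaPair β o * sigmaIndex β fun p => p ≠ i ∧ p ≠ j := by
    rcases hk with rfl | rfl
    · refine ⟨j, Or.inr rfl, ?_⟩
      rw [sigmaPair_eq_sigmaIndex]
      refine (sigmaIndex_mul β _ _ _ fun x => ?_).symm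
      by_cases hx : x = j
      · simp [hx, hij.symm]
      · simp [hx]
    · refine ⟨i, Or.inl rfl, ?_⟩
      rw [sigmaPair_eq_sigmaIndex]
      refine (sigmaIndex_mul β _ _ _ fun x => ?_).symm
      by_cases hx : x = i
      · simp [hx, hij]
      · simp [hx]
  rw [hS, Matrix.mul_smul, ← mul_assoc, hM o ho, neg_mul, smul_neg, ← neg_smul, Matrix.mul_smul]
  congr 1
  ring

end Main

end EightVertex

end

open EightVertex in
theorem mainTheorem5 (τ η : ℂ) (hτ : 0 < τ.im) (hη : ∀ a b : ℚ, η ≠ a + b * τ)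
    (ρ : ℂ → ℂ) (hρ : MeromorphicOn ρ Set.univ)
    (N : ℕ) (i j : Fin (N + 2)) (hij : i ≠ j) :
    -- the transformation laws under half periods
    (∀ t : Fin (N + 2) → ℂ, Regular τ η ρ t → ∀ (k : Fin (N + 2)) (a : Fin 3),
      (k ≠ i → k ≠ j →
        sigmaPair 1 k * Xhat τ η ρ a i j (shift k (1 / 2) t) =
            Xhat τ η ρ a i j t * sigmaPair 1 k ∧
        sigmaPair 3 k * Xhat τ η ρ a i j (shift k (τ / 2) t) =
            Xhat τ η ρ a i j t * sigmaPair 3 k) ∧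
      (k = i ∨ k = j →
        sigmaPair 1 k * Xhat τ η ρ a i j (shift k (1 / 2) t) =
            Xhat τ η ρ a i j t *
              ((-1 : ℂ) ^ (N + 2) • sigmaProd 1 (Finset.univ.filter fun p => p ≠ k)) ∧
        sigmaPair 3 k * Xhat τ η ρ a i j (shift k (τ / 2) t) =
            (Xhat τ η ρ a i j t +
              (if a = 0 then (if k = i then 1 / 2 else -1 / 2 : ℂ) • Xhat τ η ρ 2 i j t else 0)) *
              ((-1 : ℂ) ^ (N + 2) • sigmaProd 3 (Finset.univ.filter fun p => p ≠ k))) ∧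
      -- for `{i, j} = {1, 2}`, in terms of the sites other than `i` and `j`
      (k = i ∨ k = j → (i = 0 ∧ j = 1 ∨ i = 1 ∧ j = 0) →
        sigmaPair 1 k * Xhat τ η ρ a i j (shift k (1 / 2) t) =
            Xhat τ η ρ a i j t *
              ((-1 : ℂ) ^ (N + 1) •
                sigmaProd 1 (Finset.univ.filter fun p => p ≠ i ∧ p ≠ j)) ∧
        sigmaPair 3 k * Xhat τ η ρ a i j (shift k (τ / 2) t) =
            (Xhat τ η ρ a i j t +
              (if a = 0 then (if k = i then 1 / 2 else -1 / 2 : ℂ) • Xhat τ η ρ 2 i j t else 0)) *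
              ((-1 : ℂ) ^ (N + 1) •
                sigmaProd 3 (Finset.univ.filter fun p => p ≠ i ∧ p ≠ j)))) ∧
    -- `X̂₂` and `X̂₃` are elliptic in each variable
    (∀ t : Fin (N + 2) → ℂ, Regular τ η ρ t → ∀ (k : Fin (N + 2)) (a : Fin 3), a ≠ 0 →
      (∀ r s, MeromorphicOn (fun z => Xhat τ η ρ a i j (Function.update t k z) r s) Set.univ) ∧
      Xhat τ η ρ a i j (shift k 1 t) = Xhat τ η ρ a i j t ∧
      Xhat τ η ρ a i j (shift k τ t) = Xhat τ η ρ a i j t) := by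
  have h := theta_two_eta_ne_zero hτ hη
  obtain ⟨B, C, D, F⟩ := exists_isTraceFamily hτ hη N
  refine ⟨fun t ht k a => ⟨fun hi hj => ?_, fun hk => ?_, fun hk h01 => ?_⟩,
    fun t ht k a ha => ⟨fun r s => ?_, ?_, ?_⟩⟩
  · exact ⟨F.Xhat_half_of_ne hτ hη hij ht hi hj a, F.Xhat_half_tau_of_ne hτ hη hij ht hi hj a⟩
  · rw [sigmaProd_filter, sigmaProd_filter]
    exact ⟨F.Xhat_half_of_mem hτ hη hij ht hk a, F.Xhat_half_tau_of_mem hτ hη hij ht hk a⟩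
  · have ho : ∀ o, o = i ∨ o = j → o = 0 ∨ o = 1 := by
      rcases h01 with ⟨rfl, rfl⟩ | ⟨rfl, rfl⟩
      · exact fun o ho => ho
      · exact fun o ho => ho.symm
    rw [sigmaProd_filter, sigmaProd_filter, F.Xhat_half_of_mem hτ hη hij ht hk a,
      F.Xhat_half_tau_of_mem hτ hη hij ht hk a]
    -- It remains to check that the left factors are odd under both singlet pairs; for the second
    -- law this includes the jump term.
    refine ⟨mul_sigmaIndex_of_pair hij hk fun o hoij => ?_,
      mul_sigmaIndex_of_pair hij hk fun o hoij => ?_⟩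
    · exact F.Xhat_mul_sigmaPair hτ hη hij ht h01 (by decide) (ho o hoij) a
    · rw [add_mul, F.Xhat_mul_sigmaPair hτ hη hij ht h01 (by decide) (ho o hoij) a]
      split_ifs
      · rw [Matrix.smul_mul, F.Xhat_mul_sigmaPair hτ hη hij ht h01 (by decide) (ho o hoij) 2]
        module
      · rw [Matrix.smul_mul, F.Xhat_mul_sigmaPair hτ hη hij ht h01 (by decide) (ho o hoij) 2]
        module
      · rw [zero_mul, add_zero, add_zero]
  · refine fun z _ => F.matMeromorphic_Xhat hτ hη (fun z => hρ z trivial) hij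
      (T := fun z => Function.update t k z) (fun p => ?_) a r s z
    by_cases hp : p = k
    · subst hp
      simp
    · simp [Function.update_of_ne hp]
  · have ht' : Regular τ η ρ (shift k 1 t) := by
      have := (ht.shift_half h k).shift_half h k
      rwa [shift_shift, add_halves] at this
    match a with
    | 0 => exact absurd rfl ha
    | 1 => rw [F.Xhat_one hτ hη hij ht', F.Xhat_one hτ hη hij ht,
        pairTransfer_add_one ht h hij k (fun w hw t => (F.half w hw t).2.1)
          (fun w hw t hnw => (F.neutral w hw t hnw).2.1)]
    | 2 => rw [F.Xhat_two hτ hη hij ht', F.Xhat_two hτ hη hij ht,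
        pairTransfer_add_one ht h hij k (fun w hw t => (F.half w hw t).2.2)
          (fun w hw t hnw => (F.neutral w hw t hnw).2.2)]
  · have ht' : Regular τ η ρ (shift k τ t) := by
      have := (ht.shift_half_tau h k).shift_half_tau h k
      rwa [shift_shift, add_halves] at this
    match a with
    | 0 => exact absurd rfl ha
    | 1 => rw [F.Xhat_one hτ hη hij ht', F.Xhat_one hτ hη hij ht,
        pairTransfer_add_tau ht h hij k (fun w hw t => (F.half_tau w hw t).2.1)
          (fun w hw t hnw => (F.neutral w hw t hnw).2.1)]
    | 2 => rw [F.Xhat_two hτ hη hij ht', F.Xhat_two hτ hη hij ht,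
        pairTransfer_add_tau ht h hij k (fun w hw t => (F.half_tau w hw t).2.2)
          (fun w hw t hnw => (F.neutral w hw t hnw).2.2)]
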